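/- Let $\Bbbk$ be a field and $(Q,I)$ a graded gentle quiver: $Q$ is a finite quiver with integer degrees $|\alpha|$ of arrows, $I$ is generated by paths of length $2$, at most two arrows start and at most two arrows end at each vertex, and for every arrow $\alpha$ there is at most one arrow $\beta$ with $\beta\alpha$ a path in $I$, at most one with $\beta\alpha$ a path not in $I$, and likewise for $\alpha\beta$ (paths are composed from right to left). Assume that no connected component of $Q$ is a single vertex with one loop or the Kronecker quiver. Let $A=\Bbbk Q/I$, and let $[-,-]\colon \mathrm{HH}^i\times\mathrm{HH}^j\to\mathrm{HH}^{i+j-1}$ be the Gerstenhaber bracket on the Hochschild cohomology $\mathrm{HH}^\bullet(A,A)$ of the graded algebra $A$, the cohomology of $\prod_{n}\mathrm{Hom}^{d-n}_{\Bbbk}(A^{\otimes n},A)$; here for $f$ of bidegree $(m,r)$ and $g$ of bidegree $(n,s)$ one has $[f,g]=f\circ g-(-1)^{(m+r-1)(n+s-1)}g\circ f$ and $f\circ g=\sum_{i=1}^m(-1)^{(i-1)(n-1)+(m-1)(n+s-1)}f(1^{\otimes (i-1)}\otimes g\otimes 1^{\otimes (m-i)})$ with the Koszul sign rule. An anti-path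 is a path all of whose subpaths of length $2$ lie in $I$; a path of $A$ is a path none of whose subpaths of length $2$ lies in $I$. An anti-path (path of $A$) of positive length is complete if its square is again an anti-path (path of $A$); it is primitive if it is not a proper power. For an anti-path $p$ of length $n$ and a parallel path $q$ with start vertex $x$, let $(p,q)$ be the Hochschild cochain of arity $n$ which sends paths $v_1,\dots,v_n$ of $A$ to $\sum(-1)^{|v'|(|q|-|p|)}v'qv''$, the sum over all factorisations $v_1\cdots v_n=v'pv''$ (if $n=0$ it is the element $q\in A$). Consider the following elements, which correspond to data on the graded marked surface $\Sigma_A$ of $A$: - the unit $\mathbb 1=\sum_x(e_x,e_x)$; - for $f\in H^1(\Sigma_A,\Bbbk)\cong H^1(|Q|,\Bbbk)=\Bbbk^{Q_1}/\{(g(t(\alpha))-g(s(\alpha)))_\alpha\mid g\in\Bbbk^{Q_0}\}$, the element $f=\sum_\alpha f(\alpha)\,(\alpha,\alpha)\in\mathrm{HH}^1$; - for a primitive complete anti-path $u$ (an unmarked boundary component) with winding number $\omega=l(u)-|u|$, or a primitive complete path $u$ of $A$ (a fully marked boundary component) with $\omega=|u|$, and for $m\ge1$ such that $m\omega$ is even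 or $\operatorname{char}\Bbbk=2$, elements $\mathcal N^0(u^m)\in\mathrm{HH}^{m\omega}$ and $\mathcal N^1(u^m)\in\mathrm{HH}^{m\omega+1}$. For $w=u^m=\alpha_1\cdots\alpha_n$ and $r=l(u)$, with $\mathrm{rot}^i(w)=\alpha_{i+1}\cdots\alpha_n\alpha_1\cdots\alpha_i$ starting at $x_i$: for anti-paths $\mathcal N^0(w)=\sum_{i<r}(-1)^{in+|w||\alpha_1\cdots\alpha_i|}(\mathrm{rot}^i(w),e_{x_i})$ and $\mathcal N^1(w)=(-1)^{n(1+|\alpha_n|)}(\alpha_nw,\alpha_n)$; for paths $\mathcal N^0(w)=\sum_{i<r}(-1)^{|w||\alpha_1\cdots\alpha_i|}(e_{x_i},\mathrm{rot}^i(w))$ and $\mathcal N^1(w)=-(\alpha_n,\alpha_nw)$; - for a boundary component $B$ with exactly one stop, $[B]=(p,q)\in\mathrm{HH}^{l(p)+|q|-|p|}$, where either $p$ is a maximal anti-path of positive length and $q$ is a parallel path of $A$ which is trivial or has first and last arrow different from those of $p$, or $p$ is trivial and $q$ is a closed maximal path of $A$ of positive length. To $\mathcal N^s(u^m)$ and $[B]$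 belongs the closed walk $\gamma$ in $Q$ with formal inverses of the arrows, given by $u^{-m}$ if $u$ is an anti-path, by $u^m$ if $u$ is a path of $A$, and by $p^{-1}q$ for $[B]$; let $f(\gamma)$ be the sum of the values $\pm f(\alpha)$ along $\gamma$. Then all these elements are Hochschild cocycles, the class of $f$ is well defined on $H^1$, and in $\mathrm{HH}^\bullet(A,A)$: (1) $[f,v]=f(\gamma)\,v$ for every $v$ of the form $\mathcal N^s(u^m)$ or $[B]$ with closed walk $\gamma$. (2) For $u$ as above and $m,n\ge1$ with $m\omega$ and $n\omega$ even, or $\operatorname{char}\Bbbk=2$, $$[\mathcal N^1(u^m),\mathcal N^1(u^n)]=(m-n)\,\mathcal N^1(u^{m+n}),\qquad [\mathcal N^0(u^m),\mathcal N^1(u^n)]=m\,\mathcal N^0(u^{m+n}).$$ For every $m\ge1$ of any parity the cochain $\mathcal N^1(u^m)$ is a cocycle, and for all $m,n\ge 1$ the class $[\mathcal N^1(u^m),\mathcal N^1(u^n)]$ is $(m-n)\mathcal N^1(u^{m+n})$ if $m\omega,n\omega$ are even, $m\,\mathcal N^1(u^{m+n})$ if $m\omega$ is odd and $n\omega$ even,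 and $0$ if both are odd; moreover $[\mathcal N^0(u^m),\mathcal N^1(u^n)]=0$ if $m\omega$ is even and $n\omega$ is odd. (3) All brackets of two of these elements which are not, up to exchanging the two elements, of the form $[f,v]$ as in (1), or $[\mathcal N^1(u^m),\mathcal N^1(v^n)]$ or $[\mathcal N^0(u^m),\mathcal N^1(v^n)]$ with $u$ and $v$ rotations of each other, vanish. The only exception, about which nothing is claimed, is the pair $[B]=(ab,e)$, $[B']=(e',ba)$ where $a,b$ are arrows with $ab\in I$, $ba\notin I$ forming a component of $Q$ which is an oriented $2$-cycle (so that $\Sigma_A$ has the same underlying marked surface as for the Kronecker quiver, an annulus with one stop on each boundary component), $|a|+|b|$ is odd and $\operatorname{char}\Bbbk\ne2$. -/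

import Mathlib

open scoped DirectSum

noncomputable section

/-! ### The Hochschild complex of a graded algebra and the Gerstenhaber bracket -/

namespace GradedHochschild

variable {k B : Type*} [Field k] [Ring B] [Algebra k B]

/-- The Koszul sign operator `a ↦ (-1)^(r * |a|) a` of a graded algebra. -/
def koszul (𝒜 : ℤ → Submodule k B) [GradedAlgebra 𝒜] (r : ℤ) : B →ₗ[k] B :=
  DirectSum.coeLinearMap 𝒜 ∘ₗ
    DirectSum.lmap (fun i => (((r * i).negOnePow : ℤ) : k) • LinearMap.id) ∘ₗ
      (DirectSum.decomposeLinearEquiv 𝒜).toLinearMap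

/-- The ambient space of all sequences of functions `Bⁿ → B`, `n ≥ 0`.  The Hochschild cochains are
the elements of `cochains` below. -/
abbrev Coch (B : Type*) : Type _ := ∀ n : ℕ, (Fin n → B) → B

/-- The degree `d` part `∏ₙ Hom^(d-n)(B^{⊗ n}, B)` of the Hochschild complex: the `n`-th component
is a `k`-multilinear map which is homogeneous of internal degree `d - n`. -/
def cochains (𝒜 : ℤ → Submodule k B) (d : ℤ) : Submodule k (Coch B) where
  carrier := {F | ∀ n : ℕ,
    (∃ f : MultilinearMap k (fun _ : Fin n => B) B, ∀ v, f v = F n v) ∧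
    ∀ (e : Fin n → ℤ) (v : Fin n → B), (∀ i, v i ∈ 𝒜 (e i)) →
      F n v ∈ 𝒜 ((∑ i, e i) + (d - n))}
  zero_mem' := fun n => ⟨⟨0, fun _ => rfl⟩, fun _ _ _ => Submodule.zero_mem _⟩
  add_mem' := by
    intro F G hF hG n
    obtain ⟨f, hf⟩ := (hF n).1
    obtain ⟨g, hg⟩ := (hG n).1
    exact ⟨⟨f + g, fun v => by simp [hf, hg]⟩,
      fun e v hv => Submodule.add_mem _ ((hF n).2 e v hv) ((hG n).2 e v hv)⟩
  smul_mem' := by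
    intro c F hF n
    obtain ⟨f, hf⟩ := (hF n).1
    exact ⟨⟨c • f, fun v => by simp [hf]⟩,
      fun e v hv => Submodule.smul_mem _ _ ((hF n).2 e v hv)⟩

/-- The Hochschild differential on elements of total degree `d`.  On a map `f` of arity `n` and
internal degree `r = d - n` it is
`(-1)^r (m(1 ⊗ f) + (-1)^(n+1) m(f ⊗ 1) + ∑_{i<n} (-1)^(i+1) f(1^{⊗ i} ⊗ m ⊗ 1^{⊗ (n-1-i)}))`,
evaluated with the Koszul sign rule. -/
def diff (𝒜 : ℤ → Submodule k B) [GradedAlgebra 𝒜] (d : ℤ) : Coch B →ₗ[k] Coch B where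
  toFun F := fun N => match N with
    | 0 => fun _ => 0
    | n + 1 => fun v => (((d - n).negOnePow : ℤ) : k) •
        (koszul 𝒜 (d - n) (v 0) * F n (fun j => v j.succ)
          + (-1 : k) ^ (n + 1) • (F n (fun j => v j.castSucc) * v (Fin.last n))
          + ∑ i : Fin n, (-1 : k) ^ (i.val + 1) •
              F n (Fin.contractNth i.castSucc (fun a b => a * b) v))
  map_add' := by
    intro F G
    funext N v
    cases N with
    | zero => simp
    | succ n =>
      simp only [Pi.add_apply, mul_add, add_mul, smul_add, Finset.sum_add_distrib]
      abel
  map_smul' := by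
    intro c F
    funext N v
    cases N with
    | zero => simp
    | succ n =>
      simp only [Pi.smul_apply, RingHom.id_apply, mul_smul_comm, smul_mul_assoc, smul_add,
        Finset.smul_sum, smul_comm c]

/-- Hochschild cocycles of total degree `d`. -/
def cocycles (𝒜 : ℤ → Submodule k B) [GradedAlgebra 𝒜] (d : ℤ) : Submodule k (Coch B) :=
  cochains 𝒜 d ⊓ LinearMap.ker (diff 𝒜 d)

/-- Hochschild coboundaries of total degree `d`. -/
def coboundaries (𝒜 : ℤ → Submodule k B) [GradedAlgebra 𝒜] (d : ℤ) : Submodule k (Coch B) :=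
  (cochains 𝒜 (d - 1)).map (diff 𝒜 (d - 1))

/-- The Hochschild cohomology `HH^d(B, B)` in total degree `d`. -/
abbrev HH (𝒜 : ℤ → Submodule k B) [GradedAlgebra 𝒜] (d : ℤ) : Type _ :=
  cocycles 𝒜 d ⧸ (coboundaries 𝒜 d).submoduleOf (cocycles 𝒜 d)

/-- `F` is a cocycle of degree `d` whose cohomology class is `x`. -/
def Represents (𝒜 : ℤ → Submodule k B) [GradedAlgebra 𝒜] {d : ℤ} (F : Coch B) (x : HH 𝒜 d) :
    Prop :=
  ∃ h : F ∈ cocycles 𝒜 d, Submodule.Quotient.mk ⟨F, h⟩ = x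

/-- For `f` of arity `m` and `g` of arity `n` and internal degree `s`, where `m + n = N + 1`, the map
`f(1^{⊗ p} ⊗ g ⊗ 1^{⊗ (m-1-p)})` of arity `N`, evaluated with the Koszul sign rule. -/
def insertAt (𝒜 : ℤ → Submodule k B) [GradedAlgebra 𝒜] {m n N : ℕ} (h : m + n = N + 1) (s : ℤ)
    (f : (Fin m → B) → B) (g : (Fin n → B) → B) (p : Fin m) : (Fin N → B) → B := fun v =>
  f fun j =>
    if h1 : j.val < p.val then koszul 𝒜 s (v ⟨j.val, by omega⟩)
    else if h2 : j.val = p.val then g fun l => v ⟨p.val + l.val, by omega⟩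
    else v ⟨j.val + n - 1, by omega⟩

/-- The product `F ∘ G` of elements of total degrees `i` and `j`: the components of arities `m` and
`n`, with `m + n = N + 1`, contribute `∑_{p<m} (-1)^(p(n-1)) (-1)^((m-1)(j-1)) f(1^{⊗ p} ⊗ g ⊗ 1^{⊗ (m-1-p)})`. -/
def circ (𝒜 : ℤ → Submodule k B) [GradedAlgebra 𝒜] (j : ℤ) (F G : Coch B) : Coch B :=
  fun N v => ∑ m : Fin (N + 2), ∑ p : Fin m.val,
    ((((p.val : ℤ) * ((N + 1 - m.val : ℕ) - 1) + (m.val - 1) * (j - 1)).negOnePow : ℤ) : k) •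
      insertAt 𝒜 (show m.val + (N + 1 - m.val) = N + 1 by omega) (j - (N + 1 - m.val : ℕ))
        (F m.val) (G (N + 1 - m.val)) p v

/-- The Gerstenhaber bracket `[F, G] = F ∘ G - (-1)^((i-1)(j-1)) G ∘ F` of elements of total degrees
`i` and `j`. -/
def bracket (𝒜 : ℤ → Submodule k B) [GradedAlgebra 𝒜] (i j : ℤ) (F G : Coch B) : Coch B :=
  circ 𝒜 j F G - (((((i - 1) * (j - 1)).negOnePow : ℤ) : k)) • circ 𝒜 i G F

/-- `[x, y] = z` for the Gerstenhaber bracket `HH^i × HH^j → HH^(i+j-1)`: for all cocycles `F` and `G`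
representing `x` and `y`, the bracket `[F, G]` is a cocycle representing `z`. -/
def IsBracket (𝒜 : ℤ → Submodule k B) [GradedAlgebra 𝒜] {i j l : ℤ}
    (x : HH 𝒜 i) (y : HH 𝒜 j) (z : HH 𝒜 l) : Prop :=
  l = i + j - 1 ∧ ∀ F G : Coch B, Represents 𝒜 F x → Represents 𝒜 G y →
    Represents 𝒜 (bracket 𝒜 i j F G) z

end GradedHochschild

/-! ### Graded gentle quivers and graded gentle algebras -/

/-- A graded gentle quiver with vertices `V` and arrows `E`.  Arrows are composed from right to left:
`rel a b` means that `ab` is a path of length two which lies in the ideal `I`; these paths generate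
`I`. -/
structure GradedGentleQuiver (V E : Type*) where
  src : E → V
  tgt : E → V
  deg : E → ℤ
  rel : E → E → Prop
  rel_composable : ∀ a b, rel a b → src a = tgt b
  out_le_two : ∀ x, {a | src a = x}.encard ≤ 2
  in_le_two : ∀ x, {a | tgt a = x}.encard ≤ 2
  rel_left_unique : ∀ a b b', rel b a → rel b' a → b = b'
  rel_right_unique : ∀ a b b', rel a b → rel a b' → b = b'
  nonrel_left_unique : ∀ a b b', src b = tgt a → ¬ rel b a → src b' = tgt a → ¬ rel b' a → b = b'
  nonrel_right_unique : ∀ a b b', src a = tgt b → ¬ rel a b → src a = tgt b' → ¬ rel a b' → b = b'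

namespace GradedGentleQuiver

variable {V E : Type*} (Q : GradedGentleQuiver V E)

/-- `ab` is a path of length two which does not lie in `I`. -/
def nonrel (a b : E) : Prop := Q.src a = Q.tgt b ∧ ¬ Q.rel a b

/-- The word `α₁ ⋯ α_l` is a path from `s` to `t`, that is, `t = t(α₁)`, `s(α_i) = t(α_{i+1})` and
`s(α_l) = s`; the empty word is the trivial path. -/
def IsWalk : V → V → List E → Prop
  | t, s, [] => t = s
  | t, s, a :: w => Q.tgt a = t ∧ IsWalk (Q.src a) s w

/-- The degree of a path. -/
def wdeg (w : List E) : ℤ := (w.map Q.deg).sum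

/-- The paths of the quiver which do not lie in `I`, including the trivial paths. -/
@[ext]
structure NZPath where
  tgt : V
  src : V
  word : List E
  walk : Q.IsWalk tgt src word
  nonzero : word.IsChain Q.nonrel

theorem IsWalk.append {Q : GradedGentleQuiver V E} {t s r : V} {w w' : List E}
    (h : Q.IsWalk t s w) (h' : Q.IsWalk s r w') : Q.IsWalk t r (w ++ w') := by
  induction w generalizing t with
  | nil => cases h; exact h'
  | cons a w ih => exact ⟨h.1, ih h.2⟩

/-- The trivial path at `x`. -/
def trivialPath (x : V) : Q.NZPath := ⟨x, x, [], rfl, by simp⟩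

/-- An arrow as a path. -/
def arrowPath (a : E) : Q.NZPath := ⟨Q.tgt a, Q.src a, [a], ⟨rfl, rfl⟩, by simp⟩

theorem wdeg_append (w w' : List E) : Q.wdeg (w ++ w') = Q.wdeg w + Q.wdeg w' := by
  simp [wdeg]

variable (k : Type*) [Field k]

/-- The graded gentle algebra `kQ / I`.  As `I` is generated by paths, the paths which do not lie in
`I` form a basis of it; the product of two of them is their concatenation, if this is a path which
does not lie in `I`, and zero otherwise. -/
def Alg : Type _ := Q.NZPath →₀ k

instance : AddCommGroup (Q.Alg k) := inferInstanceAs (AddCommGroup (Q.NZPath →₀ k))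

instance : Module k (Q.Alg k) := inferInstanceAs (Module k (Q.NZPath →₀ k))

/-- The basis element of the algebra given by a path. -/
def ofPath (p : Q.NZPath) : Q.Alg k := Finsupp.single p (1 : k)

open scoped Classical in
/-- The product of two basis elements. -/
def pathMul (p q : Q.NZPath) : Q.Alg k :=
  if h : p.src = q.tgt ∧ (p.word ++ q.word).IsChain Q.nonrel then
    Q.ofPath k ⟨p.tgt, q.src, p.word ++ q.word, p.walk.append (h.1 ▸ q.walk), h.2⟩
  else 0

/-- The product of the algebra as a bilinear map. -/
def mulLin : Q.Alg k →ₗ[k] Q.Alg k →ₗ[k] Q.Alg k :=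
  Finsupp.linearCombination k fun p : Q.NZPath =>
    (Finsupp.linearCombination k fun q : Q.NZPath => Q.pathMul k p q : Q.Alg k →ₗ[k] Q.Alg k)

variable {k}

theorem mulLin_ofPath (p q : Q.NZPath) :
    Q.mulLin k (Q.ofPath k p) (Q.ofPath k q) = Q.pathMul k p q := by
  have h : Q.mulLin k (Q.ofPath k p) =
      (Finsupp.linearCombination k fun q : Q.NZPath => Q.pathMul k p q : Q.Alg k →ₗ[k] Q.Alg k) :=
    (Finsupp.linearCombination_single k (1 : k) p).trans (one_smul k _)
  rw [h]
  exact (Finsupp.linearCombination_single k (1 : k) q).trans (one_smul k _)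

theorem alg_induction {motive : Q.Alg k → Prop} (a : Q.Alg k) (h0 : motive 0)
    (hadd : ∀ a b, motive a → motive b → motive (a + b))
    (hs : ∀ (c : k) p, motive (c • Q.ofPath k p)) : motive a := by
  refine Finsupp.induction_linear (motive := motive) a h0 hadd ?_
  intro p c
  have : (Finsupp.single p c : Q.NZPath →₀ k) = c • Finsupp.single p (1 : k) := by simp
  rw [this]
  exact hs c p

theorem pathMul_assoc (p q r : Q.NZPath) :
    Q.mulLin k (Q.pathMul k p q) (Q.ofPath k r) = Q.mulLin k (Q.ofPath k p) (Q.pathMul k q r) := by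
  unfold pathMul
  split_ifs with h1 h2 h2
  · rw [mulLin_ofPath, mulLin_ofPath]
    unfold pathMul
    by_cases h : (p.word ++ (q.word ++ r.word)).IsChain Q.nonrel
    · rw [dif_pos ⟨h2.1, by rwa [List.append_assoc]⟩, dif_pos ⟨h1.1, h⟩]
      congr 2
      exact List.append_assoc _ _ _
    · rw [dif_neg (fun h' => h (by simpa using h'.2)), dif_neg (fun h' => h h'.2)]
  · rw [mulLin_ofPath, map_zero, pathMul, dif_neg]
    rintro ⟨h3, h4⟩
    refine h2 ⟨h3, ?_⟩
    simp only [List.append_assoc] at h4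
    exact h4.right_of_append
  · rw [mulLin_ofPath, map_zero, LinearMap.zero_apply, pathMul, dif_neg]
    rintro ⟨h3, h4⟩
    refine h1 ⟨h3, ?_⟩
    simp only [← List.append_assoc] at h4
    exact h4.left_of_append
  · simp

theorem mulLin_assoc (a b c : Q.Alg k) :
    Q.mulLin k (Q.mulLin k a b) c = Q.mulLin k a (Q.mulLin k b c) := by
  induction a using Q.alg_induction with
  | h0 => simp
  | hadd x y hx hy => simp [hx, hy]
  | hs u p =>
    induction b using Q.alg_induction with
    | h0 => simp
    | hadd x y hx hy => simp only [map_add, LinearMap.add_apply, hx, hy]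
    | hs v q =>
      induction c using Q.alg_induction with
      | h0 => simp
      | hadd x y hx hy => simp only [map_add, hx, hy]
      | hs w r =>
        simp only [map_smul, LinearMap.smul_apply, mulLin_ofPath, pathMul_assoc]

section
variable [Fintype V]

instance : One (Q.Alg k) := ⟨∑ x, Q.ofPath k (Q.trivialPath x)⟩

theorem alg_one_def : (1 : Q.Alg k) = ∑ x, Q.ofPath k (Q.trivialPath x) := rfl

theorem mulLin_one_left (a : Q.Alg k) : Q.mulLin k 1 a = a := by
  classical
  induction a using Q.alg_induction with
  | h0 => simp
  | hadd x y hx hy => rw [map_add, hx, hy]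
  | hs c p =>
    rw [map_smul, alg_one_def, map_sum, LinearMap.sum_apply, Finset.sum_eq_single p.tgt]
    · rw [mulLin_ofPath, pathMul, dif_pos ⟨rfl, p.nonzero⟩]
      rfl
    · intro x _ hx
      rw [mulLin_ofPath, pathMul, dif_neg]
      exact fun h => hx h.1
    · simp

theorem mulLin_one_right (a : Q.Alg k) : Q.mulLin k a 1 = a := by
  classical
  induction a using Q.alg_induction with
  | h0 => simp
  | hadd x y hx hy => rw [map_add, LinearMap.add_apply, hx, hy]
  | hs c p =>
    rw [map_smul, LinearMap.smul_apply, alg_one_def, map_sum, Finset.sum_eq_single p.src]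
    · rw [mulLin_ofPath, pathMul, dif_pos ⟨rfl, by simpa [trivialPath] using p.nonzero⟩]
      congr 2
      ext <;> simp [trivialPath]
    · intro x _ hx
      rw [mulLin_ofPath, pathMul, dif_neg]
      exact fun h => hx h.1.symm
    · simp

instance : Ring (Q.Alg k) where
  __ := (inferInstance : AddCommGroup (Q.Alg k))
  mul a b := Q.mulLin k a b
  left_distrib a b c := map_add (Q.mulLin k a) b c
  right_distrib a b c := by
    change Q.mulLin k (a + b) c = Q.mulLin k a c + Q.mulLin k b c
    simp
  zero_mul a := by
    change Q.mulLin k 0 a = 0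
    simp
  mul_zero a := map_zero (Q.mulLin k a)
  mul_assoc := Q.mulLin_assoc
  one_mul := Q.mulLin_one_left
  mul_one := Q.mulLin_one_right

theorem alg_mul_def (a b : Q.Alg k) : a * b = Q.mulLin k a b := rfl

instance : Algebra k (Q.Alg k) :=
  Algebra.ofModule
    (fun c a b => by
      change Q.mulLin k (c • a) b = c • Q.mulLin k a b
      simp)
    (fun c a b => map_smul (Q.mulLin k a) c b)

variable (k)

/-- The grading of the algebra: the degree `d` part is spanned by the paths of degree `d`. -/
def grading (d : ℤ) : Submodule k (Q.Alg k) :=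
  Submodule.span k {a | ∃ p : Q.NZPath, Q.wdeg p.word = d ∧ a = Q.ofPath k p}

variable {k}

theorem ofPath_mem_grading (p : Q.NZPath) : Q.ofPath k p ∈ Q.grading k (Q.wdeg p.word) :=
  Submodule.subset_span ⟨p, rfl, rfl⟩

instance : SetLike.GradedMonoid (Q.grading k) where
  one_mem := by
    rw [alg_one_def]
    exact Submodule.sum_mem _ fun x _ => Q.ofPath_mem_grading (Q.trivialPath x)
  mul_mem := by
    intro i j a b ha hb
    induction ha using Submodule.span_induction with
    | zero => rw [zero_mul]; exact Submodule.zero_mem _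
    | add x y _ _ hx hy => rw [add_mul]; exact Submodule.add_mem _ hx hy
    | smul c x _ hx => rw [smul_mul_assoc]; exact Submodule.smul_mem _ _ hx
    | mem x hx =>
      obtain ⟨p, rfl, rfl⟩ := hx
      induction hb using Submodule.span_induction with
      | zero => rw [mul_zero]; exact Submodule.zero_mem _
      | add x y _ _ hx hy => rw [mul_add]; exact Submodule.add_mem _ hx hy
      | smul c x _ hx => rw [mul_smul_comm]; exact Submodule.smul_mem _ _ hx
      | mem y hy =>
        obtain ⟨q, rfl, rfl⟩ := hy
        rw [alg_mul_def, mulLin_ofPath, pathMul]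
        split_ifs
        · rw [← wdeg_append]
          exact Q.ofPath_mem_grading ⟨_, _, _, _, _⟩
        · exact Submodule.zero_mem _

/-- The decomposition of an element of the algebra into homogeneous components. -/
def decomposeLin : Q.Alg k →ₗ[k] ⨁ d, Q.grading k d :=
  Finsupp.linearCombination k fun p : Q.NZPath =>
    DirectSum.lof k ℤ (fun d => Q.grading k d) (Q.wdeg p.word)
      ⟨Q.ofPath k p, Q.ofPath_mem_grading p⟩

theorem decomposeLin_ofPath (p : Q.NZPath) : Q.decomposeLin (Q.ofPath k p) =
    DirectSum.lof k ℤ (fun d => Q.grading k d) (Q.wdeg p.word)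
      ⟨Q.ofPath k p, Q.ofPath_mem_grading p⟩ :=
  (Finsupp.linearCombination_single k (1 : k) p).trans (one_smul k _)

instance : DirectSum.Decomposition (Q.grading k) where
  decompose' := Q.decomposeLin
  left_inv a := by
    induction a using Q.alg_induction with
    | h0 => simp
    | hadd x y hx hy => rw [map_add, map_add, hx, hy]
    | hs c p =>
      rw [map_smul, decomposeLin_ofPath, ← map_smul]
      exact DirectSum.coeAddMonoidHom_of _ _ _
  right_inv x := by
    induction x using DirectSum.induction_on with
    | zero => simp
    | add x y hx hy => rw [map_add, map_add, hx, hy]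
    | of i x =>
      obtain ⟨a, ha⟩ := x
      rw [DirectSum.coeAddMonoidHom_of]
      change Q.decomposeLin a = DirectSum.lof k ℤ (fun d => Q.grading k d) i ⟨a, ha⟩
      induction ha using Submodule.span_induction with
      | zero =>
        rw [map_zero]
        exact (map_zero (DirectSum.lof k ℤ (fun d => Q.grading k d) i)).symm
      | add x y h h' hx hy =>
        rw [map_add, hx, hy, ← map_add]
        rfl
      | smul c x h hx =>
        rw [map_smul, hx, ← map_smul]
        rfl
      | mem x hx =>
        obtain ⟨p, rfl, rfl⟩ := hx
        exact Q.decomposeLin_ofPath p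

instance : GradedAlgebra (Q.grading k) where

end

/-! ### Paths and anti-paths -/

/-- The word is a complete anti-path: it is non-empty and cyclically all its subpaths of length two
lie in `I`. -/
def IsCompleteAnti (w : List E) : Prop := w ≠ [] ∧ (w ++ w).IsChain Q.rel

/-- The word is a complete path: it is non-empty and cyclically it is a path without subpaths of
length two in `I`. -/
def IsCompletePath (w : List E) : Prop := w ≠ [] ∧ (w ++ w).IsChain Q.nonrel

/-- The period of a word: the smallest `n ≥ 1` such that its `n`-fold rotation is itself. -/
def period (w : List E) : ℕ := Function.minimalPeriod (fun w' : List E => w'.rotate 1) w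

/-- The primitive complete anti-paths and the primitive complete paths of the quiver.  They stand for
the parametrisations of the unmarked and of the fully marked boundary components of the surface. -/
structure PrimitiveLoop where
  anti : Bool
  word : List E
  complete : if anti then Q.IsCompleteAnti word else Q.IsCompletePath word
  primitive : period word = word.length

namespace PrimitiveLoop

variable {Q}

/-- The `m`-th power of a complete path or anti-path. -/
def pow (u : Q.PrimitiveLoop) (m : ℕ) : List E := (List.replicate m u.word).flatten

/-- The winding number: `l(p) - |p|` for a complete anti-path `p`, and `|q|` for a complete path `q`. -/
def winding (u : Q.PrimitiveLoop) : ℤ :=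
  if u.anti then u.word.length - Q.wdeg u.word else Q.wdeg u.word

/-- Both are anti-paths or both are paths, and they agree up to rotation: they belong to the same
boundary component. -/
def SameComponent (u v : Q.PrimitiveLoop) : Prop := u.anti = v.anti ∧ u.word ~r v.word

theorem word_ne_nil (u : Q.PrimitiveLoop) : u.word ≠ [] := by
  have h := u.complete
  split_ifs at h
  · exact h.1
  · exact h.1

theorem pow_ne_nil (u : Q.PrimitiveLoop) (m : ℕ+) : u.pow m ≠ [] := by
  have h := u.word_ne_nil
  simp only [PrimitiveLoop.pow, ne_eq, List.flatten_eq_nil_iff, List.mem_replicate]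
  exact fun h' => h (h' _ ⟨m.ne_zero, rfl⟩)

variable (k) in
/-- The condition that the `m`-th power of `u` has even winding number, or `char k = 2`. -/
def Good (u : Q.PrimitiveLoop) (m : ℕ+) : Prop :=
  Even ((m : ℤ) * u.winding) ∨ ringChar k = 2

theorem Good.add {u : Q.PrimitiveLoop} {m n : ℕ+} (hm : u.Good k m) (hn : u.Good k n) :
    u.Good k (m + n) := by
  rcases hm with hm | hm
  · rcases hn with hn | hn
    · left
      have := hm.add hn
      push_cast
      rwa [add_mul]
    · exact Or.inr hn
  · exact Or.inr hm

end PrimitiveLoop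

/-- The data of a boundary component with exactly one stop: parallel paths `(p, q)` from `s` to `t`,
where `p` is a maximal anti-path of positive length and `q` is a path without subpaths in `I` whose
first and last arrows (if `q` is not trivial) differ from those of `p`; or `p` is trivial and `q` is a
closed maximal path of positive length without subpaths in `I`. -/
structure OneStop where
  s : V
  t : V
  p : List E
  q : List E
  p_walk : Q.IsWalk t s p
  q_walk : Q.IsWalk t s q
  p_anti : p.IsChain Q.rel
  q_path : q.IsChain Q.nonrel
  maximal :
    (p ≠ [] ∧ (∀ w : List E, w.IsChain Q.rel → p <:+: w → w = p) ∧
      p.head? ≠ q.head? ∧ p.getLast? ≠ q.getLast?) ∨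
    (p = [] ∧ q ≠ [] ∧ ∀ w : List E, w.IsChain Q.nonrel → q <:+: w → w = q)

/-- No connected component of the quiver consists of one vertex and one loop, or is a Kronecker quiver
(two vertices and two parallel arrows). -/
def NoLoopOrKronecker : Prop :=
  (∀ a, Q.src a = Q.tgt a → ∃ b, b ≠ a ∧ (Q.src b = Q.src a ∨ Q.tgt b = Q.src a)) ∧
  (∀ a b, a ≠ b → Q.src a = Q.src b → Q.tgt a = Q.tgt b → Q.src a ≠ Q.tgt a →
    ∃ c, c ≠ a ∧ c ≠ b ∧
      (Q.src c = Q.src a ∨ Q.src c = Q.tgt a ∨ Q.tgt c = Q.src a ∨ Q.tgt c = Q.tgt a))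

/-! ### The Hochschild cochains -/

variable [Fintype V]
variable (k)

open GradedHochschild

/-- An arrow as an element of the algebra. -/
def arrow (a : E) : Q.Alg k := Q.ofPath k (Q.arrowPath a)

/-- A word as an element of the algebra: the product of its arrows. -/
def wordElt (w : List E) : Q.Alg k := (w.map (Q.arrow k)).prod

/-- The path with word `w` and start vertex `x` as an element of the algebra. -/
def pathElt (w : List E) (x : V) : Q.Alg k := Q.wordElt k w * Q.ofPath k (Q.trivialPath x)

variable {k} in
/-- The coefficients of an element of the algebra in the basis of paths. -/
def coeffs (a : Q.Alg k) : Q.NZPath →₀ k := a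

variable {k} in
/-- The `k`-multilinear extension of a function on tuples of basis elements. -/
def extend {n : ℕ} (f : (Fin n → Q.NZPath) → Q.Alg k) : (Fin n → Q.Alg k) → Q.Alg k := fun v =>
  ∑ X ∈ Fintype.piFinset (fun i => (Q.coeffs (v i)).support),
    (∏ i, Q.coeffs (v i) (X i)) • f X

open scoped Classical in
/-- The Hochschild cochain `(p, q)` attached to an anti-path `p` and a parallel path `q` with start
vertex `x`.  Its arity is the length of `p`, and it sends a tuple of paths `(v₁, …, v_n)` outside `I`
to the sum of `(-1)^(|v'| (|q| - |p|)) v' q v''` over all factorisations `v₁ ⋯ v_n = v' p v''`.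
It is the image of the basis element `(p, q)` of the Bardzell complex under the comparison map from
the Bardzell complex to the Hochschild complex. -/
def dual (p q : List E) (x : V) : Coch (Q.Alg k) := fun n v =>
  if p.length = n then
    Q.extend (fun X : Fin n → Q.NZPath =>
      let T : List E := (List.ofFn fun i => (X i).word).flatten
      ∑ i ∈ Finset.range (T.length + 1),
        if p <+: T.drop i then
          (((Q.wdeg (T.take i) * (Q.wdeg q - Q.wdeg p)).negOnePow : ℤ) : k) •
            (Q.wordElt k (T.take i) * Q.pathElt k q x * Q.wordElt k (T.drop (i + p.length)))
        else 0) v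
  else 0

open scoped Classical in
/-- The cochain `N⁰(w)` of a complete anti-path (`anti = true`) or complete path (`anti = false`) `w`
of period `r`: the signed sum over `0 ≤ i < r` of `(rotⁱ w, e_x)`, respectively `(e_x, rotⁱ w)`, where
`x` is the start and end vertex of `rotⁱ w`. -/
def cochainN0 (anti : Bool) (w : List E) : Coch (Q.Alg k) :=
  ∑ i : Fin w.length, if i.val < period w then
    if anti then
      (((i.val * w.length + Q.wdeg w * Q.wdeg (w.take i.val)).negOnePow : ℤ) : k) •
        Q.dual k (w.rotate i.val) [] (Q.tgt (w.get i))
    else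
      (((Q.wdeg w * Q.wdeg (w.take i.val)).negOnePow : ℤ) : k) •
        Q.dual k [] (w.rotate i.val) (Q.tgt (w.get i))
  else 0

/-- The cochain `N¹(w)` of a complete anti-path or complete path `w` with last letter `α`:
`(-1)^(l(w) (1 + |α|)) (α w, α)` for an anti-path, and `-(α, α w)` for a path.  The signs are
normalised so that `[N⁰(uᵐ), N¹(uⁿ)] = m N⁰(uᵐ⁺ⁿ)` for paths as well as for anti-paths. -/
def cochainN1 (anti : Bool) (w : List E) (hw : w ≠ []) : Coch (Q.Alg k) :=
  let α := w.getLast hw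
  if anti then
    (((w.length * (1 + Q.deg α)).negOnePow : ℤ) : k) • Q.dual k (α :: w) [α] (Q.src α)
  else
    -Q.dual k [α] (α :: w) (Q.src α)

variable {k} in
/-- The cochain `∑_α f(α) (α, α)`. -/
def cochainH [Fintype E] (f : E → k) : Coch (Q.Alg k) :=
  ∑ a, f a • Q.dual k [a] [a] (Q.src a)

/-- The unit `∑_x (e_x, e_x)`. -/
def cochainUnit : Coch (Q.Alg k) := ∑ x, Q.dual k [] [] x

variable {Q}

/-- The cochain `N⁰(uᵐ)`. -/
def PrimitiveLoop.N0 (u : Q.PrimitiveLoop) (m : ℕ+) : Coch (Q.Alg k) :=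
  Q.cochainN0 k u.anti (u.pow m)

/-- The cochain `N¹(uᵐ)`. -/
def PrimitiveLoop.N1 (u : Q.PrimitiveLoop) (m : ℕ+) : Coch (Q.Alg k) :=
  Q.cochainN1 k u.anti (u.pow m) (u.pow_ne_nil m)

variable (Q)

/-- The elements of Hochschild cohomology whose brackets are described: the unit, the classes coming
from the first cohomology of the surface (given by 1-cocycles `f : E → k` on the quiver), the classes
`N⁰(uᵐ)` and `N¹(uᵐ)` and the classes of boundary components with one stop. -/
inductive Elt where
  | unit : Elt
  | ofH (f : E → k) : Elt
  | ofN0 (u : Q.PrimitiveLoop) (m : ℕ+) (h : u.Good k m) : Elt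
  | ofN1 (u : Q.PrimitiveLoop) (m : ℕ+) (h : u.Good k m) : Elt
  | ofB (c : Q.OneStop) : Elt

namespace Elt

variable {Q} {k}

/-- The degree in Hochschild cohomology. -/
def degree : Q.Elt k → ℤ
  | unit => 0
  | ofH _ => 1
  | ofN0 u m _ => m * u.winding
  | ofN1 u m _ => m * u.winding + 1
  | ofB c => c.p.length + Q.wdeg c.q - Q.wdeg c.p

/-- The representing Hochschild cocycle. -/
def cochain [Fintype E] : Q.Elt k → Coch (Q.Alg k)
  | unit => Q.cochainUnit k
  | ofH f => Q.cochainH f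
  | ofN0 u m _ => u.N0 k m
  | ofN1 u m _ => u.N1 k m
  | ofB c => Q.dual k c.p c.q c.s

/-- The closed walk in `Q^±` which is the boundary cycle of the element: `(α, true)` stands for `α` and
`(α, false)` for `α⁻¹`.  It runs along paths in their direction and along anti-paths against it.  For
the unit and for the classes `ofH f` there is no boundary cycle. -/
def boundaryCycle : Q.Elt k → Option (List (E × Bool))
  | unit => none
  | ofH _ => none
  | ofN0 u m _ => some (loopCycle u m)
  | ofN1 u m _ => some (loopCycle u m)
  | ofB c => some (c.p.reverse.map (fun a => (a, false)) ++ c.q.map (fun a => (a, true)))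
where
  loopCycle (u : Q.PrimitiveLoop) (m : ℕ+) : List (E × Bool) :=
    if u.anti then (u.pow m).reverse.map (fun a => (a, false))
    else (u.pow m).map (fun a => (a, true))

end Elt

variable {Q} {k} in
/-- The value of a 1-cocycle on a closed walk in `Q^±`. -/
def evalWalk (f : E → k) (c : List (E × Bool)) : k :=
  (c.map fun x => if x.2 then f x.1 else -f x.1).sum

variable {k} in
/-- The coboundary of a function on the vertices. -/
def coboundary (g : V → k) : E → k := fun a => g (Q.tgt a) - g (Q.src a)

variable {Q} {k} in
/-- The pairs of elements whose bracket is described explicitly. -/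
inductive Elt.Listed : Q.Elt k → Q.Elt k → Prop
  | h_N0 (f u m h) : Listed (.ofH f) (.ofN0 u m h)
  | h_N1 (f u m h) : Listed (.ofH f) (.ofN1 u m h)
  | h_B (f c) : Listed (.ofH f) (.ofB c)
  | N0_N1 (u m hu v n hv) : u.SameComponent v → Listed (.ofN0 u m hu) (.ofN1 v n hv)
  | N1_N1 (u m hu v n hv) : u.SameComponent v → Listed (.ofN1 u m hu) (.ofN1 v n hv)

variable {Q} {k} in
/-- The two classes with one stop of an oriented cycle with two arrows `a`, `b` of odd total degree and
the single relation `ab`, in characteristic different from two. -/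
def Elt.ExceptionalPair (x y : Q.Elt k) : Prop :=
  ∃ (a b : E) (c c' : Q.OneStop), x = .ofB c ∧ y = .ofB c' ∧ c.p = [a, b] ∧ c.q = [] ∧
    c'.p = [] ∧ c'.q = [b, a] ∧ Odd (Q.deg a + Q.deg b) ∧ ringChar k ≠ 2

end GradedGentleQuiver

end

open GradedHochschild GradedGentleQuiver

/-! Cochains are treated as functions on lists, so that the Gerstenhaber composition becomes a
signed sum over cuts of the argument list. A single identity carries the general theory: the graded
pre-Lie law `comp_comp`. It says that the associator of the composition consists of the insertions
of two cochains into disjoint slots, and these are symmetric up to sign. The Hochschild differential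
is the bracket with the multiplication `m` (`ev_diff`), and associativity is `m ∘ m = 0`. Hence the
pre-Lie law gives `dif_dif` and the Leibniz rule `dif_brk`, and the bracket descends to cohomology,
where one pair of representatives suffices (`isBracket_of_represents`).

The second ingredient reduces everything to anti-paths, in the manner of discrete Morse theory.
Consider a list of composable paths of positive length which is not just an anti-path of arrows. It
begins with a maximal, possibly empty, anti-path of arrows that can be followed in two ways. Either
the last of these arrows is some `β` and the next entry `Z` has nonzero product `βZ`, or the next
entry is a longer path `βZ` whose first arrow continues the anti-path. Merging and splitting `β` and
`Z` matches lists of the two kinds, and only anti-paths remain unmatched. Consequently a normalised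
cocycle which vanishes on anti-paths is a coboundary (`mem_coboundaries_of_vanishesAnti`), and one
which also vanishes on the unmerged lists is zero (`Normal.eq_zero_of_vanishes`). The differential
of a cochain `(p, q)` vanishes on unmerged lists (`vanishesUp_diff_dual`), and on anti-paths `(p,
q)` is the indicator of `p` with value `q` (`dualList_arr`). So the cocycle condition and the
equality of classes need to be tested only on anti-paths; in effect the computation takes place in
the Bardzell complex.

The listed brackets are then counts. The derivation `f` scales a pair `(p, q)` by `f(q) - f(p)`,
which is the value of `f` on the boundary cycle. For a loop `u` with last letter `α`, the bracket
with `N¹(uⁿ)` replaces occurrences of `α` in a periodic word. There are `m + 1` occurrences in `αuᵐ`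
and `m` in each rotation of `uᵐ`, and consecutive occurrences differ by the sign `(-1)^(nω)`. The
coefficients are therefore the sums `sgnSum`. For even winding numbers this gives `(m + 1) - (n + 1)
= m - n` and `m`; for odd ones the sums alternate.

For the vanishing brackets, a composition of `(p, q)` with `(p', q')` can be nonzero on an anti-path
only if an arrow of `p` occurs in `q'`, and the possible shapes are listed in `Ins`. Gentleness,
together with the maximality or periodicity of the words, forces the resulting pair to have a common
first or last arrow, or a common prolongation on the left. A cocycle supported on such pairs is a
coboundary, because a common arrow can be stripped off (`mem_coboundaries_of_strip`). The oriented
cycle with two arrows and one relation is the one case where insertion produces the diagonal pairs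
`(a, a)` and `(b, b)`. If `|a| + |b|` is even or the characteristic is two, their combination is the
coboundary of a function on the vertices. -/

noncomputable section

namespace GradedHochschild

/-! ### Signs -/

/-- The sign `(-1)^e` in a field. -/
abbrev sgn (k : Type*) [Field k] (e : ℤ) : k := ((e.negOnePow : ℤ) : k)

section Sign
variable (k : Type*) [Field k]

/-- A sign depends only on the parity of its exponent. Longer sign identities are pushed through
this lemma to `ZMod 2`, where the exponents are polynomials in finitely many residues and `decide`
settles them. -/
theorem sgn_congr {a b : ℤ} (h : (a : ZMod 2) = (b : ZMod 2)) : sgn k a = sgn k b := by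
  have h2 : Even (a - b) := by
    rw [← ZMod.intCast_eq_zero_iff_even]
    push_cast
    rw [h, sub_self]
  have : a.negOnePow = b.negOnePow := by
    rw [Int.negOnePow_eq_iff]
    exact h2
  simp only [sgn, this]

theorem sgn_add (a b : ℤ) : sgn k (a + b) = sgn k a * sgn k b := by
  simp [sgn, Int.negOnePow_add]

theorem sgn_mul_sgn (a b : ℤ) : sgn k a * sgn k b = sgn k (a + b) := (sgn_add k a b).symm

@[simp] theorem sgn_zero : sgn k 0 = 1 := by simp [sgn]

theorem sgn_one : sgn k 1 = -1 := by simp [sgn]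

theorem sgn_mul_self (a : ℤ) : sgn k a * sgn k a = 1 := by
  rw [← sgn_add, ← sgn_zero k]
  apply sgn_congr
  push_cast
  generalize (a : ZMod 2) = x
  revert x; decide

theorem sgn_ne_zero (a : ℤ) : sgn k a ≠ 0 := left_ne_zero_of_mul_eq_one (sgn_mul_self k a)

theorem sgn_natCast (n : ℕ) : sgn k n = (-1) ^ n := by
  simp [sgn, Int.negOnePow_def]

theorem sgn_of_even {a : ℤ} (h : Even a) : sgn k a = 1 := by
  simp [sgn, Int.negOnePow_even a h]

theorem sgn_of_odd {a : ℤ} (h : Odd a) : sgn k a = -1 := by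
  simp [sgn, Int.negOnePow_odd a h]

theorem neg_sgn (a : ℤ) : -sgn k a = sgn k (a + 1) := by
  rw [sgn_add, sgn_one, mul_neg_one]

end Sign

/-! ### Sums over decompositions of lists -/

section Split
variable {A C M : Type*} [AddCommMonoid M]

/-- The sum of `φ a b` over all decompositions `l = a ++ b`. -/
def sumSplit (φ : List A → List A → M) (l : List A) : M :=
  ∑ p ∈ Finset.range (l.length + 1), φ (l.take p) (l.drop p)

theorem sumSplit_nil (φ : List A → List A → M) : sumSplit φ [] = φ [] [] := by simp [sumSplit]

theorem sumSplit_cons (φ : List A → List A → M) (x : A) (l : List A) :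
    sumSplit φ (x :: l) = φ [] (x :: l) + sumSplit (fun a b => φ (x :: a) b) l := by
  rw [sumSplit, List.length_cons, Finset.sum_range_succ', add_comm]
  simp [sumSplit]

theorem sumSplit_add (φ ψ : List A → List A → M) (l : List A) :
    sumSplit (fun a b => φ a b + ψ a b) l = sumSplit φ l + sumSplit ψ l :=
  Finset.sum_add_distrib

theorem sumSplit_zero (l : List A) : sumSplit (fun _ _ => (0 : M)) l = 0 :=
  Finset.sum_const_zero

theorem sumSplit_map (f : C → A) (φ : List A → List A → M) (l : List C) :
    sumSplit φ (l.map f) = sumSplit (fun a b => φ (a.map f) (b.map f)) l := by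
  simp [sumSplit, List.map_take, List.map_drop]

/-- Of two cuts of a list, either may be made first. This coassociativity of deconcatenation
rearranges iterated insertions. -/
theorem sumSplit_assoc (φ : List A → List A → List A → M) (l : List A) :
    sumSplit (fun ab c => sumSplit (fun a b => φ a b c) ab) l =
      sumSplit (fun a bc => sumSplit (fun b c => φ a b c) bc) l := by
  induction l generalizing φ with
  | nil => simp [sumSplit_nil]
  | cons x l ih =>
    simp only [sumSplit_cons, sumSplit_nil, sumSplit_add, ih, add_assoc]

theorem sumSplit_mid (φ : List A → List A → M) (x : List A) (h : A) (z : List A) :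
    sumSplit φ (x ++ h :: z) =
      sumSplit (fun a b => φ a (b ++ h :: z)) x + sumSplit (fun a b => φ (x ++ h :: a) b) z := by
  induction x generalizing φ with
  | nil => simp [sumSplit_cons, sumSplit_nil]
  | cons y x ih => simp only [List.cons_append, sumSplit_cons, ih, add_assoc]

theorem sumSplit_congr {φ ψ : List A → List A → M} {l : List A}
    (h : ∀ a b, a ++ b = l → φ a b = ψ a b) : sumSplit φ l = sumSplit ψ l :=
  Finset.sum_congr rfl fun p _ => h _ _ (List.take_append_drop p l)

theorem map_sumSplit {N F : Type*} [AddCommMonoid N] [FunLike F M N] [AddMonoidHomClass F M N]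
    (T : F) (φ : List A → List A → M) (l : List A) :
    T (sumSplit φ l) = sumSplit (fun a b => T (φ a b)) l := map_sum T _ _

theorem sumSplit_smul {R : Type*} [Semiring R] [Module R M] (r : R) (φ : List A → List A → M)
    (l : List A) : r • sumSplit φ l = sumSplit (fun a b => r • φ a b) l := Finset.smul_sum

/-- The sum of `φ a b c` over all decompositions `l = a ++ b ++ c`. -/
def sumSplit₃ (φ : List A → List A → List A → M) (l : List A) : M :=
  sumSplit (fun a r => sumSplit (fun b c => φ a b c) r) l

theorem sumSplit₃_congr {φ ψ : List A → List A → List A → M} {l : List A}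
    (h : ∀ a b c, a ++ (b ++ c) = l → φ a b c = ψ a b c) : sumSplit₃ φ l = sumSplit₃ ψ l :=
  sumSplit_congr fun a r hr => sumSplit_congr fun b c hbc => h a b c (by rw [hbc, hr])

theorem sumSplit₃_map (f : C → A) (φ : List A → List A → List A → M) (l : List C) :
    sumSplit₃ φ (l.map f) = sumSplit₃ (fun a b c => φ (a.map f) (b.map f) (c.map f)) l := by
  simp only [sumSplit₃, sumSplit_map]

/-- The marked entry lies in the third, the second or the first factor. When it is the value of an
inner insertion, these are the three relative positions of two insertions. -/
theorem sumSplit₃_mid (φ : List A → List A → List A → M) (x : List A) (h : A) (z : List A) :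
    sumSplit₃ φ (x ++ h :: z) =
      sumSplit₃ (fun a b c => φ a b (c ++ h :: z)) x +
      sumSplit (fun x₁ x₂ => sumSplit (fun z₁ z₂ => φ x₁ (x₂ ++ h :: z₁) z₂) z) x +
      sumSplit₃ (fun a b c => φ (x ++ h :: a) b c) z := by
  simp only [sumSplit₃, sumSplit_mid, sumSplit_add]

end Split

/-! ### Cochains as functions on lists -/

variable {k B : Type*} [Field k] [Ring B] [Algebra k B]

/-- The value of a family of functions `Bⁿ → B` on a list. -/
def ev (F : Coch B) (l : List B) : B := F l.length l.get

/-- With the arity as a variable, substituting the length equation removes the cast between `Fin n`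
and `Fin l.length`. All passages from tuples to lists go through this statement. -/
theorem apply_eq_ev' (F : Coch B) : ∀ {n : ℕ} {v : Fin n → B} {l : List B} (h : l.length = n),
    (∀ j : Fin n, v j = l.get (j.cast h.symm)) → F n v = ev F l := by
  rintro n v l rfl h
  exact congrArg (F _) (funext h)

theorem apply_eq_ev (F : Coch B) {n : ℕ} (v : Fin n → B) : F n v = ev F (List.ofFn v) :=
  apply_eq_ev' F (by simp) (by simp)

theorem coch_ext {F G : Coch B} (h : ∀ l, ev F l = ev G l) : F = G := by
  funext n v
  rw [apply_eq_ev F, apply_eq_ev G, h]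

@[simp] theorem ev_add (F G : Coch B) (l : List B) : ev (F + G) l = ev F l + ev G l := rfl
@[simp] theorem ev_sub (F G : Coch B) (l : List B) : ev (F - G) l = ev F l - ev G l := rfl
@[simp] theorem ev_neg (F : Coch B) (l : List B) : ev (-F) l = -ev F l := rfl
@[simp] theorem ev_smul (c : k) (F : Coch B) (l : List B) : ev (c • F) l = c • ev F l := rfl

theorem ev_sum {ι : Type*} (s : Finset ι) (F : ι → Coch B) (l : List B) :
    ev (∑ i ∈ s, F i) l = ∑ i ∈ s, ev (F i) l := by
  simp [ev, Finset.sum_apply]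

section Koszul
variable (𝒜 : ℤ → Submodule k B) [GradedAlgebra 𝒜]

theorem koszul_of_mem (r : ℤ) {i : ℤ} {x : B} (hx : x ∈ 𝒜 i) :
    koszul 𝒜 r x = sgn k (r * i) • x := by
  simp only [koszul, LinearMap.comp_apply, LinearEquiv.coe_coe,
    DirectSum.decomposeLinearEquiv_apply]
  rw [DirectSum.decompose_of_mem 𝒜 hx]
  erw [DirectSum.lmap_lof]
  simp [DirectSum.coeLinearMap_lof]

theorem koszul_koszul (r s : ℤ) (x : B) : koszul 𝒜 r (koszul 𝒜 s x) = koszul 𝒜 (r + s) x := by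
  induction x using DirectSum.Decomposition.inductionOn 𝒜 with
  | zero => simp
  | homogeneous x =>
    rw [koszul_of_mem 𝒜 s x.2, map_smul, koszul_of_mem 𝒜 r x.2, koszul_of_mem 𝒜 _ x.2, smul_smul,
      ← sgn_add]
    congr 2
    ring
  | add x y hx hy => simp only [map_add, hx, hy]

theorem koszul_zero (x : B) : koszul 𝒜 0 x = x := by
  induction x using DirectSum.Decomposition.inductionOn 𝒜 with
  | zero => simp
  | homogeneous x => rw [koszul_of_mem 𝒜 0 x.2]; simp
  | add x y hx hy => simp only [map_add, hx, hy]

theorem koszul_mem (r : ℤ) {i : ℤ} {x : B} (hx : x ∈ 𝒜 i) : koszul 𝒜 r x ∈ 𝒜 i := by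
  rw [koszul_of_mem 𝒜 r hx]
  exact Submodule.smul_mem _ _ hx

theorem map_koszul_koszul (r s : ℤ) (l : List B) :
    (l.map (koszul 𝒜 s)).map (koszul 𝒜 r) = l.map (koszul 𝒜 (r + s)) := by
  simp [Function.comp_def, koszul_koszul]

end Koszul

/-! ### Multilinear and homogeneous functions on lists -/

variable (k) in
/-- The function on lists is `k`-linear in every entry. -/
def Lin (f : List B → B) : Prop := ∀ a c, IsLinearMap k fun b => f (a ++ b :: c)

/-- The function on lists is homogeneous of total degree `d`. -/
def Hom (𝒜 : ℤ → Submodule k B) (d : ℤ) (f : List B → B) : Prop :=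
  ∀ L : List (ℤ × B), (∀ x ∈ L, x.2 ∈ 𝒜 x.1) →
    f (L.map Prod.snd) ∈ 𝒜 ((L.map Prod.fst).sum + (d - L.length))

theorem IsLinearMap.comp_linearMap {f : B → B} (hf : IsLinearMap k f) (T : B →ₗ[k] B) :
    IsLinearMap k fun x => f (T x) :=
  ⟨fun x y => by rw [map_add, hf.map_add], fun c x => by rw [map_smul, hf.map_smul]⟩

theorem IsLinearMap.comp' {f g : B → B} (hf : IsLinearMap k f) (hg : IsLinearMap k g) :
    IsLinearMap k fun x => f (g x) :=
  ⟨fun x y => by rw [hg.map_add, hf.map_add], fun c x => by rw [hg.map_smul, hf.map_smul]⟩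

theorem IsLinearMap.sumSplit {A : Type*} {φ : B → List A → List A → B} {l : List A}
    (h : ∀ a b, a ++ b = l → IsLinearMap k fun x => φ x a b) :
    IsLinearMap k fun x => sumSplit (φ x) l := by
  have h' := fun p => h _ _ (List.take_append_drop p l)
  constructor
  · intro x y
    simp only [GradedHochschild.sumSplit, ← Finset.sum_add_distrib]
    exact Finset.sum_congr rfl fun p _ => (h' p).map_add x y
  · intro c x
    simp only [GradedHochschild.sumSplit, Finset.smul_sum]
    exact Finset.sum_congr rfl fun p _ => (h' p).map_smul c x

theorem IsLinearMap.const_smul {f : B → B} (hf : IsLinearMap k f) (c : k) :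
    IsLinearMap k fun x => c • f x :=
  ⟨fun x y => by rw [hf.map_add, smul_add], fun e x => by rw [hf.map_smul, smul_comm]⟩

theorem IsLinearMap.add' {f g : B → B} (hf : IsLinearMap k f) (hg : IsLinearMap k g) :
    IsLinearMap k fun x => f x + g x :=
  ⟨fun x y => by rw [hf.map_add, hg.map_add]; abel,
    fun c x => by rw [hf.map_smul, hg.map_smul, smul_add]⟩

section
variable (𝒜 : ℤ → Submodule k B) [GradedAlgebra 𝒜]

theorem Lin.ext_of_homogeneous {f g : List B → B} (hf : Lin k f) (hg : Lin k g)
    (h : ∀ L : List (ℤ × B), (∀ x ∈ L, x.2 ∈ 𝒜 x.1) → f (L.map Prod.snd) = g (L.map Prod.snd))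
    (l : List B) : f l = g l := by
  -- The prefix `l` is still arbitrary while the suffix `L` is already homogeneous. The entries of
  -- the prefix are decomposed one at a time from the right.
  suffices H : ∀ l : List B, ∀ L : List (ℤ × B), (∀ x ∈ L, x.2 ∈ 𝒜 x.1) →
      f (l ++ L.map Prod.snd) = g (l ++ L.map Prod.snd) by
    simpa using H l [] (by simp)
  intro l
  induction l using List.reverseRecOn with
  | nil => simpa using h
  | append_singleton l b ih =>
    intro L hL
    simp only [List.append_assoc, List.singleton_append]
    induction b using DirectSum.Decomposition.inductionOn 𝒜 with
    | zero => rw [(hf _ _).map_zero, (hg _ _).map_zero]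
    | @homogeneous i x =>
      have := ih ((i, (x : B)) :: L) (by
        intro y hy
        rcases List.mem_cons.1 hy with rfl | hy
        · exact x.2
        · exact hL y hy)
      simpa using this
    | add x y hx hy => rw [(hf _ _).map_add, (hg _ _).map_add, hx, hy]

/-- Changing one entry of a tuple is changing the entry between two sublists. Under this dictionary
multilinearity on tuples is linearity in a marked entry of a list. -/
theorem cochains_iff {d : ℤ} {F : Coch B} :
    F ∈ cochains 𝒜 d ↔ Lin k (ev F) ∧ Hom 𝒜 d (ev F) := by
  constructor
  · intro h
    constructor
    · intro a c
      obtain ⟨f, hf⟩ := (h (a.length + 1 + c.length)).1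
      let v : Fin (a.length + 1 + c.length) → B := fun i => (a ++ 0 :: c).get (i.cast (by simp; omega))
      let i : Fin (a.length + 1 + c.length) := ⟨a.length, by omega⟩
      have key : ∀ b, ev F (a ++ b :: c) = f (Function.update v i b) := by
        intro b
        rw [hf]
        refine (apply_eq_ev' F (by simp; omega) ?_).symm
        intro j
        by_cases hj : j = i
        · subst hj
          simp [i]
        · rw [Function.update_of_ne hj]
          have hj' : j.val ≠ a.length := fun h => hj (Fin.ext h)
          simp only [v, List.get_eq_getElem, Fin.val_cast, List.getElem_append]
          split_ifs with h1
          · rfl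
          · rw [List.getElem_cons, List.getElem_cons, dif_neg (by omega), dif_neg (by omega)]
      constructor
      · intro x y
        simp only [key, f.map_update_add]
      · intro e x
        simp only [key, f.map_update_smul]
    · intro L hL
      have := (h (L.map Prod.snd).length).2 (fun i => (L.get (i.cast (by simp))).1)
        (L.map Prod.snd).get (by
          intro i
          simp only [List.get_eq_getElem, List.getElem_map]
          exact hL _ (List.getElem_mem _))
      have e : ∑ i : Fin (L.map Prod.snd).length, (L.get (i.cast (by simp))).1 =
          (L.map Prod.fst).sum := by
        rw [← List.sum_ofFn]
        congr 1
        apply List.ext_getElem <;> simp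
      rw [e] at this
      simpa [ev] using this
  · rintro ⟨h1, h2⟩ n
    have key : ∀ (v : Fin n → B) (i : Fin n) (x : B),
        F n (Function.update v i x) = ev F ((List.ofFn v).take i ++ x :: (List.ofFn v).drop (i + 1)) := by
      intro v i x
      rw [apply_eq_ev F]
      congr 1
      have := @List.set_eq_take_append_cons_drop _ (List.ofFn v) i.val x
      rw [if_pos (by simp)] at this
      rw [← this]
      apply List.ext_getElem
      · simp
      · intro j hj hj'
        rw [List.getElem_set]
        simp only [List.getElem_ofFn, Function.update_apply]
        simp only [Fin.ext_iff]
        split_ifs with h3 h4 h4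
        · rfl
        · omega
        · omega
        · rfl
    refine ⟨⟨⟨F n, ?_, ?_⟩, fun _ => rfl⟩, ?_⟩
    · intro hd v i x y
      obtain rfl : hd = instDecidableEqFin n := Subsingleton.elim _ _
      simp only [key]
      exact (h1 _ _).map_add x y
    · intro hd v i c x
      obtain rfl : hd = instDecidableEqFin n := Subsingleton.elim _ _
      simp only [key]
      exact (h1 _ _).map_smul c x
    · intro e v hv
      have := h2 (List.ofFn fun i => (e i, v i)) (by
        intro x hx
        obtain ⟨i, rfl⟩ := (List.mem_ofFn' _ _).1 hx
        exact hv i)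
      rw [apply_eq_ev F]
      simpa [List.map_ofFn, Function.comp_def, List.sum_ofFn] using this

theorem ev_circ (j : ℤ) (F G : Coch B) (l : List B) :
    ev (circ 𝒜 j F G) l = sumSplit₃ (fun a b c =>
      sgn k (a.length * (b.length - 1) + (a.length + c.length) * (j - 1)) •
        ev F (a.map (koszul 𝒜 (j - b.length)) ++ ev G b :: c)) l := by
  simp only [ev, circ, sumSplit₃, sumSplit]
  rw [Finset.sum_sigma', Finset.sum_sigma']
  -- The arity `m` of the outer map and the slot `p` correspond to the position `p` of the first cut
  -- and the length `n` of the block fed to the inner map, where `m + n` is the number of arguments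
  -- plus one.
  refine Finset.sum_bij' (fun x _ => ⟨x.2.val, l.length + 1 - x.1.val⟩)
    (fun y hy => ⟨⟨l.length + 1 - y.2, by omega⟩, ⟨y.1, by
      simp only [Finset.mem_sigma, Finset.mem_range, List.length_drop] at hy
      show y.1 < l.length + 1 - y.2
      omega⟩⟩) ?_ ?_ ?_ ?_ ?_
  · rintro ⟨m, p⟩ -
    have := m.2
    have := p.2
    simp only [Finset.mem_sigma, Finset.mem_range, List.length_drop]
    omega
  · intro y hy
    simp
  · rintro ⟨m, p⟩ -
    have := m.2
    have hm : l.length + 1 - (l.length + 1 - m.val) = m.val := by omega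
    ext
    · exact hm
    · simp only
      rw [Fin.heq_ext_iff hm]
  · rintro ⟨p, n⟩ hy
    simp only [Finset.mem_sigma, Finset.mem_range, List.length_drop] at hy
    simp only [Sigma.mk.injEq, heq_eq_eq, true_and]
    omega
  · rintro ⟨⟨m, hm⟩, ⟨p, hp⟩⟩ -
    simp only at hp ⊢
    have h1 : (l.take p).length = p := by simp; omega
    have h2 : ((l.drop p).take (l.length + 1 - m)).length = l.length + 1 - m := by simp; omega
    have h3 : ((l.drop p).drop (l.length + 1 - m)).length = m - 1 - p := by simp; omega
    congr 1
    · simp only [h1, h2, h3]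
      rw [show (m : ℤ) - 1 = p + (m - 1 - p : ℕ) by omega]
    · refine apply_eq_ev' F ?_ ?_
      · simp; omega
      · intro q
        simp only [List.get_eq_getElem, Fin.val_cast]
        have hq := q.2
        split_ifs with h4 h5
        · rw [List.getElem_append_left (by simp; omega)]
          simp only [List.getElem_map, h2, List.getElem_take]
        · rw [List.getElem_append_right (by simp; omega)]
          simp only [List.length_map, h1]
          rw [List.getElem_cons, dif_pos (by omega)]
          refine apply_eq_ev' G h2 ?_
          intro i
          simp
        · rw [List.getElem_append_right (by simp; omega)]
          simp only [List.length_map, h1]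
          rw [List.getElem_cons, dif_neg (by omega)]
          simp only [List.getElem_drop]
          congr 1
          omega

end

end GradedHochschild
end

/-! ### The graded pre-Lie identity -/

noncomputable section

namespace GradedHochschild

section Split
variable {A M : Type*} [AddCommMonoid M]

theorem sumSplit_comm {C : Type*} (φ : List A → List A → List C → List C → M) (l : List A)
    (m : List C) :
    sumSplit (fun a b => sumSplit (fun c d => φ a b c d) m) l =
      sumSplit (fun c d => sumSplit (fun a b => φ a b c d) l) m := Finset.sum_comm

theorem sumSplit₃_add (φ ψ : List A → List A → List A → M) (l : List A) :
    sumSplit₃ (fun a b c => φ a b c + ψ a b c) l = sumSplit₃ φ l + sumSplit₃ ψ l := by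
  simp only [sumSplit₃, sumSplit_add]

theorem sumSplit₃_smul {R : Type*} [Semiring R] [Module R M] (r : R)
    (φ : List A → List A → List A → M) (l : List A) :
    r • sumSplit₃ φ l = sumSplit₃ (fun a b c => r • φ a b c) l := by
  simp only [sumSplit₃, sumSplit_smul]

/-- Both sides run over the decompositions into five consecutive blocks. The outer sum fixes the
middle block on the left, and the union of the three middle blocks on the right. -/
theorem sumSplit₃_sumSplit_sumSplit (T : List A → List A → List A → List A → List A → M)
    (l : List A) :
    sumSplit₃ (fun x y z => sumSplit (fun x₁ x₂ => sumSplit (fun z₁ z₂ => T x₁ x₂ y z₁ z₂) z) x) l =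
      sumSplit₃ (fun a b c => sumSplit₃ (fun b₁ b₂ b₃ => T a b₁ b₂ b₃ c) b) l := by
  have h1 : ∀ x r : List A, sumSplit (fun y z => sumSplit (fun x₁ x₂ =>
      sumSplit (fun z₁ z₂ => T x₁ x₂ y z₁ z₂) z) x) r =
      sumSplit (fun x₁ x₂ => sumSplit (fun y z =>
      sumSplit (fun z₁ z₂ => T x₁ x₂ y z₁ z₂) z) r) x := fun x r => sumSplit_comm _ _ _
  simp only [sumSplit₃, h1, sumSplit_assoc]

theorem sumSplit₃_sumSplit₃ (T : List A → List A → List A → List A → List A → M) (l : List A) :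
    sumSplit₃ (fun x y z => sumSplit₃ (fun z₁ z₂ z₃ => T x y z₁ z₂ z₃) z) l =
      sumSplit₃ (fun x y z => sumSplit₃ (fun x₁ x₂ x₃ => T x₁ x₂ x₃ y z) x) l := by
  have h1 : ∀ x r : List A, sumSplit (fun y z => sumSplit (fun x₁ x₂ =>
      sumSplit (fun x₂ x₃ => T x₁ x₂ x₃ y z) x₂) x) r =
      sumSplit (fun x₁ x₂ => sumSplit (fun x₂ x₃ => sumSplit (fun y z =>
        T x₁ x₂ x₃ y z) r) x₂) x := fun x r => by
    rw [sumSplit_comm]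
    refine sumSplit_congr fun _ _ _ => sumSplit_comm _ _ _
  simp only [sumSplit₃, h1, sumSplit_assoc]

end Split

variable {k B : Type*} [Field k] [Ring B] [Algebra k B]
variable (𝒜 : ℤ → Submodule k B) [GradedAlgebra 𝒜]

/-- The composition of functions on lists underlying `circ`. -/
def comp (j : ℤ) (f g : List B → B) (l : List B) : B :=
  sumSplit₃ (fun a b c =>
    sgn k (a.length * (b.length - 1) + (a.length + c.length) * (j - 1)) •
      f (a.map (koszul 𝒜 (j - b.length)) ++ g b :: c)) l

theorem ev_circ_eq_comp (j : ℤ) (F G : Coch B) : ev (circ 𝒜 j F G) = comp 𝒜 j (ev F) (ev G) :=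
  funext fun l => ev_circ 𝒜 j F G l

variable {𝒜} in
theorem Lin.comp {j : ℤ} {f g : List B → B} (hf : Lin k f) (hg : Lin k g) :
    Lin k (comp 𝒜 j f g) := by
  intro x z
  simp only [GradedHochschild.comp, sumSplit₃_mid]
  refine (IsLinearMap.add' (IsLinearMap.add' ?_ ?_) ?_)
  · refine IsLinearMap.sumSplit fun a r _ => IsLinearMap.sumSplit fun b c _ => ?_
    simp only [List.length_append, List.length_cons]
    refine IsLinearMap.const_smul ?_ _
    have := hf (a.map (koszul 𝒜 (j - b.length)) ++ g b :: c) z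
    simpa using this
  · refine IsLinearMap.sumSplit fun a r _ => IsLinearMap.sumSplit fun b c _ => ?_
    simp only [List.length_append, List.length_cons]
    refine IsLinearMap.const_smul ?_ _
    exact IsLinearMap.comp' (hf _ _) (hg r b)
  · refine IsLinearMap.sumSplit fun a r _ => IsLinearMap.sumSplit fun b c _ => ?_
    simp only [List.length_append, List.length_cons]
    refine IsLinearMap.const_smul ?_ _
    have := hf (x.map (koszul 𝒜 (j - b.length))) (a.map (koszul 𝒜 (j - b.length)) ++ g b :: c)
    have := IsLinearMap.comp_linearMap this (koszul 𝒜 (j - b.length))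
    simpa using this

variable {𝒜}

theorem sumSplit₃_mem {A : Type*} {φ : List A → List A → List A → B} {l : List A}
    {S : Submodule k B} (h : ∀ a b c, a ++ (b ++ c) = l → φ a b c ∈ S) : sumSplit₃ φ l ∈ S := by
  unfold sumSplit₃ sumSplit
  exact Submodule.sum_mem _ fun p _ => Submodule.sum_mem _ fun q _ => h _ _ _ (by simp)

theorem Hom.comp {i j : ℤ} {f g : List B → B} (hf : Hom 𝒜 i f) (hg : Hom 𝒜 j g) :
    Hom 𝒜 (i + j - 1) (comp 𝒜 j f g) := by
  intro L hL
  rw [GradedHochschild.comp, sumSplit₃_map]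
  refine sumSplit₃_mem fun a b c h => Submodule.smul_mem _ _ ?_
  subst h
  simp only [List.length_map]
  have := hf (a.map (fun p => (p.1, koszul 𝒜 (j - b.length) p.2)) ++
    ((b.map Prod.fst).sum + (j - b.length), g (b.map Prod.snd)) :: c) (by
      intro x hx
      simp only [List.mem_append, List.mem_map, List.mem_cons] at hx
      rcases hx with ⟨p, hp, rfl⟩ | rfl | hx
      · exact koszul_mem 𝒜 _ (hL p (by simp [hp]))
      · exact hg b fun x hx => hL x (by simp [hx])
      · exact hL x (by simp [hx]))
  convert this using 2
  · simp [Function.comp_def]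
    ring
  · simp [Function.comp_def]

/-- The Koszul operator multiplies a homogeneous element by a sign linear in its degree, and `g`
shifts the total degree of its arguments by `d - l.length`. The two therefore commute up to the sign
of that shift. -/
theorem Lin.koszul_map {d : ℤ} {g : List B → B} (hg : Lin k g) (hd : Hom 𝒜 d g) (r : ℤ)
    (l : List B) : g (l.map (koszul 𝒜 r)) = sgn k (r * (d - l.length)) • koszul 𝒜 r (g l) := by
  have key : ∀ L : List (ℤ × B), (∀ x ∈ L, x.2 ∈ 𝒜 x.1) → ∀ a,
      g (a ++ (L.map Prod.snd).map (koszul 𝒜 r)) =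
        sgn k (r * (L.map Prod.fst).sum) • g (a ++ L.map Prod.snd) := by
    intro L
    induction L with
    | nil => simp
    | cons x L ih =>
      intro hL a
      have h1 := ih (fun y hy => hL y (List.mem_cons_of_mem _ hy)) (a ++ [x.2])
      simp only [List.append_assoc, List.singleton_append] at h1
      simp only [List.map_cons, List.sum_cons]
      rw [koszul_of_mem 𝒜 r (hL x List.mem_cons_self), (hg _ _).map_smul, h1, smul_smul, ← sgn_add]
      congr 2
      ring
  refine Lin.ext_of_homogeneous 𝒜 (f := fun l => g (l.map (koszul 𝒜 r)))
    (g := fun l => sgn k (r * (d - l.length)) • koszul 𝒜 r (g l)) ?_ ?_ ?_ l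
  · intro a c
    simp only [List.map_append, List.map_cons]
    exact IsLinearMap.comp_linearMap (hg _ _) _
  · intro a c
    simp only [List.length_append, List.length_cons]
    refine IsLinearMap.const_smul ?_ _
    exact IsLinearMap.comp' (LinearMap.isLinear _) (hg a c)
  · intro L hL
    have h1 := key L hL []
    simp only [List.nil_append] at h1
    rw [h1, koszul_of_mem 𝒜 r (hd L hL), smul_smul, ← sgn_add]
    congr 1
    apply sgn_congr
    simp only [List.length_map]
    generalize (L.map Prod.fst).sum = s
    push_cast
    generalize (r : ZMod 2) = r'
    generalize (s : ZMod 2) = s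
    generalize (d : ZMod 2) = d'
    generalize (L.length : ZMod 2) = n
    revert r' s d' n; decide

variable (𝒜) in
/-- The sum of all `± f(a, g(b), c, q(d), e)` over decompositions of a list, where `g` and `q` have
total degrees `j` and `h`. -/
def disj (j h : ℤ) (f g q : List B → B) (l : List B) : B :=
  sumSplit₃ (fun x y z => sumSplit₃ (fun x₁ x₂ x₃ =>
    sgn k ((x₁.length + x₂.length + x₃.length) * (y.length - 1) +
        (x₁.length + x₂.length + x₃.length + z.length) * (h - 1) +
        (x₁.length * (x₂.length - 1) + (x₁.length + (x₃.length + 1 + z.length)) * (j - 1))) •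
      f (x₁.map (koszul 𝒜 ((j - x₂.length) + (h - y.length))) ++
        g (x₂.map (koszul 𝒜 (h - y.length))) ::
          (x₃.map (koszul 𝒜 (h - y.length)) ++ q y :: z))) x) l

theorem smul_congr {c d : k} {x y : B} (h : c = d) (h' : x = y) : c • x = d • y := by rw [h, h']

/-- The graded pre-Lie identity: inserting `q` into `f ∘ g` puts it either inside the argument of
`g`, which gives `f ∘ (g ∘ q)`, or into a slot of `f` to the right or to the left of `g`. The last
two families are the same disjoint insertions with the roles of `g` and `q` exchanged. -/
theorem comp_comp {j h : ℤ} {f g q : List B → B} (hf : Lin k f) (hq : Lin k q)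
    (hhq : Hom 𝒜 h q) (l : List B) :
    comp 𝒜 h (comp 𝒜 j f g) q l = comp 𝒜 (j + h - 1) f (comp 𝒜 h g q) l + disj 𝒜 j h f g q l +
      sgn k ((j - 1) * (h - 1)) • disj 𝒜 h j f q g l := by
  have hfsum : ∀ (u v w : List B) (φ : List B → List B → List B → B),
      f (u ++ sumSplit₃ φ w :: v) = sumSplit₃ (fun a b c => f (u ++ φ a b c :: v)) w := by
    intro u v w φ
    let T := (hf u v).mk'
    have hT : ∀ b, f (u ++ b :: v) = T b := fun b => rfl
    simp only [hT, sumSplit₃, map_sumSplit]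
  -- The three summands are the cases where `g` stands to the left of `q`, where `q` is an argument
  -- of `g`, and where `g` stands to the right of `q`.
  have lhs : comp 𝒜 h (comp 𝒜 j f g) q l =
      disj 𝒜 j h f g q l +
      sumSplit₃ (fun x y z => sumSplit (fun x₁ x₂ => sumSplit (fun z₁ z₂ =>
        sgn k ((x₁.length + x₂.length) * (y.length - 1) + (x₁.length + x₂.length + (z₁.length + z₂.length)) * (h - 1) +
            (x₁.length * (x₂.length + 1 + z₁.length - 1) + (x₁.length + z₂.length) * (j - 1))) •
            f (x₁.map (koszul 𝒜 ((h - y.length) + (j - (x₂.length + 1 + z₁.length)))) ++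
              g (x₂.map (koszul 𝒜 (h - y.length)) ++ q y :: z₁) :: z₂)) z) x) l +
      sumSplit₃ (fun x y z =>
        sumSplit₃ (fun z₁ z₂ z₃ =>
          sgn k (x.length * (y.length - 1) + (x.length + (z₁.length + z₂.length + z₃.length)) * (h - 1) +
            ((x.length + 1 + z₁.length) * (z₂.length - 1) + (x.length + 1 + z₁.length + z₃.length) * (j - 1))) •
            f (x.map (koszul 𝒜 ((h - y.length) + (j - z₂.length))) ++ koszul 𝒜 (j - z₂.length) (q y) ::
              (z₁.map (koszul 𝒜 (j - z₂.length)) ++ g z₂ :: z₃))) z) l := by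
    rw [disj, ← sumSplit₃_add, ← sumSplit₃_add]
    refine sumSplit₃_congr fun x y z _ => ?_
    rw [comp, sumSplit₃_mid, smul_add, smul_add]
    congr 1
    · congr 1
      · rw [sumSplit₃_map, sumSplit₃_smul]
        refine sumSplit₃_congr fun a b c h' => ?_
        subst h'
        simp only [smul_smul, sgn_mul_sgn, List.length_append, List.length_map, List.length_cons,
          map_koszul_koszul]
        refine smul_congr (congrArg (sgn k) (by push_cast; ring)) ?_
        congr 4
      · rw [sumSplit_map, sumSplit_smul]
        refine sumSplit_congr fun a b h' => ?_
        rw [sumSplit_smul]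
        refine sumSplit_congr fun c d h'' => ?_
        subst h' h''
        simp only [smul_smul, sgn_mul_sgn, List.length_append, List.length_map, List.length_cons,
          map_koszul_koszul]
        refine smul_congr (congrArg (sgn k) (by push_cast; ring)) ?_
        congr 4
        push_cast
        ring_nf
    · rw [sumSplit₃_smul]
      refine sumSplit₃_congr fun a b c h' => ?_
      subst h'
      simp only [smul_smul, sgn_mul_sgn, List.length_append, List.length_map, List.length_cons,
          map_koszul_koszul, List.map_append, List.map_cons, List.append_assoc, List.cons_append]
      refine smul_congr (congrArg (sgn k) (by push_cast; ring)) ?_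
      congr 4
      ring_nf
  rw [lhs, add_comm (disj 𝒜 j h f g q l), sumSplit₃_sumSplit_sumSplit,
    sumSplit₃_sumSplit₃, disj, disj, sumSplit₃_smul]
  congr 1
  · congr 1
    refine sumSplit₃_congr fun a b c _ => ?_
    rw [comp, hfsum, sumSplit₃_smul]
    refine sumSplit₃_congr fun b₁ b₂ b₃ h' => ?_
    subst h'
    simp only [(hf _ _).map_smul, smul_smul, sgn_mul_sgn, List.length_append]
    congr 1
    · apply sgn_congr
      push_cast
      generalize (a.length : ZMod 2) = a
      generalize (b₁.length : ZMod 2) = b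
      generalize (b₂.length : ZMod 2) = b'
      generalize (b₃.length : ZMod 2) = b''
      generalize (c.length : ZMod 2) = c
      generalize (h : ZMod 2) = h
      generalize (j : ZMod 2) = j
      revert a b b' b'' c h j; decide
    · congr 4
      push_cast
      ring_nf
  · refine sumSplit₃_congr fun x y z _ => ?_
    rw [sumSplit₃_smul]
    refine sumSplit₃_congr fun x₁ x₂ x₃ h' => ?_
    -- When `g` stands to the right of `q`, its Koszul operator is applied to the value of `q`,
    -- whereas in the disjoint insertion it is applied to the arguments of `q`. The difference is
    -- the sign of moving the two internal degrees past each other.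
    rw [hq.koszul_map hhq, (hf _ _).map_smul]
    simp only [smul_smul, sgn_mul_sgn]
    have : sgn k (x₁.length * (x₂.length - 1) + (x₁.length + (x₃.length + y.length + z.length)) * (h - 1) +
            ((x₁.length + 1 + x₃.length) * (y.length - 1) + (x₁.length + 1 + x₃.length + z.length) * (j - 1))) =
        sgn k ((j - 1) * (h - 1) + ((x₁.length + x₂.length + x₃.length) * (y.length - 1) +
        (x₁.length + x₂.length + x₃.length + z.length) * (j - 1) +
        (x₁.length * (x₂.length - 1) + (x₁.length + (x₃.length + 1 + z.length)) * (h - 1))) +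
        (j - y.length) * (h - x₂.length)) := by
      apply sgn_congr
      push_cast
      generalize (x₁.length : ZMod 2) = a
      generalize (x₂.length : ZMod 2) = b
      generalize (x₃.length : ZMod 2) = b'
      generalize (y.length : ZMod 2) = b''
      generalize (z.length : ZMod 2) = c
      generalize (h : ZMod 2) = h
      generalize (j : ZMod 2) = j
      revert a b b' b'' c h j; decide
    rw [this]
    refine smul_congr (congrArg (sgn k) (by ring)) ?_
    congr 4

end GradedHochschild
end

/-! ### The Hochschild differential as the bracket with the multiplication -/

noncomputable section

namespace GradedHochschild

section Split
variable {A M : Type*} [AddCommMonoid M]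

/-- The sum of `φ a u v c` over all decompositions `l = a ++ [u, v] ++ c`. -/
def mergeSum (φ : List A → A → A → List A → M) : List A → M
  | [] => 0
  | [_] => 0
  | x :: y :: t => φ [] x y t + mergeSum (fun a => φ (x :: a)) (y :: t)

theorem mergeSum_congr {φ ψ : List A → A → A → List A → M} {l : List A}
    (h : ∀ a u v c, a ++ u :: v :: c = l → φ a u v c = ψ a u v c) :
    mergeSum φ l = mergeSum ψ l := by
  induction l generalizing φ ψ with
  | nil => rfl
  | cons x l ih =>
    cases l with
    | nil => rfl
    | cons y t =>
      simp only [mergeSum]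
      rw [h [] x y t rfl, ih fun a u v c h' => h (x :: a) u v c (by rw [← h']; rfl)]

theorem mergeSum_zero (l : List A) : mergeSum (fun _ _ _ _ => (0 : M)) l = 0 := by
  induction l with
  | nil => rfl
  | cons x l ih =>
    cases l with
    | nil => rfl
    | cons y t => simp only [mergeSum, ih, add_zero]

theorem mergeSum_eq_zero {φ : List A → A → A → List A → M} {l : List A}
    (h : ∀ a u v c, a ++ u :: v :: c = l → φ a u v c = 0) : mergeSum φ l = 0 := by
  rw [mergeSum_congr h, mergeSum_zero]

theorem mergeSum_smul {R : Type*} [Semiring R] [Module R M] (r : R)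
    (φ : List A → A → A → List A → M) (l : List A) :
    r • mergeSum φ l = mergeSum (fun a u v c => r • φ a u v c) l := by
  induction l generalizing φ with
  | nil => simp [mergeSum]
  | cons x l ih =>
    cases l with
    | nil => simp [mergeSum]
    | cons y t => simp only [mergeSum, smul_add, ih]

theorem mergeSum_map {C : Type*} (f : C → A) (φ : List A → A → A → List A → M) (l : List C) :
    mergeSum φ (l.map f) = mergeSum (fun a u v c => φ (a.map f) (f u) (f v) (c.map f)) l := by
  induction l generalizing φ with
  | nil => rfl
  | cons x l ih =>
    cases l with
    | nil => rfl
    | cons y t =>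
      simp only [List.map_cons, mergeSum, List.map_nil]
      rw [← List.map_cons, ih]

theorem mergeSum_append (φ : List A → A → A → List A → M) (l : List A) (x y : A) (t : List A) :
    mergeSum φ (l ++ x :: y :: t) = mergeSum (fun a u v c => φ a u v (c ++ y :: t)) (l ++ [x]) +
      φ l x y t + mergeSum (fun a u v c => φ (l ++ x :: a) u v c) (y :: t) := by
  induction l generalizing φ with
  | nil => simp [mergeSum]
  | cons z l ih =>
    cases l with
    | nil => simp [mergeSum, add_assoc]
    | cons z' l =>
      simp only [List.cons_append, mergeSum] at ih ⊢
      rw [ih]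
      simp only [add_assoc, List.append_assoc, List.cons_append, List.nil_append]

theorem mergeSum_cons_eq_sum (φ : List A → A → A → List A → M) (x : A) (t : List A) :
    mergeSum φ (x :: t) = ∑ i : Fin t.length,
      φ ((x :: t).take i) ((x :: t)[i.val]'(by have := i.2; simp only [List.length_cons]; omega)) t[i] (t.drop (i + 1)) := by
  induction t generalizing φ x with
  | nil => simp [mergeSum]
  | cons y t ih =>
    simp only [mergeSum, List.length_cons, Fin.sum_univ_succ, ih]
    simp

/-- Used for `f ∘ m`: a block fed to the multiplication has length two, so it is a pair of
neighbours. -/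
theorem sumSplit₃_eq_mergeSum {φ : List A → List A → List A → M} (l : List A)
    (h : ∀ a b c, a ++ (b ++ c) = l → b.length ≠ 2 → φ a b c = 0) :
    sumSplit₃ φ l = mergeSum (fun a u v c => φ a [u, v] c) l := by
  induction l generalizing φ with
  | nil => simp [sumSplit₃, sumSplit_nil, mergeSum, h]
  | cons x l ih =>
    have ih' := @ih (fun a b c => φ (x :: a) b c) (fun a b c h1 h2 => h _ _ _ (by rw [← h1]; rfl) h2)
    rw [sumSplit₃] at ih' ⊢
    rw [sumSplit_cons, ih', sumSplit_cons]
    rw [h _ _ _ (by simp) (by simp), zero_add]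
    cases l with
    | nil => simp [sumSplit_nil, mergeSum, h]
    | cons y t =>
      rw [sumSplit_cons, h _ _ _ (by simp) (by simp), zero_add, mergeSum]
      congr 1
      cases t with
      | nil => simp [sumSplit_nil]
      | cons z t =>
        rw [sumSplit_cons]
        refine (congrArg _ ?_).trans (add_zero _)
        rw [← sumSplit_zero t]
        exact sumSplit_congr fun a b hab => h _ _ _ (by simp [hab]) (by simp)

theorem sumSplit_eq_last {φ : List A → List A → M} (l : List A) (hl : l ≠ [])
    (h : ∀ a b, a ++ b = l → b.length ≠ 1 → φ a b = 0) :
    sumSplit φ l = φ l.dropLast [l.getLast hl] := by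
  have hlen := List.length_pos_of_ne_nil hl
  rw [sumSplit, Finset.sum_eq_single (l.length - 1)]
  · rw [List.drop_length_sub_one hl, List.dropLast_eq_take]
  · intro p hp hp'
    rw [Finset.mem_range] at hp
    exact h _ _ (by simp) (by simp; omega)
  · intro h
    exact absurd (Finset.mem_range.2 (by omega)) h

/-- Used for `m ∘ f`: besides the inserted value the multiplication has one free argument, so the
inserted block omits exactly the first or the last entry. -/
theorem sumSplit₃_eq_ends {φ : List A → List A → List A → M} (x : A) (t : List A)
    (h : ∀ a b c, a ++ (b ++ c) = x :: t → a.length + c.length ≠ 1 → φ a b c = 0) :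
    sumSplit₃ φ (x :: t) =
      φ [x] t [] + φ [] (x :: t).dropLast [(x :: t).getLast (List.cons_ne_nil _ _)] := by
  rw [sumSplit₃, sumSplit_cons, sumSplit_eq_last (x :: t) (List.cons_ne_nil _ _)
    (fun a b h1 h2 => h _ _ _ (by simpa using h1) (by simpa using h2)), add_comm]
  congr 1
  have h0 : ∀ a r, a ++ r = t → a ≠ [] → sumSplit (fun b c => φ (x :: a) b c) r = 0 := by
    intro a r h1 h2
    rw [← sumSplit_zero r]
    refine sumSplit_congr fun b c hbc => h _ _ _ (by simp [hbc, h1]) ?_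
    have := List.length_pos_of_ne_nil h2
    simp
    omega
  have h1 : sumSplit (fun a r => sumSplit (fun b c => φ (x :: a) b c) r) t =
      sumSplit (fun b c => φ [x] b c) t := by
    cases t with
    | nil => simp [sumSplit_nil]
    | cons y t =>
      rw [sumSplit_cons]
      refine (congrArg _ ?_).trans (add_zero _)
      rw [← sumSplit_zero t]
      exact sumSplit_congr fun a b hab => h0 _ _ (by simp [hab]) (by simp)
  rw [h1, sumSplit, Finset.sum_eq_single t.length]
  · simp
  · intro p hp hp'
    rw [Finset.mem_range] at hp
    refine h _ _ _ (by simp) ?_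
    simp
    omega
  · simp

end Split

variable {k B : Type*} [Field k] [Ring B] [Algebra k B]
variable (𝒜 : ℤ → Submodule k B) [GradedAlgebra 𝒜]

/-- The multiplication as a function on lists of length two. -/
def mulL : List B → B
  | [x, y] => x * y
  | _ => 0

theorem mulL_of_length_ne {l : List B} (h : l.length ≠ 2) : mulL l = 0 := by
  match l with
  | [] => rfl
  | [_] => rfl
  | [_, _] => simp at h
  | _ :: _ :: _ :: _ => rfl

theorem mulL_lin : Lin k (mulL : List B → B) := by
  intro a c
  match a, c with
  | [], [] => exact ⟨fun _ _ => by simp [mulL], fun _ _ => by simp [mulL]⟩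
  | [], [y] => exact ⟨fun _ _ => by simp [mulL, add_mul], fun _ _ => by simp [mulL]⟩
  | [x], [] => exact ⟨fun _ _ => by simp [mulL, mul_add], fun _ _ => by simp [mulL]⟩
  | [], _ :: _ :: _ => exact ⟨fun _ _ => by simp [mulL], fun _ _ => by simp [mulL]⟩
  | [x], _ :: _ => exact ⟨fun _ _ => by simp [mulL], fun _ _ => by simp [mulL]⟩
  | x :: y :: t, c =>
    have h : ∀ b, mulL (x :: y :: t ++ b :: c) = 0 := fun b => mulL_of_length_ne (by simp)
    exact ⟨fun _ _ => by simp only [h, add_zero], fun _ _ => by simp only [h, smul_zero]⟩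

theorem mulL_hom : Hom 𝒜 2 (mulL : List B → B) := by
  intro L hL
  match L with
  | [] => exact Submodule.zero_mem _
  | [_] => exact Submodule.zero_mem _
  | [x, y] =>
    have := SetLike.mul_mem_graded (hL x (by simp)) (hL y (by simp))
    simpa [mulL] using this
  | _ :: _ :: _ :: _ => exact Submodule.zero_mem _

theorem ev_diff_nil (d : ℤ) (F : Coch B) : ev (diff 𝒜 d F) [] = 0 := rfl

theorem ev_diff_cons (d : ℤ) (F : Coch B) (x : B) (t : List B) :
    ev (diff 𝒜 d F) (x :: t) = sgn k (d - t.length) •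
      (koszul 𝒜 (d - t.length) x * ev F t
        + sgn k (t.length + 1) • (ev F (x :: t).dropLast * (x :: t).getLast (List.cons_ne_nil _ _))
        + mergeSum (fun a u v c => sgn k (a.length + 1) • ev F (a ++ u * v :: c)) (x :: t)) := by
  rw [mergeSum_cons_eq_sum]
  change sgn k (d - t.length) • (koszul 𝒜 (d - t.length) x * ev F t
          + (-1 : k) ^ (t.length + 1) • (F t.length (fun j => (x :: t).get j.castSucc) * (x :: t).get (Fin.last _))
          + ∑ i : Fin t.length, (-1 : k) ^ (i.val + 1) •
              F t.length (Fin.contractNth i.castSucc (fun a b => a * b) (x :: t).get)) = _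
  congr 2
  · congr 1
    refine smul_congr ?_ ?_
    · rw [← sgn_natCast]
      push_cast
      rfl
    · congr 1
      · refine apply_eq_ev' F (by simp) ?_
        intro j
        simp
      · rw [List.getLast_eq_getElem]
        rfl
  · refine Finset.sum_congr rfl fun i _ => smul_congr ?_ ?_
    · rw [← sgn_natCast]
      have : (List.take i.val (x :: t)).length = i.val := by simp; omega
      rw [this]
      push_cast
      rfl
    · refine apply_eq_ev' F (by simp; omega) ?_
      intro j
      have hi := i.2
      have hj := j.2
      have : (List.take i.val (x :: t)).length = i.val := by simp; omega
      rcases lt_trichotomy j.val i.val with h | h | h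
      · rw [Fin.contractNth_apply_of_lt _ _ _ _ h]
        simp only [List.get_eq_getElem, Fin.val_cast, Fin.val_castSucc]
        rw [List.getElem_append_left (by rw [this]; exact h), List.getElem_take]
      · rw [Fin.contractNth_apply_of_eq _ _ _ _ h]
        simp only [List.get_eq_getElem, Fin.val_cast, Fin.val_castSucc]
        rw [List.getElem_append_right (by rw [this]; exact h.ge)]
        conv_rhs => rw [List.getElem_cons, dif_pos (by rw [this]; omega)]
        simp only [Fin.val_succ, List.getElem_cons_succ, h]
        rfl
      · rw [Fin.contractNth_apply_of_gt _ _ _ _ h]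
        simp only [List.get_eq_getElem, Fin.val_cast, Fin.val_succ]
        rw [List.getElem_append_right (by rw [this]; exact h.le)]
        conv_rhs => rw [List.getElem_cons, dif_neg (by rw [this]; omega)]
        simp only [List.getElem_cons_succ, List.getElem_drop, this]
        congr 1
        omega

theorem comp_mulL_right {f : List B → B} (hf : Lin k f) (l : List B) :
    comp 𝒜 2 f mulL l = mergeSum (fun a u v c => sgn k c.length • f (a ++ u * v :: c)) l := by
  rw [comp, sumSplit₃_eq_mergeSum]
  · refine mergeSum_congr fun a u v c h => ?_
    refine smul_congr ?_ ?_
    · apply sgn_congr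
      push_cast
      simp only [List.length_cons, List.length_nil]
      push_cast
      generalize (a.length : ZMod 2) = x
      generalize (c.length : ZMod 2) = y
      revert x y; decide
    · congr 1
      rw [show (2 : ℤ) - ([u, v].length : ℤ) = 0 by simp]
      rw [show (koszul 𝒜 0 : B → B) = id from funext (koszul_zero 𝒜)]
      simp [mulL]
  · intro a b c _ hb
    rw [mulL_of_length_ne hb, (hf _ _).map_zero, smul_zero]

theorem comp_mulL_left_nil (d : ℤ) (f : List B → B) : comp 𝒜 d mulL f [] = 0 := by
  simp [comp, sumSplit₃, sumSplit_nil, mulL]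

theorem comp_mulL_left_cons (d : ℤ) (f : List B → B) (x : B) (t : List B) :
    comp 𝒜 d mulL f (x :: t) = sgn k (t.length + d) • (koszul 𝒜 (d - t.length) x * f t) +
      sgn k (d - 1) • (f (x :: t).dropLast * (x :: t).getLast (List.cons_ne_nil _ _)) := by
  rw [comp, sumSplit₃_eq_ends]
  · congr 1
    · refine smul_congr ?_ rfl
      apply sgn_congr
      simp only [List.length_cons, List.length_nil]
      push_cast
      generalize (t.length : ZMod 2) = x
      generalize (d : ZMod 2) = y
      revert x y; decide
    · refine smul_congr ?_ rfl
      congr 1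
      simp
  · intro a b c _ h
    rw [mulL_of_length_ne, smul_zero]
    simp
    omega

/-- The Hochschild differential on functions on lists. -/
def dif (d : ℤ) (f : List B → B) (l : List B) : B :=
  comp 𝒜 d mulL f l - sgn k (d - 1) • comp 𝒜 2 f mulL l

/-- The multiplication has total degree two, so the right-hand side is `[m, f]`. The outer terms of
the Hochschild differential come from `m ∘ f` and the merging terms from `f ∘ m`. -/
theorem ev_diff (d : ℤ) {F : Coch B} (hF : Lin k (ev F)) : ev (diff 𝒜 d F) = dif 𝒜 d (ev F) := by
  funext l
  cases l with
  | nil => simp [ev_diff_nil, dif, comp_mulL_left_nil, comp_mulL_right 𝒜 hF, mergeSum]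
  | cons x t =>
    rw [ev_diff_cons, dif, comp_mulL_left_cons, comp_mulL_right 𝒜 hF, smul_add, smul_add,
      sub_eq_add_neg (_ + _), ← neg_smul, neg_sgn, mergeSum_smul, mergeSum_smul, smul_smul,
      sgn_mul_sgn]
    congr 1
    · congr 1
      · refine smul_congr (sgn_congr k ?_) rfl
        push_cast
        generalize (t.length : ZMod 2) = x
        generalize (d : ZMod 2) = y
        revert x y; decide
      · refine smul_congr (sgn_congr k ?_) rfl
        push_cast
        generalize (t.length : ZMod 2) = x
        generalize (d : ZMod 2) = y
        revert x y; decide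
    · refine mergeSum_congr fun a u v c h => ?_
      rw [smul_smul, smul_smul, sgn_mul_sgn, sgn_mul_sgn]
      refine smul_congr (sgn_congr k ?_) rfl
      have := congrArg List.length h
      simp only [List.length_append, List.length_cons] at this
      have h2 : t.length = a.length + c.length + 1 := by omega
      rw [h2]
      push_cast
      generalize (a.length : ZMod 2) = x
      generalize (c.length : ZMod 2) = z
      generalize (d : ZMod 2) = y
      revert x z y; decide

variable {𝒜}

theorem comp_add_left (j : ℤ) (f f' g : List B → B) :
    comp 𝒜 j (f + f') g = comp 𝒜 j f g + comp 𝒜 j f' g := by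
  funext l
  simp only [comp, Pi.add_apply, smul_add, sumSplit₃_add]

theorem comp_smul_left (j : ℤ) (c : k) (f g : List B → B) :
    comp 𝒜 j (c • f) g = c • comp 𝒜 j f g := by
  funext l
  simp only [comp, Pi.smul_apply, sumSplit₃_smul, smul_comm c]

theorem comp_add_right (j : ℤ) {f : List B → B} (hf : Lin k f) (g g' : List B → B) :
    comp 𝒜 j f (g + g') = comp 𝒜 j f g + comp 𝒜 j f g' := by
  funext l
  simp only [comp, Pi.add_apply, (hf _ _).map_add, smul_add, sumSplit₃_add]

theorem comp_smul_right (j : ℤ) (c : k) {f : List B → B} (hf : Lin k f) (g : List B → B) :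
    comp 𝒜 j f (c • g) = c • comp 𝒜 j f g := by
  funext l
  simp only [comp, Pi.smul_apply, (hf _ _).map_smul, sumSplit₃_smul, smul_comm c]

theorem comp_zero_left (j : ℤ) (g : List B → B) : comp 𝒜 j 0 g = 0 := by
  have := comp_smul_left (𝒜 := 𝒜) j (0 : k) 0 g
  simpa using this

theorem comp_zero_right (j : ℤ) {f : List B → B} (hf : Lin k f) : comp 𝒜 j f 0 = 0 := by
  have := comp_smul_right (𝒜 := 𝒜) j (0 : k) hf 0
  simpa using this

/-- On three arguments the two terms are `(xy)z` and `x(yz)` with opposite signs, so this is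
associativity. -/
theorem comp_mulL_mulL : comp 𝒜 2 mulL mulL = (0 : List B → B) := by
  funext l
  rw [comp_mulL_right 𝒜 mulL_lin]
  match l with
  | [] => rfl
  | [_] => rfl
  | [_, _] => simp [mergeSum, mulL]
  | [_, _, _] => simp [mergeSum, mulL, mul_assoc]
  | x :: y :: z :: w :: t =>
    refine mergeSum_eq_zero fun a u v c h => ?_
    rw [mulL_of_length_ne, smul_zero]
    have := congrArg List.length h
    simp only [List.length_append, List.length_cons] at this ⊢
    omega

theorem dif_eq (d : ℤ) (f : List B → B) :
    dif 𝒜 d f = comp 𝒜 d mulL f + (-sgn k (d - 1)) • comp 𝒜 2 f mulL := by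
  funext l
  simp [dif, sub_eq_add_neg]

theorem Lin.add {f g : List B → B} (hf : Lin k f) (hg : Lin k g) : Lin k (f + g) :=
  fun a c => IsLinearMap.add' (hf a c) (hg a c)

theorem Lin.smul {f : List B → B} (c : k) (hf : Lin k f) : Lin k (c • f) :=
  fun a e => IsLinearMap.const_smul (hf a e) c

theorem Hom.add {d : ℤ} {f g : List B → B} (hf : Hom 𝒜 d f) (hg : Hom 𝒜 d g) : Hom 𝒜 d (f + g) :=
  fun L hL => Submodule.add_mem _ (hf L hL) (hg L hL)

theorem Hom.smul {d : ℤ} {f : List B → B} (c : k) (hf : Hom 𝒜 d f) : Hom 𝒜 d (c • f) :=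
  fun L hL => Submodule.smul_mem _ _ (hf L hL)

theorem Lin.dif {d : ℤ} {f : List B → B} (hf : Lin k f) : Lin k (dif 𝒜 d f) := by
  rw [dif_eq]
  exact (mulL_lin.comp hf).add ((hf.comp mulL_lin).smul _)

theorem Hom.dif {d : ℤ} {f : List B → B} (hf : Hom 𝒜 d f) : Hom 𝒜 (d + 1) (dif 𝒜 d f) := by
  rw [dif_eq]
  refine Hom.add ?_ (Hom.smul _ ?_)
  · convert (mulL_hom 𝒜).comp hf using 1
    ring
  · convert hf.comp (mulL_hom 𝒜) using 1
    ring

/-- Expanding `[m, [m, f]]` by the pre-Lie identity for the orders `m m f`, `m f m` and `f m m`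
leaves terms containing `m ∘ m = 0` and disjoint insertions which cancel in pairs. No division by
two is needed, so the characteristic plays no role. -/
theorem dif_dif {d : ℤ} {f : List B → B} (hf : Lin k f) (hd : Hom 𝒜 d f) :
    dif 𝒜 (d + 1) (dif 𝒜 d f) = 0 := by
  have e1 : ∀ l, _ := comp_comp (𝒜 := 𝒜) (j := 2) (f := mulL) (g := mulL) mulL_lin hf hd
  have e2 : ∀ l, _ := comp_comp (𝒜 := 𝒜) (j := d) (f := mulL) (g := f) mulL_lin mulL_lin (mulL_hom 𝒜)
  have e3 : ∀ l, _ := comp_comp (𝒜 := 𝒜) (j := 2) (g := mulL) hf mulL_lin (mulL_hom 𝒜)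
  rw [dif_eq, dif_eq, comp_add_right _ mulL_lin, comp_smul_right _ _ mulL_lin, comp_add_left,
    comp_smul_left]
  funext l
  have e1 := e1 l
  have e2 := e2 l
  have e3 := e3 l
  simp only [comp_mulL_mulL, comp_zero_right _ hf, comp_zero_left] at e1 e2 e3
  simp only [Pi.add_apply, Pi.smul_apply, Pi.zero_apply, show d + 2 - 1 = d + 1 by ring,
    show 2 + d - 1 = d + 1 by ring, show ((2 : ℤ) - 1) = 1 by norm_num, one_mul, mul_one,
    sgn_one] at e1 e2 e3 ⊢
  rw [show d + 1 - 1 = (d - 1) + 1 by ring, ← neg_sgn]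
  rcases Int.even_or_odd (d - 1) with h | h
  · rw [sgn_of_even k h] at *
    linear_combination (norm := module) (-1 : k) • e1 + (1 : k) • e2 - (1 : k) • e3
  · rw [sgn_of_odd k h] at *
    linear_combination (norm := module) (-1 : k) • e1 - (1 : k) • e2 - (1 : k) • e3

end GradedHochschild
end

/-! ### The Leibniz rule and the bracket on cohomology -/

noncomputable section

namespace GradedHochschild
variable {k B : Type*} [Field k] [Ring B] [Algebra k B]
variable {𝒜 : ℤ → Submodule k B} [GradedAlgebra 𝒜]

variable (𝒜) in
/-- The Gerstenhaber bracket of functions on lists. -/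
def brk (i j : ℤ) (f g : List B → B) : List B → B :=
  comp 𝒜 j f g + (-sgn k ((i - 1) * (j - 1))) • comp 𝒜 i g f

theorem ev_bracket (i j : ℤ) (F G : Coch B) :
    ev (bracket 𝒜 i j F G) = brk 𝒜 i j (ev F) (ev G) := by
  funext l
  rw [brk, ← ev_circ_eq_comp, ← ev_circ_eq_comp]
  simp only [bracket, ev_sub, ev_smul, Pi.add_apply, neg_smul]
  exact sub_eq_add_neg _ _

/-- This is the graded Jacobi identity for `m`, `f` and `g`. It is a signed sum of the pre-Lie
identities for the six orders of the three maps, in which all disjoint insertions cancel. -/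
theorem dif_brk {i j : ℤ} {f g : List B → B} (hf : Lin k f) (hi : Hom 𝒜 i f) (hg : Lin k g)
    (hj : Hom 𝒜 j g) : dif 𝒜 (i + j - 1) (brk 𝒜 i j f g) =
      brk 𝒜 (i + 1) j (dif 𝒜 i f) g + sgn k (i - 1) • brk 𝒜 i (j + 1) f (dif 𝒜 j g) := by
  have e1 : ∀ l, _ := comp_comp (𝒜 := 𝒜) (j := i) (f := mulL) (g := f) mulL_lin hg hj
  have e2 : ∀ l, _ := comp_comp (𝒜 := 𝒜) (j := j) (f := mulL) (g := g) mulL_lin hf hi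
  have e3 : ∀ l, _ := comp_comp (𝒜 := 𝒜) (j := 2) (f := f) (g := mulL) hf hg hj
  have e4 : ∀ l, _ := comp_comp (𝒜 := 𝒜) (j := j) (f := f) (g := g) hf mulL_lin (mulL_hom 𝒜)
  have e5 : ∀ l, _ := comp_comp (𝒜 := 𝒜) (j := 2) (f := g) (g := mulL) hg hf hi
  have e6 : ∀ l, _ := comp_comp (𝒜 := 𝒜) (j := i) (f := g) (g := f) hg mulL_lin (mulL_hom 𝒜)
  simp only [dif_eq, brk, comp_add_right _ mulL_lin, comp_smul_right _ _ mulL_lin, comp_add_left,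
    comp_smul_left, comp_add_right _ hf, comp_smul_right _ _ hf, comp_add_right _ hg,
    comp_smul_right _ _ hg]
  funext l
  have e1 := e1 l
  have e2 := e2 l
  have e3 := e3 l
  have e4 := e4 l
  have e5 := e5 l
  have e6 := e6 l
  have a1 : sgn k (i + j - 1 - 1) = sgn k (i - 1) * sgn k (j - 1) := by
    rw [← sgn_add]; congr 1; ring
  have a2 : sgn k ((i + 1 - 1) * (j - 1)) = sgn k ((i - 1) * (j - 1)) * sgn k (j - 1) := by
    rw [← sgn_add]; congr 1; ring
  have a3 : sgn k ((i - 1) * (j + 1 - 1)) = sgn k ((i - 1) * (j - 1)) * sgn k (i - 1) := by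
    rw [← sgn_add]; congr 1; ring
  have a4 : sgn k ((j - 1) * (i - 1)) = sgn k ((i - 1) * (j - 1)) := by rw [mul_comm]
  simp only [Pi.add_apply, Pi.smul_apply, show (2 : ℤ) + j - 1 = j + 1 by ring,
    show (j : ℤ) + 2 - 1 = j + 1 by ring, show (2 : ℤ) + i - 1 = i + 1 by ring,
    show (i : ℤ) + 2 - 1 = i + 1 by ring, show j + i - 1 = i + j - 1 by ring,
    show ((2 : ℤ) - 1) = 1 by norm_num, one_mul, mul_one, a1, a2, a3, a4] at e1 e2 e3 e4 e5 e6 ⊢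
  have p : ∀ e : ℤ, sgn k e = 1 ∨ sgn k e = -1 := fun e => by
    rcases Int.even_or_odd e with h | h
    · exact Or.inl (sgn_of_even k h)
    · exact Or.inr (sgn_of_odd k h)
  -- The three signs are treated separately, without using that the third is determined by the
  -- parities behind the first two. In each case the same six identities are combined with
  -- coefficients `±1`.
  rcases p (i - 1) with ha | ha <;> rcases p (j - 1) with hb | hb <;>
    rcases p ((i - 1) * (j - 1)) with hc | hc <;> simp only [ha, hb, hc] at e1 e2 e3 e4 e5 e6 ⊢
  · linear_combination (norm := module) (-1 : k) • e1 + (1 : k) • e2 + (1 : k) • e3 - (1 : k) • e4 -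
      (1 : k) • e5 + (1 : k) • e6
  · linear_combination (norm := module) (-1 : k) • e1 - (1 : k) • e2 + (1 : k) • e3 - (1 : k) • e4 +
      (1 : k) • e5 - (1 : k) • e6
  · linear_combination (norm := module) (-1 : k) • e1 + (1 : k) • e2 + (1 : k) • e3 + (1 : k) • e4 +
      (1 : k) • e5 - (1 : k) • e6
  · linear_combination (norm := module) (-1 : k) • e1 - (1 : k) • e2 + (1 : k) • e3 + (1 : k) • e4 -
      (1 : k) • e5 + (1 : k) • e6
  · linear_combination (norm := module) (-1 : k) • e1 + (1 : k) • e2 - (1 : k) • e3 + (1 : k) • e4 -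
      (1 : k) • e5 - (1 : k) • e6
  · linear_combination (norm := module) (-1 : k) • e1 - (1 : k) • e2 - (1 : k) • e3 + (1 : k) • e4 +
      (1 : k) • e5 + (1 : k) • e6
  · linear_combination (norm := module) (-1 : k) • e1 + (1 : k) • e2 - (1 : k) • e3 - (1 : k) • e4 +
      (1 : k) • e5 + (1 : k) • e6
  · linear_combination (norm := module) (-1 : k) • e1 - (1 : k) • e2 - (1 : k) • e3 - (1 : k) • e4 -
      (1 : k) • e5 - (1 : k) • e6

theorem Lin.brk {i j : ℤ} {f g : List B → B} (hf : Lin k f) (hg : Lin k g) :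
    Lin k (brk 𝒜 i j f g) := (hf.comp hg).add ((hg.comp hf).smul _)

theorem Hom.brk {i j : ℤ} {f g : List B → B} (hf : Hom 𝒜 i f) (hg : Hom 𝒜 j g) :
    Hom 𝒜 (i + j - 1) (brk 𝒜 i j f g) := by
  refine (hf.comp hg).add (Hom.smul _ ?_)
  rw [add_comm i j]
  exact hg.comp hf

theorem bracket_mem_cochains {i j l : ℤ} (hl : l = i + j - 1) {F G : Coch B}
    (hF : F ∈ cochains 𝒜 i) (hG : G ∈ cochains 𝒜 j) : bracket 𝒜 i j F G ∈ cochains 𝒜 l := by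
  rw [cochains_iff] at *
  rw [ev_bracket, hl]
  exact ⟨hF.1.brk hG.1, hF.2.brk hG.2⟩

theorem diff_mem_cochains {d e : ℤ} (he : e = d + 1) {F : Coch B} (hF : F ∈ cochains 𝒜 d) :
    diff 𝒜 d F ∈ cochains 𝒜 e := by
  rw [cochains_iff] at *
  rw [ev_diff 𝒜 d hF.1, he]
  exact ⟨hF.1.dif, hF.2.dif⟩

theorem diff_diff {d e : ℤ} (he : e = d + 1) {F : Coch B} (hF : F ∈ cochains 𝒜 d) :
    diff 𝒜 e (diff 𝒜 d F) = 0 := by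
  have hF' := (cochains_iff 𝒜).1 hF
  have h := (cochains_iff 𝒜).1 (diff_mem_cochains he hF)
  refine coch_ext fun l => ?_
  rw [ev_diff 𝒜 e h.1, ev_diff 𝒜 d hF'.1, he, dif_dif hF'.1 hF'.2]
  rfl

theorem diff_bracket {i j l : ℤ} (hl : l = i + j - 1) {F G : Coch B}
    (hF : F ∈ cochains 𝒜 i) (hG : G ∈ cochains 𝒜 j) :
    diff 𝒜 l (bracket 𝒜 i j F G) = bracket 𝒜 (i + 1) j (diff 𝒜 i F) G +
      sgn k (i - 1) • bracket 𝒜 i (j + 1) F (diff 𝒜 j G) := by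
  have h := (cochains_iff 𝒜).1 (bracket_mem_cochains hl hF hG)
  rw [cochains_iff] at hF hG
  refine coch_ext fun x => ?_
  rw [ev_diff 𝒜 l h.1, ev_add, ev_smul, ev_bracket, ev_bracket, ev_bracket, ev_diff 𝒜 i hF.1,
    ev_diff 𝒜 j hG.1, hl, dif_brk hF.1 hF.2 hG.1 hG.2]
  rfl

theorem bracket_add_left {i j : ℤ} {F F' G : Coch B} (hG : G ∈ cochains 𝒜 j) :
    bracket 𝒜 i j (F + F') G = bracket 𝒜 i j F G + bracket 𝒜 i j F' G := by
  rw [cochains_iff] at hG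
  refine coch_ext fun x => ?_
  rw [ev_add, ev_bracket, ev_bracket, ev_bracket, show ev (F + F') = ev F + ev F' from rfl]
  simp only [brk, comp_add_left, comp_add_right _ hG.1, smul_add, Pi.add_apply]
  abel

theorem bracket_add_right {i j : ℤ} {F G G' : Coch B} (hF : F ∈ cochains 𝒜 i) :
    bracket 𝒜 i j F (G + G') = bracket 𝒜 i j F G + bracket 𝒜 i j F G' := by
  rw [cochains_iff] at hF
  refine coch_ext fun x => ?_
  rw [ev_add, ev_bracket, ev_bracket, ev_bracket, show ev (G + G') = ev G + ev G' from rfl]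
  simp only [brk, comp_add_left, comp_add_right _ hF.1, smul_add, Pi.add_apply]
  abel

theorem bracket_zero_left {i j : ℤ} {G : Coch B} (hG : G ∈ cochains 𝒜 j) :
    bracket 𝒜 i j 0 G = 0 := by
  have := bracket_add_left (i := i) (F := 0) (F' := 0) hG
  simpa using this

theorem bracket_zero_right {i j : ℤ} {F : Coch B} (hF : F ∈ cochains 𝒜 i) :
    bracket 𝒜 i j F 0 = 0 := by
  have := bracket_add_right (j := j) (G := 0) (G' := 0) hF
  simpa using this

theorem mem_cocycles {d : ℤ} {F : Coch B} : F ∈ cocycles 𝒜 d ↔ F ∈ cochains 𝒜 d ∧ diff 𝒜 d F = 0 :=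
  Iff.rfl

theorem coboundaries_le_cocycles (d : ℤ) : coboundaries 𝒜 d ≤ cocycles 𝒜 d := by
  rintro _ ⟨P, hP, rfl⟩
  exact ⟨diff_mem_cochains (by ring) hP, diff_diff (by ring) hP⟩

theorem bracket_mem_cocycles {i j l : ℤ} (hl : l = i + j - 1) {F G : Coch B}
    (hF : F ∈ cocycles 𝒜 i) (hG : G ∈ cocycles 𝒜 j) : bracket 𝒜 i j F G ∈ cocycles 𝒜 l := by
  refine mem_cocycles.2 ⟨bracket_mem_cochains hl hF.1 hG.1, ?_⟩
  rw [diff_bracket hl hF.1 hG.1, (mem_cocycles.1 hF).2, (mem_cocycles.1 hG).2,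
    bracket_zero_left hG.1, bracket_zero_right hF.1, smul_zero, add_zero]

/-- If `F = dP` and `dG = 0`, the Leibniz rule reads `d[P, G] = [F, G]`. -/
theorem bracket_mem_coboundaries_left {i j l : ℤ} (hl : l = i + j - 1) {F G : Coch B}
    (hF : F ∈ coboundaries 𝒜 i) (hG : G ∈ cocycles 𝒜 j) :
    bracket 𝒜 i j F G ∈ coboundaries 𝒜 l := by
  obtain ⟨P, hP, rfl⟩ := hF
  refine ⟨bracket 𝒜 (i - 1) j P G, bracket_mem_cochains (by rw [hl]; ring) hP hG.1, ?_⟩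
  rw [diff_bracket (by rw [hl]; ring) hP hG.1, (mem_cocycles.1 hG).2, bracket_zero_right hP,
    smul_zero, add_zero, sub_add_cancel]

theorem bracket_mem_coboundaries_right {i j l : ℤ} (hl : l = i + j - 1) {F G : Coch B}
    (hF : F ∈ cocycles 𝒜 i) (hG : G ∈ coboundaries 𝒜 j) :
    bracket 𝒜 i j F G ∈ coboundaries 𝒜 l := by
  obtain ⟨P, hP, rfl⟩ := hG
  refine ⟨sgn k (i - 1) • bracket 𝒜 i (j - 1) F P,
    Submodule.smul_mem _ _ (bracket_mem_cochains (by rw [hl]; ring) hF.1 hP), ?_⟩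
  rw [map_smul, diff_bracket (by rw [hl]; ring) hF.1 hP, (mem_cocycles.1 hF).2,
    bracket_zero_left hP, zero_add, smul_smul, sgn_mul_self, one_smul, sub_add_cancel]

theorem Represents.sub_mem {d : ℤ} {F F' : Coch B} {x : HH 𝒜 d} (h : Represents 𝒜 F x)
    (h' : Represents 𝒜 F' x) : F - F' ∈ coboundaries 𝒜 d := by
  obtain ⟨h1, rfl⟩ := h
  obtain ⟨h2, h3⟩ := h'
  have := (Submodule.Quotient.eq _).1 h3.symm
  exact this

theorem Represents.of_sub_mem {d : ℤ} {F F' : Coch B} {x : HH 𝒜 d} (h : Represents 𝒜 F x)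
    (h' : F' - F ∈ coboundaries 𝒜 d) : Represents 𝒜 F' x := by
  obtain ⟨h1, rfl⟩ := h
  have h2 : F' ∈ cocycles 𝒜 d := by
    have := Submodule.add_mem _ (coboundaries_le_cocycles d h') h1
    rwa [sub_add_cancel] at this
  exact ⟨h2, (Submodule.Quotient.eq _).2 h'⟩

theorem Represents.smul {d : ℤ} {F : Coch B} {x : HH 𝒜 d} (h : Represents 𝒜 F x) (c : k) :
    Represents 𝒜 (c • F) (c • x) := by
  obtain ⟨h1, rfl⟩ := h
  exact ⟨Submodule.smul_mem _ _ h1, rfl⟩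

theorem represents_zero (d : ℤ) : Represents 𝒜 (0 : Coch B) (0 : HH 𝒜 d) :=
  ⟨Submodule.zero_mem _, rfl⟩

/-- Changing a representative changes the bracket by a bracket of a coboundary with a cocycle, which
is again a coboundary. Hence a single pair of representatives decides, and it may be chosen
normalised. -/
theorem isBracket_of_represents {i j l : ℤ} {x : HH 𝒜 i} {y : HH 𝒜 j} {z : HH 𝒜 l} {F G Z : Coch B}
    (hl : l = i + j - 1) (hF : Represents 𝒜 F x) (hG : Represents 𝒜 G y) (hZ : Represents 𝒜 Z z)
    (h : bracket 𝒜 i j F G - Z ∈ coboundaries 𝒜 l) : IsBracket 𝒜 x y z := by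
  refine ⟨hl, fun F' G' hF' hG' => hZ.of_sub_mem ?_⟩
  have h1 := bracket_mem_coboundaries_left hl (hF'.sub_mem hF) hG'.choose
  have h2 := bracket_mem_coboundaries_right hl hF.choose (hG'.sub_mem hG)
  have e1 := bracket_add_left (i := i) (F := F' - F) (F' := F) (G := G') hG'.choose.1
  have e2 := bracket_add_right (j := j) (F := F) (G := G' - G) (G' := G) hF.choose.1
  rw [sub_add_cancel] at e1 e2
  rw [e1, e2, add_sub_assoc, add_sub_assoc]
  exact Submodule.add_mem _ h1 (Submodule.add_mem _ h2 h)

end GradedHochschild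
end

noncomputable section

open GradedHochschild

namespace GradedGentleQuiver

variable {V E : Type*} {Q : GradedGentleQuiver V E} {k : Type*} [Field k]

/-! ### Coefficients -/

theorem coeffs_add (a b : Q.Alg k) : Q.coeffs (a + b) = Q.coeffs a + Q.coeffs b := rfl
theorem coeffs_smul (c : k) (a : Q.Alg k) : Q.coeffs (c • a) = c • Q.coeffs a := rfl
theorem coeffs_zero : Q.coeffs (0 : Q.Alg k) = 0 := rfl
theorem coeffs_ofPath (p : Q.NZPath) : Q.coeffs (Q.ofPath k p) = Finsupp.single p 1 := rfl

theorem alg_ext {a b : Q.Alg k} (h : ∀ y, Q.coeffs a y = Q.coeffs b y) : a = b := Finsupp.ext h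

theorem coeffs_sum {ι : Type*} (s : Finset ι) (f : ι → Q.Alg k) :
    Q.coeffs (∑ i ∈ s, f i) = ∑ i ∈ s, Q.coeffs (f i) := rfl

theorem coeffs_ofPath_ne {p y : Q.NZPath} (h : Q.coeffs (Q.ofPath k p) y ≠ 0) : y = p := by
  classical
  rw [coeffs_ofPath, Finsupp.single_apply] at h
  by_contra hne
  exact h (if_neg fun h' => hne h'.symm)

theorem coeffs_ofPath_self (p : Q.NZPath) : Q.coeffs (Q.ofPath k p) p = 1 := by
  rw [coeffs_ofPath, Finsupp.single_eq_same]

theorem sum_coeffs (a : Q.Alg k) : a = ∑ y ∈ (Q.coeffs a).support, Q.coeffs a y • Q.ofPath k y := by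
  refine alg_ext fun z => ?_
  have : Q.coeffs a = (Q.coeffs a).sum Finsupp.single := (Finsupp.sum_single _).symm
  conv_lhs => rw [this]
  rw [coeffs_sum, Finsupp.sum]
  congr 1
  refine Finset.sum_congr rfl fun y _ => ?_
  rw [coeffs_smul, coeffs_ofPath, Finsupp.smul_single, smul_eq_mul, mul_one]

theorem exists_coeffs_ne_zero {a : Q.Alg k} (h : a ≠ 0) : ∃ y, Q.coeffs a y ≠ 0 := by
  by_contra! h'
  exact h (alg_ext h')

/-- The concatenation of two paths. -/
def NZPath.append (p q : Q.NZPath) (h : p.src = q.tgt) (h' : (p.word ++ q.word).IsChain Q.nonrel) :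
    Q.NZPath :=
  ⟨p.tgt, q.src, p.word ++ q.word, p.walk.append (h ▸ q.walk), h'⟩

/-- A non-empty word determines its end vertices; only trivial paths carry a vertex as additional
information. -/
theorem NZPath.ext_of_word_ne_nil {p q : Q.NZPath} (h : p.word = q.word) (hp : p.word ≠ []) :
    p = q := by
  have key : ∀ (w : List E) (t s t' s' : V), w ≠ [] → Q.IsWalk t s w → Q.IsWalk t' s' w →
      t = t' ∧ s = s' := by
    intro w
    induction w with
    | nil => simp
    | cons a w ih =>
      intro t s t' s' _ h1 h2
      refine ⟨h1.1.symm.trans h2.1, ?_⟩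
      cases w with
      | nil => exact Eq.trans (Eq.symm h1.2) h2.2
      | cons b w => exact (ih _ _ _ _ (by simp) h1.2 h2.2).2
  have := key p.word p.tgt p.src q.tgt q.src hp p.walk (h ▸ q.walk)
  exact NZPath.ext this.1 this.2 h

theorem NZPath.src_eq_tgt_of_word_eq_nil {p : Q.NZPath} (h : p.word = []) : p.tgt = p.src := by
  have := p.walk
  rw [h] at this
  exact this

theorem NZPath.ext_of_tgt {p q : Q.NZPath} (h : p.word = q.word) (h' : p.tgt = q.tgt) : p = q := by
  by_cases hp : p.word = []
  · refine NZPath.ext h' ?_ h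
    rw [← src_eq_tgt_of_word_eq_nil hp, ← src_eq_tgt_of_word_eq_nil (h ▸ hp), h']
  · exact ext_of_word_ne_nil h hp

theorem NZPath.ext_of_src {p q : Q.NZPath} (h : p.word = q.word) (h' : p.src = q.src) : p = q := by
  by_cases hp : p.word = []
  · refine NZPath.ext ?_ h' h
    rw [src_eq_tgt_of_word_eq_nil hp, src_eq_tgt_of_word_eq_nil (h ▸ hp), h']
  · exact ext_of_word_ne_nil h hp

section
variable [Fintype V]

theorem ofPath_mul_ofPath (p q : Q.NZPath) : Q.ofPath k p * Q.ofPath k q = Q.pathMul k p q :=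
  Q.mulLin_ofPath p q

theorem ofPath_mul_ofPath_pos {p q : Q.NZPath} (h : p.src = q.tgt)
    (h' : (p.word ++ q.word).IsChain Q.nonrel) :
    Q.ofPath k p * Q.ofPath k q = Q.ofPath k (p.append q h h') := by
  rw [ofPath_mul_ofPath, pathMul, dif_pos ⟨h, h'⟩]
  rfl

theorem ofPath_mul_ofPath_neg {p q : Q.NZPath}
    (h : ¬ (p.src = q.tgt ∧ (p.word ++ q.word).IsChain Q.nonrel)) :
    Q.ofPath k p * Q.ofPath k q = 0 := by
  rw [ofPath_mul_ofPath, pathMul, dif_neg h]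

theorem coeffs_ofPath_mul_ne {p y : Q.NZPath} {a : Q.Alg k}
    (h : Q.coeffs (Q.ofPath k p * a) y ≠ 0) : ∃ z, Q.coeffs a z ≠ 0 ∧ p.src = z.tgt ∧ y.tgt = p.tgt ∧
      y.src = z.src ∧ y.word = p.word ++ z.word := by
  rw [sum_coeffs a, Finset.mul_sum, coeffs_sum, Finset.sum_apply'] at h
  obtain ⟨z, hz, hz'⟩ := Finset.exists_ne_zero_of_sum_ne_zero h
  refine ⟨z, by simpa using hz, ?_⟩
  rw [mul_smul_comm, coeffs_smul, Finsupp.smul_apply] at hz'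
  have hz' := right_ne_zero_of_smul hz'
  by_cases hc : p.src = z.tgt ∧ (p.word ++ z.word).IsChain Q.nonrel
  · rw [ofPath_mul_ofPath_pos hc.1 hc.2] at hz'
    obtain rfl := coeffs_ofPath_ne hz'
    exact ⟨hc.1, rfl, rfl, rfl⟩
  · rw [ofPath_mul_ofPath_neg hc, coeffs_zero] at hz'
    exact absurd rfl hz'

theorem coeffs_mul_ofPath_ne {p y : Q.NZPath} {a : Q.Alg k}
    (h : Q.coeffs (a * Q.ofPath k p) y ≠ 0) : ∃ z, Q.coeffs a z ≠ 0 ∧ z.src = p.tgt ∧ y.tgt = z.tgt ∧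
      y.src = p.src ∧ y.word = z.word ++ p.word := by
  rw [sum_coeffs a, Finset.sum_mul, coeffs_sum, Finset.sum_apply'] at h
  obtain ⟨z, hz, hz'⟩ := Finset.exists_ne_zero_of_sum_ne_zero h
  refine ⟨z, by simpa using hz, ?_⟩
  rw [smul_mul_assoc, coeffs_smul, Finsupp.smul_apply] at hz'
  have hz' := right_ne_zero_of_smul hz'
  by_cases hc : z.src = p.tgt ∧ (z.word ++ p.word).IsChain Q.nonrel
  · rw [ofPath_mul_ofPath_pos hc.1 hc.2] at hz'
    obtain rfl := coeffs_ofPath_ne hz'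
    exact ⟨hc.1, rfl, rfl, rfl⟩
  · rw [ofPath_mul_ofPath_neg hc, coeffs_zero] at hz'
    exact absurd rfl hz'

/-- Left multiplication by a path is injective on the paths which it does not annihilate, so exactly
one coefficient of `a` contributes to this coefficient of the product. -/
theorem coeffs_ofPath_mul {p y z : Q.NZPath} (a : Q.Alg k) (h : p.src = z.tgt) (ht : y.tgt = p.tgt)
    (hw : y.word = p.word ++ z.word) (hs : y.src = z.src) :
    Q.coeffs (Q.ofPath k p * a) y = Q.coeffs a z := by
  induction a using Q.alg_induction with
  | h0 => rw [mul_zero]; rfl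
  | hadd a b ha hb => rw [mul_add, coeffs_add, Finsupp.add_apply, ha, hb]; rfl
  | hs c q =>
    rw [mul_smul_comm, coeffs_smul, coeffs_smul, Finsupp.smul_apply, Finsupp.smul_apply]
    congr 1
    by_cases hq : q = z
    · subst hq
      have hc : (p.word ++ q.word).IsChain Q.nonrel := hw ▸ y.nonzero
      rw [ofPath_mul_ofPath_pos h hc, coeffs_ofPath_self]
      have : y = p.append q h hc := NZPath.ext ht hs hw
      rw [this, coeffs_ofPath_self]
    · rw [coeffs_ofPath, Finsupp.single_eq_of_ne (Ne.symm hq)]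
      by_contra hne
      obtain ⟨z', hz', h1, h2, h3, h4⟩ := coeffs_ofPath_mul_ne hne
      obtain rfl := coeffs_ofPath_ne hz'
      rw [hw] at h4
      exact hq (NZPath.ext (h1.symm.trans h) (h3.symm.trans hs) (List.append_cancel_left h4).symm)

theorem coeffs_mul_ofPath {p y z : Q.NZPath} (a : Q.Alg k) (h : z.src = p.tgt) (ht : y.tgt = z.tgt)
    (hw : y.word = z.word ++ p.word) (hs : y.src = p.src) :
    Q.coeffs (a * Q.ofPath k p) y = Q.coeffs a z := by
  induction a using Q.alg_induction with
  | h0 => rw [zero_mul]; rfl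
  | hadd a b ha hb => rw [add_mul, coeffs_add, Finsupp.add_apply, ha, hb]; rfl
  | hs c q =>
    rw [smul_mul_assoc, coeffs_smul, coeffs_smul, Finsupp.smul_apply, Finsupp.smul_apply]
    congr 1
    by_cases hq : q = z
    · subst hq
      have hc : (q.word ++ p.word).IsChain Q.nonrel := hw ▸ y.nonzero
      rw [ofPath_mul_ofPath_pos h hc, coeffs_ofPath_self]
      have : y = q.append p h hc := NZPath.ext ht hs hw
      rw [this, coeffs_ofPath_self]
    · rw [coeffs_ofPath, Finsupp.single_eq_of_ne (Ne.symm hq)]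
      by_contra hne
      obtain ⟨z', hz', h1, h2, h3, h4⟩ := coeffs_mul_ofPath_ne hne
      obtain rfl := coeffs_ofPath_ne hz'
      rw [hw] at h4
      exact hq (NZPath.ext (h2.symm.trans ht) (h1.trans h.symm) (List.append_cancel_right h4).symm)

theorem koszul_ofPath (r : ℤ) (p : Q.NZPath) :
    koszul (Q.grading k) r (Q.ofPath k p) = sgn k (r * Q.wdeg p.word) • Q.ofPath k p :=
  koszul_of_mem _ r (Q.ofPath_mem_grading p)

/-! ### Multilinear functions on lists of paths -/

theorem Lin.eq_sum {f : List (Q.Alg k) → Q.Alg k} (hf : Lin k f) (a c : List (Q.Alg k))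
    (b : Q.Alg k) :
    f (a ++ b :: c) = ∑ y ∈ (Q.coeffs b).support, Q.coeffs b y • f (a ++ Q.ofPath k y :: c) := by
  let T := (hf a c).mk'
  have hT : ∀ b, f (a ++ b :: c) = T b := fun b => rfl
  simp only [hT]
  conv_lhs => rw [sum_coeffs b]
  rw [map_sum]
  simp only [map_smul]

theorem Lin.exists_coeffs_ne_zero {f : List (Q.Alg k) → Q.Alg k} (hf : Lin k f)
    {a c : List (Q.Alg k)} {b : Q.Alg k} {y : Q.NZPath} (h : Q.coeffs (f (a ++ b :: c)) y ≠ 0) :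
    ∃ z, Q.coeffs b z ≠ 0 ∧ Q.coeffs (f (a ++ Q.ofPath k z :: c)) y ≠ 0 := by
  rw [Lin.eq_sum hf, coeffs_sum, Finset.sum_apply'] at h
  obtain ⟨z, hz, hz'⟩ := Finset.exists_ne_zero_of_sum_ne_zero h
  refine ⟨z, by simpa using hz, ?_⟩
  rw [coeffs_smul, Finsupp.smul_apply] at hz'
  exact right_ne_zero_of_smul hz'

theorem Lin.ext_of_paths {f g : List (Q.Alg k) → Q.Alg k} (hf : Lin k f) (hg : Lin k g)
    (h : ∀ L : List Q.NZPath, f (L.map (Q.ofPath k)) = g (L.map (Q.ofPath k)))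
    (l : List (Q.Alg k)) : f l = g l := by
  suffices H : ∀ l : List (Q.Alg k), ∀ L : List Q.NZPath,
      f (l ++ L.map (Q.ofPath k)) = g (l ++ L.map (Q.ofPath k)) by
    simpa using H l []
  intro l
  induction l using List.reverseRecOn with
  | nil => simpa using h
  | append_singleton l b ih =>
    intro L
    simp only [List.append_assoc, List.singleton_append]
    rw [Lin.eq_sum hf, Lin.eq_sum hg]
    exact Finset.sum_congr rfl fun y _ => congrArg _ (ih (y :: L))

theorem Lin.koszul_append_left {f : List (Q.Alg k) → Q.Alg k} (hf : Lin k f) (r : ℤ)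
    (L : List Q.NZPath) (a c : List (Q.Alg k)) :
    f (a ++ ((L.map (Q.ofPath k)).map (koszul (Q.grading k) r) ++ c)) =
      sgn k (r * Q.wdeg (L.map (·.word)).flatten) • f (a ++ (L.map (Q.ofPath k) ++ c)) := by
  induction L generalizing a with
  | nil => simp [wdeg]
  | cons X L ih =>
    simp only [List.map_cons, List.cons_append, koszul_ofPath, (hf _ _).map_smul]
    have := ih (a ++ [Q.ofPath k X])
    simp only [List.append_assoc, List.singleton_append] at this
    rw [this, smul_smul, ← sgn_add, List.flatten_cons, wdeg_append, mul_add]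

/-! ### Normalised cochains relative to the vertices -/

variable (Q) in
/-- The list consists of composable paths of positive length, running from `s` to `t`. -/
def PathSeq : V → V → List Q.NZPath → Prop
  | t, s, [] => t = s
  | t, s, X :: L => X.tgt = t ∧ X.word ≠ [] ∧ PathSeq X.src s L

theorem pathSeq_append {t s : V} {A C : List Q.NZPath} :
    Q.PathSeq t s (A ++ C) ↔ ∃ r, Q.PathSeq t r A ∧ Q.PathSeq r s C := by
  induction A generalizing t with
  | nil => simp [PathSeq]
  | cons X A ih => simp [PathSeq, ih, and_assoc]

/-- The function is supported on sequences of composable paths of positive length, and its values on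
such sequences are linear combinations of parallel paths. -/
def Normal (f : List (Q.Alg k) → Q.Alg k) : Prop :=
  ∀ (L : List Q.NZPath) (y : Q.NZPath), Q.coeffs (f (L.map (Q.ofPath k))) y ≠ 0 →
    Q.PathSeq y.tgt y.src L

theorem Normal.add {f g : List (Q.Alg k) → Q.Alg k} (hf : Normal f) (hg : Normal g) :
    Normal (f + g) := by
  intro L y h
  rw [Pi.add_apply, coeffs_add, Finsupp.add_apply] at h
  by_contra h'
  exact h (by rw [not_not.1 fun h1 => h' (hf L y h1), not_not.1 fun h1 => h' (hg L y h1), add_zero])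

theorem Normal.smul {f : List (Q.Alg k) → Q.Alg k} (c : k) (hf : Normal f) : Normal (c • f) := by
  intro L y h
  rw [Pi.smul_apply, coeffs_smul, Finsupp.smul_apply] at h
  exact hf L y (right_ne_zero_of_smul h)

theorem coeffs_sumSplit₃_ne {A : Type*} {φ : List A → List A → List A → Q.Alg k} {l : List A}
    {y : Q.NZPath} (h : Q.coeffs (sumSplit₃ φ l) y ≠ 0) :
    ∃ a b c, a ++ (b ++ c) = l ∧ Q.coeffs (φ a b c) y ≠ 0 := by
  by_contra! h'
  let S : Submodule k (Q.Alg k) := LinearMap.ker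
    ((Finsupp.lapply y : (Q.NZPath →₀ k) →ₗ[k] k) : Q.Alg k →ₗ[k] k)
  exact h (sumSplit₃_mem (S := S) fun a b c hl => h' a b c hl)

theorem coeffs_comp_ne {j : ℤ} {f g : List (Q.Alg k) → Q.Alg k} (hf : Lin k f)
    {L : List Q.NZPath} {y : Q.NZPath}
    (h : Q.coeffs (comp (Q.grading k) j f g (L.map (Q.ofPath k))) y ≠ 0) :
    ∃ A B C, L = A ++ (B ++ C) ∧ ∃ z, Q.coeffs (g (B.map (Q.ofPath k))) z ≠ 0 ∧
      Q.coeffs (f ((A ++ z :: C).map (Q.ofPath k))) y ≠ 0 := by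
  rw [comp, sumSplit₃_map] at h
  obtain ⟨A, B, C, rfl, h'⟩ := coeffs_sumSplit₃_ne h
  clear h
  refine ⟨A, B, C, rfl, ?_⟩
  have := Lin.koszul_append_left hf (j - (B.map (Q.ofPath k)).length) A []
    (g (B.map (Q.ofPath k)) :: C.map (Q.ofPath k))
  simp only [List.nil_append] at this
  rw [this, smul_smul, coeffs_smul, Finsupp.smul_apply] at h'
  obtain ⟨z, h1, h2⟩ := Lin.exists_coeffs_ne_zero hf (right_ne_zero_of_smul h')
  exact ⟨z, h1, by simpa using h2⟩

/-- Replacing one path of a composable sequence by a composable sequence parallel to it leaves the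
whole sequence composable. -/
theorem Normal.comp {j : ℤ} {f g : List (Q.Alg k) → Q.Alg k} (hf : Lin k f) (hnf : Normal f)
    (hng : Normal g) : Normal (comp (Q.grading k) j f g) := by
  intro L y h
  obtain ⟨A, B, C, rfl, z, h1, h2⟩ := coeffs_comp_ne hf h
  have h1 := hng _ _ h1
  have h2 := hnf _ _ h2
  rw [pathSeq_append] at h2
  obtain ⟨r, h3, h4, -, h5⟩ := h2
  exact pathSeq_append.2 ⟨r, h3, pathSeq_append.2 ⟨z.src, h4 ▸ h1, h5⟩⟩

theorem Normal.brk {i j : ℤ} {f g : List (Q.Alg k) → Q.Alg k} (hf : Lin k f) (hg : Lin k g)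
    (hnf : Normal f) (hng : Normal g) : Normal (brk (Q.grading k) i j f g) :=
  (Normal.comp hf hnf hng).add ((Normal.comp hg hng hnf).smul _)

end

end GradedGentleQuiver
end

/-! ### The differential preserves normalised cochains -/

noncomputable section

open GradedHochschild

namespace GradedGentleQuiver

variable {V E : Type*} {Q : GradedGentleQuiver V E} {k : Type*} [Field k] [Fintype V]

theorem ofPath_trivial_mul_ofPath {e z : Q.NZPath} (he : e.word = []) (h : e.src = z.tgt) :
    Q.ofPath k e * Q.ofPath k z = Q.ofPath k z := by
  have hc : (e.word ++ z.word).IsChain Q.nonrel := by rw [he]; exact z.nonzero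
  rw [ofPath_mul_ofPath_pos h hc]
  congr 1
  refine NZPath.ext ?_ rfl (by simp [NZPath.append, he])
  exact (NZPath.src_eq_tgt_of_word_eq_nil he).trans h

theorem ofPath_mul_ofPath_trivial {e z : Q.NZPath} (he : e.word = []) (h : z.src = e.tgt) :
    Q.ofPath k z * Q.ofPath k e = Q.ofPath k z := by
  have hc : (z.word ++ e.word).IsChain Q.nonrel := by rw [he, List.append_nil]; exact z.nonzero
  rw [ofPath_mul_ofPath_pos h hc]
  congr 1
  refine NZPath.ext rfl ?_ (by simp [NZPath.append, he])
  exact (NZPath.src_eq_tgt_of_word_eq_nil he).symm.trans h.symm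

theorem trivial_mul_of_support {e : Q.NZPath} (he : e.word = []) {a : Q.Alg k}
    (h : ∀ y, Q.coeffs a y ≠ 0 → y.tgt = e.src) : Q.ofPath k e * a = a := by
  conv_lhs => rw [sum_coeffs a]
  conv_rhs => rw [sum_coeffs a]
  rw [Finset.mul_sum]
  refine Finset.sum_congr rfl fun y hy => ?_
  rw [mul_smul_comm, ofPath_trivial_mul_ofPath he (h y (by simpa using hy)).symm]

theorem mul_trivial_of_support {e : Q.NZPath} (he : e.word = []) {a : Q.Alg k}
    (h : ∀ y, Q.coeffs a y ≠ 0 → y.src = e.tgt) : a * Q.ofPath k e = a := by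
  conv_lhs => rw [sum_coeffs a]
  conv_rhs => rw [sum_coeffs a]
  rw [Finset.sum_mul]
  refine Finset.sum_congr rfl fun y hy => ?_
  rw [smul_mul_assoc, ofPath_mul_ofPath_trivial he (h y (by simpa using hy))]

theorem trivial_mul_eq_zero {e : Q.NZPath} {a : Q.Alg k}
    (h : ∀ y, Q.coeffs a y ≠ 0 → e.src ≠ y.tgt) : Q.ofPath k e * a = 0 := by
  by_contra hne
  obtain ⟨y, hy⟩ := exists_coeffs_ne_zero hne
  obtain ⟨z, hz, h1, -⟩ := coeffs_ofPath_mul_ne hy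
  exact h z hz h1

theorem mul_trivial_eq_zero {e : Q.NZPath} {a : Q.Alg k}
    (h : ∀ y, Q.coeffs a y ≠ 0 → y.src ≠ e.tgt) : a * Q.ofPath k e = 0 := by
  by_contra hne
  obtain ⟨y, hy⟩ := exists_coeffs_ne_zero hne
  obtain ⟨z, hz, h1, -⟩ := coeffs_mul_ofPath_ne hy
  exact h z hz h1

theorem Normal.eq_zero {f : List (Q.Alg k) → Q.Alg k} (hf : Normal f) {L : List Q.NZPath}
    (h : ∀ t s, ¬ Q.PathSeq t s L) : f (L.map (Q.ofPath k)) = 0 := by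
  by_contra hne
  obtain ⟨y, hy⟩ := exists_coeffs_ne_zero hne
  exact h _ _ (hf L y hy)

theorem pathSeq_middle {t s : V} {A C : List Q.NZPath} {X Y : Q.NZPath}
    (h : Q.PathSeq t s (A ++ X :: Y :: C)) : X.src = Y.tgt := by
  obtain ⟨r, -, -, -, h, -⟩ := pathSeq_append.1 h
  exact h.symm

theorem PathSeq.word_ne_nil {t s : V} {L : List Q.NZPath} (h : Q.PathSeq t s L) {X : Q.NZPath}
    (hX : X ∈ L) : X.word ≠ [] := by
  obtain ⟨A, C, rfl⟩ := List.append_of_mem hX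
  obtain ⟨r, -, -, h, -⟩ := pathSeq_append.1 h
  exact h

/-- Normality speaks about lists of basis elements. Linearity in the entries on both sides extends
the vanishing to arbitrary surrounding arguments. -/
theorem Normal.eq_zero_of_trivial {f : List (Q.Alg k) → Q.Alg k} (hl : Lin k f) (hf : Normal f)
    {e : Q.NZPath} (he : e.word = []) (a c : List (Q.Alg k)) : f (a ++ Q.ofPath k e :: c) = 0 := by
  refine Lin.ext_of_paths (f := fun a => f (a ++ Q.ofPath k e :: c)) (g := 0) (k := k) ?_ ?_ ?_ a
  · intro x z
    have := hl x (z ++ Q.ofPath k e :: c)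
    simpa using this
  · exact fun x z => ⟨fun _ _ => by simp, fun _ _ => by simp⟩
  intro A
  refine Lin.ext_of_paths (f := fun c => f (A.map (Q.ofPath k) ++ Q.ofPath k e :: c)) (g := 0)
    (k := k) ?_ ?_ ?_ c
  · intro x z
    have := hl (A.map (Q.ofPath k) ++ Q.ofPath k e :: x) z
    simpa using this
  · exact fun x z => ⟨fun _ _ => by simp, fun _ _ => by simp⟩
  intro C
  have := hf.eq_zero (L := A ++ e :: C) fun t s h => h.word_ne_nil (X := e) (by simp) he
  simpa using this

variable (Q k) in
/-- A list of paths as a list of elements of the algebra. -/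
abbrev bas (L : List Q.NZPath) : List (Q.Alg k) := L.map (Q.ofPath k)

variable (F : Coch (Q.Alg k))

/-- The Hochschild differential on a list of paths. -/
theorem ev_diff_paths (d : ℤ) (X : Q.NZPath) (T : List Q.NZPath) :
    ev (diff (Q.grading k) d F) (Q.bas k (X :: T)) = sgn k (d - T.length) •
      (sgn k ((d - T.length) * Q.wdeg X.word) • (Q.ofPath k X * ev F (Q.bas k T))
        + sgn k (T.length + 1) • (ev F (Q.bas k (X :: T).dropLast) *
            Q.ofPath k ((X :: T).getLast (List.cons_ne_nil _ _)))
        + mergeSum (fun a u v c => sgn k (a.length + 1) •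
            ev F (Q.bas k a ++ (Q.ofPath k u * Q.ofPath k v) :: Q.bas k c)) (X :: T)) := by
  refine (ev_diff_cons _ d F (Q.ofPath k X) (T.map (Q.ofPath k))).trans ?_
  have e1 : (Q.ofPath k X :: T.map (Q.ofPath k)).dropLast = Q.bas k (X :: T).dropLast := by
    rw [← List.map_cons]
    exact List.map_dropLast.symm
  have e2 : (Q.ofPath k X :: T.map (Q.ofPath k)).getLast (List.cons_ne_nil _ _) =
      Q.ofPath k ((X :: T).getLast (List.cons_ne_nil _ _)) :=
    List.getLast_map (f := Q.ofPath k) (l := X :: T) (by simp)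
  rw [List.length_map, koszul_ofPath, smul_mul_assoc, e1, e2, ← List.map_cons, mergeSum_map]
  simp only [List.length_map]

variable {F}

theorem mergeSum_mid_eq_zero {φ : List Q.NZPath → Q.NZPath → Q.NZPath → List Q.NZPath → Q.Alg k}
    {l : List Q.NZPath} (h : ∀ a u v c, φ a u v c = 0) : mergeSum φ l = 0 :=
  mergeSum_eq_zero fun a u v c _ => h a u v c

/-- All terms which keep the trivial path as an argument vanish. The two terms which absorb it into
its left or right neighbour, or into the value at an end of the list, cancel. If it composes with
only one side, the remaining term is zero because the surrounding list is not composable. -/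
theorem ev_diff_trivial (hl : Lin k (ev F)) (hF : Normal (ev F)) (d : ℤ) {e : Q.NZPath}
    (he : e.word = []) (A C : List Q.NZPath) :
    ev (diff (Q.grading k) d F) (Q.bas k (A ++ e :: C)) = 0 := by
  have h0 := Normal.eq_zero_of_trivial hl hF he
  have hw : Q.wdeg e.word = 0 := by rw [he]; rfl
  rcases List.eq_nil_or_concat A with rfl | ⟨A, a, rfl⟩
  · cases C with
    | nil =>
      rw [List.nil_append, ev_diff_paths]
      have h1 : ∀ y, Q.coeffs (ev F (Q.bas k [])) y ≠ 0 → y.tgt = y.src := fun y hy => hF [] y hy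
      -- For a single argument both surviving terms are outer ones. They cancel because the value in
      -- arity zero is a combination of closed paths and so commutes with the idempotents of the
      -- vertices.
      have : Q.ofPath k e * ev F (Q.bas k []) = ev F (Q.bas k []) * Q.ofPath k e := by
        refine alg_ext fun y => ?_
        have hee := NZPath.src_eq_tgt_of_word_eq_nil he
        by_cases hy : y.tgt = e.src
        · rw [coeffs_ofPath_mul (z := y) _ hy.symm (hy.trans hee.symm) (by simp [he]) rfl]
          by_cases hy' : y.src = e.tgt
          · rw [coeffs_mul_ofPath (z := y) _ hy' rfl (by simp [he]) (hy'.trans hee)]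
          · have h3 : Q.coeffs (ev F (Q.bas k [])) y = 0 := by
              by_contra h3
              exact hy' ((h1 y h3).symm.trans (hy.trans hee.symm))
            rw [h3]
            by_contra h4
            obtain ⟨z, -, h5, -, h6, -⟩ := coeffs_mul_ofPath_ne (Ne.symm h4)
            exact hy' (h6.trans hee.symm)
        · have h2 : Q.coeffs (Q.ofPath k e * ev F (Q.bas k [])) y = 0 := by
            by_contra h3
            obtain ⟨z, -, h4, h5, -⟩ := coeffs_ofPath_mul_ne h3
            exact hy (h5.trans hee)
          rw [h2]
          by_contra h3
          obtain ⟨z, h4, h5, h6, h7, -⟩ := coeffs_mul_ofPath_ne (Ne.symm h3)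
          exact hy (h6.trans ((h1 z h4).trans (h5.trans hee)))
      simp only [List.dropLast_singleton, List.getLast_singleton, mergeSum, this, hw]
      simp
    | cons c C =>
      rw [List.nil_append, ev_diff_paths]
      have h1 : ev F (Q.bas k (e :: c :: C).dropLast) = 0 := by
        rw [List.dropLast_cons_cons]
        exact h0 [] _
      rw [h1, zero_mul, smul_zero, add_zero, mergeSum, hw, mul_zero, sgn_zero, one_smul]
      rw [mergeSum_mid_eq_zero fun a u v c => by rw [bas, List.map_cons]; exact smul_eq_zero_of_right _ (h0 [] _), add_zero]
      simp only [List.map_nil, List.nil_append, List.length_nil, Nat.cast_zero, zero_add, sgn_one,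
        neg_smul, one_smul]
      refine smul_eq_zero_of_right _ ?_
      by_cases hec : e.src = c.tgt
      · rw [ofPath_trivial_mul_ofPath he hec, trivial_mul_of_support he]
        · simp
        · intro y hy
          exact ((hF _ _ hy).1.symm.trans hec.symm)
      · have hm : Q.ofPath k e * Q.ofPath k c = 0 := ofPath_mul_ofPath_neg fun h => hec h.1
        rw [hm, trivial_mul_eq_zero]
        · have := (hl [] (Q.bas k C)).map_zero
          rw [List.nil_append] at this
          rw [this]
          simp
        · intro y hy h
          exact hec (h.trans (hF _ _ hy).1.symm)
  · rw [List.concat_eq_append, List.append_assoc, List.singleton_append]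
    obtain ⟨X, T, hXT⟩ : ∃ X T, A ++ a :: e :: C = X :: T := by
      cases A with
      | nil => exact ⟨_, _, rfl⟩
      | cons X T => exact ⟨_, _, rfl⟩
    have hfirst : ev F (Q.bas k T) = 0 := by
      cases A with
      | nil =>
        obtain ⟨rfl, rfl⟩ := List.cons.inj hXT
        exact h0 [] _
      | cons X T =>
        obtain ⟨rfl, rfl⟩ := List.cons.inj hXT
        have := h0 (Q.bas k (T ++ [a])) (Q.bas k C)
        simpa using this
    have hlen : T.length = A.length + 1 + C.length := by
      have := congrArg List.length hXT
      simp at this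
      omega
    rw [hXT, ev_diff_paths, hfirst, mul_zero, smul_zero, zero_add]
    simp only [← hXT]
    rw [mergeSum_append]
    rw [mergeSum_mid_eq_zero fun u v w c => by
      refine smul_eq_zero_of_right _ ?_
      have := h0 (Q.bas k u ++ Q.ofPath k v * Q.ofPath k w :: Q.bas k c) (Q.bas k C)
      simpa using this, zero_add]
    refine smul_eq_zero_of_right _ ?_
    cases C with
    | nil =>
      simp only [mergeSum, add_zero, hlen]
      have hd : (A ++ [a, e]).dropLast = A ++ [a] := by
        rw [← List.dropLast_concat (l₁ := A ++ [a]) (b := e)]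
        simp
      have hg : (A ++ [a, e]).getLast (by simp) = e := by simp
      simp only [hd, hg]
      have hsup : ∀ y, Q.coeffs (ev F (Q.bas k (A ++ [a]))) y ≠ 0 → y.src = a.src := by
        intro y hy
        obtain ⟨r, h1, h2, -, h3⟩ := pathSeq_append.1 (hF _ _ hy)
        exact h3.symm
      by_cases hec : a.src = e.tgt
      · rw [mul_trivial_of_support he fun y hy => (hsup y hy).trans hec,
          ofPath_mul_ofPath_trivial he hec]
        simp only [List.length_nil]
        push_cast
        rw [show (A.length : ℤ) + 1 + 0 + 1 = (A.length + 1) + 1 by ring, ← neg_sgn]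
        simp
      · rw [mul_trivial_eq_zero fun y hy h => hec ((hsup y hy).symm.trans h),
          ofPath_mul_ofPath_neg fun h => hec h.1, (hl _ _).map_zero]
        simp
    | cons c C =>
      have hlast : ev F (Q.bas k (A ++ a :: e :: c :: C).dropLast) = 0 := by
        have h1 : (A ++ a :: e :: c :: C).dropLast = (A ++ [a]) ++ e :: (c :: C).dropLast := by
          rw [List.dropLast_append_of_ne_nil (by simp)]
          simp
        rw [h1]
        have := h0 (Q.bas k (A ++ [a])) (Q.bas k (c :: C).dropLast)
        simpa using this
      rw [hlast, zero_mul, smul_zero, zero_add, mergeSum]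
      rw [mergeSum_mid_eq_zero fun u v w c => by
        refine smul_eq_zero_of_right _ ?_
        have := h0 (Q.bas k (A ++ [a])) (Q.bas k u ++ Q.ofPath k v * Q.ofPath k w :: Q.bas k c)
        simpa using this, add_zero]
      simp only [List.length_append, List.length_cons, List.length_nil]
      push_cast
      rw [← neg_sgn k ((A.length : ℤ) + 1)]
      by_cases h1 : a.src = e.tgt
      · by_cases h2 : e.src = c.tgt
        · rw [ofPath_mul_ofPath_trivial he h1, ofPath_trivial_mul_ofPath he h2]
          simp
        · rw [ofPath_mul_ofPath_trivial he h1, ofPath_mul_ofPath_neg fun h => h2 h.1,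
            (hl _ _).map_zero]
          have := hF.eq_zero (L := A ++ a :: c :: C) fun t s h => h2 <| by
            rw [← pathSeq_middle h, h1, NZPath.src_eq_tgt_of_word_eq_nil he]
          simp only [bas, List.map_append, List.map_cons] at this ⊢
          rw [this]
          simp
      · rw [ofPath_mul_ofPath_neg fun h => h1 h.1, (hl _ _).map_zero]
        by_cases h2 : e.src = c.tgt
        · rw [ofPath_trivial_mul_ofPath he h2]
          have := hF.eq_zero (L := A ++ a :: c :: C) fun t s h => h1 <| by
            rw [pathSeq_middle h, ← h2, NZPath.src_eq_tgt_of_word_eq_nil he]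
          simp only [bas, List.map_append, List.map_cons] at this ⊢
          simp [this]
        · rw [ofPath_mul_ofPath_neg fun h => h2 h.1, (hl _ _).map_zero]
          simp

theorem coeffs_add_ne {a b : Q.Alg k} {y : Q.NZPath} (h : Q.coeffs (a + b) y ≠ 0) :
    Q.coeffs a y ≠ 0 ∨ Q.coeffs b y ≠ 0 := by
  by_contra! h'
  exact h (by rw [coeffs_add, Finsupp.add_apply, h'.1, h'.2, add_zero])

theorem coeffs_smul_ne {c : k} {a : Q.Alg k} {y : Q.NZPath} (h : Q.coeffs (c • a) y ≠ 0) :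
    Q.coeffs a y ≠ 0 := by
  rw [coeffs_smul, Finsupp.smul_apply] at h
  exact right_ne_zero_of_smul h

theorem coeffs_mergeSum_ne {A : Type*} {φ : List A → A → A → List A → Q.Alg k} {l : List A}
    {y : Q.NZPath} (h : Q.coeffs (mergeSum φ l) y ≠ 0) :
    ∃ a u v c, a ++ u :: v :: c = l ∧ Q.coeffs (φ a u v c) y ≠ 0 := by
  induction l generalizing φ with
  | nil => exact absurd rfl h
  | cons x l ih =>
    cases l with
    | nil => exact absurd rfl h
    | cons z t =>
      rcases coeffs_add_ne h with h | h
      · exact ⟨[], x, z, t, rfl, h⟩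
      · obtain ⟨a, u, v, c, h1, h2⟩ := ih h
        exact ⟨x :: a, u, v, c, by rw [← h1]; rfl, h2⟩

/-- Composability survives in each term, since a term merges two composable neighbours or splits off
an outer path. That no entry is trivial cannot be seen term by term and comes from
`ev_diff_trivial`. -/
theorem Normal.diff (hl : Lin k (ev F)) (hF : Normal (ev F)) (d : ℤ) :
    Normal (ev (diff (Q.grading k) d F)) := by
  intro L y h
  have hne : ∀ X ∈ L, X.word ≠ [] := by
    intro X hX hX'
    obtain ⟨A, C, rfl⟩ := List.append_of_mem hX
    exact h (by rw [ev_diff_trivial hl hF d hX' A C]; rfl)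
  cases L with
  | nil => exact absurd rfl h
  | cons X T =>
    rw [ev_diff_paths] at h
    rcases coeffs_add_ne (coeffs_smul_ne h) with h | h
    · rcases coeffs_add_ne h with h | h
      · obtain ⟨z, h1, h2, h3, h4, -⟩ := coeffs_ofPath_mul_ne (coeffs_smul_ne h)
        refine ⟨h3.symm, hne X (by simp), ?_⟩
        rw [h2, h4]
        exact hF _ _ h1
      · obtain ⟨z, h1, h2, h3, h4, -⟩ := coeffs_mul_ofPath_ne (coeffs_smul_ne h)
        rw [← List.dropLast_append_getLast (List.cons_ne_nil X T), pathSeq_append]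
        refine ⟨z.src, h3 ▸ hF _ _ h1, h2.symm, hne _ (List.getLast_mem _), h4.symm⟩
    · obtain ⟨a, u, v, c, h1, h2⟩ := coeffs_mergeSum_ne h
      rw [← h1] at hne ⊢
      have h2 := coeffs_smul_ne h2
      by_cases hc : u.src = v.tgt ∧ (u.word ++ v.word).IsChain Q.nonrel
      · rw [ofPath_mul_ofPath_pos hc.1 hc.2] at h2
        have h3 := hF (a ++ u.append v hc.1 hc.2 :: c) y (by simpa using h2)
        obtain ⟨r, h4, h5, -, h6⟩ := pathSeq_append.1 h3
        exact pathSeq_append.2 ⟨r, h4, h5, hne u (by simp), hc.1.symm, hne v (by simp), h6⟩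
      · rw [ofPath_mul_ofPath_neg hc, (hl _ _).map_zero] at h2
        exact absurd rfl h2

end GradedGentleQuiver
end

noncomputable section

open GradedHochschild

namespace GradedGentleQuiver

variable {V E : Type*} {Q : GradedGentleQuiver V E} {k : Type*} [Field k] [Fintype V]

/-! ### Multilinear extensions -/

/-- Index sets may be enlarged by paths with coefficient zero. Additivity needs this, since the
supports of `x`, `y` and `x + y` differ and the three sums must run over a common set. -/
theorem extend_eq_sum {n : ℕ} (f : (Fin n → Q.NZPath) → Q.Alg k) (v : Fin n → Q.Alg k)
    (t : Fin n → Finset Q.NZPath) (ht : ∀ i, (Q.coeffs (v i)).support ⊆ t i) :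
    Q.extend f v = ∑ X ∈ Fintype.piFinset t, (∏ i, Q.coeffs (v i) (X i)) • f X := by
  refine Finset.sum_subset (Fintype.piFinset_subset _ _ ht) fun X _ hX => ?_
  rw [Fintype.mem_piFinset] at hX
  push Not at hX
  obtain ⟨i, hi⟩ := hX
  rw [Finset.prod_eq_zero (Finset.mem_univ i) (by simpa using hi), zero_smul]

theorem extend_update_add {n : ℕ} (f : (Fin n → Q.NZPath) → Q.Alg k) (v : Fin n → Q.Alg k)
    (i : Fin n) (x y : Q.Alg k) : Q.extend f (Function.update v i (x + y)) =
      Q.extend f (Function.update v i x) + Q.extend f (Function.update v i y) := by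
  classical
  let t : Fin n → Finset Q.NZPath := fun j => (Q.coeffs (v j)).support ∪
    ((Q.coeffs x).support ∪ ((Q.coeffs y).support ∪ (Q.coeffs (x + y)).support))
  have ht : ∀ z, (Q.coeffs z).support ⊆ ((Q.coeffs x).support ∪ ((Q.coeffs y).support ∪
      (Q.coeffs (x + y)).support)) → ∀ j, (Q.coeffs (Function.update v i z j)).support ⊆ t j := by
    intro z hz j
    by_cases hj : j = i
    · subst hj
      rw [Function.update_self]
      exact hz.trans Finset.subset_union_right
    · rw [Function.update_of_ne hj]
      exact Finset.subset_union_left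
  rw [extend_eq_sum f _ t (ht _ (Finset.subset_union_right.trans Finset.subset_union_right)),
    extend_eq_sum f _ t (ht _ Finset.subset_union_left),
    extend_eq_sum f _ t (ht _ (Finset.subset_union_left.trans Finset.subset_union_right)),
    ← Finset.sum_add_distrib]
  refine Finset.sum_congr rfl fun X _ => ?_
  rw [← add_smul]
  congr 1
  have hp : ∀ z, ∏ j, Q.coeffs (Function.update v i z j) (X j) =
      Q.coeffs z (X i) * ∏ j ∈ Finset.univ.erase i, Q.coeffs (v j) (X j) := by
    intro z
    rw [← Finset.mul_prod_erase _ _ (Finset.mem_univ i), Function.update_self]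
    congr 1
    refine Finset.prod_congr rfl fun j hj => ?_
    rw [Function.update_of_ne (Finset.ne_of_mem_erase hj)]
  rw [hp, hp, hp, ← add_mul]
  rfl

theorem extend_update_smul {n : ℕ} (f : (Fin n → Q.NZPath) → Q.Alg k) (v : Fin n → Q.Alg k)
    (i : Fin n) (c : k) (x : Q.Alg k) : Q.extend f (Function.update v i (c • x)) =
      c • Q.extend f (Function.update v i x) := by
  classical
  let t : Fin n → Finset Q.NZPath := fun j => (Q.coeffs (v j)).support ∪
    ((Q.coeffs x).support ∪ (Q.coeffs (c • x)).support)
  have ht : ∀ z, (Q.coeffs z).support ⊆ ((Q.coeffs x).support ∪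
      (Q.coeffs (c • x)).support) → ∀ j, (Q.coeffs (Function.update v i z j)).support ⊆ t j := by
    intro z hz j
    by_cases hj : j = i
    · subst hj
      rw [Function.update_self]
      exact hz.trans Finset.subset_union_right
    · rw [Function.update_of_ne hj]
      exact Finset.subset_union_left
  rw [extend_eq_sum f _ t (ht _ Finset.subset_union_right),
    extend_eq_sum f _ t (ht _ Finset.subset_union_left), Finset.smul_sum]
  refine Finset.sum_congr rfl fun X _ => ?_
  rw [smul_smul]
  congr 1
  have hp : ∀ z, ∏ j, Q.coeffs (Function.update v i z j) (X j) =
      Q.coeffs z (X i) * ∏ j ∈ Finset.univ.erase i, Q.coeffs (v j) (X j) := by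
    intro z
    rw [← Finset.mul_prod_erase _ _ (Finset.mem_univ i), Function.update_self]
    congr 1
    refine Finset.prod_congr rfl fun j hj => ?_
    rw [Function.update_of_ne (Finset.ne_of_mem_erase hj)]
  rw [hp, hp, ← mul_assoc]
  rfl

theorem extend_ofPath {n : ℕ} (f : (Fin n → Q.NZPath) → Q.Alg k) (X : Fin n → Q.NZPath) :
    Q.extend f (fun i => Q.ofPath k (X i)) = f X := by
  rw [extend_eq_sum f _ (fun i => {X i}) (fun i => by
    rw [coeffs_ofPath]
    exact Finsupp.support_single_subset), Fintype.piFinset_singleton, Finset.sum_singleton]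
  simp only [coeffs_ofPath_self, Finset.prod_const_one, one_smul]

/-- The cochain with prescribed values on lists of paths. -/
def extC (g : List Q.NZPath → Q.Alg k) : Coch (Q.Alg k) := fun n v =>
  Q.extend (fun X : Fin n → Q.NZPath => g (List.ofFn X)) v

theorem ev_extC (g : List Q.NZPath → Q.Alg k) (L : List Q.NZPath) :
    ev (extC g) (Q.bas k L) = g L := by
  have h := apply_eq_ev' (extC g) (n := L.length) (v := fun i => Q.ofPath k (L.get i))
    (l := Q.bas k L) (by simp) (by simp)
  rw [← h, extC, extend_ofPath, List.ofFn_get]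

theorem extC_mem_cochains {g : List Q.NZPath → Q.Alg k} {d : ℤ}
    (h : ∀ L : List Q.NZPath, g L ∈ Q.grading k (Q.wdeg (L.map (·.word)).flatten + (d - L.length))) :
    extC g ∈ cochains (Q.grading k) d := by
  intro n
  refine ⟨⟨⟨extC g n, ?_, ?_⟩, fun _ => rfl⟩, ?_⟩
  · intro hd v i x y
    obtain rfl : hd = instDecidableEqFin n := Subsingleton.elim _ _
    exact extend_update_add _ v i x y
  · intro hd v i c x
    obtain rfl : hd = instDecidableEqFin n := Subsingleton.elim _ _
    exact extend_update_smul _ v i c x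
  · intro e v hv
    refine Submodule.sum_mem _ fun X hX => Submodule.smul_mem _ _ ?_
    have hdeg : ∀ i, Q.wdeg (X i).word = e i := by
      intro i
      have hXi := (Fintype.mem_piFinset.1 hX) i
      rw [Finsupp.mem_support_iff] at hXi
      have key : ∀ a ∈ Q.grading k (e i), ∀ y : Q.NZPath, Q.wdeg y.word ≠ e i → Q.coeffs a y = 0 := by
        intro a ha y hy
        induction ha using Submodule.span_induction with
        | zero => rfl
        | add a b _ _ ha hb => rw [coeffs_add, Finsupp.add_apply, ha, hb, add_zero]
        | smul c a _ ha => rw [coeffs_smul, Finsupp.smul_apply, ha, smul_zero]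
        | mem a ha =>
          obtain ⟨p, hp, rfl⟩ := ha
          by_contra hne
          exact hy (coeffs_ofPath_ne hne ▸ hp)
      by_contra hne
      exact hXi (key _ (hv i) _ hne)
    have := h (List.ofFn X)
    rw [List.length_ofFn] at this
    convert this using 3
    rw [List.map_ofFn]
    have hs : ∀ m (e : Fin m → ℤ) (X : Fin m → Q.NZPath), (∀ i, Q.wdeg (X i).word = e i) →
        ∑ i, e i = Q.wdeg (List.ofFn ((·.word) ∘ X)).flatten := by
      intro m
      induction m with
      | zero => intro e X _; simp [wdeg]
      | succ m ih =>
        intro e X hX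
        rw [Fin.sum_univ_succ, List.ofFn_succ, List.flatten_cons, wdeg_append,
          ih (fun i => e i.succ) (fun i => X i.succ) fun i => hX i.succ, ← hX 0]
        rfl
    exact hs n e X hdeg

theorem wdeg_flatten (L : List Q.NZPath) :
    Q.wdeg (L.map (·.word)).flatten = (L.map fun X => Q.wdeg X.word).sum := by
  induction L with
  | nil => rfl
  | cons X L ih => rw [List.map_cons, List.flatten_cons, wdeg_append, ih]; simp

theorem Lin.of_mem_cochains {F : Coch (Q.Alg k)} {d : ℤ} (h : F ∈ cochains (Q.grading k) d) :
    Lin k (ev F) := ((cochains_iff _).1 h).1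

theorem Hom.mem_paths {F : Coch (Q.Alg k)} {d : ℤ} (h : F ∈ cochains (Q.grading k) d)
    (L : List Q.NZPath) :
    ev F (Q.bas k L) ∈ Q.grading k (Q.wdeg (L.map (·.word)).flatten + (d - L.length)) := by
  have := ((cochains_iff _).1 h).2 (L.map fun X => (Q.wdeg X.word, Q.ofPath k X)) (by
    intro x hx
    obtain ⟨X, -, rfl⟩ := List.mem_map.1 hx
    exact Q.ofPath_mem_grading X)
  simp only [List.map_map, List.length_map] at this
  rw [wdeg_flatten]
  exact this

end GradedGentleQuiver
end

noncomputable section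

open GradedHochschild

namespace GradedGentleQuiver

variable {V E : Type*} {Q : GradedGentleQuiver V E} {k : Type*} [Field k] [Fintype V]

/-! ### Cochains vanishing on anti-paths -/

variable (Q) in
/-- A word as a list of paths of length one. -/
abbrev arr (w : List E) : List Q.NZPath := w.map Q.arrowPath

theorem NZPath.tgt_eq {Y : Q.NZPath} {b : E} {w : List E} (h : Y.word = b :: w) :
    Y.tgt = Q.tgt b := by
  have := Y.walk
  rw [h] at this
  exact this.1.symm

theorem arrow_mul_of_word {b : E} {Y Z : Q.NZPath} (hY : Y.word = b :: Z.word)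
    (hZ : Z.word ≠ []) : Q.ofPath k (Q.arrowPath b) * Q.ofPath k Z = Q.ofPath k Y := by
  have hc : ((Q.arrowPath b).word ++ Z.word).IsChain Q.nonrel := by
    have := Y.nonzero
    rw [hY] at this
    exact this
  obtain ⟨c, w, hw⟩ := List.exists_cons_of_ne_nil hZ
  have hs : (Q.arrowPath b).src = Z.tgt := by
    rw [NZPath.tgt_eq hw]
    rw [hw] at hc
    exact (List.isChain_cons_cons.1 hc).1.1
  rw [ofPath_mul_ofPath_pos hs hc]
  congr 1
  exact NZPath.ext_of_word_ne_nil (hY.symm) (by simp [NZPath.append, arrowPath])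

theorem arrow_mul_arrow_of_rel {a b : E} (h : Q.rel a b) :
    Q.ofPath k (Q.arrowPath a) * Q.ofPath k (Q.arrowPath b) = 0 := by
  refine ofPath_mul_ofPath_neg fun hc => ?_
  have := List.isChain_cons_cons.1 hc.2
  exact this.1.2 h

/-- The multilinear function vanishes on the lists `(α₁, …, α_n, β, Z, …)` of paths, where
`α₁ ⋯ α_n β` is an anti-path and `βZ` is a path of the algebra. -/
def VanishesUp (f : List (Q.Alg k) → Q.Alg k) : Prop :=
  ∀ (A : List E) (b : E) (Y Z : Q.NZPath) (R : List Q.NZPath), (A ++ [b]).IsChain Q.rel →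
    Y.word = b :: Z.word → Z.word ≠ [] →
    f (Q.bas k (Q.arr A ++ Q.arrowPath b :: Z :: R)) = 0

/-- The multilinear function vanishes on anti-paths. -/
def VanishesAnti (f : List (Q.Alg k) → Q.Alg k) : Prop :=
  ∀ w : List E, w.IsChain Q.rel → f (Q.bas k (Q.arr w)) = 0

/-- A merge at or after `Z` either prolongs `Z` on the right or does not touch it. The product of
`β` with that entry remains a nonzero path, so the list stays of the same kind. -/
theorem VanishesUp.merge {f : List (Q.Alg k) → Q.Alg k} (hl : Lin k f) (h : VanishesUp f)
    {A : List E} {b : E} {Y Z : Q.NZPath} (hA : (A ++ [b]).IsChain Q.rel)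
    (hY : Y.word = b :: Z.word) (hZ : Z.word ≠ []) {R a c : List Q.NZPath} {u v : Q.NZPath}
    (hR : a ++ u :: v :: c = Z :: R) :
    f (Q.bas k (Q.arr A ++ Q.arrowPath b :: a) ++ (Q.ofPath k u * Q.ofPath k v) :: Q.bas k c) =
      0 := by
  by_cases hc : u.src = v.tgt ∧ (u.word ++ v.word).IsChain Q.nonrel
  · rw [ofPath_mul_ofPath_pos hc.1 hc.2]
    cases a with
    | nil =>
      obtain ⟨rfl, rfl⟩ := List.cons.inj hR
      have hch : (Y.word ++ v.word).IsChain Q.nonrel := by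
        obtain ⟨e, w, hw⟩ := List.exists_cons_of_ne_nil hZ
        have h1 := hc.2
        have h2 := Y.nonzero
        rw [hY] at h2 ⊢
        rw [hw] at h1 h2 ⊢
        simp only [List.cons_append, List.isChain_cons_cons] at h1 h2 ⊢
        exact ⟨h2.1, h1⟩
      have hsrc : Y.src = v.tgt := by
        rw [← hc.1]
        have h1 := Y.walk
        rw [hY] at h1
        obtain ⟨e, w, hw⟩ := List.exists_cons_of_ne_nil hZ
        have h3 := Y.nonzero
        rw [hY, hw] at h3
        have h4 := (List.isChain_cons_cons.1 h3).1.1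
        have : Q.IsWalk (Q.src b) u.src u.word := by
          rw [h4, ← NZPath.tgt_eq hw]
          exact u.walk
        have h5 := congrArg NZPath.src (NZPath.ext_of_word_ne_nil (p := ⟨Q.src b, Y.src, u.word, h1.2, u.nonzero⟩)
          (q := ⟨Q.src b, u.src, u.word, this, u.nonzero⟩) rfl hZ)
        exact h5
      have := h A b (Y.append v hsrc hch) (u.append v hc.1 hc.2) c hA
        (by simp [NZPath.append, hY]) (by simp [NZPath.append, hZ])
      simpa using this
    | cons z a =>
      obtain ⟨rfl, rfl⟩ := List.cons.inj hR
      have := h A b Y z (a ++ u.append v hc.1 hc.2 :: c) hA hY hZ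
      simpa using this
  · rw [ofPath_mul_ofPath_neg hc, (hl _ _).map_zero]

theorem arr_merge_eq_zero {A : List E} (hA : A.IsChain Q.rel) {a c : List Q.NZPath}
    {u v : Q.NZPath} (h : a ++ u :: v :: c = Q.arr A) : Q.ofPath k u * Q.ofPath k v = 0 := by
  obtain ⟨A', B, rfl, rfl, hB⟩ := List.map_eq_append_iff.1 h.symm
  cases B with
  | nil => exact absurd hB (by simp)
  | cons x B =>
  cases B with
  | nil => exact absurd hB (by simp)
  | cons y B =>
  obtain ⟨rfl, hB'⟩ := List.cons.inj hB
  obtain ⟨rfl, -⟩ := List.cons.inj hB'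
  exact arrow_mul_arrow_of_rel (List.isChain_cons_cons.1 hA.right_of_append).1

theorem VanishesAnti.diff {F : Coch (Q.Alg k)} (hl : Lin k (ev F)) (h : VanishesAnti (ev F))
    (d : ℤ) : VanishesAnti (ev (diff (Q.grading k) d F)) := by
  intro w hw
  cases w with
  | nil => exact ev_diff_nil _ _ _
  | cons a w =>
    have hl' : ev F (Q.bas k (Q.arrowPath a :: Q.arr w).dropLast) = 0 := by
      rw [← List.map_cons, ← List.map_dropLast]
      exact h _ hw.dropLast
    rw [arr, List.map_cons, ev_diff_paths, ← arr, h w hw.tail, mul_zero, smul_zero, zero_add,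
      hl', zero_mul, smul_zero, zero_add, mergeSum_eq_zero, smul_zero]
    intro x u v c hx
    rw [arr_merge_eq_zero hw hx, (hl _ _).map_zero, smul_zero]

/-- On `(α₁, …, α_n, β, Z, …)` the essential term of the differential is the merge of `β` with `Z`,
which leads to the matched list. Merges further left are zero products, merges further right stay of
the same kind, and omitting the last entry gives a list of this kind or an anti-path. Omitting the
first entry also stays of this kind unless `n = 0`, and in that case it leaves a multiplication by
`β`. -/
theorem ev_diff_up {F : Coch (Q.Alg k)} (hl : Lin k (ev F)) (hu : VanishesUp (ev F))
    (ha : VanishesAnti (ev F)) (d : ℤ) {A : List E} {b : E} {Y Z : Q.NZPath} {R : List Q.NZPath}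
    (hA : (A ++ [b]).IsChain Q.rel) (hY : Y.word = b :: Z.word) (hZ : Z.word ≠ []) :
    ev (diff (Q.grading k) d F) (Q.bas k (Q.arr A ++ Q.arrowPath b :: Z :: R)) =
      sgn k (d - (A.length + R.length + 1)) • ((if A = [] then
        sgn k ((d - (R.length + 1)) * Q.deg b) •
          (Q.ofPath k (Q.arrowPath b) * ev F (Q.bas k (Z :: R))) else 0) +
        sgn k (A.length + 1) • ev F (Q.bas k (Q.arr A ++ Y :: R))) := by
  obtain ⟨X, T, hXT⟩ : ∃ X T, Q.arr A ++ Q.arrowPath b :: Z :: R = X :: T := by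
    cases A with
    | nil => exact ⟨_, _, rfl⟩
    | cons X T => exact ⟨_, _, rfl⟩
  have hlen : T.length = A.length + R.length + 1 := by
    have := congrArg List.length hXT
    simp at this
    omega
  have hlast : ev F (Q.bas k (Q.arr A ++ Q.arrowPath b :: Z :: R).dropLast) = 0 := by
    rcases List.eq_nil_or_concat R with rfl | ⟨R, r, rfl⟩
    · have : (Q.arr A ++ [Q.arrowPath b, Z]).dropLast = Q.arr (A ++ [b]) := by
        rw [List.dropLast_append_of_ne_nil (by simp)]
        simp
      rw [this]
      exact ha _ hA
    · have : (Q.arr A ++ Q.arrowPath b :: Z :: R.concat r).dropLast =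
          Q.arr A ++ Q.arrowPath b :: Z :: R := by
        rw [List.concat_eq_append, ← List.cons_append, ← List.cons_append, ← List.append_assoc,
          List.dropLast_concat]
      rw [this]
      exact hu A b Y Z R hA hY hZ
  have hfirst : sgn k ((d - T.length) * Q.wdeg X.word) • (Q.ofPath k X * ev F (Q.bas k T)) =
      if A = [] then sgn k ((d - (R.length + 1)) * Q.deg b) •
          (Q.ofPath k (Q.arrowPath b) * ev F (Q.bas k (Z :: R))) else 0 := by
    cases A with
    | nil =>
      obtain ⟨rfl, rfl⟩ := List.cons.inj hXT
      simp [arrowPath, wdeg]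
    | cons x A =>
      obtain ⟨rfl, rfl⟩ := List.cons.inj hXT
      rw [if_neg (by simp)]
      have h0 : ev F (Q.bas k (List.append (List.map Q.arrowPath A) (Q.arrowPath b :: Z :: R))) = 0 :=
        hu A b Y Z R hA.tail hY hZ
      rw [h0, mul_zero, smul_zero]
  rw [hXT, ev_diff_paths, hfirst]
  simp only [← hXT]
  rw [hlast, zero_mul, smul_zero, add_zero, mergeSum_append, mergeSum_eq_zero, zero_add,
    mergeSum_eq_zero (l := Z :: R), add_zero, arrow_mul_of_word hY hZ, hlen]
  · simp
  · intro a u v c h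
    rw [hu.merge hl hA hY hZ h, smul_zero]
  · intro a u v c h
    have h' : a ++ u :: v :: c = Q.arr (A ++ [b]) := by rw [h]; simp
    rw [arr_merge_eq_zero hA h', (hl _ _).map_zero, smul_zero]

theorem NZPath.exists_tail {Y : Q.NZPath} {b : E} {w : List E} (h : Y.word = b :: w) :
    ∃ Z : Q.NZPath, Z.word = w ∧ Z.tgt = Q.src b ∧ Z.src = Y.src := by
  have h1 := Y.walk
  have h2 := Y.nonzero
  rw [h] at h1 h2
  exact ⟨⟨_, _, w, h1.2, h2.tail⟩, rfl, rfl, rfl⟩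

/-- A normalised cocycle which vanishes on anti-paths and on the lists of `VanishesUp` is zero. -/
theorem Normal.eq_zero_of_vanishes {F : Coch (Q.Alg k)} (hl : Lin k (ev F)) (hF : Normal (ev F))
    {d : ℤ} (hd : GradedHochschild.diff (Q.grading k) d F = 0) (hu : VanishesUp (ev F)) (ha : VanishesAnti (ev F))
    (L : List Q.NZPath) : ev F (Q.bas k L) = 0 := by
  have hd' : ∀ l, ev (GradedHochschild.diff (Q.grading k) d F) l = 0 := by rw [hd]; exact fun l => rfl
  by_contra hne
  obtain ⟨y, hy⟩ := exists_coeffs_ne_zero hne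
  -- Scan the list while it remains an anti-path of arrows. If the next path does not continue it by
  -- a relation, the list is one of `VanishesUp`. If it continues it by more than one arrow, the
  -- list is matched with one of `VanishesUp` and `ev_diff_up` shows that the value is zero.
  have key : ∀ (R : List Q.NZPath) (A : List E) (a : E) (t s : V), (A ++ [a]).IsChain Q.rel →
      Q.PathSeq t s (Q.arr (A ++ [a]) ++ R) → ev F (Q.bas k (Q.arr (A ++ [a]) ++ R)) = 0 := by
    intro R
    induction R with
    | nil =>
      intro A a t s hA _
      rw [List.append_nil]
      exact ha _ hA
    | cons Y R ih =>
      intro A a t s hA hs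
      have hYw := hs.word_ne_nil (X := Y) (by simp)
      obtain ⟨b, w, hw⟩ := List.exists_cons_of_ne_nil hYw
      have hab : Q.src a = Q.tgt b := by
        rw [arr, List.map_append, List.append_assoc] at hs
        have := pathSeq_middle hs
        rwa [NZPath.tgt_eq hw] at this
      by_cases hr : Q.rel a b
      · have hA' : (A ++ [a] ++ [b]).IsChain Q.rel := by
          rw [List.append_assoc]
          exact List.isChain_append_cons_cons.2 ⟨hA, hr, by simp⟩
        by_cases hw' : w = []
        · subst hw'
          have hYb : Y = Q.arrowPath b := NZPath.ext_of_word_ne_nil hw hYw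
          subst hYb
          have := ih (A ++ [a]) b t s hA' (by simpa using hs)
          simpa using this
        · obtain ⟨Z, hZ, -⟩ := Y.exists_tail hw
          have h := ev_diff_up (R := R) hl hu ha d (Y := Y) (Z := Z) hA' (by rw [hw, hZ])
            (by rwa [hZ])
          rw [hd', if_neg (by simp), zero_add] at h
          have h := h.symm
          rwa [smul_eq_zero_iff_right (sgn_ne_zero k _), smul_eq_zero_iff_right (sgn_ne_zero k _)]
            at h
      · have hch : (a :: Y.word).IsChain Q.nonrel := by
          have := Y.nonzero
          rw [hw] at this ⊢
          exact List.isChain_cons_cons.2 ⟨⟨hab, hr⟩, this⟩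
        have := hu A a ⟨Q.tgt a, Y.src, a :: Y.word, ⟨rfl, by
          rw [hab, ← NZPath.tgt_eq hw]; exact Y.walk⟩, hch⟩ Y R hA rfl hYw
        simpa using this
  -- With no arrows in front, the extra term of `ev_diff_up` involves the list whose first path has
  -- lost its first arrow. Induction on the length of the first path removes this term.
  have key2 : ∀ (w : List E) (X : Q.NZPath) (R : List Q.NZPath) (t s : V), X.word = w →
      Q.PathSeq t s (X :: R) → ev F (Q.bas k (X :: R)) = 0 := by
    intro w
    induction w with
    | nil => exact fun X R t s hX h => absurd hX h.2.1
    | cons b w ih =>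
      intro X R t s hX h
      by_cases hw' : w = []
      · subst hw'
        obtain rfl : X = Q.arrowPath b := NZPath.ext_of_word_ne_nil hX h.2.1
        exact key R [] b t s (by simp) h
      · obtain ⟨Z, hZ, hZt, hZs⟩ := X.exists_tail hX
        have h1 := ev_diff_up (R := R) hl hu ha d (Y := X) (Z := Z) (A := []) (by simp : ([] ++ [b] : List E).IsChain Q.rel) (by rw [hX, hZ])
            (by rwa [hZ])
        rw [hd', ih Z R Z.tgt s hZ ⟨rfl, by rwa [hZ], hZs ▸ h.2.2⟩, if_pos rfl, mul_zero, smul_zero,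
          zero_add] at h1
        have h1 := h1.symm
        rwa [smul_eq_zero_iff_right (sgn_ne_zero k _), smul_eq_zero_iff_right (sgn_ne_zero k _)]
            at h1
  cases L with
  | nil => exact hne (ha [] (by simp))
  | cons X R => exact hne (key2 X.word X R _ _ rfl (hF _ _ hy))

end GradedGentleQuiver
end

noncomputable section

open GradedHochschild

namespace GradedGentleQuiver

variable {V E : Type*} {Q : GradedGentleQuiver V E} {k : Type*} [Field k] [Fintype V]

/-! ### The contraction -/

theorem mem_grading_of_coeffs {d : ℤ} {a : Q.Alg k}
    (h : ∀ y, Q.coeffs a y ≠ 0 → Q.wdeg y.word = d) : a ∈ Q.grading k d := by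
  rw [sum_coeffs a]
  refine Submodule.sum_mem _ fun y hy => Submodule.smul_mem _ _ ?_
  rw [← h y (by simpa using hy)]
  exact Q.ofPath_mem_grading y

theorem wdeg_eq_of_mem_grading {d : ℤ} {a : Q.Alg k} (ha : a ∈ Q.grading k d) {y : Q.NZPath}
    (h : Q.coeffs a y ≠ 0) : Q.wdeg y.word = d := by
  induction ha using Submodule.span_induction with
  | zero => exact absurd rfl h
  | add a b _ _ ha hb => exact (coeffs_add_ne h).elim ha hb
  | smul c a _ ha => exact ha (coeffs_smul_ne h)
  | mem a ha =>
    obtain ⟨p, hp, rfl⟩ := ha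
    exact coeffs_ofPath_ne h ▸ hp

/-- The path without its first arrow. -/
def NZPath.tl (Y : Q.NZPath) : Q.NZPath :=
  match h : Y.word with
  | [] => Y
  | b :: w => ⟨Q.src b, Y.src, w, by have := Y.walk; rw [h] at this; exact this.2, by
      have := Y.nonzero; rw [h] at this; exact this.tail⟩

theorem NZPath.tl_eq {Y : Q.NZPath} {b : E} {w : List E} (h : Y.word = b :: w) :
    Y.tl = ⟨Q.src b, Y.src, w, by have := Y.walk; rw [h] at this; exact this.2, by
      have := Y.nonzero; rw [h] at this; exact this.tail⟩ := by
  unfold tl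
  split
  · rename_i h'
    rw [h] at h'
    exact absurd h' (by simp)
  · rename_i b' w' h'
    rw [h] at h'
    obtain ⟨rfl, rfl⟩ := List.cons.inj h'
    rfl

theorem NZPath.tl_eq_of_word {Y Z : Q.NZPath} {b : E} (h : Y.word = b :: Z.word)
    (hZ : Z.word ≠ []) : Y.tl = Z := by
  rw [tl_eq h]
  exact NZPath.ext_of_word_ne_nil rfl hZ

open scoped Classical in
/-- Searches the list for the first path of length at least two which continues an anti-path of
arrows ending with `a`, and splits off its first arrow. -/
def splitFirst (a : E) : List Q.NZPath → (List Q.NZPath → Q.Alg k) → Q.Alg k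
  | [], _ => 0
  | Y :: R, Φ => match Y.word with
    | [] => 0
    | [b] => if Q.rel a b then -splitFirst b R fun L => Φ (Y :: L) else 0
    | b :: _ :: _ => if Q.rel a b then Φ (Q.arrowPath b :: Y.tl :: R) else 0

theorem pathSeq_merge {t s : V} {Y : Q.NZPath} {b c : E} {w : List E} {R : List Q.NZPath}
    (hY : Y.word = b :: c :: w) (h : Q.PathSeq t s (Q.arrowPath b :: Y.tl :: R)) :
    Q.PathSeq t s (Y :: R) := by
  rw [NZPath.tl_eq hY] at h
  exact ⟨(NZPath.tgt_eq hY).trans h.1, by simp [hY], h.2.2.2.2⟩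

open scoped Classical in
theorem splitFirst_arrow {a b : E} {R : List Q.NZPath} {Φ : List Q.NZPath → Q.Alg k} :
    splitFirst a (Q.arrowPath b :: R) Φ =
      if Q.rel a b then -splitFirst b R fun L => Φ (Q.arrowPath b :: L) else 0 := rfl

theorem coeffs_splitFirst_ne {a : E} {R : List Q.NZPath} {Φ : List Q.NZPath → Q.Alg k}
    {y : Q.NZPath} (h : Q.coeffs (splitFirst a R Φ) y ≠ 0) :
    ∃ L, Q.coeffs (Φ L) y ≠ 0 ∧ L.length = R.length + 1 ∧
      (L.map (·.word)).flatten = (R.map (·.word)).flatten ∧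
      ∀ t s, Q.PathSeq t s L → Q.PathSeq t s R := by
  induction R generalizing a Φ with
  | nil => exact absurd rfl h
  | cons Y R ih =>
    unfold splitFirst at h
    split at h
    · exact absurd rfl h
    · rename_i b hb
      split_ifs at h
      · rw [← neg_one_smul k] at h
        obtain ⟨L, h1, h2, h3, h4⟩ := ih (coeffs_smul_ne h)
        exact ⟨Y :: L, h1, by simp [h2], by simp [h3], fun t s h5 => ⟨h5.1, h5.2.1, h4 _ _ h5.2.2⟩⟩
      · exact absurd rfl h
    · rename_i b c w hb
      split_ifs at h
      · refine ⟨_, h, by simp, ?_, fun t s => pathSeq_merge hb⟩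
        simp [NZPath.tl_eq hb, arrowPath, hb]
      · exact absurd rfl h

theorem splitFirst_arr {a : E} {w : List E} {Φ : List Q.NZPath → Q.Alg k} :
    splitFirst a (Q.arr w) Φ = 0 := by
  induction w generalizing a Φ with
  | nil => rfl
  | cons b w ih =>
    rw [arr, List.map_cons, splitFirst_arrow, ← arr, ih, neg_zero, ite_self]

/-- The search passes the arrows of the anti-path, each contributing a factor `-1`, and stops at the
longer path `Y`. -/
theorem splitFirst_down {a : E} {A : List E} {b : E} {Y Z : Q.NZPath} {R : List Q.NZPath}
    {Φ : List Q.NZPath → Q.Alg k} (hA : (a :: A ++ [b]).IsChain Q.rel) (hY : Y.word = b :: Z.word)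
    (hZ : Z.word ≠ []) : splitFirst a (Q.arr A ++ Y :: R) Φ =
      sgn k A.length • Φ (Q.arr A ++ Q.arrowPath b :: Z :: R) := by
  induction A generalizing a Φ with
  | nil =>
    have hr : Q.rel a b := (List.isChain_cons_cons.1 hA).1
    obtain ⟨c, w, hw⟩ := List.exists_cons_of_ne_nil hZ
    have hY' := NZPath.tl_eq_of_word hY hZ
    rw [arr, List.map_nil, List.nil_append, List.nil_append, splitFirst]
    split
    · simp_all
    · simp_all
    · rename_i b' c' w' h'
      rw [hY, hw] at h'
      obtain ⟨rfl, -⟩ := List.cons.inj h'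
      rw [if_pos hr, hY']
      simp
  | cons a' A ih =>
    have hr : Q.rel a a' := (List.isChain_cons_cons.1 hA).1
    rw [arr, List.map_cons, List.cons_append, splitFirst_arrow, ← arr, if_pos hr, ih hA.tail, ← neg_one_smul k, smul_smul, ← sgn_one, sgn_mul_sgn]
    refine smul_congr (sgn_congr k ?_) rfl
    simp [add_comm]

/-- The arrow before `Z` has a nonzero product with it, so `Z` does not continue the anti-path and
the search ends with the value zero. Hence the contraction vanishes on the lists of `VanishesUp`. -/
theorem splitFirst_up {a : E} {A : List E} {b : E} {Y Z : Q.NZPath} {R : List Q.NZPath}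
    {Φ : List Q.NZPath → Q.Alg k} (hA : (a :: A).getLast (by simp) = b)
    (hY : Y.word = b :: Z.word) (hZ : Z.word ≠ []) :
    splitFirst a (Q.arr A ++ Z :: R) Φ = 0 := by
  induction A generalizing a Φ with
  | nil =>
    obtain rfl : a = b := hA
    obtain ⟨c, w, hw⟩ := List.exists_cons_of_ne_nil hZ
    have hr : ¬ Q.rel a c := by
      have := Y.nonzero
      rw [hY, hw] at this
      exact (List.isChain_cons_cons.1 this).1.2
    rw [arr, List.map_nil, List.nil_append, splitFirst]
    split
    · rfl
    · rename_i h
      rw [hw] at h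
      obtain ⟨rfl, -⟩ := List.cons.inj h
      exact if_neg hr
    · rename_i h
      rw [hw] at h
      obtain ⟨rfl, -⟩ := List.cons.inj h
      exact if_neg hr
  | cons a' A ih =>
    rw [arr, List.map_cons, List.cons_append, splitFirst_arrow, ← arr, ih hA, neg_zero, ite_self]

/-- The contraction of the cochain `F` of degree `d` on the list of paths with first entry `X`. The
word is the word of `X`. -/
def contractAux (F : Coch (Q.Alg k)) (d : ℤ) : List E → Q.NZPath → List Q.NZPath → Q.Alg k
  | [], _, _ => 0
  | [a], X, R => sgn k (d - (R.length + 2)) • splitFirst a R fun L => ev F (Q.bas k (X :: L))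
  -- The differential at the list with `X` split into `a` and its tail contains both the value at
  -- `X` and `a` times the value at the tail. Solving for the value at `X` gives a recursion on the
  -- length of `X`. The exponent `d - (R.length + 2)` is the internal degree of the component of
  -- arity `R.length + 1` of a cochain of degree `d - 1`.
  | a :: c :: w, X, R =>
      sgn k ((d - (R.length + 2)) * Q.deg a) •
        (Q.ofPath k (Q.arrowPath a) * contractAux F d (c :: w) X.tl R) -
      sgn k (d - (R.length + 2)) • ev F (Q.bas k (Q.arrowPath a :: X.tl :: R))

/-- The contraction of a cochain of degree `d`. -/
def contract (F : Coch (Q.Alg k)) (d : ℤ) : List Q.NZPath → Q.Alg k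
  | [] => 0
  | X :: R => contractAux F d X.word X R

theorem coeffs_sub_ne {a b : Q.Alg k} {y : Q.NZPath} (h : Q.coeffs (a - b) y ≠ 0) :
    Q.coeffs a y ≠ 0 ∨ Q.coeffs b y ≠ 0 := by
  rw [sub_eq_add_neg, ← neg_one_smul k] at h
  exact (coeffs_add_ne h).imp id coeffs_smul_ne

theorem coeffs_contractAux_ne {F : Coch (Q.Alg k)} {d : ℤ} (hF : F ∈ cochains (Q.grading k) d)
    (hn : Normal (ev F)) {w : List E} {X : Q.NZPath} (hX : X.word = w) {R : List Q.NZPath}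
    {y : Q.NZPath} (h : Q.coeffs (contractAux F d w X R) y ≠ 0) :
    Q.PathSeq y.tgt y.src (X :: R) ∧ Q.wdeg y.word =
      Q.wdeg ((X :: R).map (·.word)).flatten + (d - 1 - (X :: R).length) := by
  induction w generalizing X y with
  | nil => exact absurd rfl h
  | cons a w ih =>
    cases w with
    | nil =>
      obtain ⟨L, h1, h2, h3, h4⟩ := coeffs_splitFirst_ne (coeffs_smul_ne h)
      have h5 := hn _ _ h1
      refine ⟨⟨h5.1, h5.2.1, h4 _ _ h5.2.2⟩, ?_⟩
      rw [wdeg_eq_of_mem_grading (Hom.mem_paths hF _) h1]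
      simp only [List.map_cons, List.flatten_cons, h3, List.length_cons, h2]
      push_cast
      ring
    | cons c w =>
      have ht := NZPath.tl_eq hX
      rcases coeffs_sub_ne h with h | h
      · obtain ⟨z, h1, h2, h3, h4, h5⟩ := coeffs_ofPath_mul_ne (coeffs_smul_ne h)
        obtain ⟨h6, h7⟩ := ih (X := X.tl) (by rw [ht]) h1
        constructor
        · refine pathSeq_merge hX ⟨h3.symm, by simp [arrowPath], ?_⟩
          rw [h2, h4]
          exact h6
        · rw [h5, wdeg_append, h7, List.map_cons, List.map_cons, List.flatten_cons,
            List.flatten_cons, hX, ht]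
          simp only [wdeg_append, arrowPath, List.length_cons]
          rw [show a :: c :: w = [a] ++ c :: w from rfl, wdeg_append]
          ring
      · have h := coeffs_smul_ne h
        refine ⟨pathSeq_merge hX (hn _ _ h), ?_⟩
        rw [wdeg_eq_of_mem_grading (Hom.mem_paths hF _) h]
        simp only [List.map_cons, List.flatten_cons, List.length_cons, wdeg_append, hX, ht,
          arrowPath]
        rw [show a :: c :: w = [a] ++ c :: w from rfl, wdeg_append]
        push_cast
        ring

theorem coeffs_contract_ne {F : Coch (Q.Alg k)} {d : ℤ} (hF : F ∈ cochains (Q.grading k) d)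
    (hn : Normal (ev F)) {L : List Q.NZPath} {y : Q.NZPath}
    (h : Q.coeffs (contract F d L) y ≠ 0) :
    Q.PathSeq y.tgt y.src L ∧ Q.wdeg y.word =
      Q.wdeg (L.map (·.word)).flatten + (d - 1 - L.length) := by
  cases L with
  | nil => exact absurd rfl h
  | cons X R => exact coeffs_contractAux_ne hF hn rfl h

/-- A normalised cocycle which vanishes on anti-paths is a coboundary. -/
theorem mem_coboundaries_of_vanishesAnti {F : Coch (Q.Alg k)} {d : ℤ}
    (hF : F ∈ cochains (Q.grading k) d) (hd : diff (Q.grading k) d F = 0) (hn : Normal (ev F))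
    (ha : VanishesAnti (ev F)) : F ∈ coboundaries (Q.grading k) d := by
  -- The contraction `G` vanishes on anti-paths and on the lists of `VanishesUp`, and its values on
  -- the matched lists are chosen so that `dG = F` on the lists of `VanishesUp`. Hence `F - dG`
  -- satisfies the hypotheses of `Normal.eq_zero_of_vanishes`.
  have hG : extC (contract F d) ∈ cochains (Q.grading k) (d - 1) :=
    extC_mem_cochains fun L => mem_grading_of_coeffs fun y hy => (coeffs_contract_ne hF hn hy).2
  have hGn : Normal (ev (extC (contract F d))) := fun L y hy =>
    (coeffs_contract_ne hF hn (by rw [ev_extC] at hy; exact hy)).1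
  have hGl := Lin.of_mem_cochains hG
  have hGa : VanishesAnti (ev (extC (contract F d))) := by
    intro w hw
    rw [ev_extC]
    cases w with
    | nil => rfl
    | cons a w =>
      change sgn k _ • splitFirst a (Q.arr w) _ = 0
      rw [splitFirst_arr, smul_zero]
  have hGu : VanishesUp (ev (extC (contract F d))) := by
    intro A b Y Z R hA hY hZ
    rw [ev_extC]
    cases A with
    | nil =>
      change sgn k _ • splitFirst b (Q.arr [] ++ Z :: R) _ = 0
      rw [splitFirst_up rfl hY hZ, smul_zero]
    | cons a A =>
      change sgn k _ • splitFirst a (Q.arr A ++ Q.arrowPath b :: Z :: R) _ = 0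
      have : Q.arr A ++ Q.arrowPath b :: Z :: R = Q.arr (A ++ [b]) ++ Z :: R := by simp
      rw [this, splitFirst_up (by simp) hY hZ, smul_zero]
  have hdG : diff (Q.grading k) (d - 1) (extC (contract F d)) ∈ cochains (Q.grading k) d :=
    diff_mem_cochains (by ring) hG
  have hF' : F - diff (Q.grading k) (d - 1) (extC (contract F d)) ∈ cochains (Q.grading k) d :=
    Submodule.sub_mem _ hF hdG
  have hFn : Normal (ev (F - diff (Q.grading k) (d - 1) (extC (contract F d)))) := by
    have := hn.add ((Normal.diff hGl hGn (d - 1)).smul (-1))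
    rw [neg_one_smul, ← sub_eq_add_neg] at this
    exact this
  have h0 := Normal.eq_zero_of_vanishes (Lin.of_mem_cochains hF') hFn (d := d)
    (by rw [map_sub, hd, diff_diff (by ring) hG, sub_zero]) ?_ ?_
  · refine ⟨extC (contract F d), hG, (sub_eq_zero.1 (coch_ext fun l => ?_)).symm⟩
    exact Lin.ext_of_paths (Lin.of_mem_cochains hF') (g := 0)
      (fun x z => ⟨fun _ _ => by simp, fun _ _ => by simp⟩) h0 l
  · intro A b Y Z R hA hY hZ
    rw [ev_sub, ev_diff_up hGl hGu hGa _ hA hY hZ, ev_extC, ev_extC, sub_eq_zero]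
    cases A with
    | nil =>
      obtain ⟨c, w, hw⟩ := List.exists_cons_of_ne_nil hZ
      have hc : contract F d (Y :: R) = sgn k ((d - (R.length + 2)) * Q.deg b) •
        (Q.ofPath k (Q.arrowPath b) * contract F d (Z :: R)) -
        sgn k (d - (R.length + 2)) • ev F (Q.bas k (Q.arrowPath b :: Z :: R)) := by
        rw [contract, hY, hw, contractAux, NZPath.tl_eq_of_word hY hZ, ← hw]
        rfl
      rw [if_pos rfl, arr, List.map_nil, List.nil_append, List.nil_append, hc]
      simp only [List.length_nil, Nat.cast_zero, zero_add, sgn_one, neg_smul, one_smul]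
      rw [show d - 1 - ((R.length : ℤ) + 1) = d - (R.length + 2) by ring, neg_sub, add_sub_cancel,
        smul_smul, sgn_mul_self, one_smul]
    | cons a A =>
      have hc : contract F d (Q.arr (a :: A) ++ Y :: R) =
          sgn k (d - ((Q.arr A ++ Y :: R).length + 2)) •
            splitFirst a (Q.arr A ++ Y :: R) fun L => ev F (Q.bas k (Q.arrowPath a :: L)) := rfl
      rw [if_neg (by simp), hc, splitFirst_down hA hY hZ, zero_add, smul_smul, smul_smul, smul_smul,
        sgn_mul_sgn, sgn_mul_sgn, sgn_mul_sgn]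
      refine (one_smul k _).symm.trans (smul_congr ?_ (by simp))
      rw [← sgn_zero]
      apply sgn_congr
      simp only [List.length_append, List.length_map, List.length_cons]
      push_cast
      generalize (A.length : ZMod 2) = x
      generalize (R.length : ZMod 2) = y
      generalize (d : ZMod 2) = z
      revert x y z; decide
  · intro w hw
    rw [ev_sub, ha w hw, hGa.diff hGl (d - 1) w hw, sub_zero]

end GradedGentleQuiver
end

noncomputable section

open GradedHochschild

namespace GradedGentleQuiver

variable {V E : Type*} {Q : GradedGentleQuiver V E}

/-! ### Anti-paths in concatenations of paths -/

/-- Two consecutive letters of an anti-path cannot lie in the same nonzero path, so each path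
contains at most one of them. -/
theorem length_le_of_flatten {L : List (List E)} (hL : ∀ X ∈ L, X.IsChain Q.nonrel)
    {v p v' : List E} (hp : p.IsChain Q.rel) (h : L.flatten = v ++ (p ++ v')) :
    p.length ≤ L.length := by
  induction L generalizing v p with
  | nil =>
    have : p = [] := by
      have h1 := congrArg List.length h
      simp at h1
      exact List.eq_nil_of_length_eq_zero (by omega)
    simp [this]
  | cons X L ih =>
    rw [List.flatten_cons] at h
    rcases List.append_eq_append_iff.1 h with ⟨m, h1, h2⟩ | ⟨m, h1, h2⟩
    · have := ih (fun Y hY => hL Y (by simp [hY])) hp h2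
      simp; omega
    · cases p with
      | nil => simp
      | cons a p =>
        cases m with
        | nil =>
          have := ih (v := []) (fun Y hY => hL Y (by simp [hY])) hp h2.symm
          simp at this ⊢; omega
        | cons a' m =>
          obtain ⟨rfl, h2'⟩ := List.cons.inj h2
          cases p with
          | nil => simp
          | cons b p =>
            cases m with
            | nil =>
              have := ih (v := []) (fun Y hY => hL Y (by simp [hY])) hp.tail h2'.symm
              simp at this ⊢; omega
            | cons b' m =>
              obtain ⟨rfl, -⟩ := List.cons.inj h2'
              have h3 := hL X (by simp)
              rw [h1] at h3
              exact absurd (List.isChain_cons_cons.1 hp).1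
                (List.isChain_cons_cons.1 h3.right_of_append).1.2

/-- The extremal case of the count: if there are as many letters as paths, every path contains
exactly one. So the first path ends with the first letter, unless it is the only path. -/
theorem flatten_step {X : List E} {L : List (List E)} (hL : ∀ Y ∈ X :: L, Y.IsChain Q.nonrel)
    {v p v' : List E} {a : E} (hp : (a :: p).IsChain Q.rel)
    (h : (X :: L).flatten = v ++ (a :: p ++ v')) (hlen : p.length = L.length) :
    (X = v ++ [a] ∧ L.flatten = p ++ v' ∧ L ≠ []) ∨ (p = [] ∧ L = [] ∧ X = v ++ a :: v') := by
  rw [List.flatten_cons] at h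
  have hL' : ∀ Y ∈ L, Y.IsChain Q.nonrel := fun Y hY => hL Y (by simp [hY])
  rcases List.append_eq_append_iff.1 h with ⟨m, h1, h2⟩ | ⟨m, h1, h2⟩
  · have := length_le_of_flatten hL' hp h2
    simp at this; omega
  · cases m with
    | nil =>
      have := length_le_of_flatten (v := []) hL' hp h2.symm
      simp at this; omega
    | cons a' m =>
      obtain ⟨rfl, h2'⟩ := List.cons.inj h2
      cases p with
      | nil =>
        obtain rfl : L = [] := List.eq_nil_of_length_eq_zero hlen.symm
        right
        simp at h2'
        simp [h1, h2']
      | cons b p =>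
        left
        cases m with
        | nil =>
          refine ⟨h1, h2'.symm, ?_⟩
          rintro rfl
          simp at hlen
        | cons b' m =>
          obtain ⟨rfl, -⟩ := List.cons.inj h2'
          have h3 := hL X (by simp)
          rw [h1] at h3
          exact absurd (List.isChain_cons_cons.1 hp).1
            (List.isChain_cons_cons.1 h3.right_of_append).1.2

theorem ne_nil_of_flatten {L : List (List E)} (hL : ∀ Y ∈ L, Y.IsChain Q.nonrel)
    {v p v' : List E} (hp : p.IsChain Q.rel)
    (h : L.flatten = v ++ (p ++ v')) (hlen : p.length = L.length) : [] ∉ L := by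
  induction L generalizing v p with
  | nil => simp
  | cons X L ih =>
    cases p with
    | nil => simp at hlen
    | cons a p =>
      rcases flatten_step hL hp h (by simpa using hlen) with ⟨h1, h2, -⟩ | ⟨-, rfl, h1⟩
      · have := ih (v := []) (fun Y hY => hL Y (by simp [hY])) hp.tail h2 (by simpa using hlen)
        simp [h1, this]
      · simp [h1]

/-- A path strictly inside the list is cut on both sides by consecutive letters of the anti-path, so
it is an arrow. When the path is first in the list, `v = []` replaces the missing left neighbour. -/
theorem flatten_middle {A C : List (List E)} {U : List E}
    (hL : ∀ Y ∈ A ++ U :: C, Y.IsChain Q.nonrel) {v p v' : List E} (hp : p.IsChain Q.rel)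
    (h : (A ++ U :: C).flatten = v ++ (p ++ v')) (hlen : p.length = (A ++ U :: C).length)
    (hA : A ≠ [] ∨ v = []) (hC : C ≠ []) : U.length = 1 := by
  induction A generalizing v p with
  | nil =>
    obtain rfl := hA.resolve_left (by simp)
    cases p with
    | nil => simp at hlen
    | cons a p =>
      rcases flatten_step hL hp h (by simpa using hlen) with ⟨h1, -⟩ | ⟨-, h1, -⟩
      · simp [h1]
      · exact absurd h1 hC
  | cons X A ih =>
    cases p with
    | nil => simp at hlen
    | cons a p =>
      rcases flatten_step hL hp h (by simpa using hlen) with ⟨h1, h2, -⟩ | ⟨-, h1, -⟩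
      · exact ih (v := []) (fun Y hY => hL Y (by simp at hY ⊢; tauto)) hp.tail h2 (by simpa using hlen)
          (Or.inr rfl)
      · simp at h1

theorem flatten_adjacent {A C : List (List E)} {U W : List E}
    (hL : ∀ Y ∈ A ++ U :: W :: C, Y.IsChain Q.nonrel) {v p v' : List E} (hp : p.IsChain Q.rel)
    (h : (A ++ U :: W :: C).flatten = v ++ (p ++ v'))
    (hlen : p.length = (A ++ U :: W :: C).length) :
    ∃ u a b w, U = u ++ [a] ∧ W = b :: w ∧ Q.rel a b := by
  induction A generalizing v p with
  | nil =>
    cases p with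
    | nil => simp at hlen
    | cons a p =>
      rcases flatten_step hL hp h (by simpa using hlen) with ⟨h1, h2, -⟩ | ⟨-, h1, -⟩
      · cases p with
        | nil => simp at hlen
        | cons b p =>
          rcases flatten_step (v := []) (fun Y hY => hL Y (by simp at hY ⊢; tauto)) hp.tail h2
            (by simpa using hlen) with ⟨h3, -⟩ | ⟨-, -, h3⟩
          · exact ⟨v, a, b, [], h1, h3, (List.isChain_cons_cons.1 hp).1⟩
          · exact ⟨v, a, b, _, h1, h3, (List.isChain_cons_cons.1 hp).1⟩
      · simp at h1
  | cons X A ih =>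
    cases p with
    | nil => simp at hlen
    | cons a p =>
      rcases flatten_step hL hp h (by simpa using hlen) with ⟨h1, h2, -⟩ | ⟨-, h1, -⟩
      · exact ih (v := []) (fun Y hY => hL Y (by simp at hY ⊢; tauto)) hp.tail h2 (by simpa using hlen)
      · simp at h1

theorem IsWalk.of_append {t s : V} {w w' : List E} (h : Q.IsWalk t s (w ++ w')) :
    ∃ r, Q.IsWalk t r w ∧ Q.IsWalk r s w' := by
  induction w generalizing t with
  | nil => exact ⟨t, rfl, h⟩
  | cons a w ih =>
    obtain ⟨r, h1, h2⟩ := ih h.2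
    exact ⟨r, ⟨h.1, h1⟩, h2⟩

theorem IsWalk.unique {t s t' s' : V} {w : List E} (hw : w ≠ []) (h : Q.IsWalk t s w)
    (h' : Q.IsWalk t' s' w) : t = t' ∧ s = s' := by
  induction w generalizing t t' with
  | nil => exact absurd rfl hw
  | cons a w ih =>
    refine ⟨h.1.symm.trans h'.1, ?_⟩
    cases w with
    | nil => exact Eq.trans (Eq.symm h.2) h'.2
    | cons b w => exact (ih (by simp) h.2 h'.2).2

theorem pathSeq_of_walk {t s : V} {L : List Q.NZPath}
    (h : Q.IsWalk t s (L.map (·.word)).flatten) (hL : [] ∉ L.map (·.word)) : Q.PathSeq t s L := by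
  induction L generalizing t with
  | nil => exact h
  | cons X L ih =>
    obtain ⟨r, h1, h2⟩ := IsWalk.of_append h
    have hX : X.word ≠ [] := fun h => hL (by simp [h])
    obtain ⟨rfl, rfl⟩ := IsWalk.unique hX h1 X.walk
    exact ⟨rfl, hX, ih h2 fun h => hL (by simp at h ⊢; tauto)⟩

variable {k : Type*} [Field k] [Fintype V]

/-! ### The cochains of pairs of an anti-path and a parallel path -/

theorem wordElt_nil : Q.wordElt k [] = 1 := rfl

theorem wordElt_cons (a : E) (w : List E) :
    Q.wordElt k (a :: w) = Q.ofPath k (Q.arrowPath a) * Q.wordElt k w := by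
  simp [wordElt, arrow]

theorem coeffs_wordElt_mul_ne {w : List E} {a : Q.Alg k} {y : Q.NZPath}
    (h : Q.coeffs (Q.wordElt k w * a) y ≠ 0) : ∃ z, Q.coeffs a z ≠ 0 ∧ y.word = w ++ z.word ∧
      Q.IsWalk y.tgt z.tgt w ∧ y.src = z.src := by
  induction w generalizing y with
  | nil =>
    rw [wordElt_nil, one_mul] at h
    exact ⟨y, h, rfl, rfl, rfl⟩
  | cons b w ih =>
    rw [wordElt_cons, mul_assoc] at h
    obtain ⟨z, h1, h2, h3, h4, h5⟩ := coeffs_ofPath_mul_ne h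
    obtain ⟨z', h6, h7, h8, h9⟩ := ih h1
    exact ⟨z', h6, by rw [h5, h7]; rfl, ⟨h3.symm, by rw [← h2] at h8; exact h8⟩, h4.trans h9⟩

theorem coeffs_mul_wordElt_ne {w : List E} {a : Q.Alg k} {y : Q.NZPath}
    (h : Q.coeffs (a * Q.wordElt k w) y ≠ 0) : ∃ z, Q.coeffs a z ≠ 0 ∧ y.word = z.word ++ w ∧
      Q.IsWalk z.src y.src w ∧ y.tgt = z.tgt := by
  induction w generalizing a with
  | nil =>
    rw [wordElt_nil, mul_one] at h
    exact ⟨y, h, by simp, rfl, rfl⟩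
  | cons b w ih =>
    rw [wordElt_cons, ← mul_assoc] at h
    obtain ⟨z, h1, h2, h3, h4⟩ := ih h
    obtain ⟨z', h6, h7, h8, h9, h10⟩ := coeffs_mul_ofPath_ne h1
    exact ⟨z', h6, by rw [h2, h10]; simp [arrowPath], ⟨h7.symm, by rw [h9] at h3; exact h3⟩,
      h4.trans h8⟩

theorem wordElt_mul_trivialPath (q : Q.NZPath) :
    Q.wordElt k q.word * Q.ofPath k (Q.trivialPath q.src) = Q.ofPath k q := by
  obtain ⟨t, s, w, hw, hn⟩ := q
  induction w generalizing t with
  | nil =>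
    rw [wordElt_nil, one_mul]
    congr 1
    exact NZPath.ext (Eq.symm hw) rfl rfl
  | cons a w ih =>
    rw [wordElt_cons, mul_assoc, ih (Q.src a) hw.2 hn.tail,
      ofPath_mul_ofPath_pos rfl hn]
    congr 1
    exact NZPath.ext hw.1 rfl rfl

theorem pathElt_eq (q : Q.NZPath) : Q.pathElt k q.word q.src = Q.ofPath k q :=
  wordElt_mul_trivialPath q

/-- As a product of arrows, a non-empty word already knows its start vertex, so multiplying by that
idempotent changes nothing. -/
theorem mul_wordElt (a : Q.Alg k) (z : Q.NZPath) (hz : z.word ≠ []) :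
    a * Q.wordElt k z.word = a * Q.ofPath k z := by
  rw [← wordElt_mul_trivialPath z, ← mul_assoc]
  refine (mul_trivial_of_support rfl fun y hy => ?_).symm
  obtain ⟨z', -, -, h, -⟩ := coeffs_mul_wordElt_ne hy
  exact (IsWalk.unique hz h z.walk).2

open scoped Classical in
/-- The values of the cochain of a pair on lists of paths with concatenation `T`. -/
def dualSum (p : List E) (q : Q.NZPath) (T : List E) : Q.Alg k :=
  ∑ i ∈ Finset.range (T.length + 1), if p <+: T.drop i then
    sgn k (Q.wdeg (T.take i) * (Q.wdeg q.word - Q.wdeg p)) •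
      (Q.wordElt k (T.take i) * Q.ofPath k q * Q.wordElt k (T.drop (i + p.length))) else 0

/-- The cochain of a pair as a function on lists of paths. -/
def dualList (p : List E) (q : Q.NZPath) (L : List Q.NZPath) : Q.Alg k :=
  if p.length = L.length then dualSum p q (L.map (·.word)).flatten else 0

theorem dual_eq_extC (p : List E) (q : Q.NZPath) :
    Q.dual k p q.word q.src = extC (dualList p q) := by
  funext n v
  unfold dual extC dualList
  split_ifs with h
  · congr 1
    funext X
    rw [if_pos (by simpa using h), dualSum, List.map_ofFn, pathElt_eq]
    rfl
  · simp only [List.length_ofFn, if_neg h, extend, smul_zero, Finset.sum_const_zero]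

/-- Every path in the value arises from the concatenated word by replacing one occurrence of `p` by
`q`. -/
theorem coeffs_dualSum_ne {p : List E} {q : Q.NZPath} {T : List E} {y : Q.NZPath}
    (h : Q.coeffs (dualSum (k := k) p q T) y ≠ 0) : ∃ v v', T = v ++ (p ++ v') ∧
      y.word = v ++ (q.word ++ v') ∧ Q.IsWalk y.tgt q.tgt v ∧ Q.IsWalk q.src y.src v' := by
  rw [dualSum, coeffs_sum, Finset.sum_apply'] at h
  obtain ⟨i, -, hi⟩ := Finset.exists_ne_zero_of_sum_ne_zero h
  split_ifs at hi with hp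
  · obtain ⟨v', hv'⟩ := hp
    obtain ⟨z, h1, h2, h3, h4⟩ := coeffs_mul_wordElt_ne (coeffs_smul_ne hi)
    obtain ⟨z', h5, h6, h7, h8⟩ := coeffs_wordElt_mul_ne h1
    obtain rfl := coeffs_ofPath_ne h5
    have hd : T.drop (i + p.length) = v' := by
      rw [← List.drop_drop, ← hv']
      simp
    rw [hd] at h2 h3
    refine ⟨T.take i, v', by rw [hv', List.take_append_drop], by rw [h2, h6, List.append_assoc],
      h4 ▸ h7, h8 ▸ h3⟩
  · exact absurd rfl hi

end GradedGentleQuiver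
end

/-! ### Values and differentials of the cochains of pairs -/

noncomputable section

open GradedHochschild

namespace GradedGentleQuiver

variable {V E : Type*} {Q : GradedGentleQuiver V E} {k : Type*} [Field k] [Fintype V]

theorem ev_dual (p : List E) (q : Q.NZPath) (L : List Q.NZPath) :
    ev (Q.dual k p q.word q.src) (Q.bas k L) = dualList p q L := by
  rw [dual_eq_extC, ev_extC]

theorem isChain_words (L : List Q.NZPath) : ∀ Y ∈ L.map (·.word), Y.IsChain Q.nonrel := by
  intro Y hY
  obtain ⟨X, -, rfl⟩ := List.mem_map.1 hY
  exact X.nonzero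

theorem coeffs_dualList_ne {p : List E} (hp : p.IsChain Q.rel) {q : Q.NZPath}
    (hpq : Q.IsWalk q.tgt q.src p) {L : List Q.NZPath} {y : Q.NZPath}
    (h : Q.coeffs (dualList (k := k) p q L) y ≠ 0) : p.length = L.length ∧
      Q.PathSeq y.tgt y.src L ∧ ∃ v v', (L.map (·.word)).flatten = v ++ (p ++ v') ∧
        y.word = v ++ (q.word ++ v') := by
  rw [dualList] at h
  split_ifs at h with hlen
  · obtain ⟨v, v', h1, h2, h3, h4⟩ := coeffs_dualSum_ne h
    refine ⟨hlen, pathSeq_of_walk ?_ ?_, v, v', h1, h2⟩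
    · rw [h1]
      exact h3.append (hpq.append h4)
    · exact ne_nil_of_flatten (isChain_words L) hp h1 (by simpa using hlen)
  · exact absurd rfl h

theorem flatten_arr (w : List E) : ((Q.arr w).map (·.word)).flatten = w := by
  induction w with
  | nil => rfl
  | cons a w ih =>
    rw [arr, List.map_cons, List.map_cons, List.flatten_cons, ← arr, ih]
    rfl

open scoped Classical in
theorem dualSum_eq_of_length {p : List E} {q : Q.NZPath} {T : List E}
    (h : ∀ i, i ≠ 0 → i ≤ T.length → ¬ p <+: T.drop i) :
    dualSum (k := k) p q T = if p <+: T then Q.ofPath k q * Q.wordElt k (T.drop p.length) else 0 := by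
  rw [dualSum, Finset.sum_eq_single 0]
  · simp [wordElt_nil, wdeg]
  · intro i hi hi0
    rw [if_neg (h i hi0 (by simpa [Nat.lt_succ_iff] using hi))]
  · simp

-- An anti-path with as many arrows as `p` has no room for cofactors. On anti-paths, therefore,
-- these cochains are the dual basis in which everything below is computed.
open scoped Classical in
theorem dualList_arr {p : List E} {q : Q.NZPath} {w : List E} :
    dualList (k := k) p q (Q.arr w) = if p = w then Q.ofPath k q else 0 := by
  rw [dualList, flatten_arr, List.length_map]
  by_cases hlen : p.length = w.length
  · rw [if_pos hlen, dualSum_eq_of_length]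
    · by_cases hp : p = w
      · rw [if_pos hp, if_pos (hp ▸ List.prefix_refl _), hp, List.drop_length, wordElt_nil, mul_one]
      · rw [if_neg hp, if_neg fun h => hp (h.eq_of_length hlen)]
    · intro i hi hi' h
      have := h.length_le
      simp at this
      omega
  · rw [if_neg hlen, if_neg fun h => hlen (congrArg _ h)]

theorem dual_mem_cochains {p : List E} (hp : p.IsChain Q.rel) {q : Q.NZPath}
    (hpq : Q.IsWalk q.tgt q.src p) {d : ℤ} (hd : d = p.length + Q.wdeg q.word - Q.wdeg p) :
    Q.dual k p q.word q.src ∈ cochains (Q.grading k) d := by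
  rw [dual_eq_extC]
  refine extC_mem_cochains fun L => mem_grading_of_coeffs fun y hy => ?_
  obtain ⟨h1, -, v, v', h2, h3⟩ := coeffs_dualList_ne hp hpq hy
  rw [h2, h3, ← h1, hd]
  simp only [wdeg_append]
  ring

theorem normal_dual {p : List E} (hp : p.IsChain Q.rel) {q : Q.NZPath}
    (hpq : Q.IsWalk q.tgt q.src p) : Normal (ev (Q.dual k p q.word q.src)) := by
  intro L y hy
  rw [ev_dual] at hy
  exact (coeffs_dualList_ne hp hpq hy).2.1

-- The left cofactor either starts with `b` or is trivial.
open scoped Classical in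
theorem dualSum_cons (p : List E) (q : Q.NZPath) (b : E) (T : List E) :
    dualSum (k := k) p q (b :: T) =
      sgn k (Q.deg b * (Q.wdeg q.word - Q.wdeg p)) •
        (Q.ofPath k (Q.arrowPath b) * dualSum p q T) +
      if p <+: b :: T then Q.ofPath k q * Q.wordElt k ((b :: T).drop p.length) else 0 := by
  rw [dualSum, List.length_cons, Finset.sum_range_succ']
  congr 1
  · rw [dualSum, Finset.mul_sum, Finset.smul_sum]
    refine Finset.sum_congr rfl fun i _ => ?_
    rw [List.drop_succ_cons, List.take_succ_cons, add_right_comm, List.drop_succ_cons]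
    split_ifs
    · rw [mul_smul_comm, smul_smul, sgn_mul_sgn, wordElt_cons, ← mul_assoc, ← mul_assoc]
      refine smul_congr (congrArg _ ?_) rfl
      rw [show b :: T.take i = [b] ++ T.take i from rfl, wdeg_append]
      simp [wdeg]
      ring
    · rw [mul_zero, smul_zero]
  · simp [wordElt_nil, wdeg]

theorem dualList_middle {p : List E} (hp : p.IsChain Q.rel) {q : Q.NZPath}
    (hpq : Q.IsWalk q.tgt q.src p) {A C : List Q.NZPath} {Y : Q.NZPath} (hA : A ≠ []) (hC : C ≠ [])
    (hY : Y.word.length ≠ 1) : dualList (k := k) p q (A ++ Y :: C) = 0 := by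
  by_contra hne
  obtain ⟨y, hy⟩ := exists_coeffs_ne_zero hne
  obtain ⟨h1, -, v, v', h2, -⟩ := coeffs_dualList_ne hp hpq hy
  have h3 := isChain_words (A ++ Y :: C)
  rw [List.map_append, List.map_cons] at h2 h3
  exact hY (flatten_middle h3 hp h2 (by simpa using h1) (Or.inl (by simpa using hA)) (by simpa using hC))

theorem dualList_adjacent {p : List E} (hp : p.IsChain Q.rel) {q : Q.NZPath}
    (hpq : Q.IsWalk q.tgt q.src p) {A C : List Q.NZPath} {b : E} {Y Z : Q.NZPath}
    (hY : Y.word = b :: Z.word) :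
    dualList (k := k) p q (A ++ Q.arrowPath b :: Z :: C) = 0 := by
  by_contra hne
  obtain ⟨y, hy⟩ := exists_coeffs_ne_zero hne
  obtain ⟨h1, -, v, v', h2, -⟩ := coeffs_dualList_ne hp hpq hy
  have h3 := isChain_words (A ++ Q.arrowPath b :: Z :: C)
  rw [List.map_append, List.map_cons, List.map_cons] at h2 h3
  obtain ⟨u, a, c, w, h4, h5, h6⟩ := flatten_adjacent h3 hp h2 (by simpa using h1)
  have h4 : [b] = u ++ [a] := h4
  have h7 := Y.nonzero
  rw [hY, h5] at h7
  have : b = a := by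
    have := congrArg List.getLast? h4
    simpa using this
  exact (List.isChain_cons_cons.1 h7).1.2 (this ▸ h6)

/-- If the left cofactor is trivial, `p` starts with `b`. A second letter of `p` would be the first
letter of `Z`, which is impossible because `bZ` is nonzero. So this term occurs only for `p = [b]`
and a list of length one. -/
theorem dualList_cons {p : List E} (hp : p.IsChain Q.rel) (hp0 : p ≠ []) {q : Q.NZPath}
    {C : List Q.NZPath} {b : E} {Y Z : Q.NZPath} (hY : Y.word = b :: Z.word) (hZ : Z.word ≠ []) :
    dualList (k := k) p q (Y :: C) = sgn k (Q.deg b * (Q.wdeg q.word - Q.wdeg p)) •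
      (Q.ofPath k (Q.arrowPath b) * dualList p q (Z :: C)) +
      if C = [] then dualList p q [Q.arrowPath b] * Q.ofPath k Z else 0 := by
  classical
  have h1 : dualList (k := k) p q [Q.arrowPath b] = if p = [b] then Q.ofPath k q else 0 :=
    dualList_arr (w := [b])
  rw [dualList, dualList, h1]
  by_cases hlen : p.length = C.length + 1
  · rw [if_pos (by simpa using hlen), if_pos (by simpa using hlen), List.map_cons, List.flatten_cons, hY,
      List.cons_append, dualSum_cons, List.map_cons, List.flatten_cons]
    congr 1
    cases p with
    | nil => exact absurd rfl hp0
    | cons a p =>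
      by_cases hC : C = []
      · subst hC
        obtain rfl : p = [] := List.eq_nil_of_length_eq_zero (by simpa using hlen)
        rw [if_pos rfl]
        by_cases hab : a = b
        · subst hab
          rw [if_pos rfl, if_pos (by simp)]
          simp [mul_wordElt _ Z hZ]
        · rw [if_neg (by simpa using hab), if_neg (by simpa using hab), zero_mul]
      · rw [if_neg hC, if_neg]
        intro h
        cases p with
        | nil => exact hC (List.eq_nil_of_length_eq_zero (by simpa using hlen.symm))
        | cons a' p =>
          obtain ⟨c, w, hw⟩ := List.exists_cons_of_ne_nil hZ
          have h7 := Y.nonzero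
          rw [hY, hw] at h7
          rw [hw] at h
          simp only [List.cons_append, List.cons_prefix_cons] at h
          obtain ⟨rfl, rfl, -⟩ := h
          exact (List.isChain_cons_cons.1 h7).1.2 (List.isChain_cons_cons.1 hp).1
  · rw [if_neg (by simpa using hlen), if_neg (by simpa using hlen), mul_zero, smul_zero, zero_add]
    split_ifs with h2 h3
    · subst h3
      simp [h2] at hlen
    · rw [zero_mul]
    · rfl

/-- Each entry contains one letter of `p`. The arrow at the beginning of `A` leaves no room for a
left cofactor, so `p = Ab` and `Z` is the right cofactor. -/
theorem dualList_concat {p : List E} (hp : p.IsChain Q.rel) {q : Q.NZPath}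
    (hpq : Q.IsWalk q.tgt q.src p) {A : List E} (hA : A ≠ []) {b : E} {Y Z : Q.NZPath}
    (hY : Y.word = b :: Z.word) (hZ : Z.word ≠ []) :
    dualList (k := k) p q (Q.arr A ++ [Y]) = dualList p q (Q.arr (A ++ [b])) * Q.ofPath k Z := by
  classical
  rw [dualList_arr, dualList]
  by_cases hlen : p.length = A.length + 1
  · rw [if_pos (by simpa using hlen)]
    have hfl : ((Q.arr A ++ [Y]).map (·.word)).flatten = A ++ b :: Z.word := by
      rw [List.map_append, List.flatten_append, flatten_arr, ← hY]
      simp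
    rw [hfl, dualSum_eq_of_length]
    · by_cases h : p = A ++ [b]
      · rw [if_pos h, if_pos (by rw [h]; exact ⟨Z.word, by simp⟩), ← mul_wordElt _ Z hZ, h]
        congr 2
        rw [show A ++ b :: Z.word = (A ++ [b]) ++ Z.word by simp, List.drop_left]
      · rw [if_neg h, if_neg, zero_mul]
        intro h'
        refine h ((List.prefix_of_prefix_length_le h' (l₂ := A ++ [b]) ⟨Z.word, by simp⟩
          (by simp [hlen])).eq_of_length (by simp [hlen]))
    · rintro i hi hi' ⟨v', hv'⟩
      obtain ⟨a, A, rfl⟩ := List.exists_cons_of_ne_nil hA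
      obtain ⟨a', p, rfl⟩ := List.exists_cons_of_ne_nil (l := p) (by rintro rfl; simp at hlen)
      have h1 : (((Q.arr (a :: A) ++ [Y])).map (·.word)).flatten =
          (a :: A ++ b :: Z.word).take i ++ (a' :: p ++ v') := by
        rw [hfl, hv', List.take_append_drop]
      rcases flatten_step (isChain_words (Q.arr (a :: A) ++ [Y])) hp h1 (by simpa using hlen) with
        ⟨h2, -⟩ | ⟨-, h2, -⟩
      · have := congrArg List.length h2
        simp [arrowPath] at this
        omega
      · simp at h2
  · rw [if_neg (by simpa using hlen), if_neg (by rintro rfl; simp at hlen), zero_mul]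

/-- Only three terms can survive on `(A, β, Z, R)`: the left outer one if `A` is empty, the right
outer one if `R` is empty, and the merge of `β` with `Z`. They cancel by `dualList_cons` and
`dualList_concat`; if `A` and `R` are non-empty, the merge vanishes by `dualList_middle`. The other
terms cut a nonzero path between two entries, where an anti-path would need a relation
(`dualList_adjacent`). -/
theorem vanishesUp_diff_dual {p : List E} (hp : p.IsChain Q.rel) {q : Q.NZPath}
    (hpq : Q.IsWalk q.tgt q.src p) {d : ℤ} (hd : d = p.length + Q.wdeg q.word - Q.wdeg p) :
    VanishesUp (ev (diff (Q.grading k) d (Q.dual k p q.word q.src))) := by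
  intro A b Y Z R hA hY hZ
  have hl := Lin.of_mem_cochains (dual_mem_cochains (k := k) hp hpq hd)
  obtain ⟨X, T, hXT⟩ : ∃ X T, Q.arr A ++ Q.arrowPath b :: Z :: R = X :: T := by
    cases A with
    | nil => exact ⟨_, _, rfl⟩
    | cons X T => exact ⟨_, _, rfl⟩
  have hlen : T.length = A.length + R.length + 1 := by
    have := congrArg List.length hXT
    simp at this
    omega
  have hlast : ev (Q.dual k p q.word q.src) (Q.bas k (Q.arr A ++ Q.arrowPath b :: Z :: R).dropLast) *
      Q.ofPath k ((Q.arr A ++ Q.arrowPath b :: Z :: R).getLast (by simp)) =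
        if R = [] then dualList p q (Q.arr (A ++ [b])) * Q.ofPath k Z else 0 := by
    rw [ev_dual]
    rcases List.eq_nil_or_concat R with rfl | ⟨R, r, rfl⟩
    · have : (Q.arr A ++ [Q.arrowPath b, Z]).dropLast = Q.arr (A ++ [b]) := by
        rw [List.dropLast_append_of_ne_nil (by simp)]
        simp
      rw [this, if_pos rfl]
      simp
    · have : (Q.arr A ++ Q.arrowPath b :: Z :: R.concat r).dropLast =
          Q.arr A ++ Q.arrowPath b :: Z :: R := by
        rw [List.concat_eq_append, ← List.cons_append, ← List.cons_append, ← List.append_assoc,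
          List.dropLast_concat]
      rw [this, dualList_adjacent hp hpq hY, zero_mul, if_neg (by simp)]
  have hfirst : sgn k ((d - T.length) * Q.wdeg X.word) • (Q.ofPath k X *
      ev (Q.dual k p q.word q.src) (Q.bas k T)) =
      if A = [] then sgn k ((d - (R.length + 1)) * Q.deg b) •
          (Q.ofPath k (Q.arrowPath b) * dualList p q (Z :: R)) else 0 := by
    rw [ev_dual]
    cases A with
    | nil =>
      obtain ⟨rfl, rfl⟩ := List.cons.inj hXT
      simp [arrowPath, wdeg]
    | cons x A =>
      obtain ⟨rfl, rfl⟩ := List.cons.inj hXT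
      rw [if_neg (by simp)]
      have h0 : dualList (k := k) p q (List.append (List.map Q.arrowPath A) (Q.arrowPath b :: Z :: R)) = 0 :=
        dualList_adjacent hp hpq hY
      rw [h0, mul_zero, smul_zero]
  rw [hXT, ev_diff_paths, hfirst]
  simp only [← hXT]
  rw [hlast, mergeSum_append, mergeSum_eq_zero, zero_add,
    mergeSum_eq_zero (l := Z :: R), add_zero, arrow_mul_of_word hY hZ]
  · have hbas : Q.bas k (Q.arr A) ++ Q.ofPath k Y :: Q.bas k R = Q.bas k (Q.arr A ++ Y :: R) := by
      simp
    rw [hbas, ev_dual]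
    refine smul_eq_zero_of_right _ ?_
    by_cases hp0 : p = []
    · subst hp0
      simp [dualList]
    by_cases hA0 : A = []
    · subst hA0
      have h1 := dualList_cons (k := k) hp hp0 (q := q) (C := R) hY hZ
      rw [if_pos rfl]
      simp only [List.map_nil, List.nil_append, h1]
      simp only [List.length_nil, Nat.cast_zero, zero_add, sgn_one, neg_smul, one_smul]
      have hlen' : dualList (k := k) p q (Z :: R) ≠ 0 → p.length = R.length + 1 := by
        intro h
        by_contra h'
        exact h (if_neg (by simpa using h'))
      have e1 : sgn k ((d - (R.length + 1)) * Q.deg b) •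
          (Q.ofPath k (Q.arrowPath b) * dualList p q (Z :: R)) =
          sgn k (Q.deg b * (Q.wdeg q.word - Q.wdeg p)) •
          (Q.ofPath k (Q.arrowPath b) * dualList p q (Z :: R)) := by
        by_cases h0 : dualList (k := k) p q (Z :: R) = 0
        · rw [h0, mul_zero, smul_zero, smul_zero]
        · rw [hd, hlen' h0]
          refine smul_congr (congrArg _ ?_) rfl
          push_cast
          ring
      have e2 : sgn k (T.length + 1) • (if R = [] then dualList p q (Q.arr [b]) * Q.ofPath k Z else 0) =
          if R = [] then dualList p q (Q.arr [b]) * Q.ofPath k Z else 0 := by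
        split_ifs with hR
        · rw [hlen, hR]
          simp [sgn_of_even]
        · rw [smul_zero]
      have e3 : Q.arr [b] = [Q.arrowPath b] := rfl
      rw [e1, e2, e3]
      abel
    · rw [if_neg hA0, zero_add]
      by_cases hR : R = []
      · subst hR
        rw [if_pos rfl, dualList_concat hp hpq hA0 hY hZ, ← add_smul]
        refine smul_eq_zero_of_left ?_ _
        rw [hlen]
        simp only [List.length_nil, List.length_map]
        push_cast
        rw [show (A.length : ℤ) + 0 + 1 + 1 = A.length + 1 + 1 by ring, ← neg_sgn]
        ring
      · rw [if_neg hR, dualList_middle hp hpq (by simpa using hA0) hR]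
        · simp
        · rw [hY]
          simpa using hZ
  · intro a u v c h
    refine smul_eq_zero_of_right _ ?_
    by_cases hc : u.src = v.tgt ∧ (u.word ++ v.word).IsChain Q.nonrel
    · rw [ofPath_mul_ofPath_pos hc.1 hc.2]
      have hbas : Q.bas k (Q.arr A ++ Q.arrowPath b :: a) ++ Q.ofPath k (u.append v hc.1 hc.2) ::
        Q.bas k c = Q.bas k (Q.arr A ++ Q.arrowPath b :: a ++ u.append v hc.1 hc.2 :: c) := by simp
      rw [hbas, ev_dual]
      cases a with
      | nil =>
        obtain ⟨rfl, rfl⟩ := List.cons.inj h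
        by_contra hne
        obtain ⟨y, hy⟩ := exists_coeffs_ne_zero hne
        obtain ⟨h1, -, x, x', h2, -⟩ := coeffs_dualList_ne hp hpq hy
        have h3 := isChain_words (Q.arr A ++ [Q.arrowPath b] ++ u.append v hc.1 hc.2 :: c)
        simp only [List.map_append, List.map_cons, List.append_assoc, List.singleton_append,
          List.cons_append, List.nil_append, List.map_nil] at h2 h3
        obtain ⟨z, e, e', w, h4, h5, h6⟩ := flatten_adjacent h3 hp h2 (by simpa using h1)
        have h4 : [b] = z ++ [e] := h4
        have : b = e := by
          have := congrArg List.getLast? h4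
          simpa using this
        subst this
        obtain ⟨c', w', hw'⟩ := List.exists_cons_of_ne_nil hZ
        have h5 : u.word ++ v.word = e' :: w := h5
        have h7 := Y.nonzero
        rw [hw'] at h5
        obtain rfl := (List.cons.inj h5).1
        rw [hY, hw'] at h7
        exact (List.isChain_cons_cons.1 h7).1.2 h6
      | cons z a =>
        obtain ⟨rfl, rfl⟩ := List.cons.inj h
        rw [List.append_assoc, List.cons_append, List.cons_append]
        exact dualList_adjacent hp hpq hY
    · rw [ofPath_mul_ofPath_neg hc, (hl _ _).map_zero]
  · intro a u v c h
    have h' : a ++ u :: v :: c = Q.arr (A ++ [b]) := by rw [h]; simp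
    rw [arr_merge_eq_zero hA h', (hl _ _).map_zero, smul_zero]

/-! ### Adapted cochains -/

variable (Q k) in
/-- The normalised cochains whose differential vanishes on the lists of `VanishesUp`; such a cochain
is a cocycle as soon as its differential vanishes on anti-paths. -/
def adapted (d : ℤ) : Submodule k (Coch (Q.Alg k)) where
  carrier := {F | F ∈ cochains (Q.grading k) d ∧ Normal (ev F) ∧
    VanishesUp (ev (diff (Q.grading k) d F))}
  zero_mem' := ⟨Submodule.zero_mem _, fun L y h => absurd rfl h, by
    rw [map_zero]; exact fun _ _ _ _ _ _ _ _ => rfl⟩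
  add_mem' := by
    rintro F G ⟨h1, h2, h3⟩ ⟨h4, h5, h6⟩
    refine ⟨Submodule.add_mem _ h1 h4, h2.add h5, ?_⟩
    intro A b Y Z R hA hY hZ
    rw [map_add, ev_add, h3 A b Y Z R hA hY hZ, h6 A b Y Z R hA hY hZ, add_zero]
  smul_mem' := by
    rintro c F ⟨h1, h2, h3⟩
    refine ⟨Submodule.smul_mem _ _ h1, h2.smul c, ?_⟩
    intro A b Y Z R hA hY hZ
    rw [map_smul, ev_smul, h3 A b Y Z R hA hY hZ, smul_zero]

theorem dual_mem_adapted {p : List E} (hp : p.IsChain Q.rel) {q : Q.NZPath}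
    (hpq : Q.IsWalk q.tgt q.src p) {d : ℤ} (hd : d = p.length + Q.wdeg q.word - Q.wdeg p) :
    Q.dual k p q.word q.src ∈ Q.adapted k d :=
  ⟨dual_mem_cochains hp hpq hd, normal_dual hp hpq, vanishesUp_diff_dual hp hpq hd⟩

variable (Q k) in
/-- The normalised cocycles. -/
def normalCocycles (d : ℤ) : Submodule k (Coch (Q.Alg k)) where
  carrier := {F | F ∈ cocycles (Q.grading k) d ∧ Normal (ev F)}
  zero_mem' := ⟨Submodule.zero_mem _, fun L y h => absurd rfl h⟩
  add_mem' := fun h h' => ⟨Submodule.add_mem _ h.1 h'.1, h.2.add h'.2⟩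
  smul_mem' := fun c _ h => ⟨Submodule.smul_mem _ _ h.1, h.2.smul c⟩

/-- The differential of `F` is itself a normalised cocycle, and it vanishes on the lists of
`VanishesUp` because `F` is adapted. Vanishing on anti-paths then makes it zero by
`Normal.eq_zero_of_vanishes`. -/
theorem mem_normalCocycles_of_adapted {F : Coch (Q.Alg k)} {d : ℤ} (hF : F ∈ Q.adapted k d)
    (h : VanishesAnti (ev (diff (Q.grading k) d F))) : F ∈ Q.normalCocycles k d := by
  obtain ⟨h1, h2, h3⟩ := hF
  have hl := Lin.of_mem_cochains h1
  have h4 : diff (Q.grading k) d F ∈ cochains (Q.grading k) (d + 1) := diff_mem_cochains rfl h1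
  refine ⟨mem_cocycles.2 ⟨h1, coch_ext fun l => ?_⟩, h2⟩
  exact Lin.ext_of_paths (Lin.of_mem_cochains h4) (g := 0)
    (fun x z => ⟨fun _ _ => by simp, fun _ _ => by simp⟩)
    (Normal.eq_zero_of_vanishes (Lin.of_mem_cochains h4) (Normal.diff hl h2 d)
      (diff_diff rfl h1) h3 h) l

theorem bracket_mem_normalCocycles {F G : Coch (Q.Alg k)} {i j l : ℤ} (hl : l = i + j - 1)
    (hF : F ∈ Q.normalCocycles k i) (hG : G ∈ Q.normalCocycles k j) :
    bracket (Q.grading k) i j F G ∈ Q.normalCocycles k l := by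
  refine ⟨bracket_mem_cocycles hl hF.1 hG.1, ?_⟩
  have h1 := Lin.of_mem_cochains (mem_cocycles.1 hF.1).1
  have h2 := Lin.of_mem_cochains (mem_cocycles.1 hG.1).1
  have := Normal.brk (i := i) (j := j) h1 h2 hF.2 hG.2
  rw [ev_bracket]
  exact this

/-- The class of a normalised cocycle is determined by its values on anti-paths; the identities in
cohomology below are verified there. -/
theorem mem_coboundaries_of_normalCocycles {F : Coch (Q.Alg k)} {d : ℤ}
    (hF : F ∈ Q.normalCocycles k d) (h : VanishesAnti (ev F)) :
    F ∈ coboundaries (Q.grading k) d :=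
  mem_coboundaries_of_vanishesAnti (mem_cocycles.1 hF.1).1 (mem_cocycles.1 hF.1).2 hF.2 h

/-- The differential of a cochain on an anti-path. -/
theorem ev_diff_arr {F : Coch (Q.Alg k)} (hl : Lin k (ev F)) (d : ℤ) {a : E} {w : List E}
    (hw : (a :: w).IsChain Q.rel) :
    ev (diff (Q.grading k) d F) (Q.bas k (Q.arr (a :: w))) = sgn k (d - w.length) •
      (sgn k ((d - w.length) * Q.deg a) •
        (Q.ofPath k (Q.arrowPath a) * ev F (Q.bas k (Q.arr w))) +
      sgn k (w.length + 1) • (ev F (Q.bas k (Q.arr (a :: w).dropLast)) *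
        Q.ofPath k (Q.arrowPath ((a :: w).getLast (List.cons_ne_nil _ _))))) := by
  have e1 : (Q.arrowPath a :: Q.arr w).dropLast = Q.arr (a :: w).dropLast := by
    rw [← List.map_cons]
    exact List.map_dropLast.symm
  have e2 : (Q.arrowPath a :: Q.arr w).getLast (List.cons_ne_nil _ _) =
      Q.arrowPath ((a :: w).getLast (List.cons_ne_nil _ _)) :=
    List.getLast_map (f := Q.arrowPath) (l := a :: w) (by simp)
  rw [arr, List.map_cons, ev_diff_paths, e1, e2, mergeSum_eq_zero, add_zero, List.length_map]
  · simp [arrowPath, wdeg]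
  · intro x u v c hx
    rw [arr_merge_eq_zero hw hx, (hl _ _).map_zero, smul_zero]

end GradedGentleQuiver
end

noncomputable section

open GradedHochschild

namespace GradedGentleQuiver

variable {V E : Type*} {Q : GradedGentleQuiver V E} {k : Type*} [Field k] [Fintype V]

/-! ### Coefficients of values on anti-paths -/

/-- The path `y` is the product of the arrow `a` and the path `z`. -/
def IsLeft (a : E) (z y : Q.NZPath) : Prop :=
  y.word = a :: z.word ∧ y.src = z.src ∧ z.tgt = Q.src a

/-- The path `y` is the product of the path `z` and the arrow `b`. -/
def IsRight (b : E) (z y : Q.NZPath) : Prop :=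
  y.word = z.word ++ [b] ∧ y.tgt = z.tgt ∧ z.src = Q.tgt b

theorem exists_isLeft {a : E} {y : Q.NZPath} (h : y.word.head? = some a) : ∃ z, IsLeft a z y := by
  obtain ⟨w, hw⟩ : ∃ w, y.word = a :: w := by
    cases h' : y.word with
    | nil => simp [h'] at h
    | cons b w => simp [h'] at h; exact ⟨w, by rw [h]⟩
  obtain ⟨z, h1, h2, h3⟩ := y.exists_tail hw
  exact ⟨z, by rw [hw, h1], h3.symm, h2⟩

theorem exists_isRight {b : E} {y : Q.NZPath} (h : y.word.getLast? = some b) :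
    ∃ z, IsRight b z y := by
  obtain ⟨w, hw⟩ : ∃ w, y.word = w ++ [b] := by
    obtain ⟨w, hw⟩ := List.getLast?_eq_some_iff.1 h
    exact ⟨w, hw⟩
  have h1 := y.walk
  have h2 := y.nonzero
  rw [hw] at h1 h2
  obtain ⟨r, h3, h4⟩ := IsWalk.of_append h1
  exact ⟨⟨y.tgt, r, w, h3, h2.left_of_append⟩, hw, rfl, h4.1.symm⟩

theorem IsLeft.tgt {a : E} {z y : Q.NZPath} (h : IsLeft a z y) : y.tgt = Q.tgt a :=
  NZPath.tgt_eq h.1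

theorem IsRight.src {b : E} {z y : Q.NZPath} (h : IsRight b z y) : y.src = Q.src b := by
  have h1 := y.walk
  rw [h.1] at h1
  obtain ⟨r, h3, h4⟩ := IsWalk.of_append h1
  exact h4.2.symm

theorem IsLeft.left_unique {a : E} {z z' y : Q.NZPath} (h : IsLeft a z y) (h' : IsLeft a z' y) :
    z = z' :=
  NZPath.ext_of_tgt (List.cons.inj (h.1.symm.trans h'.1)).2 (h.2.2.trans h'.2.2.symm)

theorem IsLeft.right_unique {a : E} {z y y' : Q.NZPath} (h : IsLeft a z y) (h' : IsLeft a z y') :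
    y = y' :=
  NZPath.ext_of_src (h.1.trans h'.1.symm) (h.2.1.trans h'.2.1.symm)

theorem IsRight.left_unique {b : E} {z z' y : Q.NZPath} (h : IsRight b z y) (h' : IsRight b z' y) :
    z = z' :=
  NZPath.ext_of_src (List.append_cancel_right (h.1.symm.trans h'.1)) (h.2.2.trans h'.2.2.symm)

theorem IsRight.right_unique {b : E} {z y y' : Q.NZPath} (h : IsRight b z y)
    (h' : IsRight b z y') : y = y' :=
  NZPath.ext_of_tgt (h.1.trans h'.1.symm) (h.2.1.trans h'.2.1.symm)

theorem isWalk_of_pathSeq_arr {t s : V} {w : List E} (h : Q.PathSeq t s (Q.arr w)) :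
    Q.IsWalk t s w := by
  induction w generalizing t with
  | nil => exact h
  | cons a w ih => exact ⟨h.1, ih h.2.2⟩

theorem coeffs_arrow_mul {a : E} {z y : Q.NZPath} (h : IsLeft a z y) (x : Q.Alg k) :
    Q.coeffs (Q.ofPath k (Q.arrowPath a) * x) y = Q.coeffs x z :=
  coeffs_ofPath_mul x h.2.2.symm h.tgt h.1 h.2.1

theorem coeffs_mul_arrow {b : E} {z y : Q.NZPath} (h : IsRight b z y) (x : Q.Alg k) :
    Q.coeffs (x * Q.ofPath k (Q.arrowPath b)) y = Q.coeffs x z :=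
  coeffs_mul_ofPath x h.2.2 h.2.1 h.1 h.src

theorem coeffs_arrow_mul_eq_zero {a : E} {y : Q.NZPath} (h : y.word.head? ≠ some a) (x : Q.Alg k) :
    Q.coeffs (Q.ofPath k (Q.arrowPath a) * x) y = 0 := by
  by_contra hne
  obtain ⟨z, -, -, -, -, h5⟩ := coeffs_ofPath_mul_ne hne
  exact h (by rw [h5]; rfl)

theorem coeffs_mul_arrow_eq_zero {b : E} {y : Q.NZPath} (h : y.word.getLast? ≠ some b)
    (x : Q.Alg k) : Q.coeffs (x * Q.ofPath k (Q.arrowPath b)) y = 0 := by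
  by_contra hne
  obtain ⟨z, -, -, -, -, h5⟩ := coeffs_mul_ofPath_ne hne
  exact h (by rw [h5]; simp [arrowPath])

/-- The coefficient of the value of a cochain on an anti-path. -/
def coef (F : Coch (Q.Alg k)) (w : List E) (y : Q.NZPath) : k :=
  Q.coeffs (ev F (Q.bas k (Q.arr w))) y

theorem coef_sub (F G : Coch (Q.Alg k)) (w : List E) (y : Q.NZPath) :
    coef (F - G) w y = coef F w y - coef G w y := rfl

theorem coef_smul (c : k) (F : Coch (Q.Alg k)) (w : List E) (y : Q.NZPath) :
    coef (c • F) w y = c * coef F w y := rfl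

theorem coef_sum {ι : Type*} (s : Finset ι) (F : ι → Coch (Q.Alg k)) (w : List E) (y : Q.NZPath) :
    coef (∑ i ∈ s, F i) w y = ∑ i ∈ s, coef (F i) w y := by
  rw [coef, ev_sum, coeffs_sum, Finset.sum_apply']
  rfl

theorem vanishesAnti_of_coef {F : Coch (Q.Alg k)}
    (h : ∀ w : List E, w.IsChain Q.rel → ∀ y, coef F w y = 0) : VanishesAnti (ev F) :=
  fun w hw => alg_ext fun y => h w hw y

open scoped Classical in
theorem coef_dual (p : List E) (q : Q.NZPath) (w : List E) (y : Q.NZPath) :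
    coef (Q.dual k p q.word q.src) w y = if p = w ∧ q = y then 1 else 0 := by
  rw [coef, ev_dual, dualList_arr]
  by_cases h : p = w
  · rw [if_pos h, coeffs_ofPath, Finsupp.single_apply]
    simp [h]
  · rw [if_neg h, if_neg fun h' => h h'.1]
    rfl

theorem coef_diff {F : Coch (Q.Alg k)} (hl : Lin k (ev F)) (d : ℤ) {a b : E} {w v : List E}
    (hw : (a :: w).IsChain Q.rel) (hv : a :: w = v ++ [b]) (y : Q.NZPath) :
    coef (diff (Q.grading k) d F) (a :: w) y = sgn k (d - w.length) *
      (sgn k ((d - w.length) * Q.deg a) * Q.coeffs (Q.ofPath k (Q.arrowPath a) *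
        ev F (Q.bas k (Q.arr w))) y +
      sgn k (w.length + 1) * Q.coeffs (ev F (Q.bas k (Q.arr v)) *
        Q.ofPath k (Q.arrowPath b)) y) := by
  have h1 : (a :: w).dropLast = v := by rw [hv, List.dropLast_concat]
  have h2 : (a :: w).getLast (List.cons_ne_nil _ _) = b := by simp [hv]
  rw [coef, ev_diff_arr hl d hw, h1, h2]
  rfl

/-- Cochains with prescribed arities. -/
def glue (F : ℕ → Coch (Q.Alg k)) : Coch (Q.Alg k) := fun n => F n n

theorem glue_mem_adapted {F : ℕ → Coch (Q.Alg k)} {d : ℤ} (h : ∀ n, F n ∈ Q.adapted k d) :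
    glue F ∈ Q.adapted k d := by
  refine ⟨fun n => (h n).1 n, fun L y hy => (h _).2.1 L y hy, ?_⟩
  intro A b Y Z R hA hY hZ
  have h1 := (h (A.length + R.length + 1)).2.2 A b Y Z R hA hY hZ
  rw [← h1]
  have h2 : (Q.bas k (Q.arr A ++ Q.arrowPath b :: Z :: R)).length = A.length + R.length + 1 + 1 := by
    simp; omega
  generalize Q.bas k (Q.arr A ++ Q.arrowPath b :: Z :: R) = l at h2 ⊢
  cases l with
  | nil => simp at h2
  | cons x l =>
    have h3 : l.length = A.length + R.length + 1 := by simpa using h2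
    rw [← h3]
    rfl

theorem coef_glue (F : ℕ → Coch (Q.Alg k)) (w : List E) (y : Q.NZPath) :
    coef (glue F) w y = coef (F w.length) w y := by
  have h : (Q.bas k (Q.arr w)).length = w.length := by simp
  change Q.coeffs (ev (F (Q.bas k (Q.arr w)).length) (Q.bas k (Q.arr w))) y = _
  rw [h]
  rfl

/-- There are adapted cochains with arbitrary values on anti-paths. -/
theorem exists_adapted [Fintype E] (d : ℤ) (c : List E → Q.Alg k)
    (hc : ∀ w y, Q.coeffs (c w) y ≠ 0 → w.IsChain Q.rel ∧ Q.IsWalk y.tgt y.src w ∧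
      Q.wdeg y.word = Q.wdeg w + (d - w.length)) :
    ∃ G ∈ Q.adapted k d, ∀ w y, coef G w y = Q.coeffs (c w) y := by
  classical
  have hfin : ∀ n, {w : List E | w.length = n}.Finite := fun n => List.finite_length_eq E n
  -- There are finitely many words of each length but possibly infinitely many lengths, so the
  -- linear combinations are formed in each arity separately and then glued.
  refine ⟨glue fun n => ∑ w ∈ (hfin n).toFinset, ∑ y ∈ (Q.coeffs (c w)).support,
    Q.coeffs (c w) y • Q.dual k w y.word y.src, glue_mem_adapted fun n => ?_, fun w z => ?_⟩
  · refine Submodule.sum_mem _ fun w _ => Submodule.sum_mem _ fun y hy => Submodule.smul_mem _ _ ?_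
    obtain ⟨h1, h2, h3⟩ := hc w y (by simpa using hy)
    exact dual_mem_adapted h1 h2 (by rw [h3]; ring)
  · rw [coef_glue, coef_sum, Finset.sum_eq_single w]
    · rw [coef_sum]
      simp only [coef_smul, coef_dual, true_and]
      rw [Finset.sum_eq_single z]
      · simp
      · intro y _ hy
        simp [hy]
      · intro hz
        simpa using hz
    · intro w' _ hw'
      rw [coef_sum]
      refine Finset.sum_eq_zero fun y _ => ?_
      simp [coef_smul, coef_dual, hw']
    · intro h
      simp at h

theorem normalCocycles.coef_ne {F : Coch (Q.Alg k)} {d : ℤ} (hF : F ∈ Q.normalCocycles k d)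
    {w : List E} {y : Q.NZPath} (h : coef F w y ≠ 0) :
    Q.IsWalk y.tgt y.src w ∧ Q.wdeg y.word = Q.wdeg w + (d - w.length) := by
  refine ⟨isWalk_of_pathSeq_arr (hF.2 _ _ h), ?_⟩
  have := wdeg_eq_of_mem_grading (Hom.mem_paths (mem_cocycles.1 hF.1).1 _) h
  rwa [flatten_arr, List.length_map] at this

/-- The cocycle condition on an anti-path. -/
theorem normalCocycles.coef_eq {F : Coch (Q.Alg k)} {d : ℤ} (hF : F ∈ Q.normalCocycles k d)
    {a b : E} {w v : List E} (hw : (a :: w).IsChain Q.rel) (hv : a :: w = v ++ [b])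
    (y : Q.NZPath) :
    sgn k ((d - w.length) * Q.deg a) * Q.coeffs (Q.ofPath k (Q.arrowPath a) *
        ev F (Q.bas k (Q.arr w))) y +
      sgn k (w.length + 1) * Q.coeffs (ev F (Q.bas k (Q.arr v)) *
        Q.ofPath k (Q.arrowPath b)) y = 0 := by
  have h := mem_cocycles.1 hF.1
  have h1 := coef_diff (Lin.of_mem_cochains h.1) d hw hv y
  rw [h.2] at h1
  have h1 : (0 : k) = _ := h1
  exact (mul_eq_zero.1 h1.symm).resolve_left (sgn_ne_zero k _)

end GradedGentleQuiver
end

noncomputable section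

open GradedHochschild

namespace GradedGentleQuiver

variable {V E : Type*} {Q : GradedGentleQuiver V E} {k : Type*} [Field k] [Fintype V]

/-! ### Cocycles supported on pairs with a common first or last arrow -/

open scoped Classical in
/-- The element whose coefficient at `z` is that of `x` at `y`, if `r z y`. -/
def pull (r : Q.NZPath → Q.NZPath → Prop) (x : Q.Alg k) : Q.Alg k :=
  ∑ y ∈ (Q.coeffs x).support,
    if h : ∃ z, r z y then Q.coeffs x y • Q.ofPath k h.choose else 0

theorem coeffs_pull_ne {r : Q.NZPath → Q.NZPath → Prop} {x : Q.Alg k} {z : Q.NZPath}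
    (h : Q.coeffs (pull r x) z ≠ 0) : ∃ y, r z y ∧ Q.coeffs x y ≠ 0 := by
  rw [pull, coeffs_sum, Finset.sum_apply'] at h
  obtain ⟨y, hy, hy'⟩ := Finset.exists_ne_zero_of_sum_ne_zero h
  split_ifs at hy' with h1
  · obtain rfl := coeffs_ofPath_ne (coeffs_smul_ne hy')
    exact ⟨y, h1.choose_spec, by simpa using hy⟩
  · exact absurd rfl hy'

theorem coeffs_pull {r : Q.NZPath → Q.NZPath → Prop} (hl : ∀ z z' y, r z y → r z' y → z = z')
    (hr : ∀ z y y', r z y → r z y' → y = y') (x : Q.Alg k) {z y : Q.NZPath} (h : r z y) :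
    Q.coeffs (pull r x) z = Q.coeffs x y := by
  rw [pull, coeffs_sum, Finset.sum_apply', Finset.sum_eq_single y]
  · have hex : ∃ z, r z y := ⟨z, h⟩
    rw [dif_pos hex, ← hl _ _ _ h hex.choose_spec, coeffs_smul, Finsupp.smul_apply,
      coeffs_ofPath_self, smul_eq_mul, mul_one]
  · intro y' _ hy'
    split_ifs with h1
    · rw [coeffs_smul, Finsupp.smul_apply]
      by_contra hne
      have := coeffs_ofPath_ne (right_ne_zero_of_smul hne)
      exact hy' (hr z y' y (this ▸ h1.choose_spec) h)
    · rfl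
  · intro hy
    have h0 : Q.coeffs x y = 0 := by simpa using hy
    rw [h0]
    split_ifs
    · rw [zero_smul]; rfl
    · rfl

/-- The words are non-empty with the same first or the same last letter; if both agree, they have
length at least two. -/
def Strip (w y : List E) : Prop :=
  w ≠ [] ∧ y ≠ [] ∧ (w.head? = y.head? ∨ w.getLast? = y.getLast?) ∧
    (w.head? = y.head? → w.getLast? = y.getLast? → w.length ≠ 1 ∧ y.length ≠ 1)

variable (Q) in
/-- Both the anti-path `w` and the path `y` can be prolonged by the same arrow on the left, and the
results end with different arrows. -/
def Prolongs (w : List E) (y : Q.NZPath) : Prop :=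
  ∃ (a : E) (z : Q.NZPath), (a :: w).IsChain Q.rel ∧ IsLeft a y z ∧
    (a :: w).getLast? ≠ z.word.getLast?

theorem exists_concat {a : E} {w : List E} : ∃ v b, a :: w = v ++ [b] := by
  rcases List.eq_nil_or_concat (a :: w) with h | ⟨v, b, h⟩
  · simp at h
  · exact ⟨v, b, by simpa using h⟩

/-- In the cocycle condition at the prolonged pair the right term vanishes because the last arrows
differ, so the left term, which is the given coefficient up to sign, vanishes too. -/
theorem normalCocycles.coef_eq_zero {F : Coch (Q.Alg k)} {d : ℤ} (hF : F ∈ Q.normalCocycles k d)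
    {w : List E} {y : Q.NZPath} (h : Q.Prolongs w y) : coef F w y = 0 := by
  obtain ⟨a, z, h1, h2, h3⟩ := h
  obtain ⟨v, b, hv⟩ := exists_concat (a := a) (w := w)
  have h4 := normalCocycles.coef_eq hF h1 hv z
  rw [coeffs_arrow_mul h2, coeffs_mul_arrow_eq_zero, mul_zero, add_zero] at h4
  · exact (mul_eq_zero.1 h4).resolve_left (sgn_ne_zero k _)
  · rw [hv] at h3
    intro h
    exact h3 (by simp [h])

/-- Gentleness determines the prolonging arrow from the anti-path if that is not trivial, and
otherwise from the path. Only a pair of trivial words leaves a choice. -/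
theorem left_prolongation_unique {a b : E} {w : List E} {z y y' : Q.NZPath}
    (ha : (a :: w).IsChain Q.rel) (hb : (b :: w).IsChain Q.rel) (hy : IsLeft a z y)
    (hy' : IsLeft b z y') : a = b ∨ (w = [] ∧ z.word = []) := by
  cases w with
  | cons c w =>
    exact Or.inl (Q.rel_left_unique _ _ _ (List.isChain_cons_cons.1 ha).1
      (List.isChain_cons_cons.1 hb).1)
  | nil =>
    cases hz : z.word with
    | nil => exact Or.inr ⟨rfl, rfl⟩
    | cons c w =>
      left
      have h1 := y.nonzero
      have h2 := y'.nonzero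
      rw [hy.1, hz] at h1
      rw [hy'.1, hz] at h2
      have h1 := (List.isChain_cons_cons.1 h1).1
      have h2 := (List.isChain_cons_cons.1 h2).1
      exact Q.nonrel_left_unique c _ _ h1.1 h1.2 h2.1 h2.2

theorem right_prolongation_unique {a b : E} {w : List E} {z y y' : Q.NZPath}
    (ha : (w ++ [a]).IsChain Q.rel) (hb : (w ++ [b]).IsChain Q.rel) (hy : IsRight a z y)
    (hy' : IsRight b z y') : a = b ∨ (w = [] ∧ z.word = []) := by
  rcases List.eq_nil_or_concat w with rfl | ⟨w, c, rfl⟩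
  · rcases List.eq_nil_or_concat z.word with hz | ⟨v, c, hz⟩
    · exact Or.inr ⟨rfl, hz⟩
    · left
      have h1 := y.nonzero
      have h2 := y'.nonzero
      rw [hy.1, hz] at h1
      rw [hy'.1, hz] at h2
      simp only [List.concat_eq_append, List.append_assoc, List.singleton_append] at h1 h2
      have h1 := (List.isChain_cons_cons.1 h1.right_of_append).1
      have h2 := (List.isChain_cons_cons.1 h2.right_of_append).1
      exact Q.nonrel_right_unique c _ _ h1.1 h1.2 h2.1 h2.2
  · simp only [List.concat_eq_append, List.append_assoc, List.singleton_append] at ha hb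
    exact Or.inl (Q.rel_right_unique _ _ _ (List.isChain_cons_cons.1 ha.right_of_append).1
      (List.isChain_cons_cons.1 hb.right_of_append).1)

theorem diff_mem_normalCocycles {G : Coch (Q.Alg k)} {d e : ℤ} (he : e = d + 1)
    (hG : G ∈ Q.adapted k d) : diff (Q.grading k) d G ∈ Q.normalCocycles k e :=
  ⟨mem_cocycles.2 ⟨diff_mem_cochains he hG.1, diff_diff he hG.1⟩,
    Normal.diff (Lin.of_mem_cochains hG.1) hG.2.1 d⟩

variable [Fintype E]

open scoped Classical in
/-- A cochain which strips the common first arrow of anti-paths and paths. -/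
theorem exists_stripLeft {F : Coch (Q.Alg k)} {d : ℤ} (hF : F ∈ Q.normalCocycles k d) :
    ∃ G ∈ Q.adapted k (d - 1), ∀ w y, coef G w y =
      ∑ a : E, if (a :: w).IsChain Q.rel then
        sgn k (d - 1 - w.length) * sgn k ((d - 1 - w.length) * Q.deg a) *
          Q.coeffs (pull (IsLeft a) (ev F (Q.bas k (Q.arr (a :: w))))) y else 0 := by
  obtain ⟨G, hG, h⟩ := exists_adapted (Q := Q) (d - 1) (fun w => ∑ a : E,
    if (a :: w).IsChain Q.rel then (sgn k (d - 1 - w.length) * sgn k ((d - 1 - w.length) * Q.deg a)) •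
      pull (IsLeft a) (ev F (Q.bas k (Q.arr (a :: w)))) else 0) (by
    intro w y hy
    rw [coeffs_sum, Finset.sum_apply'] at hy
    obtain ⟨a, -, ha⟩ := Finset.exists_ne_zero_of_sum_ne_zero hy
    split_ifs at ha with hc
    · obtain ⟨y', h1, h2⟩ := coeffs_pull_ne (coeffs_smul_ne ha)
      obtain ⟨h3, h4⟩ := normalCocycles.coef_ne hF (w := a :: w) h2
      refine ⟨hc.tail, ?_, ?_⟩
      · rw [h1.2.2, ← h1.2.1]
        exact h3.2
      · rw [h1.1] at h4
        simp only [wdeg, List.map_cons, List.sum_cons, List.length_cons] at h4 ⊢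
        push_cast at h4
        linarith
    · exact absurd rfl ha)
  refine ⟨G, hG, fun w y => ?_⟩
  rw [h, coeffs_sum, Finset.sum_apply']
  refine Finset.sum_congr rfl fun a _ => ?_
  split_ifs <;> rfl

open scoped Classical in
/-- A cochain which strips the common last arrow of anti-paths and paths. -/
theorem exists_stripRight {F : Coch (Q.Alg k)} {d : ℤ} (hF : F ∈ Q.normalCocycles k d) :
    ∃ G ∈ Q.adapted k (d - 1), ∀ w y, coef G w y =
      ∑ b : E, if (w ++ [b]).IsChain Q.rel then
        sgn k (d - 1 - w.length) * sgn k (w.length + 1) *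
          Q.coeffs (pull (IsRight b) (ev F (Q.bas k (Q.arr (w ++ [b]))))) y else 0 := by
  obtain ⟨G, hG, h⟩ := exists_adapted (Q := Q) (d - 1) (fun w => ∑ b : E,
    if (w ++ [b]).IsChain Q.rel then (sgn k (d - 1 - w.length) * sgn k (w.length + 1)) •
      pull (IsRight b) (ev F (Q.bas k (Q.arr (w ++ [b])))) else 0) (by
    intro w y hy
    rw [coeffs_sum, Finset.sum_apply'] at hy
    obtain ⟨a, -, ha⟩ := Finset.exists_ne_zero_of_sum_ne_zero hy
    split_ifs at ha with hc
    · obtain ⟨y', h1, h2⟩ := coeffs_pull_ne (coeffs_smul_ne ha)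
      obtain ⟨h3, h4⟩ := normalCocycles.coef_ne hF (w := w ++ [a]) h2
      refine ⟨hc.left_of_append, ?_, ?_⟩
      · obtain ⟨r, h5, h6⟩ := IsWalk.of_append h3
        rw [h1.2.2, ← h1.2.1, h6.1]
        exact h5
      · rw [h1.1, wdeg_append, wdeg_append, List.length_append] at h4
        push_cast at h4
        simp at h4
        linarith
    · exact absurd rfl ha)
  refine ⟨G, hG, fun w y => ?_⟩
  rw [h, coeffs_sum, Finset.sum_apply']
  refine Finset.sum_congr rfl fun a _ => ?_
  split_ifs <;> rfl

/-- A normalised cocycle all of whose coefficients on anti-paths are at pairs with a common first or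
last arrow, or at pairs with a common prolongation on the left, is a coboundary. -/
theorem mem_coboundaries_of_strip {F : Coch (Q.Alg k)} {d : ℤ} (hF : F ∈ Q.normalCocycles k d)
    (h : ∀ w : List E, w.IsChain Q.rel → ∀ y, coef F w y ≠ 0 → Strip w y.word ∨ Q.Prolongs w y) :
    F ∈ coboundaries (Q.grading k) d := by
  classical
  have hS : ∀ w : List E, w.IsChain Q.rel → ∀ y, coef F w y ≠ 0 → Strip w y.word :=
    fun w hw y hy => (h w hw y hy).resolve_right fun h' => hy (normalCocycles.coef_eq_zero hF h')
  -- The length clause of `Strip` excludes the pairs `([a], y)` with `y` beginning and ending with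
  -- `a`, in particular `([a], [a])`. This makes stripping unambiguous even where it leads to
  -- trivial words.
  have hS0 : ∀ (a : E) (z y : Q.NZPath), IsLeft a z y → y.word.getLast? = some a →
      coef F [a] y = 0 := by
    intro a z y hy hl
    by_contra hne
    exact ((hS [a] (by simp) y hne).2.2.2 (by simp [hy.1]) (by simp [hl])).1 rfl
  obtain ⟨G, hG, hGc⟩ := exists_stripLeft hF
  have hGl := Lin.of_mem_cochains hG.1
  have hdG := diff_mem_normalCocycles (e := d) (by ring) hG
  set F₁ := F - diff (Q.grading k) (d - 1) G with hF₁
  have hF₁c : F₁ ∈ Q.normalCocycles k d := Submodule.sub_mem _ hF hdG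
  -- the values of `G`
  have hGne : ∀ w y, coef G w y ≠ 0 → ∃ a y', (a :: w).IsChain Q.rel ∧ IsLeft a y y' ∧
      coef F (a :: w) y' ≠ 0 := by
    intro w y hy
    rw [hGc] at hy
    obtain ⟨a, -, ha⟩ := Finset.exists_ne_zero_of_sum_ne_zero hy
    split_ifs at ha with hc
    · obtain ⟨y', h1, h2⟩ := coeffs_pull_ne (right_ne_zero_of_mul ha)
      exact ⟨a, y', hc, h1, h2⟩
    · exact absurd rfl ha
  have hGv : ∀ (a : E) w z y, (a :: w).IsChain Q.rel → IsLeft a z y → coef G w z =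
      sgn k (d - 1 - w.length) * sgn k ((d - 1 - w.length) * Q.deg a) * coef F (a :: w) y := by
    intro a w z y hw hy
    rw [hGc, Finset.sum_eq_single a]
    · rw [if_pos hw, coeffs_pull (r := IsLeft a) (fun _ _ _ => IsLeft.left_unique)
        (fun _ _ _ => IsLeft.right_unique) _ hy]
      rfl
    · intro b _ hb
      split_ifs with hc
      · refine mul_eq_zero_of_right _ ?_
        by_contra hne
        obtain ⟨y', h1, h2⟩ := coeffs_pull_ne hne
        obtain rfl | ⟨rfl, hz⟩ := left_prolongation_unique hc hw h1 hy
        · exact hb rfl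
        · exact h2 (hS0 b z y' h1 (by simp [h1.1, hz]))
      · rfl
    · simp
  -- `F₁` vanishes at pairs with the same first arrow
  have hA : ∀ (a : E) w z y, (a :: w).IsChain Q.rel → IsLeft a z y → coef F₁ (a :: w) y = 0 := by
    intro a w z y hw hy
    obtain ⟨v, b, hv⟩ := exists_concat (a := a) (w := w)
    rw [hF₁, coef_sub, coef_diff hGl _ hw hv, coeffs_arrow_mul hy]
    have h1 : Q.coeffs (ev G (Q.bas k (Q.arr v)) * Q.ofPath k (Q.arrowPath b)) y = 0 := by
      by_contra hne
      have hlast : y.word.getLast? = some b := by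
        by_contra hl
        exact hne (coeffs_mul_arrow_eq_zero hl _)
      obtain ⟨y2, hy2⟩ := exists_isRight hlast
      rw [coeffs_mul_arrow hy2] at hne
      obtain ⟨c, y3, h2, h3, h4⟩ := hGne v y2 hne
      cases v with
      | nil =>
        obtain ⟨rfl, rfl⟩ := List.cons.inj hv
        cases hw2 : y2.word with
        | nil => exact h4 (hS0 c y2 y3 h3 (by simp [h3.1, hw2]))
        | cons g t =>
          have h5 : g = a := by
            have := hy2.1.symm.trans hy.1
            rw [hw2] at this
            exact (List.cons.inj this).1
          subst h5
          obtain ⟨v', g', hv'⟩ := exists_concat (a := g) (w := t)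
          have h6 := y.nonzero
          have h7 := y3.nonzero
          rw [hy2.1, hw2, hv', List.append_assoc, List.singleton_append] at h6
          rw [h3.1, hw2] at h7
          have h6 := (List.isChain_cons_cons.1 h6.right_of_append).1
          have h7 := (List.isChain_cons_cons.1 h7).1
          have h8 := Q.nonrel_left_unique g _ _ h6.1 h6.2 h7.1 h7.2
          subst h8
          refine h4 (hS0 _ y2 y3 h3 ?_)
          rw [h3.1, hw2, hv']
          rw [← List.cons_append, List.getLast?_concat]
      | cons a' v =>
        obtain ⟨rfl, hv2⟩ := List.cons.inj hv
        have h5 := (List.isChain_cons_cons.1 h2).1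
        cases hw2 : y2.word with
        | nil =>
          have h6 : b = a := by
            have := hy2.1.symm.trans hy.1
            rw [hw2] at this
            exact (List.cons.inj this).1
          subst h6
          obtain ⟨v', g', hv'⟩ := exists_concat (a := b) (w := v)
          rw [hv, hv', List.append_assoc, List.singleton_append] at hw
          have h7 := (List.isChain_cons_cons.1 hw.right_of_append).1
          have h8 := Q.rel_left_unique _ _ _ h7 h5
          subst h8
          refine ((hS _ h2 y3 h4).2.2.2 (by simp [h3.1]) ?_).2 (by simp [h3.1, hw2])
          rw [hv', ← List.cons_append, List.getLast?_concat, h3.1, hw2]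
          rfl
        | cons g t =>
          have h6 : g = a := by
            have := hy2.1.symm.trans hy.1
            rw [hw2] at this
            exact (List.cons.inj this).1
          subst h6
          have h7 := y3.nonzero
          rw [h3.1, hw2] at h7
          exact (List.isChain_cons_cons.1 h7).1.2 h5
    have h2 : Q.coeffs (ev G (Q.bas k (Q.arr w))) z = coef G w z := rfl
    rw [h1, mul_zero, add_zero, h2, hGv a w z y hw hy, sub_eq_zero]
    have e1 := sgn_mul_self k (d - 1 - w.length)
    have e2 := sgn_mul_self k ((d - 1 - w.length) * Q.deg a)
    linear_combination (- coef F (a :: w) y) * e1 -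
      coef F (a :: w) y * sgn k (d - 1 - w.length) * sgn k (d - 1 - w.length) * e2
  have hd0 : ∀ (G : Coch (Q.Alg k)) e y, coef (diff (Q.grading k) e G) [] y = 0 := by
    intro G e y
    unfold coef
    rw [arr, List.map_nil, bas, List.map_nil, ev_diff_nil]
    rfl
  -- After this correction only pairs with different first arrows and the same last arrow are left.
  have hF₁S : ∀ w : List E, w.IsChain Q.rel → ∀ y, coef F₁ w y ≠ 0 →
      w.head? ≠ y.word.head? ∧ w.getLast? = y.word.getLast? ∧ w ≠ [] := by
    intro w hw y hy
    cases w with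
    | nil =>
      rw [hF₁, coef_sub, hd0, sub_zero] at hy
      exact absurd rfl (hS _ hw y hy).1
    | cons a w =>
      have h1 : y.word.head? ≠ some a := by
        intro h1
        obtain ⟨z, hz⟩ := exists_isLeft h1
        exact hy (hA a w z y hw hz)
      refine ⟨fun h => h1 h.symm, ?_, by simp⟩
      by_contra hl
      obtain ⟨v, b, hv⟩ := exists_concat (a := a) (w := w)
      refine hy ?_
      have h2 : coef F (a :: w) y = 0 := by
        by_contra hne
        rcases (hS _ hw y hne).2.2.1 with h | h
        · exact h1 h.symm
        · exact hl h
      rw [hF₁, coef_sub, h2, coef_diff hGl _ hw hv, coeffs_arrow_mul_eq_zero h1,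
        coeffs_mul_arrow_eq_zero]
      · simp
      · rw [hv] at hl
        intro h
        exact hl (by rw [h]; simp)
  -- If an arrow `a` prolonged both `v` and `z`, it would also prolong `vb` and `zb`, since these
  -- have different first arrows. The cocycle condition there would equate the coefficient, up to
  -- sign, with one already killed by `hA`. Hence stripping the last arrow creates no new left
  -- terms.
  have hB : ∀ (b : E) v z y, (v ++ [b]).IsChain Q.rel → IsRight b z y → coef F₁ (v ++ [b]) y ≠ 0 →
      ∀ a z', (a :: v).IsChain Q.rel → ¬ IsLeft a z z' := by
    intro b v z y hw hy hne a z' hav hz'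
    have h1 := (hF₁S _ hw y hne).1
    have hwalk := (normalCocycles.coef_ne hF₁c hne).1
    have hch : (a :: (v ++ [b])).IsChain Q.rel := by
      cases v with
      | cons c v =>
        exact List.isChain_cons_cons.2 ⟨(List.isChain_cons_cons.1 hav).1, hw⟩
      | nil =>
        refine List.isChain_cons_cons.2 ⟨?_, by simp⟩
        by_contra hr
        cases hzw : z.word with
        | nil => exact h1 (by simp [hy.1, hzw])
        | cons g t =>
          have h2 := z'.nonzero
          rw [hz'.1, hzw] at h2
          have h2 := (List.isChain_cons_cons.1 h2).1
          have h3 : Q.src a = Q.tgt b := by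
            rw [← hz'.2.2, ← hy.2.1]
            exact hwalk.1.symm
          have h4 := Q.nonrel_right_unique a _ _ h2.1 h2.2 h3 hr
          exact h1 (by simp [hy.1, hzw, h4])
    have hch' : (a :: y.word).IsChain Q.nonrel := by
      cases hzw : z.word with
      | cons g t =>
        have h2 := z'.nonzero
        have h3 := y.nonzero
        rw [hz'.1, hzw] at h2
        rw [hy.1, hzw] at h3 ⊢
        exact List.isChain_cons_cons.2 ⟨(List.isChain_cons_cons.1 h2).1, h3⟩
      | nil =>
        have h5 : y.word = [b] := by simp [hy.1, hzw]
        rw [h5]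
        refine List.isChain_cons_cons.2 ⟨⟨?_, fun hr => ?_⟩, by simp⟩
        · rw [← hz'.2.2, ← hy.2.2]
          exact NZPath.src_eq_tgt_of_word_eq_nil hzw
        · cases v with
          | nil => exact h1 (by simp [h5])
          | cons c v =>
            have h6 := Q.rel_right_unique a _ _ hr (List.isChain_cons_cons.1 hav).1
            exact h1 (by simp [h5, h6])
    have hyt : y.tgt = Q.src a := hy.2.1.trans hz'.2.2
    let x : Q.NZPath := ⟨Q.tgt a, y.src, a :: y.word, ⟨rfl, hyt ▸ y.walk⟩, hch'⟩
    have hx : IsLeft a y x := ⟨rfl, rfl, hyt⟩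
    have hx' : IsRight b z' x := ⟨by simp [x, hy.1, hz'.1], hz'.tgt.symm, by
      rw [hz'.2.1]; exact hy.2.2⟩
    have h2 := normalCocycles.coef_eq hF₁c hch (v := a :: v) (b := b) rfl x
    rw [coeffs_arrow_mul hx, coeffs_mul_arrow hx'] at h2
    have h3 : Q.coeffs (ev F₁ (Q.bas k (Q.arr (a :: v)))) z' = 0 := hA a v z z' hav hz'
    rw [h3, mul_zero, add_zero] at h2
    exact hne ((mul_eq_zero.1 h2).resolve_left (sgn_ne_zero k _))
  obtain ⟨G', hG', hGc'⟩ := exists_stripRight hF₁c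
  have hGl' := Lin.of_mem_cochains hG'.1
  have hdG' := diff_mem_normalCocycles (e := d) (by ring) hG'
  have key : VanishesAnti (ev (F₁ - diff (Q.grading k) (d - 1) G')) := by
    refine vanishesAnti_of_coef fun w hw y => ?_
    cases w with
    | nil =>
      rw [coef_sub, hd0, sub_zero]
      by_contra hne
      exact (hF₁S _ hw y hne).2.2 rfl
    | cons a w =>
      obtain ⟨v, b, hv⟩ := exists_concat (a := a) (w := w)
      rw [coef_sub, coef_diff hGl' _ hw hv]
      have h1 : Q.coeffs (Q.ofPath k (Q.arrowPath a) * ev G' (Q.bas k (Q.arr w))) y = 0 := by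
        by_contra hne
        have hh : y.word.head? = some a := by
          by_contra hl
          exact hne (coeffs_arrow_mul_eq_zero hl _)
        obtain ⟨y', hy'⟩ := exists_isLeft hh
        rw [coeffs_arrow_mul hy'] at hne
        have hne : coef G' w y' ≠ 0 := hne
        rw [hGc'] at hne
        obtain ⟨c, -, hc⟩ := Finset.exists_ne_zero_of_sum_ne_zero hne
        split_ifs at hc with hch
        · obtain ⟨y3, h1, h2⟩ := coeffs_pull_ne (right_ne_zero_of_mul hc)
          exact hB c w y' y3 hch h1 h2 a y hw hy'
        · exact absurd rfl hc
      rw [h1, mul_zero, zero_add]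
      by_cases hlast : y.word.getLast? = some b
      · obtain ⟨z, hz⟩ := exists_isRight hlast
        rw [coeffs_mul_arrow hz]
        have h2 : Q.coeffs (ev G' (Q.bas k (Q.arr v))) z = coef G' v z := rfl
        have hch := hw
        rw [hv] at hch
        have hdiag : ∀ c (z' : Q.NZPath), z'.word = [c] → coef F₁ [c] z' = 0 := by
          intro c z' hz'
          by_contra hne
          exact (hF₁S [c] (by simp) z' hne).1 (by simp [hz'])
        have h3 : coef G' v z = sgn k (d - 1 - v.length) * sgn k (v.length + 1) *
            coef F₁ (v ++ [b]) y := by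
          rw [hGc', Finset.sum_eq_single b]
          · rw [if_pos hch, coeffs_pull (r := IsRight b) (fun _ _ _ => IsRight.left_unique)
              (fun _ _ _ => IsRight.right_unique) _ hz]
            rfl
          · intro c _ hcb
            split_ifs with hc
            · refine mul_eq_zero_of_right _ ?_
              by_contra hne
              obtain ⟨y', h4, h5⟩ := coeffs_pull_ne hne
              obtain rfl | ⟨rfl, hzn⟩ := right_prolongation_unique hc hch h4 hz
              · exact hcb rfl
              · exact h5 (hdiag c y' (by simp [h4.1, hzn]))
            · rfl
          · simp
        have hlen : v.length = w.length := by simpa using (congrArg List.length hv).symm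
        rw [h2, h3, hv, hlen, sub_eq_zero]
        have e1 := sgn_mul_self k (d - 1 - w.length)
        have e2 := sgn_mul_self k ((w.length : ℤ) + 1)
        linear_combination (- coef F₁ (v ++ [b]) y) * e1 -
          coef F₁ (v ++ [b]) y * sgn k (d - 1 - w.length) * sgn k (d - 1 - w.length) * e2
      · rw [coeffs_mul_arrow_eq_zero hlast, mul_zero, mul_zero, sub_zero]
        by_contra hne
        refine hlast ?_
        rw [← (hF₁S _ hw y hne).2.1, hv]
        simp
  have hmem := mem_coboundaries_of_normalCocycles (Submodule.sub_mem _ hF₁c hdG') key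
  have h1 : F = (F₁ - diff (Q.grading k) (d - 1) G') + diff (Q.grading k) (d - 1) G' +
      diff (Q.grading k) (d - 1) G := by
    rw [hF₁]
    abel
  rw [h1]
  exact Submodule.add_mem _ (Submodule.add_mem _ hmem ⟨G', hG'.1, rfl⟩) ⟨G, hG.1, rfl⟩

end GradedGentleQuiver
end

noncomputable section

open GradedHochschild

namespace GradedGentleQuiver

variable {V E : Type*} {Q : GradedGentleQuiver V E}

/-! ### First and last letters -/

theorem chain_cons_head {R : E → E → Prop} {a b : E} {w : List E} (h : (a :: w).IsChain R)
    (hb : w.head? = some b) : R a b := by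
  cases w with
  | nil => simp at hb
  | cons c w =>
    obtain rfl : c = b := by simpa using hb
    exact (List.isChain_cons_cons.1 h).1

theorem chain_append_head {R : E → E → Prop} {a b : E} {v w : List E} (h : (v ++ w).IsChain R)
    (ha : v.getLast? = some a) (hb : w.head? = some b) : R a b :=
  (List.isChain_append.1 h).2.2 a ha b hb

theorem chain_cons_iff {R : E → E → Prop} {a : E} {w : List E} :
    (a :: w).IsChain R ↔ (∀ b, w.head? = some b → R a b) ∧ w.IsChain R := by
  cases w with
  | nil => simp
  | cons c w => simp [List.isChain_cons_cons]

theorem chain_concat_iff {R : E → E → Prop} {a : E} {w : List E} :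
    (w ++ [a]).IsChain R ↔ (∀ b, w.getLast? = some b → R b a) ∧ w.IsChain R := by
  rw [List.isChain_append]
  simp
  tauto

theorem exists_head {w : List E} (h : w ≠ []) : ∃ a, w.head? = some a := by
  obtain ⟨a, v, rfl⟩ := List.exists_cons_of_ne_nil h
  exact ⟨a, rfl⟩

theorem exists_last {w : List E} (h : w ≠ []) : ∃ a, w.getLast? = some a :=
  ⟨w.getLast h, List.getLast?_eq_some_getLast h⟩

theorem head_append {v w : List E} {a : E} (h : v.head? = some a) : (v ++ w).head? = some a := by
  simp [h]

theorem last_append {v w : List E} {a : E} (h : w.getLast? = some a) :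
    (v ++ w).getLast? = some a := by
  simp [h]

theorem last_cons {v : List E} {a b : E} (h : v.getLast? = some a) :
    (b :: v).getLast? = some a := by
  rw [List.getLast?_cons, h]; rfl

theorem ne_nil_of_head {w : List E} {a : E} (h : w.head? = some a) : w ≠ [] := by
  rintro rfl; simp at h

theorem cyclic_pred {R : E → E → Prop} {w : List E} (h : (w ++ w).IsChain R) {a : E} (ha : a ∈ w) :
    ∃ g ∈ w, R g a := by
  obtain ⟨x, z, rfl⟩ := List.append_of_mem ha
  by_cases hx : x = []
  · subst hx
    obtain ⟨l, hl⟩ := exists_last (w := [] ++ a :: z) (by simp)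
    exact ⟨l, List.mem_of_getLast? hl, chain_append_head h hl (by simp)⟩
  · obtain ⟨l, hl⟩ := exists_last hx
    refine ⟨l, by simp [List.mem_of_getLast? hl], ?_⟩
    exact chain_append_head h.left_of_append hl rfl

/-- A set of letters closed under predecessors propagates to the left end of a chain. With `S` a
cyclic word, this yields a first letter which still has a predecessor. -/
theorem head_mem_of_closed {R : E → E → Prop} {S : List E} (hS : ∀ a ∈ S, ∀ g, R g a → g ∈ S)
    {v v' : List E} {a f : E} (h : (v ++ a :: v').IsChain R) (ha : a ∈ S)
    (hf : (v ++ a :: v').head? = some f) : f ∈ S := by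
  induction v generalizing f with
  | nil =>
    obtain rfl : a = f := by simpa using hf
    exact ha
  | cons x v ih =>
    obtain rfl : x = f := by simpa using hf
    obtain ⟨g, hg⟩ := exists_head (w := v ++ a :: v') (by simp)
    exact hS g (ih h.tail hg) x (chain_cons_head h hg)

theorem IsWalk.tgt_head {t s : V} {w : List E} (h : Q.IsWalk t s w) {a : E}
    (ha : w.head? = some a) : Q.tgt a = t := by
  cases w with
  | nil => simp at ha
  | cons c w =>
    obtain rfl : c = a := by simpa using ha
    exact h.1

theorem IsWalk.src_last {t s : V} {w : List E} (h : Q.IsWalk t s w) {a : E}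
    (ha : w.getLast? = some a) : Q.src a = s := by
  obtain ⟨v, rfl⟩ := List.getLast?_eq_some_iff.1 ha
  obtain ⟨r, -, h2⟩ := IsWalk.of_append h
  exact h2.2

theorem nonrel_left {a b b' : E} (h : Q.nonrel b a) (h' : Q.nonrel b' a) : b = b' :=
  Q.nonrel_left_unique a _ _ h.1 h.2 h'.1 h'.2

theorem nonrel_right {a b b' : E} (h : Q.nonrel a b) (h' : Q.nonrel a b') : b = b' :=
  Q.nonrel_right_unique a _ _ h.1 h.2 h'.1 h'.2

/-- At most one arrow composes with `a` to a nonzero path; any other composable arrow must therefore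
give a relation. -/
theorem rel_of_ne_left {a b b' : E} (h : Q.nonrel b a) (hs : Q.src b' = Q.tgt a) (hne : b' ≠ b) :
    Q.rel b' a := by
  by_contra hr
  exact hne (nonrel_left ⟨hs, hr⟩ h)

theorem rel_of_ne_right {a b b' : E} (h : Q.nonrel a b) (hs : Q.src a = Q.tgt b') (hne : b' ≠ b) :
    Q.rel a b' := by
  by_contra hr
  exact hne (nonrel_right ⟨hs, hr⟩ h)

theorem IsCompleteAnti.cyc {w : List E} (h : Q.IsCompleteAnti w) {a b : E}
    (ha : w.getLast? = some a) (hb : w.head? = some b) : Q.rel a b := chain_append_head h.2 ha hb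

theorem IsCompletePath.cyc {w : List E} (h : Q.IsCompletePath w) {a b : E}
    (ha : w.getLast? = some a) (hb : w.head? = some b) : Q.nonrel a b := chain_append_head h.2 ha hb

theorem Strip.of_head {w y : List E} {f l l' : E} (h1 : w.head? = some f) (h2 : y.head? = some f)
    (h3 : w.getLast? = some l) (h4 : y.getLast? = some l') (h : l ≠ l') : Strip w y := by
  refine ⟨ne_nil_of_head h1, ne_nil_of_head h2, Or.inl (h1.trans h2.symm), fun _ h' => ?_⟩
  rw [h3, h4] at h'
  exact absurd (Option.some.inj h') h

theorem Strip.of_last {w y : List E} {f f' l : E} (h1 : w.head? = some f) (h2 : y.head? = some f')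
    (h : f ≠ f') (h3 : w.getLast? = some l) (h4 : y.getLast? = some l) : Strip w y := by
  refine ⟨ne_nil_of_head h1, ne_nil_of_head h2, Or.inr (h3.trans h4.symm), fun h' => ?_⟩
  rw [h1, h2] at h'
  exact absurd (Option.some.inj h') h

theorem Strip.of_both {w y : List E} {f : E} (h1 : w.head? = some f) (h2 : y.head? = some f)
    (hw : w.length ≠ 1) (hy : y.length ≠ 1) : Strip w y :=
  ⟨ne_nil_of_head h1, ne_nil_of_head h2, Or.inl (h1.trans h2.symm), fun _ _ => ⟨hw, hy⟩⟩

/-! ### Maximal paths and anti-paths -/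

/-- The non-empty word is a maximal chain. -/
def IsMaxChain (R : E → E → Prop) (p : List E) : Prop :=
  p ≠ [] ∧ p.IsChain R ∧ ∀ w : List E, w.IsChain R → p <:+: w → w = p

theorem IsMaxChain.right {R : E → E → Prop} {p : List E} (h : IsMaxChain R p) {l g : E}
    (hl : p.getLast? = some l) : ¬ R l g := by
  intro hr
  have := h.2.2 (p ++ [g]) (chain_concat_iff.2 ⟨fun b hb => by
    rw [hl] at hb
    obtain rfl := Option.some.inj hb
    exact hr, h.2.1⟩) (List.prefix_append _ _).isInfix
  simp at this

theorem IsMaxChain.left {R : E → E → Prop} {p : List E} (h : IsMaxChain R p) {f g : E}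
    (hf : p.head? = some f) : ¬ R g f := by
  intro hr
  have := h.2.2 (g :: p) (chain_cons_iff.2 ⟨fun b hb => by
    rw [hf] at hb
    obtain rfl := Option.some.inj hb
    exact hr, h.2.1⟩) (List.suffix_cons _ _).isInfix
  simp at this

/-- In a longer word the common first and last letter would have a successor, and this would prolong
the chain on the right. -/
theorem IsMaxChain.eq_singleton {R : E → E → Prop} {p : List E} (h : IsMaxChain R p) {f : E}
    (hf : p.head? = some f) (hl : p.getLast? = some f) : p = [f] := by
  cases p with
  | nil => simp at hf
  | cons a p =>
    obtain rfl : a = f := by simpa using hf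
    by_cases hp : p = []
    · rw [hp]
    · obtain ⟨g, hg⟩ := exists_head hp
      exact absurd (chain_cons_head h.2.1 hg) (h.right hl)

theorem IsMaxChain.not_append {R : E → E → Prop} {p a c : List E} (h : IsMaxChain R p)
    (hw : (a ++ (p ++ c)).IsChain R) (hne : a ≠ [] ∨ c ≠ []) : False := by
  have := h.2.2 _ hw ⟨a, c, by simp⟩
  have := congrArg List.length this
  simp at this
  rcases hne with hne | hne <;> have := List.length_pos_of_ne_nil hne <;> omega

/-- Predecessors are unique, so from a common letter on one stays in the cyclic word while moving
left. The first letter of the maximal path would then still have a predecessor. -/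
theorem IsMaxChain.not_mem_cyclic_path {q w : List E} (h : IsMaxChain Q.nonrel q)
    (hw : Q.IsCompletePath w) {a : E} (ha : a ∈ q) (ha' : a ∈ w) : False := by
  obtain ⟨v, v', rfl⟩ := List.append_of_mem ha
  obtain ⟨f, hf⟩ := exists_head h.1
  have := head_mem_of_closed (S := w) (fun b hb g hg => by
    obtain ⟨g', hg', h1⟩ := cyclic_pred hw.2 hb
    rwa [nonrel_left hg h1]) h.2.1 ha' hf
  obtain ⟨g, -, hg⟩ := cyclic_pred hw.2 this
  exact h.left hf hg

theorem IsMaxChain.not_mem_cyclic_anti {p w : List E} (h : IsMaxChain Q.rel p)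
    (hw : Q.IsCompleteAnti w) {a : E} (ha : a ∈ p) (ha' : a ∈ w) : False := by
  obtain ⟨v, v', rfl⟩ := List.append_of_mem ha
  obtain ⟨f, hf⟩ := exists_head h.1
  have := head_mem_of_closed (S := w) (fun b hb g hg => by
    obtain ⟨g', hg', h1⟩ := cyclic_pred hw.2 hb
    rwa [Q.rel_left_unique _ _ _ hg h1]) h.2.1 ha' hf
  obtain ⟨g, -, hg⟩ := cyclic_pred hw.2 this
  exact h.left hf hg

/-- A loop is not a maximal path. -/
theorem NoLoopOrKronecker.not_maxPath (hQ : Q.NoLoopOrKronecker) {b : E}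
    (h : IsMaxChain Q.nonrel [b]) (hb : Q.src b = Q.tgt b) : False := by
  have hr : Q.rel b b := by
    by_contra hr
    exact h.right (l := b) rfl ⟨hb, hr⟩
  obtain ⟨c, hc, h1 | h1⟩ := hQ.1 b hb
  · exact h.left (f := b) rfl ⟨h1.trans hb, fun h2 => hc (Q.rel_left_unique b _ _ h2 hr)⟩
  · exact h.right (l := b) rfl ⟨h1.symm, fun h2 => hc (Q.rel_right_unique b _ _ h2 hr)⟩

/-- A loop is not a maximal anti-path. -/
theorem NoLoopOrKronecker.not_maxAnti (hQ : Q.NoLoopOrKronecker) {b : E}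
    (h : IsMaxChain Q.rel [b]) (hb : Q.src b = Q.tgt b) : False := by
  have hr : Q.nonrel b b := ⟨hb, h.right (l := b) rfl⟩
  obtain ⟨c, hc, h1 | h1⟩ := hQ.1 b hb
  · exact h.left (f := b) rfl (rel_of_ne_left hr (h1.trans hb) hc)
  · exact h.right (l := b) rfl (rel_of_ne_right hr h1.symm hc)

theorem not_three_out (x : V) {a b c : E} (ha : Q.src a = x) (hb : Q.src b = x) (hc : Q.src c = x)
    (hab : a ≠ b) (hac : a ≠ c) : b = c := by
  by_contra hbc
  have h1 : ({a, b, c} : Set E).encard ≤ 2 := (Set.encard_le_encard (by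
    rintro z (rfl | rfl | rfl) <;> assumption)).trans (Q.out_le_two x)
  rw [Set.encard_insert_of_notMem (by simp [hab, hac]), Set.encard_pair hbc] at h1
  norm_num at h1

theorem not_three_in (x : V) {a b c : E} (ha : Q.tgt a = x) (hb : Q.tgt b = x) (hc : Q.tgt c = x)
    (hab : a ≠ b) (hac : a ≠ c) : b = c := by
  by_contra hbc
  have h1 : ({a, b, c} : Set E).encard ≤ 2 := (Set.encard_le_encard (by
    rintro z (rfl | rfl | rfl) <;> assumption)).trans (Q.in_le_two x)
  rw [Set.encard_insert_of_notMem (by simp [hab, hac]), Set.encard_pair hbc] at h1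
  norm_num at h1

/-- Two parallel arrows are not both maximal anti-paths. -/
theorem NoLoopOrKronecker.not_maxAnti_pair (hQ : Q.NoLoopOrKronecker) {a b : E} (hab : a ≠ b)
    (ha : IsMaxChain Q.rel [a]) (hb : IsMaxChain Q.rel [b]) (hs : Q.src a = Q.src b)
    (ht : Q.tgt a = Q.tgt b) : False := by
  -- By maximality neither arrow has a relation at its ends. An arrow continuing both would have
  -- nonzero products with both, against gentleness. So any further arrow at the two vertices would
  -- be a third one out of the common source or into the common target.
  have hl : ∀ g, Q.src g ≠ Q.tgt a := fun g hg =>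
    hab (nonrel_right (a := g) ⟨hg, ha.left rfl⟩ ⟨hg.trans ht, hb.left rfl⟩)
  have hr : ∀ g, Q.src a ≠ Q.tgt g := fun g hg =>
    hab (nonrel_left (a := g) ⟨hg, ha.right rfl⟩ ⟨hs.symm.trans hg, hb.right rfl⟩)
  obtain ⟨c, hca, hcb, h | h | h | h⟩ := hQ.2 a b hab hs ht (hl a)
  · exact hcb (not_three_out (Q.src a) rfl hs.symm h hab hca.symm).symm
  · exact hl c h
  · exact hr c h.symm
  · exact hcb (not_three_in (Q.tgt a) rfl ht.symm h hab hca.symm).symm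

/-! ### Insertions of pairs of words -/

/-- The pair `(w, y)` arises by inserting `(p', q')` into `(p, q)`. -/
inductive Ins (p q p' q' w y : List E) : Prop
  | single (b : E) (v v' : List E) (hp : p = [b]) (hq : q' = v ++ b :: v') (hw : w = p')
      (hy : y = v ++ (q ++ v'))
  | left (b : E) (c v : List E) (hc : c ≠ []) (hp : p = b :: c) (hq : q' = v ++ [b])
      (hw : w = p' ++ c) (hy : y = v ++ q)
  | right (b : E) (a v' : List E) (ha : a ≠ []) (hp : p = a ++ [b]) (hq : q' = b :: v')
      (hw : w = a ++ p') (hy : y = q ++ v')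
  | middle (b : E) (a c : List E) (ha : a ≠ []) (hc : c ≠ []) (hp : p = a ++ b :: c)
      (hq : q' = [b]) (hw : w = a ++ (p' ++ c)) (hy : y = q)

theorem Ins.exists_mem {p q p' q' w y : List E} (h : Ins p q p' q' w y) : ∃ b ∈ p, b ∈ q' := by
  cases h with
  | single b v v' hp hq hw hy => exact ⟨b, by simp [hp], by simp [hq]⟩
  | left b c v hc hp hq hw hy => exact ⟨b, by simp [hp], by simp [hq]⟩
  | right b a v' ha hp hq hw hy => exact ⟨b, by simp [hp], by simp [hq]⟩
  | middle b a c ha hc hp hq hw hy => exact ⟨b, by simp [hp], by simp [hq]⟩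

theorem flatten_map_singleton (l : List E) : (l.map fun a => [a]).flatten = l := by
  induction l with
  | nil => rfl
  | cons a l ih => simp [ih]

/-- The word consists of the letters of `a`, the block `q'` and the letters of `c`, and `p` has as
many letters as there are blocks. Hence each block contributes one letter. The four shapes arise
according to which of `a` and `c` are empty, because a cofactor fits only at an end occupied by
`q'`. -/
theorem ins_of_flatten {a p' c q' p q v v' y : List E} (hp : p.IsChain Q.rel)
    (hq' : q'.IsChain Q.nonrel) (hlen : p.length = a.length + 1 + c.length)
    (h : a ++ (q' ++ c) = v ++ (p ++ v')) (hy : y = v ++ (q ++ v')) :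
    Ins p q p' q' (a ++ (p' ++ c)) y := by
  have hflat : ((a.map fun a => [a]) ++ q' :: (c.map fun a => [a])).flatten = v ++ (p ++ v') := by
    rw [List.flatten_append, List.flatten_cons, flatten_map_singleton, flatten_map_singleton, h]
  have hch : ∀ Y ∈ ((a.map fun a => [a]) ++ q' :: (c.map fun a => [a])), Y.IsChain Q.nonrel := by
    intro Y hY
    simp only [List.mem_append, List.mem_map, List.mem_cons] at hY
    rcases hY with ⟨x, -, rfl⟩ | rfl | ⟨x, -, rfl⟩
    · simp
    · exact hq'
    · simp
  have hl : p.length = ((a.map fun a => [a]) ++ q' :: (c.map fun a => [a])).length := by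
    simp; omega
  have hlen2 := congrArg List.length h
  simp only [List.length_append] at hlen2
  by_cases ha : a = []
  · subst ha
    cases p with
    | nil => simp at hlen; omega
    | cons b p =>
      rcases flatten_step hch hp hflat (by simpa using hl) with ⟨h1, h2, h3⟩ | ⟨rfl, h2, h3⟩
      · have hc : c ≠ [] := by simpa using h3
        rw [List.map_nil, List.nil_append] at *
        rw [flatten_map_singleton] at h2
        have hv' : v' = [] := by
          have := congrArg List.length h2
          simp at this hlen
          exact List.eq_nil_of_length_eq_zero (by omega)
        subst hv'
        rw [List.append_nil] at h2
        subst h2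
        exact Ins.left b c v hc rfl h1 rfl (by simpa using hy)
      · have hc : c = [] := by simpa using h2
        subst hc
        exact Ins.single b v v' rfl h3 (by simp) hy
  · by_cases hc : c = []
    · subst hc
      obtain ⟨x, a, rfl⟩ := List.exists_cons_of_ne_nil ha
      obtain ⟨b, p, rfl⟩ := List.exists_cons_of_ne_nil (l := p) (by rintro rfl; simp at hlen)
      have hv : v = [] := by
        rcases flatten_step hch hp hflat (by simpa using hl) with ⟨h1, -, -⟩ | ⟨-, h2, -⟩
        · have := congrArg List.length h1
          simp at this
          exact this
        · simp at h2
      subst hv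
      rw [List.append_nil] at h
      have h' : (x :: a) ++ q' = (b :: p) ++ v' := h
      have hle : (x :: a).length ≤ (b :: p).length := by simp at hlen ⊢; omega
      obtain ⟨m, hm⟩ : ∃ m, b :: p = (x :: a) ++ m := by
        rcases List.append_eq_append_iff.1 h' with ⟨m, h1, h2⟩ | ⟨m, h1, h2⟩
        · exact ⟨m, h1⟩
        · have := congrArg List.length h1
          have hm : m = [] := by
            rw [List.length_append] at this
            exact List.eq_nil_of_length_eq_zero (by omega)
          exact ⟨[], by rw [h1, hm]; simp⟩
      have hm1 : m.length = 1 := by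
        rw [hm] at hlen
        simp at hlen
        omega
      obtain ⟨e, rfl⟩ := List.length_eq_one_iff.1 hm1
      rw [hm, List.append_assoc] at h'
      have hq := List.append_cancel_left h'
      exact Ins.right e (x :: a) v' ha hm hq (by simp) hy
    · have h1 := flatten_middle hch hp hflat hl (Or.inl (by simpa using ha)) (by simpa using hc)
      obtain ⟨b, rfl⟩ := List.length_eq_one_iff.1 h1
      simp at hlen2
      have hv : v = [] := List.eq_nil_of_length_eq_zero (by omega)
      have hv' : v' = [] := List.eq_nil_of_length_eq_zero (by omega)
      subst hv hv'
      exact Ins.middle b a c ha hc (by simpa using h.symm) rfl rfl (by simpa using hy)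

end GradedGentleQuiver
end

noncomputable section

open GradedHochschild

namespace GradedGentleQuiver

variable {V E : Type*} {Q : GradedGentleQuiver V E}

/-! ### Insertions for the pairs of the boundary components -/

variable (Q) in
/-- The anti-path and the path have a common first or last arrow as in `Strip`, or a common
prolongation on the left as in `Prolongs`. -/
def Removable (w y : List E) : Prop :=
  Strip w y ∨ ∃ a, (a :: w).IsChain Q.rel ∧ (a :: y).IsChain Q.nonrel ∧
    (a :: w).getLast? ≠ (a :: y).getLast? ∧ (w ≠ [] ∨ y ≠ [])

variable (Q) in
/-- The pairs occurring in `N¹` of anti-paths. -/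
def IsN1Anti (p q : List E) : Prop :=
  ∃ a w, p = a :: w ∧ q = [a] ∧ Q.IsCompleteAnti w ∧ w.getLast? = some a

variable (Q) in
/-- The pairs occurring in `N¹` of paths. -/
def IsN1Path (p q : List E) : Prop :=
  ∃ a w, p = [a] ∧ q = a :: w ∧ Q.IsCompletePath w ∧ w.getLast? = some a

variable (Q) in
/-- The pairs of boundary components with one stop which are not fully marked. -/
def IsStopAnti (p q : List E) : Prop :=
  IsMaxChain Q.rel p ∧ q.IsChain Q.nonrel ∧ p.head? ≠ q.head? ∧ p.getLast? ≠ q.getLast?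

/-- The successor of a letter in an anti-path is unique. If `b` can be left out, it equals the
letter after it. -/
theorem loop_of_removed {a c : List E} {b : E} (ha : a ≠ []) (hc : c ≠ [])
    (hp : (a ++ b :: c).IsChain Q.rel) (hw : (a ++ c).IsChain Q.rel) : Q.rel b b := by
  obtain ⟨x, hx⟩ := exists_last ha
  obtain ⟨z, hz⟩ := exists_head hc
  have h1 := chain_append_head hp hx rfl
  have h2 := chain_cons_head hp.right_of_append hz
  have h3 := chain_append_head hw hx hz
  rwa [← Q.rel_right_unique _ _ _ h1 h3] at h2

/-- A path through a loop whose square is zero is not zero after removing the loop only if it starts or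
ends with the loop. -/
theorem not_removed_loop {v v' : List E} {b : E} (hb : Q.rel b b) (hv : v ≠ []) (hv' : v' ≠ [])
    (hq : (v ++ b :: v').IsChain Q.nonrel) (hy : (v ++ v').IsChain Q.nonrel) : False := by
  obtain ⟨x, hx⟩ := exists_last hv
  obtain ⟨z, hz⟩ := exists_head hv'
  have h1 := chain_append_head hq hx rfl
  have h2 := chain_cons_head hq.right_of_append hz
  have h3 := chain_append_head hy hx hz
  rw [← nonrel_right h1 h3] at h2
  exact h2.2 hb

variable {p q p' q' w y : List E}

/-- The common arrow `b` precedes cyclically what remains of both loops, so it prolongs both on the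
left. The prolonged words end with different letters: one last letter forms a relation with `b` and
the other does not. -/
theorem Ins.n0Anti_n0Path (h : Ins p q p' q' w y) (hX : Q.IsCompleteAnti p) (hq : q = [])
    (hp' : p' = []) (hY : Q.IsCompletePath q') (hw : w.IsChain Q.rel) (hy : y.IsChain Q.nonrel) :
    Q.Removable w y := by
  subst hq hp'
  right
  cases h with
  | single b v v' e1 e2 e3 e4 =>
    subst e1 e2 e3 e4
    have hb : Q.rel b b := hX.cyc rfl rfl
    rw [List.nil_append] at hy ⊢
    by_cases hv : v = []
    · subst hv
      by_cases hv' : v' = []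
      · subst hv'
        exact absurd hb (hY.cyc (a := b) (b := b) rfl rfl).2
      · refine ⟨b, by simp, hY.2.left_of_append, fun h => ?_, Or.inr (by simpa using hv')⟩
        exact (hY.cyc (a := b) (b := b) h.symm rfl).2 hb
    · by_cases hv' : v' = []
      · subst hv'
        rw [List.append_nil]
        refine ⟨b, by simp, chain_cons_iff.2 ⟨fun f hf => ?_, hY.2.left_of_append.left_of_append⟩,
          fun h => ?_, Or.inr hv⟩
        · exact hY.cyc (by simp) (head_append hf)
        · obtain ⟨l, hl⟩ := exists_last hv
          rw [last_cons hl] at h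
          obtain rfl : b = l := by simpa using h
          exact (chain_append_head hY.2.left_of_append hl rfl).2 hb
      · exact (not_removed_loop hb hv hv' hY.2.left_of_append hy).elim
  | left b c v hc e1 e2 e3 e4 =>
    subst e1 e2 e3 e4
    try simp only [List.append_nil] at *
    obtain ⟨l, hl⟩ := exists_last hc
    have hlb : Q.rel l b := hX.cyc (last_cons hl) rfl
    refine ⟨b, hX.2.left_of_append, chain_cons_iff.2 ⟨fun f hf => ?_,
      hY.2.left_of_append.left_of_append⟩, fun h => ?_, Or.inl hc⟩
    · exact hY.cyc (by simp) (head_append hf)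
    · rw [last_cons hl] at h
      by_cases hv : v = []
      · subst hv
        obtain rfl : l = b := by simpa using h
        exact (hY.cyc (a := l) (b := l) rfl rfl).2 hlb
      · obtain ⟨m, hm⟩ := exists_last hv
        rw [last_cons hm] at h
        obtain rfl : l = m := by simpa using h
        exact (chain_append_head hY.2.left_of_append hm rfl).2 hlb
  | right b a v' ha e1 e2 e3 e4 =>
    subst e1 e2 e3 e4
    try simp only [List.append_nil] at *
    obtain ⟨l, hl⟩ := exists_last ha
    have hlb : Q.rel l b := chain_append_head hX.2.left_of_append hl rfl
    refine ⟨b, chain_cons_iff.2 ⟨fun f hf => hX.cyc (by simp) (head_append hf), hw⟩,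
      hY.2.left_of_append, fun h => ?_, Or.inl ha⟩
    rw [last_cons hl] at h
    exact (hY.cyc (b := b) h.symm rfl).2 hlb
  | middle b a c ha hc e1 e2 e3 e4 =>
    subst e1 e2 e3 e4
    exact absurd (loop_of_removed ha hc hX.2.left_of_append hw) (hY.cyc (a := b) (b := b) rfl rfl).2

/-- The distinguished arrow `α` ends up at the same end of both words. At the other end the letters
differ, since one forms a relation with `α` and the other a nonzero product. -/
theorem Ins.n0Anti_n1Path (h : Ins p q p' q' w y) (hX : Q.IsCompleteAnti p) (hq : q = [])
    (hY : Q.IsN1Path p' q') (hq' : q'.IsChain Q.nonrel) (hy : y.IsChain Q.nonrel) :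
    Strip w y := by
  obtain ⟨α, w', rfl, rfl, hC, hα⟩ := hY
  subst hq
  obtain ⟨f, hf⟩ := exists_head hC.1
  have hαf : Q.nonrel α f := hC.cyc hα hf
  cases h with
  | single b v v' e1 e2 e3 e4 =>
    subst e1 e3 e4
    have hb : Q.rel b b := hX.cyc rfl rfl
    rw [List.nil_append] at hy ⊢
    cases v with
    | nil =>
      obtain ⟨rfl, rfl⟩ := List.cons.inj e2
      refine Strip.of_last rfl hf ?_ rfl hα
      rintro rfl
      exact hαf.2 hb
    | cons x v =>
      obtain ⟨rfl, e2'⟩ := List.cons.inj e2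
      by_cases hv' : v' = []
      · subst hv'
        obtain ⟨l, hl⟩ := exists_last (w := α :: v) (by simp)
        have hbα : α = b := by
          rw [e2'] at hα
          simpa using hα.symm
        subst hbα
        refine Strip.of_head rfl rfl rfl (l' := l) (by simpa using hl) ?_
        rintro rfl
        rw [e2] at hq'
        exact (chain_append_head hq' hl rfl).2 hb
      · rw [e2] at hq'
        exact (not_removed_loop hb (by simp) hv' hq' hy).elim
  | left b c v hc e1 e2 e3 e4 =>
    subst e1 e3 e4
    have hbα : α = b := by
      have := congrArg List.getLast? e2
      rw [last_cons hα] at this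
      simpa using this
    subst hbα
    cases v with
    | nil => exact absurd (List.cons.inj e2).2 hC.1
    | cons x v =>
      obtain ⟨rfl, e2'⟩ := List.cons.inj e2
      obtain ⟨l, hl⟩ := exists_last hc
      obtain ⟨m, hm⟩ := exists_last (w := α :: v) (by simp)
      refine Strip.of_head rfl rfl (last_append hl) (l' := m) (by simpa using hm) ?_
      rintro rfl
      rw [e2] at hq'
      exact (chain_append_head hq' hm rfl).2 (hX.cyc (last_cons hl) rfl)
  | right b a v' ha e1 e2 e3 e4 =>
    subst e1 e3 e4
    obtain ⟨rfl, rfl⟩ := List.cons.inj e2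
    obtain ⟨g, hg⟩ := exists_head ha
    refine Strip.of_last (head_append hg) hf ?_ (by simp) hα
    rintro rfl
    exact hαf.2 (hX.cyc (by simp) (head_append hg))
  | middle b a c ha hc e1 e2 e3 e4 => exact absurd (List.cons.inj e2).2 hC.1

/-- Inserting `p'` next to other letters would embed a maximal anti-path properly into the anti-path
`w`. So `p` is a loop `b` with zero square, and `b` is an end letter of `q'`. Once it is removed,
gentleness forces the parallel words to share an end arrow. -/
theorem Ins.n0Anti_stopAnti (h : Ins p q p' q' w y) (hX : Q.IsCompleteAnti p) (hq : q = [])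
    (hY : Q.IsStopAnti p' q') {t s : V} (hp' : Q.IsWalk t s p') (hq' : Q.IsWalk t s q')
    (hw : w.IsChain Q.rel) (hy : y.IsChain Q.nonrel) : Strip w y := by
  obtain ⟨hM, hn, hh, hl⟩ := hY
  subst hq
  cases h with
  | single b v v' e1 e2 e3 e4 =>
    subst e1 e2 e3 e4
    have hb : Q.rel b b := hX.cyc rfl rfl
    rw [List.nil_append] at hy ⊢
    obtain ⟨f, hf⟩ := exists_head hM.1
    obtain ⟨l, hl'⟩ := exists_last hM.1
    by_cases hv : v = []
    · subst hv
      have hbf : Q.nonrel b f := by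
        refine ⟨(Q.rel_composable _ _ hb).trans ((hq'.tgt_head rfl).trans (hp'.tgt_head hf).symm), fun hr => hh ?_⟩
        rw [hf, Q.rel_right_unique _ _ _ hr hb]
        rfl
      by_cases hv' : v' = []
      · subst hv'
        have hlb : Q.nonrel l b := by
          refine ⟨(hp'.src_last hl').trans ((hq'.src_last (a := b) rfl).symm.trans (Q.rel_composable _ _ hb)), fun hr => hl ?_⟩
          rw [hl', Q.rel_left_unique _ _ _ hr hb]
          rfl
        refine absurd (rel_of_ne_right hlb ?_ ?_) (hM.right hl' (g := f))
        · exact hlb.1.trans ((hq'.tgt_head rfl).trans (hp'.tgt_head hf).symm)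
        · rintro rfl
          exact hbf.2 hb
      · obtain ⟨z, hz⟩ := exists_head hv'
        obtain ⟨m, hm⟩ := exists_last hv'
        obtain rfl := nonrel_right hbf (chain_cons_head hn hz)
        refine Strip.of_head hf hz hl' hm ?_
        rintro rfl
        exact hl (by rw [hl', List.nil_append, last_cons hm])
    · by_cases hv' : v' = []
      · subst hv'
        rw [List.append_nil]
        obtain ⟨m, hm⟩ := exists_last hv
        obtain ⟨z, hz⟩ := exists_head hv
        have hlb : Q.nonrel l b := by
          refine ⟨(hp'.src_last hl').trans ((hq'.src_last (a := b) (by simp)).symm.trans (Q.rel_composable _ _ hb)), fun hr => hl ?_⟩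
          rw [hl', Q.rel_left_unique _ _ _ hr hb]
          simp
        obtain rfl := nonrel_left hlb (chain_append_head hn hm rfl)
        refine Strip.of_last hf hz ?_ hl' hm
        rintro rfl
        exact hh (by rw [hf, head_append hz])
      · exact (not_removed_loop hb hv hv' hn hy).elim
  | left b c v hc e1 e2 e3 e4 =>
    subst e3
    exact (hM.not_append (a := []) hw (Or.inr hc)).elim
  | right b a v' ha e1 e2 e3 e4 =>
    subst e3
    exact (hM.not_append (c := []) (by rwa [List.append_nil]) (Or.inl ha)).elim
  | middle b a c ha hc e1 e2 e3 e4 =>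
    subst e3
    exact (hM.not_append hw (Or.inl ha)).elim

/-- The last and the first arrow of a closed maximal path form a relation, and this determines the
cyclic neighbour in `p` of the removed arrow. Both words then begin, or both end, with that
neighbour. -/
theorem Ins.n0Anti_stopPath (hQ : Q.NoLoopOrKronecker) (h : Ins p q p' q' w y)
    (hX : Q.IsCompleteAnti p) (hq : q = []) (hp' : p' = []) (hM : IsMaxChain Q.nonrel q') {t : V}
    (hq' : Q.IsWalk t t q') (hy : y.IsChain Q.nonrel) : Strip w y := by
  subst hq hp'
  have hn := hM.2.1
  have hsing : ∀ b, q' ≠ [b] := by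
    rintro b rfl
    exact hQ.not_maxPath hM ((hq'.src_last rfl).trans (hq'.tgt_head rfl).symm)
  have hcl : ∀ l f, q'.getLast? = some l → q'.head? = some f → Q.src l = Q.tgt f := fun l f hl hf =>
    (hq'.src_last hl).trans (hq'.tgt_head hf).symm
  cases h with
  | single b v v' e1 e2 e3 e4 =>
    subst e1 e2 e3 e4
    have hb : Q.rel b b := hX.cyc rfl rfl
    rw [List.nil_append] at hy ⊢
    have hbb := Q.rel_composable _ _ hb
    exfalso
    by_cases hv : v = []
    · subst hv
      obtain ⟨l, hl⟩ := exists_last (w := [] ++ b :: v') (by simp)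
      have h1 := hcl l b hl rfl
      refine hM.right hl (g := b) ⟨h1, fun hr => ?_⟩
      obtain rfl := Q.rel_left_unique _ _ _ hr hb
      exact hsing _ (hM.eq_singleton rfl hl)
    · by_cases hv' : v' = []
      · subst hv'
        obtain ⟨f, hf⟩ := exists_head (w := v ++ [b]) (by simp)
        have h1 := hcl b f (by simp) hf
        refine hM.left hf (g := b) ⟨h1, fun hr => ?_⟩
        obtain rfl := Q.rel_right_unique _ _ _ hr hb
        exact hsing _ (hM.eq_singleton hf (by simp))
      · exact not_removed_loop hb hv hv' hn hy
  | left b c v hc e1 e2 e3 e4 =>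
    subst e1 e2 e3 e4
    try simp only [List.append_nil] at *
    by_cases hv : v = []
    · exact absurd (by rw [hv]; rfl) (hsing b)
    obtain ⟨f, hf⟩ := exists_head hv
    obtain ⟨g, hg⟩ := exists_head hc
    obtain ⟨l, hl⟩ := exists_last hc
    obtain ⟨m, hm⟩ := exists_last hv
    have hbf : Q.rel b f := by
      by_contra hr
      exact hM.left (head_append hf) ⟨hcl b f (by simp) (head_append hf), hr⟩
    obtain rfl := Q.rel_right_unique _ _ _ hbf (chain_cons_head hX.2.left_of_append hg)
    refine Strip.of_head hg hf hl hm ?_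
    rintro rfl
    exact (chain_append_head hn hm rfl).2 (hX.cyc (last_cons hl) rfl)
  | right b a v' ha e1 e2 e3 e4 =>
    subst e1 e2 e3 e4
    try simp only [List.append_nil] at *
    by_cases hv : y = []
    · exact absurd (by rw [hv]) (hsing b)
    obtain ⟨f, hf⟩ := exists_head hv
    obtain ⟨g, hg⟩ := exists_head ha
    obtain ⟨l, hl⟩ := exists_last ha
    obtain ⟨m, hm⟩ := exists_last hv
    have hmb : Q.rel m b := by
      by_contra hr
      exact hM.right (last_cons hm) ⟨hcl m b (last_cons hm) rfl, hr⟩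
    obtain rfl := Q.rel_left_unique _ _ _ hmb (chain_append_head hX.2.left_of_append hl rfl)
    refine Strip.of_last hg hf ?_ hl hm
    rintro rfl
    exact (chain_cons_head hn hf).2 (hX.cyc (by simp) (head_append hg))
  | middle b a c ha hc e1 e2 e3 e4 => exact absurd e2 (hsing b)

end GradedGentleQuiver
end

/-! ### Insertions with the pairs of N¹ as the outer term -/

noncomputable section

open GradedHochschild

namespace GradedGentleQuiver

variable {V E : Type*} {Q : GradedGentleQuiver V E} {p q p' q' w y : List E}

theorem length_ne_one_of_ne_singleton {f : E} {w : List E} (h : w.head? = some f) (hw : w ≠ [f]) :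
    w.length ≠ 1 := by
  intro h1
  obtain ⟨b, rfl⟩ := List.length_eq_one_iff.1 h1
  obtain rfl : b = f := by simpa using h
  exact hw rfl

theorem IsN1Anti.chain (h : Q.IsN1Anti p q) : p.IsChain Q.rel := by
  obtain ⟨α, w, rfl, -, hC, hα⟩ := h
  exact chain_cons_iff.2 ⟨fun b hb => hC.cyc hα hb, hC.2.left_of_append⟩

theorem IsN1Path.chain (h : Q.IsN1Path p q) : q.IsChain Q.nonrel := by
  obtain ⟨α, w, -, rfl, hC, hα⟩ := h
  exact chain_cons_iff.2 ⟨fun b hb => hC.cyc hα hb, hC.2.left_of_append⟩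

theorem last_of_cons_eq_concat {a b : E} {u v : List E} (h : a :: u = v ++ [b]) {l : E}
    (hl : u.getLast? = some l) : l = b := by
  have := congrArg List.getLast? h
  rw [last_cons hl] at this
  simpa using this

/-- The arrow `α` stands at both ends of `p`. When it is removed at one end it remains at the other,
which is also the end where `q = α` stands in the path. -/
theorem Ins.n1Anti_n0Path (h : Ins p q p' q' w y) (hX : Q.IsN1Anti p q)
    (hp' : p' = []) (hY : Q.IsCompletePath q') (hw : w.IsChain Q.rel) : Strip w y := by
  have hp := hX.chain
  obtain ⟨α, w', rfl, rfl, hC, hα⟩ := hX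
  subst hp'
  cases h with
  | single b v v' e1 e2 e3 e4 => exact absurd (List.cons.inj e1).2 hC.1
  | left b c v hc e1 e2 e3 e4 =>
    obtain ⟨rfl, rfl⟩ := List.cons.inj e1
    subst e2 e3 e4
    obtain ⟨f, hf⟩ := exists_head hC.1
    obtain ⟨g, hg⟩ := exists_head hY.1
    refine Strip.of_last hf hg ?_ hα (by simp)
    rintro rfl
    exact (hY.cyc (by simp) hg).2 (hC.cyc hα hf)
  | right b a v' ha e1 e2 e3 e4 =>
    obtain ⟨x, a, rfl⟩ := List.exists_cons_of_ne_nil ha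
    obtain rfl := last_of_cons_eq_concat e1 hα
    obtain ⟨rfl, rfl⟩ := List.cons.inj e1
    subst e2 e3 e4
    obtain ⟨l, hl⟩ := exists_last (w := α :: a) (by simp)
    obtain ⟨m, hm⟩ := exists_last (w := α :: v') (by simp)
    refine Strip.of_head rfl rfl (l := l) (by simpa using hl) hm ?_
    rintro rfl
    exact (hY.cyc hm rfl).2 (chain_append_head (v := α :: a) hp hl rfl)
  | middle b a c ha hc e1 e2 e3 e4 =>
    subst e2 e3 e4
    rw [e1] at hp
    exact absurd (loop_of_removed ha hc hp hw) (hY.cyc (a := b) (b := b) rfl rfl).2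

/-- The common arrow is the distinguished arrow of both pairs, and the insertion returns the long
anti-path of the first pair with the long path of the second. Both start with that arrow and have
length at least two. -/
theorem Ins.n1Anti_n1Path (h : Ins p q p' q' w y) (hX : Q.IsN1Anti p q)
    (hY : Q.IsN1Path p' q') : Strip w y := by
  obtain ⟨α, w', rfl, rfl, hC, hα⟩ := hX
  obtain ⟨β, u, rfl, rfl, hD, hβ⟩ := hY
  have hl : ∀ {v : List E}, v ≠ [] → (α :: v).length ≠ 1 := by
    intro v hv h
    exact hv (List.eq_nil_of_length_eq_zero (by simpa using h))
  cases h with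
  | single b v v' e1 e2 e3 e4 => exact absurd (List.cons.inj e1).2 hC.1
  | left b c v hc e1 e2 e3 e4 =>
    obtain ⟨rfl, rfl⟩ := List.cons.inj e1
    obtain rfl := last_of_cons_eq_concat e2 hβ
    rw [← e2] at e4
    subst e3 e4
    exact Strip.of_both rfl rfl (hl hC.1) (hl hD.1)
  | right b a v' ha e1 e2 e3 e4 =>
    obtain rfl := last_of_cons_eq_concat e1 hα
    obtain ⟨rfl, rfl⟩ := List.cons.inj e2
    rw [← e1] at e3
    subst e3 e4
    exact Strip.of_both rfl rfl (hl hC.1) (hl hD.1)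
  | middle b a c ha hc e1 e2 e3 e4 => exact absurd (List.cons.inj e2).2 hD.1

theorem Ins.not_n1Anti_stopAnti (h : Ins p q p' q' w y) (hX : Q.IsN1Anti p q)
    (hM : IsMaxChain Q.rel p') (hw : w.IsChain Q.rel) : False := by
  obtain ⟨α, w', rfl, rfl, hC, hα⟩ := hX
  cases h with
  | single b v v' e1 e2 e3 e4 => exact absurd (List.cons.inj e1).2 hC.1
  | left b c v hc e1 e2 e3 e4 =>
    subst e3
    exact hM.not_append (a := []) hw (Or.inr hc)
  | right b a v' ha e1 e2 e3 e4 =>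
    subst e3
    exact hM.not_append (c := []) (by rwa [List.append_nil]) (Or.inl ha)
  | middle b a c ha hc e1 e2 e3 e4 =>
    subst e3
    exact hM.not_append hw (Or.inl ha)

theorem IsMaxChain.ne_singleton (hQ : Q.NoLoopOrKronecker) (hM : IsMaxChain Q.nonrel q) {t : V}
    (hq : Q.IsWalk t t q) (b : E) : q ≠ [b] := by
  rintro rfl
  exact hQ.not_maxPath hM ((hq.src_last rfl).trans (hq.tgt_head rfl).symm)

/-- The last and the first arrow of the closed maximal path form a relation, which identifies a
neighbour of `α` in the cyclic anti-path. Both words then start with the same arrow. Neither has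
length one, because a loop is not a maximal path. -/
theorem Ins.n1Anti_stopPath (hQ : Q.NoLoopOrKronecker) (h : Ins p q p' q' w y)
    (hX : Q.IsN1Anti p q) (hp' : p' = []) (hM : IsMaxChain Q.nonrel q') {t : V}
    (hq' : Q.IsWalk t t q') : Strip w y := by
  have hp := hX.chain
  obtain ⟨α, w', rfl, rfl, hC, hα⟩ := hX
  subst hp'
  have hsing := hM.ne_singleton hQ hq'
  obtain ⟨f, hf⟩ := exists_head hM.1
  obtain ⟨l, hl⟩ := exists_last hM.1
  have hcl := (hq'.src_last hl).trans (hq'.tgt_head hf).symm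
  have hlf : Q.rel l f := by
    by_contra hr
    exact hM.left hf ⟨hcl, hr⟩
  cases h with
  | single b v v' e1 e2 e3 e4 => exact absurd (List.cons.inj e1).2 hC.1
  | left b c v hc e1 e2 e3 e4 =>
    obtain ⟨rfl, rfl⟩ := List.cons.inj e1
    rw [← e2] at e4
    subst e3 e4
    obtain rfl : α = l := by rw [e2] at hl; simpa using hl
    obtain ⟨g, hg⟩ := exists_head hC.1
    obtain rfl := Q.rel_right_unique _ _ _ hlf (hC.cyc hα hg)
    refine Strip.of_both hg hf (length_ne_one_of_ne_singleton hg ?_)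
      (length_ne_one_of_ne_singleton hf (hsing _))
    intro h1
    rw [h1] at hα
    obtain rfl : f = α := by simpa using hα
    exact hsing _ (hM.eq_singleton hf hl)
  | right b a v' ha e1 e2 e3 e4 =>
    obtain rfl := last_of_cons_eq_concat e1 hα
    obtain ⟨x, a, rfl⟩ := List.exists_cons_of_ne_nil ha
    obtain ⟨rfl, e1'⟩ := List.cons.inj e1
    subst e2 e3 e4
    obtain rfl : α = f := by simpa using hf
    rw [List.append_nil]
    refine Strip.of_both rfl rfl (length_ne_one_of_ne_singleton (f := α) rfl ?_)
      (length_ne_one_of_ne_singleton (f := α) rfl (hsing _))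
    intro h1
    rw [e1, h1] at hp
    have hr : Q.rel α α := (List.isChain_cons_cons.1 hp).1
    obtain rfl := Q.rel_left_unique _ _ _ hr hlf
    exact hsing _ (hM.eq_singleton hf hl)
  | middle b a c ha hc e1 e2 e3 e4 => exact absurd e2 (hsing b)

theorem Ins.n1Path_n1Anti (h : Ins p q p' q' w y) (hX : Q.IsN1Path p q)
    (hY : Q.IsN1Anti p' q') : Strip w y := by
  obtain ⟨α, w', rfl, rfl, hC, hα⟩ := hX
  obtain ⟨β, u, rfl, rfl, hD, hβ⟩ := hY
  have hl : ∀ {v : List E}, v ≠ [] → (α :: v).length ≠ 1 := by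
    intro v hv h
    exact hv (List.eq_nil_of_length_eq_zero (by simpa using h))
  cases h with
  | single b v v' e1 e2 e3 e4 =>
    obtain rfl : α = b := by simpa using e1
    cases v with
    | nil =>
      obtain ⟨rfl, rfl⟩ := List.cons.inj e2
      subst e3 e4
      rw [List.nil_append, List.append_nil]
      exact Strip.of_both rfl rfl (hl hD.1) (hl hC.1)
    | cons x v => simp at e2
  | left b c v hc e1 e2 e3 e4 => exact absurd (List.cons.inj e1).2.symm hc
  | right b a v' ha e1 e2 e3 e4 => cases a <;> simp at e1 ha
  | middle b a c ha hc e1 e2 e3 e4 => cases a <;> simp at e1 ha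

theorem Ins.single_of_singleton {b : E} (h : Ins [b] q p' q' w y) :
    ∃ v v', q' = v ++ b :: v' ∧ w = p' ∧ y = v ++ (q ++ v') := by
  cases h with
  | single b v v' e1 e2 e3 e4 =>
    obtain rfl := (List.cons.inj e1).1
    exact ⟨v, v', e2, e3, e4⟩
  | left b c v hc e1 e2 e3 e4 => exact absurd (List.cons.inj e1).2.symm hc
  | right b a v' ha e1 e2 e3 e4 => cases a <;> simp at e1 ha
  | middle b a c ha hc e1 e2 e3 e4 => cases a <;> simp at e1 ha

/-- If `q'` met a cyclic path, its first arrow would have a nonzero predecessor `g`. By gentleness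
`g` forms a relation with the different first arrow of `p'`, which would prolong the maximal
anti-path. -/
theorem Ins.not_n1Path_stopAnti (h : Ins p q p' q' w y) (hX : Q.IsN1Path p q)
    (hY : Q.IsStopAnti p' q') {t s : V} (hp' : Q.IsWalk t s p') (hq' : Q.IsWalk t s q') : False := by
  obtain ⟨α, w', rfl, rfl, hC, hα⟩ := hX
  obtain ⟨hM, hn, hh, hl⟩ := hY
  obtain ⟨v, v', rfl, -, -⟩ := h.single_of_singleton
  obtain ⟨f, hf⟩ := exists_head (w := v ++ α :: v') (by simp)
  have := head_mem_of_closed (S := w') (fun b hb g hg => by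
    obtain ⟨g', hg', h1⟩ := cyclic_pred hC.2 hb
    rwa [nonrel_left hg h1]) hn (List.mem_of_getLast? hα) hf
  obtain ⟨g, -, hg⟩ := cyclic_pred hC.2 this
  obtain ⟨e, he⟩ := exists_head hM.1
  refine hM.left he (g := g) (rel_of_ne_right hg ?_ ?_)
  · exact hg.1.trans ((hq'.tgt_head hf).trans (hp'.tgt_head he).symm)
  · rintro rfl
    exact hh (he.trans hf.symm)

theorem Ins.not_n1Path_stopPath (h : Ins p q p' q' w y) (hX : Q.IsN1Path p q)
    (hM : IsMaxChain Q.nonrel q') : False := by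
  obtain ⟨α, w', rfl, rfl, hC, hα⟩ := hX
  obtain ⟨v, v', rfl, -, -⟩ := h.single_of_singleton
  exact hM.not_mem_cyclic_path hC (a := α) (by simp) (List.mem_of_getLast? hα)

theorem Ins.not_stopAnti_n1Anti (h : Ins p q p' q' w y) (hM : IsMaxChain Q.rel p)
    (hY : Q.IsN1Anti p' q') : False := by
  obtain ⟨α, w', rfl, rfl, hC, hα⟩ := hY
  obtain ⟨b, hb, hb'⟩ := h.exists_mem
  obtain rfl : b = α := by simpa using hb'
  exact hM.not_mem_cyclic_anti hC hb (List.mem_of_getLast? hα)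

/-- If an arrow of a path `vβv'` is replaced by a parallel path which neither starts nor ends with it and
the result is a non-zero path, then `v` is trivial. -/
theorem left_eq_nil_of_replace {b : E} {v v' q : List E} {t s : V} (hq0 : q ≠ [])
    (hb : Q.IsWalk t s [b]) (hq : Q.IsWalk t s q) (hh : q.head? ≠ some b)
    (hn : (v ++ b :: v').IsChain Q.nonrel) (hy : (v ++ (q ++ v')).IsChain Q.nonrel) : v = [] := by
  by_contra hv
  obtain ⟨g, hg⟩ := exists_last hv
  obtain ⟨f, hf⟩ := exists_head hq0
  have h1 := chain_append_head hn hg rfl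
  have h2 := chain_append_head hy hg (head_append hf)
  exact hh (by rw [hf, nonrel_right h1 h2])

theorem right_eq_nil_of_replace {b : E} {v v' q : List E} {t s : V} (hq0 : q ≠ [])
    (hb : Q.IsWalk t s [b]) (hq : Q.IsWalk t s q) (hl : q.getLast? ≠ some b)
    (hn : (v ++ b :: v').IsChain Q.nonrel) (hy : (v ++ (q ++ v')).IsChain Q.nonrel) : v' = [] := by
  by_contra hv
  obtain ⟨g, hg⟩ := exists_head hv
  obtain ⟨f, hf⟩ := exists_last hq0
  have h1 := chain_cons_head hn.right_of_append hg
  have h2 := chain_append_head hy.right_of_append hf hg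
  exact hl (by rw [hf, nonrel_left h1 h2])

/-- The insertion into a maximal anti-path consisting of one arrow. -/
theorem IsStopAnti.replace (hQ : Q.NoLoopOrKronecker) {b : E} {v v' q : List E}
    (hX : Q.IsStopAnti [b] q) {t s : V} (hp : Q.IsWalk t s [b]) (hq : Q.IsWalk t s q)
    (hn : (v ++ b :: v').IsChain Q.nonrel) (hy : (v ++ (q ++ v')).IsChain Q.nonrel) :
    q ≠ [] ∧ v = [] ∧ v' = [] := by
  obtain ⟨hM, hqn, hh, hl⟩ := hX
  have hq0 : q ≠ [] := by
    rintro rfl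
    have : t = s := hq
    subst this
    exact hQ.not_maxAnti hM ((hp.src_last rfl).trans (hp.tgt_head rfl).symm)
  exact ⟨hq0, left_eq_nil_of_replace hq0 hp hq (fun h => hh h.symm) hn hy,
    right_eq_nil_of_replace hq0 hp hq (fun h => hl h.symm) hn hy⟩

end GradedGentleQuiver
end

/-! ### Insertions with the pair of a boundary component with one stop as the outer term -/

noncomputable section

open GradedHochschild

namespace GradedGentleQuiver

variable {V E : Type*} {Q : GradedGentleQuiver V E} {p q p' q' w y : List E}

theorem exists_last_of_length {R : E → E → Prop} {v : List E} {f : E} (hv : v.IsChain R)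
    (hl : v.getLast? = some f) (h : v.length ≠ 1) : ∃ z, R z f := by
  obtain ⟨x, rfl⟩ := List.getLast?_eq_some_iff.1 hl
  obtain ⟨z, hz⟩ := exists_last (w := x) (by rintro rfl; simp at h)
  exact ⟨z, chain_append_head hv hz rfl⟩

theorem exists_head_of_length {R : E → E → Prop} {v : List E} {f : E} (hv : v.IsChain R)
    (hl : v.head? = some f) (h : v.length ≠ 1) : ∃ z, R f z := by
  obtain ⟨x, rfl⟩ := List.head?_eq_some_iff.1 hl
  obtain ⟨z, hz⟩ := exists_head (w := x) (by rintro rfl; simp at h)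
  exact ⟨z, chain_cons_head hv hz⟩

theorem eq_singleton_of_length {v : List E} {f : E} (hl : v.head? = some f) (h : v.length = 1) :
    v = [f] := by
  by_contra h'
  exact length_ne_one_of_ne_singleton hl h' h

/-- The first arrow of a closed maximal anti-path, multiplied with a loop. -/
theorem IsMaxChain.not_loop_head (hM : IsMaxChain Q.rel p) {t : V} (hp : Q.IsWalk t t p) {b : E}
    (hb : p.head? = some b) (hbb : Q.nonrel b b) (h : p ≠ [b]) : False := by
  obtain ⟨l, hl⟩ := exists_last hM.1
  by_cases hlb : l = b
  · subst hlb
    exact h (hM.eq_singleton hb hl)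
  · exact hM.right hl (rel_of_ne_left hbb ((hp.src_last hl).trans (hp.tgt_head hb).symm) hlb)

theorem IsMaxChain.not_loop_last (hM : IsMaxChain Q.rel p) {t : V} (hp : Q.IsWalk t t p) {b : E}
    (hb : p.getLast? = some b) (hbb : Q.nonrel b b) (h : p ≠ [b]) : False := by
  obtain ⟨l, hl⟩ := exists_head hM.1
  by_cases hlb : l = b
  · subst hlb
    exact h (hM.eq_singleton hl hb)
  · exact hM.left hl (rel_of_ne_right hbb ((hp.src_last hb).trans (hp.tgt_head hl).symm) hlb)

/-- If `q` is trivial, `p` is closed and by maximality its last and first arrow have a nonzero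
product. This identifies an end letter of what remains of the cyclic path. If `q` is not trivial,
its end arrows differ from those of `p`. The cyclic path must then be a loop `b` with nonzero
square, and the arrow of `q` at that end is forced to be the neighbour of `b` in `p`. -/
theorem Ins.stopAnti_n0Path (hQ : Q.NoLoopOrKronecker) (h : Ins p q p' q' w y)
    (hX : Q.IsStopAnti p q) {t s : V} (hp : Q.IsWalk t s p) (hq : Q.IsWalk t s q)
    (hp' : p' = []) (hY : Q.IsCompletePath q') (hw : w.IsChain Q.rel) (hy : y.IsChain Q.nonrel) :
    Strip w y := by
  have hX' := hX
  obtain ⟨hM, hn, hh, hl⟩ := hX'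
  have hn' := hY.2.left_of_append
  subst hp'
  cases h with
  | single b v v' e1 e2 e3 e4 =>
    exfalso
    subst e1 e2 e3 e4
    obtain ⟨hq0, rfl, rfl⟩ := hX.replace hQ hp hq hn' hy
    obtain ⟨f, hf⟩ := exists_head hq0
    have hbb : Q.nonrel b b := hY.cyc rfl rfl
    refine hM.right rfl (rel_of_ne_right hbb (hbb.1.trans ((hp.tgt_head rfl).trans
      (hq.tgt_head hf).symm)) ?_)
    rintro rfl
    exact hh (by rw [hf]; rfl)
  | left b c v hc e1 e2 e3 e4 =>
    subst e1 e2 e3 e4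
    obtain ⟨l, hlc⟩ := exists_last hc
    obtain ⟨c1, hc1⟩ := exists_head hc
    have hbc := chain_cons_head hM.2.1 hc1
    by_cases hq0 : q = []
    · subst hq0
      obtain rfl : t = s := hq
      rw [List.append_nil]
      by_cases hv : v = []
      · subst hv
        exact (hM.not_loop_head hp rfl (hY.cyc rfl rfl) (by simpa using hc)).elim
      · obtain ⟨m, hm⟩ := exists_last hv
        obtain ⟨z, hz⟩ := exists_head hv
        obtain rfl : m = l := nonrel_left (chain_append_head hn' hm rfl)
          ⟨(hp.src_last (last_cons hlc)).trans (hp.tgt_head rfl).symm, hM.right (last_cons hlc)⟩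
        refine Strip.of_last hc1 hz ?_ hlc hm
        rintro rfl
        exact (hY.cyc (by simp) (head_append hz)).2 hbc
    · obtain ⟨f, hf⟩ := exists_head hq0
      obtain ⟨m, hm⟩ := exists_last hq0
      by_cases hv : v = []
      · subst hv
        have hbb : Q.nonrel b b := hY.cyc rfl rfl
        have hbf : Q.rel b f := by
          refine rel_of_ne_right hbb (hbb.1.trans ((hp.tgt_head rfl).trans
            (hq.tgt_head hf).symm)) ?_
          rintro rfl
          exact hh (by rw [hf]; rfl)
        obtain rfl := Q.rel_right_unique _ _ _ hbf hbc
        refine Strip.of_head hc1 hf hlc hm ?_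
        rintro rfl
        exact hl (by rw [last_cons hlc, hm])
      · obtain ⟨g, hg⟩ := exists_last hv
        have := nonrel_right (chain_append_head hn' hg rfl) (chain_append_head hy hg hf)
        exact absurd (by rw [hf, ← this]; rfl) hh
  | right b a v' ha e1 e2 e3 e4 =>
    subst e1 e2 e3 e4
    rw [List.append_nil]
    obtain ⟨l, hla⟩ := exists_last ha
    obtain ⟨a1, ha1⟩ := exists_head ha
    have hlb := chain_append_head hM.2.1 hla rfl
    by_cases hq0 : q = []
    · subst hq0
      obtain rfl : t = s := hq
      by_cases hv : v' = []
      · subst hv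
        exact (hM.not_loop_last hp (by simp) (hY.cyc rfl rfl) (by simpa using ha)).elim
      · obtain ⟨m, hm⟩ := exists_last hv
        obtain ⟨z, hz⟩ := exists_head hv
        obtain rfl : z = a1 := nonrel_right (chain_cons_head hn' hz)
          ⟨(hp.src_last (by simp)).trans (hp.tgt_head (head_append ha1)).symm, hM.right (by simp)⟩
        refine Strip.of_head ha1 hz hla hm ?_
        rintro rfl
        exact (hY.cyc (last_cons hm) rfl).2 hlb
    · obtain ⟨f, hf⟩ := exists_head hq0
      obtain ⟨m, hm⟩ := exists_last hq0
      by_cases hv : v' = []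
      · subst hv
        rw [List.append_nil]
        have hbb : Q.nonrel b b := hY.cyc rfl rfl
        have hbf : Q.rel m b := by
          refine rel_of_ne_left hbb ((hq.src_last hm).trans ((hp.src_last (by simp)).symm.trans
            hbb.1)) ?_
          rintro rfl
          exact hl (by rw [hm]; simp)
        obtain rfl := Q.rel_left_unique _ _ _ hbf hlb
        refine Strip.of_last ha1 hf ?_ hla hm
        rintro rfl
        exact hh (by rw [head_append ha1, hf])
      · obtain ⟨g, hg⟩ := exists_head hv
        have := nonrel_left (chain_cons_head hn' hg) (chain_append_head hy hm hg)
        exact absurd (by rw [hm, ← this]; simp) hl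
  | middle b a c ha hc e1 e2 e3 e4 =>
    subst e1 e2 e3 e4
    exact absurd (loop_of_removed ha hc hM.2.1 hw) (hY.cyc (a := b) (b := b) rfl rfl).2

/-- A nontrivial `q` would have to start or end with the same arrow as `p`, because it would share a
neighbour with the replaced arrow. So `q` is trivial and `p` is closed, and both words start with
the same arrow. -/
theorem Ins.stopAnti_n1Path (hQ : Q.NoLoopOrKronecker) (h : Ins p q p' q' w y)
    (hX : Q.IsStopAnti p q) {t s : V} (hp : Q.IsWalk t s p) (hq : Q.IsWalk t s q)
    (hY : Q.IsN1Path p' q') (hy : y.IsChain Q.nonrel) : Strip w y := by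
  have hX' := hX
  obtain ⟨hM, hn, hh, hl⟩ := hX'
  have hn' := hY.chain
  obtain ⟨α, w', rfl, rfl, hC, hα⟩ := hY
  cases h with
  | single b v v' e1 e2 e3 e4 =>
    subst e1 e3 e4
    rw [e2] at hn'
    obtain ⟨hq0, rfl, rfl⟩ := hX.replace hQ hp hq hn' hy
    exact absurd (List.cons.inj e2).2 hC.1
  | left b c v hc e1 e2 e3 e4 =>
    obtain rfl := last_of_cons_eq_concat e2 hα
    obtain ⟨x, v, rfl⟩ := List.exists_cons_of_ne_nil (l := v) (by
      rintro rfl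
      exact hC.1 (List.cons.inj e2).2)
    obtain ⟨rfl, e2'⟩ := List.cons.inj e2
    subst e1 e3 e4
    rw [e2] at hn'
    obtain ⟨g, hg⟩ := exists_last (w := α :: v) (by simp)
    by_cases hq0 : q = []
    · subst hq0
      obtain rfl : t = s := hq
      rw [List.append_nil]
      refine Strip.of_both rfl rfl (by simpa using hc) fun h1 => ?_
      obtain rfl : v = [] := List.eq_nil_of_length_eq_zero (by simpa using h1)
      exact hM.not_loop_head hp rfl (chain_append_head hn' rfl rfl) (by simpa using hc)
    · obtain ⟨f, hf⟩ := exists_head hq0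
      have := nonrel_right (chain_append_head hn' hg rfl) (chain_append_head hy hg hf)
      exact absurd (by rw [hf, ← this]; rfl) hh
  | right b a v' ha e1 e2 e3 e4 =>
    obtain ⟨rfl, rfl⟩ := List.cons.inj e2
    subst e1 e3 e4
    obtain ⟨a1, ha1⟩ := exists_head ha
    obtain ⟨z, hz⟩ := exists_head hC.1
    by_cases hq0 : q = []
    · subst hq0
      obtain rfl : t = s := hq
      obtain rfl : z = a1 := nonrel_right (chain_cons_head hn' hz)
        ⟨(hp.src_last (by simp)).trans (hp.tgt_head (head_append ha1)).symm, hM.right (by simp)⟩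
      refine Strip.of_both (head_append ha1) hz (by simpa using ha) fun h1 => ?_
      rw [eq_singleton_of_length hz h1] at hα
      obtain rfl : z = α := by simpa using hα
      exact ha (by simpa using hM.eq_singleton (head_append ha1) (by simp))
    · obtain ⟨m, hm⟩ := exists_last hq0
      have := nonrel_left (chain_cons_head hn' hz) (chain_append_head hy hm hz)
      exact absurd (by rw [hm, ← this]; simp) hl
  | middle b a c ha hc e1 e2 e3 e4 => exact absurd (List.cons.inj e2).2 hC.1

/-- Maximality of `p'` leaves only `p = q' = [b]`. Then `q` and `p'` are parallel to `b` and neither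
begins nor ends with it. As at most two arrows start and end at a vertex, they share the first and
the last arrow. They could be a single arrow only for a Kronecker quiver. -/
theorem Ins.stopAnti_stopAnti (hQ : Q.NoLoopOrKronecker) (h : Ins p q p' q' w y)
    (hX : Q.IsStopAnti p q) {t s : V} (hp : Q.IsWalk t s p) (hq : Q.IsWalk t s q)
    (hY : Q.IsStopAnti p' q') {t' s' : V} (hp' : Q.IsWalk t' s' p') (hq' : Q.IsWalk t' s' q')
    (hw : w.IsChain Q.rel) (hy : y.IsChain Q.nonrel) : Strip w y := by
  have hX' := hX
  obtain ⟨hM, hn, hh, hl⟩ := hX'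
  obtain ⟨hM', hn', hh', hl'⟩ := hY
  cases h with
  | single b v v' e1 e2 e3 e4 =>
    subst e1 e2 e3 e4
    obtain ⟨hq0, rfl, rfl⟩ := hX.replace hQ hp hq hn' hy
    rw [List.nil_append, List.append_nil]
    obtain ⟨f, hf⟩ := exists_head hq0
    obtain ⟨m, hm⟩ := exists_last hq0
    obtain ⟨e, he⟩ := exists_head hM'.1
    obtain ⟨l, hl1⟩ := exists_last hM'.1
    have ht : t = t' := (hp.tgt_head rfl).symm.trans (hq'.tgt_head rfl)
    have hs : s = s' := (hp.src_last rfl).symm.trans (hq'.src_last rfl)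
    subst ht hs
    obtain rfl : f = e := not_three_in t (hp.tgt_head rfl) (hq.tgt_head hf) (hp'.tgt_head he)
      (by rintro rfl; exact hh (by rw [hf]; rfl)) (by rintro rfl; exact hh' (by rw [he]; rfl))
    obtain rfl : m = l := not_three_out s (hp.src_last rfl) (hq.src_last hm) (hp'.src_last hl1)
      (by rintro rfl; exact hl (by rw [hm]; rfl)) (by rintro rfl; exact hl' (by rw [hl1]; rfl))
    have hs : w ≠ [f] := by
      rintro rfl
      refine hQ.not_maxAnti_pair (a := b) (b := f) ?_ hM hM' ?_ ?_
      · rintro rfl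
        exact hh (by rw [hf]; rfl)
      · exact (hp.src_last rfl).trans (hp'.src_last rfl).symm
      · exact (hp.tgt_head rfl).trans (hp'.tgt_head rfl).symm
    refine Strip.of_both he hf (length_ne_one_of_ne_singleton he hs) fun h1 => ?_
    rw [eq_singleton_of_length hf h1] at hm
    obtain rfl : f = m := by simpa using hm
    exact hs (hM'.eq_singleton he hl1)
  | left b c v hc e1 e2 e3 e4 =>
    subst e3
    exact (hM'.not_append (a := []) hw (Or.inr hc)).elim
  | right b a v' ha e1 e2 e3 e4 =>
    subst e3
    exact (hM'.not_append (c := []) (by rwa [List.append_nil]) (Or.inl ha)).elim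
  | middle b a c ha hc e1 e2 e3 e4 =>
    subst e3
    exact (hM'.not_append hw (Or.inl ha)).elim

/-- The closing relation of `q'` and the maximality of `p` make both remaining words begin and end
alike. The length clause of `Strip` fails only if both consist of a single arrow, which is the
oriented cycle with two arrows. -/
theorem Ins.stopAnti_stopPath (hQ : Q.NoLoopOrKronecker) (h : Ins p q p' q' w y)
    (hX : Q.IsStopAnti p q) {t s : V} (hp : Q.IsWalk t s p) (hq : Q.IsWalk t s q)
    (hp' : p' = []) (hM' : IsMaxChain Q.nonrel q') {t' : V} (hq' : Q.IsWalk t' t' q')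
    (hy : y.IsChain Q.nonrel) :
    Strip w y ∨ ∃ a b, p = [a, b] ∧ q = [] ∧ q' = [b, a] := by
  have hX' := hX
  obtain ⟨hM, hn, hh, hl⟩ := hX'
  have hn' := hM'.2.1
  have hsing := hM'.ne_singleton hQ hq'
  subst hp'
  cases h with
  | single b v v' e1 e2 e3 e4 =>
    subst e1 e2 e3 e4
    obtain ⟨hq0, rfl, rfl⟩ := hX.replace hQ hp hq hn' hy
    exact (hsing _ rfl).elim
  | left b c v hc e1 e2 e3 e4 =>
    subst e1 e2 e3 e4
    have hv : v ≠ [] := by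
      rintro rfl
      exact hsing _ rfl
    obtain ⟨l, hlc⟩ := exists_last hc
    obtain ⟨c1, hc1⟩ := exists_head hc
    obtain ⟨m, hm⟩ := exists_last hv
    obtain ⟨f, hf⟩ := exists_head hv
    have hbf : Q.rel b f := by
      by_contra hr
      exact hM'.left (head_append hf) ⟨(hq'.src_last (by simp)).trans
        (hq'.tgt_head (head_append hf)).symm, hr⟩
    obtain rfl := Q.rel_right_unique _ _ _ hbf (chain_cons_head hM.2.1 hc1)
    by_cases hq0 : q = []
    · subst hq0
      obtain rfl : t = s := hq
      rw [List.append_nil]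
      obtain rfl : m = l := nonrel_left (chain_append_head hn' hm rfl)
        ⟨(hp.src_last (last_cons hlc)).trans (hp.tgt_head rfl).symm, hM.right (last_cons hlc)⟩
      by_cases h1 : w.length = 1
      · have hc' := eq_singleton_of_length hc1 h1
        subst hc'
        obtain rfl : f = m := by simpa using hlc
        by_cases h2 : v.length = 1
        · exact Or.inr ⟨b, f, rfl, rfl, by rw [eq_singleton_of_length hf h2]; rfl⟩
        · obtain ⟨z, hz⟩ := exists_last_of_length hn'.left_of_append hm h2
          exact (hM'.left (head_append hf) hz).elim
      · by_cases h2 : v.length = 1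
        · have hv' := eq_singleton_of_length hf h2
          subst hv'
          obtain rfl : f = m := by simpa using hm
          obtain ⟨z, hz⟩ := exists_head_of_length hM.2.1.tail hc1 h1
          exact (hM.right (last_cons hlc) hz).elim
        · exact Or.inl (Strip.of_both hc1 hf h1 h2)
    · obtain ⟨g, hg⟩ := exists_head hq0
      have := nonrel_right (chain_append_head hn' hm rfl) (chain_append_head hy hm hg)
      exact absurd (by rw [hg, ← this]; rfl) hh
  | right b a v' ha e1 e2 e3 e4 =>
    subst e1 e2 e3 e4
    have hv : v' ≠ [] := by
      rintro rfl
      exact hsing _ rfl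
    obtain ⟨l, hla⟩ := exists_last ha
    obtain ⟨a1, ha1⟩ := exists_head ha
    obtain ⟨m, hm⟩ := exists_last hv
    obtain ⟨f, hf⟩ := exists_head hv
    have hmb : Q.rel m b := by
      by_contra hr
      exact hM'.right (last_cons hm) ⟨(hq'.src_last (last_cons hm)).trans
        (hq'.tgt_head rfl).symm, hr⟩
    obtain rfl := Q.rel_left_unique _ _ _ hmb (chain_append_head hM.2.1 hla rfl)
    rw [List.append_nil]
    by_cases hq0 : q = []
    · subst hq0
      obtain rfl : t = s := hq
      obtain rfl : f = a1 := nonrel_right (chain_cons_head hn' hf)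
        ⟨(hp.src_last (by simp)).trans (hp.tgt_head (head_append ha1)).symm, hM.right (by simp)⟩
      rw [List.nil_append]
      by_cases h1 : a.length = 1
      · have ha' := eq_singleton_of_length ha1 h1
        subst ha'
        obtain rfl : f = m := by simpa using hla
        by_cases h2 : v'.length = 1
        · exact Or.inr ⟨f, b, rfl, rfl, by rw [eq_singleton_of_length hf h2]⟩
        · obtain ⟨z, hz⟩ := exists_head_of_length hn'.tail hf h2
          exact (hM'.right (last_cons hm) hz).elim
      · by_cases h2 : v'.length = 1
        · have hv' := eq_singleton_of_length hf h2
          subst hv'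
          obtain rfl : f = m := by simpa using hm
          obtain ⟨z, hz⟩ := exists_last_of_length hM.2.1.left_of_append hla h1
          exact (hM.left (head_append ha1) hz).elim
        · exact Or.inl (Strip.of_both ha1 hf h1 h2)
    · obtain ⟨g, hg⟩ := exists_last hq0
      have := nonrel_left (chain_cons_head hn' hf) (chain_append_head hy hg hf)
      exact absurd (by rw [hg, ← this]; simp) hl
  | middle b a c ha hc e1 e2 e3 e4 => exact (hsing _ e2).elim

end GradedGentleQuiver
end

noncomputable section

open GradedHochschild

namespace GradedGentleQuiver

variable {V E : Type*} {Q : GradedGentleQuiver V E}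

/-! ### The letters of a primitive loop -/

namespace PrimitiveLoop

variable (u v : Q.PrimitiveLoop)

/-- The length of the word. -/
def len : ℕ := u.word.length

theorem len_pos : 0 < u.len := List.length_pos_of_ne_nil u.word_ne_nil

/-- The relation between consecutive letters. -/
def step : E → E → Prop := if u.anti then Q.rel else Q.nonrel

theorem step_anti (h : u.anti = true) : u.step = Q.rel := by simp [step, h]

theorem step_path (h : u.anti = false) : u.step = Q.nonrel := by simp [step, h]

theorem word_chain : (u.word ++ u.word).IsChain u.step := by
  have h := u.complete
  unfold step
  split_ifs at h ⊢ with ha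
  · exact h.2
  · exact h.2

theorem step_comp {a b : E} (h : u.step a b) : Q.src a = Q.tgt b := by
  unfold step at h
  split_ifs at h
  · exact Q.rel_composable _ _ h
  · exact h.1

theorem step_right {a b b' : E} (h : u.step a b) (h' : u.step a b') : b = b' := by
  unfold step at h h'
  split_ifs at h h'
  · exact Q.rel_right_unique _ _ _ h h'
  · exact nonrel_right h h'

/-- The letters of the periodic word. -/
def letter (i : ℕ) : E := u.word[i % u.len]'(Nat.mod_lt _ u.len_pos)

theorem letter_mod (i : ℕ) : u.letter (i % u.len) = u.letter i := by
  unfold letter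
  congr 1
  exact Nat.mod_mod _ _

theorem letter_congr {i j : ℕ} (h : i % u.len = j % u.len) : u.letter i = u.letter j := by
  rw [← letter_mod, h, letter_mod]

theorem letter_add_mul (i t : ℕ) : u.letter (i + t * u.len) = u.letter i :=
  u.letter_congr (Nat.add_mul_mod_self_right _ _ _)

theorem letter_of_lt {i : ℕ} (h : i < u.word.length) : u.letter i = u.word[i] := by
  simp only [letter]
  congr 1
  exact Nat.mod_eq_of_lt h

theorem letter_mem (i : ℕ) : u.letter i ∈ u.word := List.getElem_mem _

theorem exists_letter {a : E} (h : a ∈ u.word) : ∃ i, u.letter i = a := by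
  obtain ⟨i, hi, rfl⟩ := List.getElem_of_mem h
  exact ⟨i, u.letter_of_lt hi⟩

theorem step_letter (i : ℕ) : u.step (u.letter i) (u.letter (i + 1)) := by
  rw [← letter_mod, u.letter_congr (i := i + 1) (j := i % u.len + 1) (by simp)]
  have hi := Nat.mod_lt i u.len_pos
  generalize i % u.len = j at hi
  have h := List.isChain_iff_getElem.1 u.word_chain j (by
    rw [List.length_append]
    have := u.len_pos
    unfold len at *
    omega)
  rw [List.getElem_append_left hi] at h
  rw [u.letter_of_lt hi]
  by_cases hj : j + 1 < u.word.length
  · rw [List.getElem_append_left hj] at h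
    rwa [u.letter_of_lt hj]
  · obtain hj : j + 1 = u.word.length := by unfold len at hi; omega
    rw [List.getElem_append_right (by omega)] at h
    rw [u.letter_congr (i := j + 1) (j := 0) (by simp [hj, len]), u.letter_of_lt u.len_pos]
    simp only [hj, Nat.sub_self] at h
    exact h

theorem src_letter (i : ℕ) : Q.src (u.letter i) = Q.tgt (u.letter (i + 1)) :=
  u.step_comp (u.step_letter i)

-- By gentleness a letter determines its successor, so two periodic words of the same kind agree
-- from a common letter on.
variable {u v} in
theorem letter_eq_add {i j : ℕ} (ha : u.anti = v.anti) (h : u.letter i = v.letter j) (n : ℕ) :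
    u.letter (i + n) = v.letter (j + n) := by
  have hs : u.step = v.step := by simp [step, ha]
  induction n with
  | zero => exact h
  | succ n ih =>
    refine u.step_right (u.step_letter (i + n)) ?_
    rw [ih, hs]
    exact v.step_letter (j + n)

/-- The factor of length `n` of the periodic word which starts at position `i`. -/
def win (i n : ℕ) : List E := (List.range n).map fun j => u.letter (i + j)

@[simp] theorem length_win (i n : ℕ) : (u.win i n).length = n := by simp [win]

theorem win_add (i a b : ℕ) : u.win i (a + b) = u.win i a ++ u.win (i + a) b := by
  simp [win, List.range_add, add_assoc]

@[simp] theorem win_zero (i : ℕ) : u.win i 0 = [] := rfl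

theorem win_succ (i n : ℕ) : u.win i (n + 1) = u.letter i :: u.win (i + 1) n := by
  rw [add_comm n 1, win_add]
  rfl

theorem win_succ' (i n : ℕ) : u.win i (n + 1) = u.win i n ++ [u.letter (i + n)] := by
  rw [win_add]
  rfl

theorem win_add_mul (i n t : ℕ) : u.win (i + t * u.len) n = u.win i n := by
  refine List.map_congr_left fun j _ => ?_
  rw [← u.letter_add_mul (i + j) t]
  congr 1
  ring

theorem win_zero_len : u.win 0 u.len = u.word := by
  refine List.ext_getElem (by simp [len]) fun i h1 h2 => ?_
  rw [← u.letter_of_lt h2]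
  simp [win]

theorem win_chain (i n : ℕ) : (u.win i n).IsChain u.step := by
  rw [List.isChain_iff_getElem]
  intro j h
  simpa [win, add_assoc] using u.step_letter (i + j)

theorem win_walk (i n : ℕ) : Q.IsWalk (Q.tgt (u.letter i)) (Q.tgt (u.letter (i + n))) (u.win i n) := by
  induction n generalizing i with
  | zero => rfl
  | succ n ih =>
    rw [win_succ]
    refine ⟨rfl, ?_⟩
    have := ih (i + 1)
    rwa [← src_letter, show i + 1 + n = i + (n + 1) by ring] at this

theorem mem_win {i n : ℕ} {a : E} (h : a ∈ u.win i n) : a ∈ u.word := by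
  obtain ⟨j, -, rfl⟩ := List.mem_map.1 h
  exact u.letter_mem _

theorem pow_eq_win (m : ℕ) : u.pow m = u.win 0 (m * u.len) := by
  induction m with
  | zero => simp [pow]
  | succ m ih =>
    rw [pow, List.replicate_succ', List.flatten_append, ← pow, ih, Nat.succ_mul, win_add,
      win_add_mul, win_zero_len]
    simp

theorem rotate_win (i m : ℕ) (h : i ≤ m * u.len) :
    (u.win 0 (m * u.len)).rotate i = u.win i (m * u.len) := by
  obtain ⟨c, hc⟩ := Nat.exists_eq_add_of_le h
  have h1 : u.win 0 (m * u.len) = u.win 0 i ++ u.win i c := by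
    rw [hc, win_add, zero_add]
  have h2 : u.win i (m * u.len) = u.win i c ++ u.win 0 i := by
    rw [hc, add_comm i c, win_add, ← hc]
    congr 1
    simpa using u.win_add_mul 0 i m
  have h3 := List.rotate_append_length_eq (u.win 0 i) (u.win i c)
  rw [length_win] at h3
  rw [h1, h2, h3]

end PrimitiveLoop

theorem iterate_rotate_one (n : ℕ) (w : List E) :
    (fun w' : List E => w'.rotate 1)^[n] w = w.rotate n := by
  induction n generalizing w with
  | zero => simp
  | succ n ih => rw [Function.iterate_succ_apply, ih, List.rotate_rotate, add_comm]

theorem period_dvd_iff {w : List E} {n : ℕ} : period w ∣ n ↔ w.rotate n = w := by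
  rw [period, ← Function.isPeriodicPt_iff_minimalPeriod_dvd, Function.IsPeriodicPt,
    Function.IsFixedPt, iterate_rotate_one]

namespace PrimitiveLoop

variable (u v : Q.PrimitiveLoop)

-- Equal letters at two positions make the periodic words from there on equal. Shifting one position
-- to `0` shows that a rotation fixes the word, and by primitivity that rotation is a multiple of
-- the length. Thus a primitive loop contains no arrow twice.
variable {u v} in
theorem letter_eq_iff {i j : ℕ} : u.letter i = u.letter j ↔ i % u.len = j % u.len := by
  refine ⟨fun h => ?_, u.letter_congr⟩
  have hi := Nat.mod_lt i u.len_pos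
  -- Shifting by `N` moves the first position to a multiple of the length.
  set N := u.len - i % u.len with hN
  have h0 : (i + N) % u.len = 0 := by
    rw [Nat.add_mod, ← Nat.mod_mod i, ← Nat.add_mod, hN, Nat.add_sub_cancel' hi.le, Nat.mod_self]
  have h1 : ∀ n, u.letter (0 + n) = u.letter ((j + N) % u.len + n) := fun n => by
    have h1 : u.letter 0 = u.letter (i + N) := u.letter_congr (by simp [h0])
    rw [letter_eq_add rfl (h1.trans (letter_eq_add rfl h N)) n]
    exact u.letter_congr (by simp)
  have h2 : u.win 0 (1 * u.len) = u.win ((j + N) % u.len) (1 * u.len) :=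
    List.map_congr_left fun n _ => h1 n
  have h3 := u.rotate_win _ 1 (by simpa using (Nat.mod_lt (j + N) u.len_pos).le)
  rw [← h2, one_mul, win_zero_len] at h3
  have h3 := period_dvd_iff.2 h3
  rw [u.primitive] at h3
  have h4 := Nat.eq_zero_of_dvd_of_lt h3 (Nat.mod_lt (j + N) u.len_pos)
  exact Nat.ModEq.add_right_cancel' (n := u.len) N (h0.trans h4.symm)

/-- A rotation by the period fixes the power, so it returns to the first letter, and by
`letter_eq_iff` the period is a multiple of the length of `u`. -/
theorem period_pow (m : ℕ+) : period (u.pow m) = u.len := by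
  have hm : 0 < (m : ℕ) := m.pos
  have h1 : period (u.pow m) ∣ u.len := by
    rw [period_dvd_iff, pow_eq_win, rotate_win _ _ _ (Nat.le_mul_of_pos_left _ hm)]
    simpa using u.win_add_mul 0 (m * u.len) 1
  have hle := Nat.le_of_dvd u.len_pos h1
  have h2 : (u.pow m).rotate (period (u.pow m)) = u.pow m := period_dvd_iff.1 dvd_rfl
  rw [pow_eq_win, rotate_win _ _ _ ((by rwa [pow_eq_win] at hle :
    _ ≤ u.len).trans (Nat.le_mul_of_pos_left _ hm)), ← pow_eq_win] at h2
  obtain ⟨n, hn⟩ : ∃ n, (m : ℕ) * u.len = n + 1 :=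
    Nat.exists_eq_succ_of_ne_zero (Nat.mul_pos hm u.len_pos).ne'
  generalize period (u.pow m) = r at *
  rw [pow_eq_win, hn, win_succ, win_succ] at h2
  have h3 := letter_eq_iff.1 (List.cons.inj h2).1
  rw [Nat.zero_mod] at h3
  exact Nat.dvd_antisymm h1 (Nat.dvd_of_mod_eq_zero h3)

variable {u v} in
/-- Loops of the same kind with a common arrow belong to the same component. -/
theorem sameComponent_of_mem (ha : u.anti = v.anti) {a : E} (hu : a ∈ u.word) (hv : a ∈ v.word) :
    u.SameComponent v := by
  obtain ⟨i, rfl⟩ := u.exists_letter hu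
  obtain ⟨j, hj⟩ := v.exists_letter hv
  have key : ∀ (u v : Q.PrimitiveLoop) (i j : ℕ), u.anti = v.anti → u.letter i = v.letter j →
      v.len ∣ u.len := by
    intro u v i j ha hj
    have h1 : v.letter (j + u.len) = v.letter j := by
      rw [← hj, ← letter_eq_add ha hj]
      simpa using u.letter_add_mul i 1
    have h2 := letter_eq_iff.1 h1
    exact (Nat.modEq_zero_iff_dvd).1 (Nat.ModEq.add_left_cancel' (n := v.len) j h2)
  have hl := Nat.dvd_antisymm (key v u j i ha.symm hj) (key u v i j ha hj.symm)
  have h1 : u.win i u.len = v.win j v.len := by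
    rw [← hl]
    exact List.map_congr_left fun n _ => letter_eq_add ha hj.symm n
  have hr : ∀ (u : Q.PrimitiveLoop) (i : ℕ), u.word ~r u.win i u.len := by
    intro u i
    refine ⟨i % u.len, ?_⟩
    have := u.rotate_win (i % u.len) 1 (by simpa using (Nat.mod_lt i u.len_pos).le)
    rw [one_mul, win_zero_len] at this
    rw [this]
    conv_rhs => rw [← Nat.mod_add_div' i u.len, win_add_mul]
  exact ⟨ha, (hr u i).trans (h1 ▸ (hr v j).symm)⟩

theorem wdeg_perm {w w' : List E} (h : w.Perm w') : Q.wdeg w = Q.wdeg w' :=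
  (h.map Q.deg).sum_eq

theorem wdeg_win_len (i : ℕ) : Q.wdeg (u.win i u.len) = Q.wdeg u.word := by
  have h := u.rotate_win (i % u.len) 1 (by simpa using (Nat.mod_lt i u.len_pos).le)
  rw [one_mul, win_zero_len] at h
  rw [← Nat.mod_add_div' i u.len, win_add_mul, ← h]
  exact wdeg_perm (List.rotate_perm _ _)

theorem wdeg_win_mul (i m : ℕ) : Q.wdeg (u.win i (m * u.len)) = m * Q.wdeg u.word := by
  induction m with
  | zero => simp [wdeg]
  | succ m ih =>
    rw [Nat.succ_mul, win_add, wdeg_append, ih, wdeg_win_len]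
    push_cast
    ring

/-- The last letter of the word. -/
def last : E := u.letter (u.len - 1)

theorem letter_eq_last_iff {i : ℕ} : u.letter i = u.last ↔ (i + 1) % u.len = 0 := by
  rw [last, letter_eq_iff, ← Nat.ModEq, ← Nat.ModEq.add_iff_right (c := 1) (d := 1) rfl,
    Nat.sub_add_cancel u.len_pos]
  simp [Nat.ModEq]

theorem getLast_pow (m : ℕ+) : (u.pow m).getLast (u.pow_ne_nil m) = u.last := by
  obtain ⟨n, hn⟩ : ∃ n, (m : ℕ) * u.len = n + 1 :=
    Nat.exists_eq_succ_of_ne_zero (Nat.mul_pos m.pos u.len_pos).ne'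
  have h : u.pow m = u.win 0 n ++ [u.letter (0 + n)] := by
    rw [pow_eq_win, hn, win_succ']
  simp only [h, List.getLast_append_singleton, zero_add]
  rw [letter_eq_last_iff, ← hn]
  simp

theorem last_cons_pow (m : ℕ) : u.last :: u.pow m = u.win (u.len - 1) (m * u.len + 1) := by
  rw [win_succ, pow_eq_win, last, Nat.sub_add_cancel u.len_pos]
  congr 1
  simpa using (u.win_add_mul 0 (m * u.len) 1).symm

theorem win_complete (i : ℕ) (m : ℕ+) : u.win i (m * u.len) ≠ [] ∧
    (u.win i (m * u.len) ++ u.win i (m * u.len)).IsChain u.step := by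
  refine ⟨fun h => ?_, ?_⟩
  · have := congrArg List.length h
    have h' := Nat.mul_pos m.pos u.len_pos
    simp at this
    have := u.len_pos
    omega
  · have h := u.win_add i (m * u.len) (m * u.len)
    rw [win_add_mul] at h
    rw [← h]
    exact u.win_chain _ _

end PrimitiveLoop
end GradedGentleQuiver
end

noncomputable section

open GradedHochschild

namespace GradedGentleQuiver

variable {k V E : Type*} [Field k] {Q : GradedGentleQuiver V E}

namespace PrimitiveLoop

variable (u v : Q.PrimitiveLoop)

/-- The factor of length `n` which starts at position `i` as a path. -/
def winPath (h : u.anti = false) (i n : ℕ) : Q.NZPath :=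
  ⟨Q.tgt (u.letter i), Q.tgt (u.letter (i + n)), u.win i n, u.win_walk i n,
    u.step_path h ▸ u.win_chain i n⟩

theorem wdeg_win_rest {i : ℕ} (h : i < u.len) : Q.wdeg (u.win i (u.len - 1 - i)) =
    Q.wdeg u.word - Q.deg u.last - Q.wdeg (u.win 0 i) := by
  have h1 := u.wdeg_win_len 0
  obtain ⟨c, hc⟩ := Nat.exists_eq_add_of_lt h
  have h2 : u.len - 1 - i = c := by omega
  have h3 : u.len - 1 = i + c := by omega
  rw [hc, win_succ', wdeg_append, win_add, wdeg_append, zero_add, zero_add, ← h3] at h1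
  rw [h2, ← h1, last]
  simp [wdeg]

end PrimitiveLoop

variable [Fintype V]

namespace PrimitiveLoop

variable (u : Q.PrimitiveLoop)

theorem sum_if_lt {M : Type*} [AddCommMonoid M] {a b : ℕ} (h : a ≤ b) (f : ℕ → M) :
    ∑ i : Fin b, (if i.val < a then f i.val else 0) = ∑ i ∈ Finset.range a, f i := by
  rw [Fin.sum_univ_eq_sum_range (fun i => if i < a then f i else 0) b, ← Finset.sum_filter]
  congr 1
  ext i
  simp only [Finset.mem_filter, Finset.mem_range]
  omega

theorem cochainN0_pow (m : ℕ+) : Q.cochainN0 k u.anti (u.pow m) = ∑ i ∈ Finset.range u.len,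
    if u.anti then sgn k (i * (u.pow m).length + Q.wdeg (u.pow m) * Q.wdeg ((u.pow m).take i)) •
      Q.dual k ((u.pow m).rotate i) [] (Q.tgt (u.letter i))
    else sgn k (Q.wdeg (u.pow m) * Q.wdeg ((u.pow m).take i)) •
      Q.dual k [] ((u.pow m).rotate i) (Q.tgt (u.letter i)) := by
  have hle : u.len ≤ (u.pow m).length := by
    rw [pow_eq_win, length_win]
    exact Nat.le_mul_of_pos_left _ m.pos
  rw [← sum_if_lt hle, cochainN0, period_pow]
  refine Finset.sum_congr rfl fun i _ => ?_
  have h1 : (u.pow m).get i = u.letter i := by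
    have hi := i.2
    simp [pow_eq_win, win]
  rw [h1]

theorem take_pow {m : ℕ} {i : ℕ} (h : i ≤ m * u.len) : (u.pow m).take i = u.win 0 i := by
  obtain ⟨c, hc⟩ := Nat.exists_eq_add_of_le h
  have h1 := u.length_win 0 i
  rw [pow_eq_win, hc, win_add, List.take_append_of_le_length h1.ge, List.take_of_length_le h1.le]

theorem N0_anti (h : u.anti = true) (m : ℕ+) : u.N0 k m = ∑ i ∈ Finset.range u.len,
    sgn k (i * (m * u.len) + m * Q.wdeg u.word * Q.wdeg (u.win 0 i)) •
      Q.dual k (u.win i (m * u.len)) [] (Q.tgt (u.letter i)) := by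
  rw [N0, cochainN0_pow]
  refine Finset.sum_congr rfl fun i hi => ?_
  have hi' : i ≤ (m : ℕ) * u.len :=
    (Finset.mem_range.1 hi).le.trans (Nat.le_mul_of_pos_left _ m.pos)
  rw [if_pos h, take_pow _ hi', pow_eq_win, rotate_win _ _ _ hi', length_win, wdeg_win_mul]
  push_cast
  rfl

theorem N0_path (h : u.anti = false) (m : ℕ+) : u.N0 k m = ∑ i ∈ Finset.range u.len,
    sgn k (m * Q.wdeg u.word * Q.wdeg (u.win 0 i)) •
      Q.dual k [] (u.winPath h i (m * u.len)).word (u.winPath h i (m * u.len)).src := by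
  rw [N0, cochainN0_pow]
  refine Finset.sum_congr rfl fun i hi => ?_
  have hi' : i ≤ (m : ℕ) * u.len :=
    (Finset.mem_range.1 hi).le.trans (Nat.le_mul_of_pos_left _ m.pos)
  rw [if_neg (by simp [h]), take_pow _ hi', pow_eq_win, rotate_win _ _ _ hi', wdeg_win_mul]
  change _ = _ • Q.dual k [] (u.win i (m * u.len)) (Q.tgt (u.letter (i + m * u.len)))
  rw [letter_add_mul]

theorem N1_anti (h : u.anti = true) (m : ℕ+) : u.N1 k m =
    sgn k (m * u.len * (1 + Q.deg u.last)) •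
      Q.dual k (u.win (u.len - 1) (m * u.len + 1)) [u.last] (Q.src u.last) := by
  rw [N1, cochainN1, getLast_pow, if_pos h, last_cons_pow, pow_eq_win, length_win]
  push_cast
  rfl

theorem N1_path (h : u.anti = false) (m : ℕ+) : u.N1 k m =
    -Q.dual k [u.last] (u.winPath h (u.len - 1) (m * u.len + 1)).word
      (u.winPath h (u.len - 1) (m * u.len + 1)).src := by
  rw [N1, cochainN1, getLast_pow, if_neg (by simp [h]), last_cons_pow, winPath, last, src_letter]
  congr 3
  refine u.letter_congr ?_
  rw [← add_assoc, add_right_comm]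
  simp

end PrimitiveLoop

/-! ### Linear combinations of cochains of pairs -/

variable (Q k) in
/-- The linear combinations of the cochains of parallel pairs `(p, q)` with a given property. -/
def terms (T : List E → List E → Prop) (d : ℤ) : Submodule k (Coch (Q.Alg k)) :=
  Submodule.span k {D | ∃ (p : List E) (q : Q.NZPath), T p q.word ∧ p.IsChain Q.rel ∧
    Q.IsWalk q.tgt q.src p ∧ d = p.length + Q.wdeg q.word - Q.wdeg p ∧
    D = Q.dual k p q.word q.src}

variable {T T' : List E → List E → Prop} {i j l d : ℤ} {F G : Coch (Q.Alg k)}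

theorem dual_mem_terms {p : List E} {q : Q.NZPath} (hT : T p q.word) (hp : p.IsChain Q.rel)
    (hpq : Q.IsWalk q.tgt q.src p) (hd : d = p.length + Q.wdeg q.word - Q.wdeg p) :
    Q.dual k p q.word q.src ∈ Q.terms k T d :=
  Submodule.subset_span ⟨p, q, hT, hp, hpq, hd, rfl⟩

theorem terms_le_adapted : Q.terms k T d ≤ Q.adapted k d := by
  refine Submodule.span_le.2 ?_
  rintro D ⟨p, q, -, hp, hpq, hd, rfl⟩
  exact dual_mem_adapted hp hpq hd

theorem coeffs_terms_ne (hF : F ∈ Q.terms k T d) {L : List Q.NZPath} {y : Q.NZPath}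
    (h : Q.coeffs (ev F (Q.bas k L)) y ≠ 0) : ∃ (p : List E) (q : Q.NZPath), T p q.word ∧
      p.IsChain Q.rel ∧ Q.IsWalk q.tgt q.src p ∧ Q.coeffs (dualList (k := k) p q L) y ≠ 0 := by
  induction hF using Submodule.span_induction with
  | zero => exact absurd rfl h
  | add F G _ _ h1 h2 =>
    rw [ev_add] at h
    rcases coeffs_add_ne h with h | h
    · exact h1 h
    · exact h2 h
  | smul c F _ h1 =>
    rw [ev_smul] at h
    exact h1 (coeffs_smul_ne h)
  | mem D hD =>
    obtain ⟨p, q, hT, hp, hpq, -, rfl⟩ := hD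
    rw [ev_dual] at h
    exact ⟨p, q, hT, hp, hpq, h⟩

theorem exists_ins (hF : F ∈ Q.terms k T i) (hG : G ∈ Q.terms k T' j) {w : List E} {y : Q.NZPath}
    (h : Q.coeffs (comp (Q.grading k) j (ev F) (ev G) (Q.bas k (Q.arr w))) y ≠ 0) :
    ∃ (p p' : List E) (q q' : Q.NZPath), T p q.word ∧ T' p' q'.word ∧ p.IsChain Q.rel ∧
      Q.IsWalk q.tgt q.src p ∧ p'.IsChain Q.rel ∧ Q.IsWalk q'.tgt q'.src p' ∧
      Ins p q.word p' q'.word w y.word := by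
  classical
  have hl := Lin.of_mem_cochains (terms_le_adapted hF).1
  obtain ⟨A, B, C, hABC, z, h1, h2⟩ := coeffs_comp_ne hl h
  rw [arr] at hABC
  obtain ⟨a, bc, rfl, rfl, hbc⟩ := List.map_eq_append_iff.1 hABC
  obtain ⟨b, c, rfl, rfl, rfl⟩ := List.map_eq_append_iff.1 hbc
  obtain ⟨p', q', hT', hp', hpq', h3⟩ := coeffs_terms_ne hG h1
  obtain ⟨p, q, hT, hp, hpq, h4⟩ := coeffs_terms_ne hF h2
  change Q.coeffs (dualList p' q' (Q.arr b)) z ≠ 0 at h3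
  rw [dualList_arr] at h3
  split_ifs at h3 with hb
  · subst hb
    obtain rfl := coeffs_ofPath_ne h3
    obtain ⟨h5, -, v, v', h6, h7⟩ := coeffs_dualList_ne hp hpq h4
    refine ⟨p, p', q, z, hT, hT', hp, hpq, hp', hpq', ins_of_flatten hp z.nonzero ?_ (v := v)
      (v' := v') ?_ h7⟩
    · simp at h5
      omega
    · rw [← h6, List.map_append, List.map_cons, List.flatten_append, List.flatten_cons]
      have e1 := flatten_arr (Q := Q) a
      have e2 := flatten_arr (Q := Q) c
      rw [arr] at e1 e2
      rw [e1, e2]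
  · exact absurd rfl h3

theorem Removable.prolongs {w : List E} {y : Q.NZPath} (h : Q.Removable w y.word)
    (hw : Q.IsWalk y.tgt y.src w) : Strip w y.word ∨ Q.Prolongs w y := by
  refine h.imp id ?_
  rintro ⟨a, h1, h2, h3, h4⟩
  have hs : Q.src a = y.tgt := by
    rcases h4 with h4 | h4
    · obtain ⟨b, hb⟩ := exists_head h4
      rw [← hw.tgt_head hb]
      exact Q.rel_composable _ _ (chain_cons_head h1 hb)
    · obtain ⟨b, hb⟩ := exists_head h4
      rw [← y.walk.tgt_head hb]
      exact (chain_cons_head h2 hb).1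
  exact ⟨a, ⟨Q.tgt a, y.src, a :: y.word, ⟨rfl, hs ▸ y.walk⟩, h2⟩, h1, ⟨rfl, rfl, hs.symm⟩, h3⟩

/-- Two properties of pairs, such that insertions of pairs are removable. -/
def InsRemovable (Q : GradedGentleQuiver V E) (T T' : List E → List E → Prop) : Prop :=
  ∀ (p p' w : List E) (q q' y : Q.NZPath), T p q.word → T' p' q'.word → p.IsChain Q.rel →
      Q.IsWalk q.tgt q.src p → p'.IsChain Q.rel → Q.IsWalk q'.tgt q'.src p' →
      w.IsChain Q.rel → Ins p q.word p' q'.word w y.word → Q.Removable w y.word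

theorem bracket_mem_coboundaries_of_insRemovable [Fintype E] (hl : l = i + j - 1)
    (hF : F ∈ Q.normalCocycles k i) (hG : G ∈ Q.normalCocycles k j)
    (hFt : F ∈ Q.terms k T i) (hGt : G ∈ Q.terms k T' j) (h : InsRemovable Q T T')
    (h' : InsRemovable Q T' T) : bracket (Q.grading k) i j F G ∈ coboundaries (Q.grading k) l := by
  have hb := bracket_mem_normalCocycles hl hF hG
  refine mem_coboundaries_of_strip hb fun w hw y hy => ?_
  refine Removable.prolongs ?_ (normalCocycles.coef_ne hb hy).1
  rw [coef, ev_bracket, brk] at hy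
  rcases coeffs_add_ne hy with hy | hy
  · obtain ⟨p, p', q, q', h1, h2, h3, h4, h5, h6, h7⟩ := exists_ins hFt hGt hy
    exact h p p' w q q' y h1 h2 h3 h4 h5 h6 hw h7
  · obtain ⟨p, p', q, q', h1, h2, h3, h4, h5, h6, h7⟩ := exists_ins hGt hFt (coeffs_smul_ne hy)
    exact h' p p' w q q' y h1 h2 h3 h4 h5 h6 hw h7

/-- The pairs occurring in the cochain of an element. -/
def Elt.IsTerm : Q.Elt k → List E → List E → Prop
  | .unit, p, q => p = [] ∧ q = []
  | .ofH _, p, q => ∃ a, p = [a] ∧ q = [a]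
  | .ofN0 u _ _, p, q =>
    (u.anti = true ∧ Q.IsCompleteAnti p ∧ q = [] ∧ ∀ a ∈ p, a ∈ u.word) ∨
    (u.anti = false ∧ p = [] ∧ Q.IsCompletePath q ∧ ∀ a ∈ q, a ∈ u.word)
  | .ofN1 u _ _, p, q =>
    (u.anti = true ∧ Q.IsN1Anti p q ∧ ∀ a ∈ p, a ∈ u.word) ∨
    (u.anti = false ∧ Q.IsN1Path p q ∧ ∀ a ∈ q, a ∈ u.word)
  | .ofB c, p, q => p = c.p ∧ q = c.q

theorem OneStop.isStop (c : Q.OneStop) :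
    Q.IsStopAnti c.p c.q ∨ (c.p = [] ∧ IsMaxChain Q.nonrel c.q ∧ c.t = c.s) := by
  rcases c.maximal with ⟨h1, h2, h3, h4⟩ | ⟨h1, h2, h3⟩
  · exact Or.inl ⟨⟨h1, c.p_anti, h2⟩, c.q_path, h3, h4⟩
  · have := c.p_walk
    rw [h1] at this
    exact Or.inr ⟨h1, ⟨h2, c.q_path, h3⟩, this⟩

end GradedGentleQuiver
end

noncomputable section

open GradedHochschild

namespace GradedGentleQuiver

variable {k V E : Type*} [Field k] {Q : GradedGentleQuiver V E}

/-- The two pairs of an oriented cycle with two arrows and one relation. -/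
def Elt.IsCyclePair (x y : Q.Elt k) : Prop :=
  ∃ (a b : E) (c c' : Q.OneStop), x = .ofB c ∧ y = .ofB c' ∧ c.p = [a, b] ∧ c.q = [] ∧
    c'.p = [] ∧ c'.q = [b, a]

variable [Fintype V]

/-- The bracket of the elements is not described explicitly. -/
structure Elt.Unlisted (x y : Q.Elt k) : Prop where
  left : ¬ x.Listed y
  right : ¬ y.Listed x
  cycle : ¬ x.IsCyclePair y
  h : ∀ f g, ¬ (x = .ofH f ∧ y = .ofH g)

theorem Elt.insRemovable (hQ : Q.NoLoopOrKronecker) {x y : Q.Elt k} (hxy : x.Unlisted y) :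
    InsRemovable Q x.IsTerm y.IsTerm := by
  intro p p' w q q' z hx hy hp hpq hp' hpq' hw hI
  obtain ⟨b, hb, hb'⟩ := hI.exists_mem
  obtain ⟨hl, hr, hc, hh⟩ := hxy
  cases x with
  | unit =>
    rw [hx.1] at hb
    simp at hb
  | ofH f =>
    cases y with
    | unit =>
      rw [hy.2] at hb'
      simp at hb'
    | ofH g => exact (hh f g ⟨rfl, rfl⟩).elim
    | ofN0 u m h => exact (hl (.h_N0 f u m h)).elim
    | ofN1 u m h => exact (hl (.h_N1 f u m h)).elim
    | ofB c => exact (hl (.h_B f c)).elim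
  | ofN0 u m h =>
    rcases hx with ⟨hu, hx, hq, hm⟩ | ⟨hu, rfl, -⟩
    · cases y with
      | unit =>
        rw [hy.2] at hb'
        simp at hb'
      | ofH g => exact (hr (.h_N0 g u m h)).elim
      | ofN0 v n h' =>
        rcases hy with ⟨hv, hy, hq', hn⟩ | ⟨hv, hp0, hy, hn⟩
        · rw [hq'] at hb'
          simp at hb'
        · exact hI.n0Anti_n0Path hx hq hp0 hy hw z.nonzero
      | ofN1 v n h' =>
        rcases hy with ⟨hv, hy, hn⟩ | ⟨hv, hy, hn⟩
        · refine (hl (.N0_N1 u m h v n h' (PrimitiveLoop.sameComponent_of_mem (hu.trans hv.symm)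
            (hm b hb) (hn b ?_)))).elim
          obtain ⟨a, w', rfl, h2, -⟩ := hy
          rw [h2] at hb'
          rw [List.mem_singleton.1 hb']
          exact List.mem_cons_self
        · exact Or.inl (hI.n0Anti_n1Path hx hq hy q'.nonzero z.nonzero)
      | ofB c =>
        obtain ⟨h1, h2⟩ := hy
        rcases c.isStop with hS | ⟨hc1, hc2, hc3⟩
        · rw [← h1, ← h2] at hS
          exact Or.inl (hI.n0Anti_stopAnti hx hq hS hpq' q'.walk hw z.nonzero)
        · rw [← h2] at hc2
          have h3 := h1.trans hc1
          rw [h3] at hpq'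
          have := q'.walk
          rw [show q'.tgt = q'.src from hpq'] at this
          exact Or.inl (hI.n0Anti_stopPath hQ hx hq h3 hc2 this z.nonzero)
    · simp at hb
  | ofN1 u m h =>
    rcases hx with ⟨hu, hx, hm⟩ | ⟨hu, hx, hm⟩
    · have hbu : b ∈ u.word := hm b hb
      cases y with
      | unit =>
        rw [hy.2] at hb'
        simp at hb'
      | ofH g => exact (hr (.h_N1 g u m h)).elim
      | ofN0 v n h' =>
        rcases hy with ⟨hv, hy, hq', hn⟩ | ⟨hv, hp0, hy, hn⟩
        · rw [hq'] at hb'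
          simp at hb'
        · exact Or.inl (hI.n1Anti_n0Path hx hp0 hy hw)
      | ofN1 v n h' =>
        rcases hy with ⟨hv, hy, hn⟩ | ⟨hv, hy, hn⟩
        · refine (hl (.N1_N1 u m h v n h' (PrimitiveLoop.sameComponent_of_mem (hu.trans hv.symm)
            hbu (hn b ?_)))).elim
          obtain ⟨a, w', rfl, h2, -⟩ := hy
          rw [h2] at hb'
          rw [List.mem_singleton.1 hb']
          exact List.mem_cons_self
        · exact Or.inl (hI.n1Anti_n1Path hx hy)
      | ofB c =>
        obtain ⟨h1, h2⟩ := hy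
        rcases c.isStop with hS | ⟨hc1, hc2, hc3⟩
        · rw [← h1, ← h2] at hS
          exact (hI.not_n1Anti_stopAnti hx hS.1 hw).elim
        · rw [← h2] at hc2
          have h3 := h1.trans hc1
          rw [h3] at hpq'
          have := q'.walk
          rw [show q'.tgt = q'.src from hpq'] at this
          exact Or.inl (hI.n1Anti_stopPath hQ hx h3 hc2 this)
    · have hbu : b ∈ u.word := by
        obtain ⟨a, w', h1, h2, -⟩ := hx
        rw [h1] at hb
        rw [List.mem_singleton.1 hb]
        exact hm a (by simp [h2])
      cases y with
      | unit =>
        rw [hy.2] at hb'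
        simp at hb'
      | ofH g => exact (hr (.h_N1 g u m h)).elim
      | ofN0 v n h' =>
        rcases hy with ⟨hv, hy, hq', hn⟩ | ⟨hv, hp0, hy, hn⟩
        · rw [hq'] at hb'
          simp at hb'
        · exact (hr (.N0_N1 v n h' u m h (PrimitiveLoop.sameComponent_of_mem (hv.trans hu.symm)
            (hn b hb') hbu))).elim
      | ofN1 v n h' =>
        rcases hy with ⟨hv, hy, hn⟩ | ⟨hv, hy, hn⟩
        · exact Or.inl (hI.n1Path_n1Anti hx hy)
        · exact (hl (.N1_N1 u m h v n h' (PrimitiveLoop.sameComponent_of_mem (hu.trans hv.symm)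
            hbu (hn b hb')))).elim
      | ofB c =>
        obtain ⟨h1, h2⟩ := hy
        rcases c.isStop with hS | ⟨hc1, hc2, hc3⟩
        · rw [← h1, ← h2] at hS
          exact (hI.not_n1Path_stopAnti hx hS hpq' q'.walk).elim
        · rw [← h2] at hc2
          exact (hI.not_n1Path_stopPath hx hc2).elim
  | ofB c₀ =>
    obtain ⟨h1, h2⟩ := hx
    rcases c₀.isStop with hc₀ | ⟨hc1, -⟩
    · rw [← h1, ← h2] at hc₀
      cases y with
      | unit =>
        rw [hy.2] at hb'
        simp at hb'
      | ofH g => exact (hr (.h_B g c₀)).elim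
      | ofN0 v n h' =>
        rcases hy with ⟨hv, hy, hq', hn⟩ | ⟨hv, hp0, hy, hn⟩
        · rw [hq'] at hb'
          simp at hb'
        · exact Or.inl (hI.stopAnti_n0Path hQ hc₀ hpq q.walk hp0 hy hw z.nonzero)
      | ofN1 v n h' =>
        rcases hy with ⟨hv, hy, hn⟩ | ⟨hv, hy, hn⟩
        · exact (hI.not_stopAnti_n1Anti hc₀.1 hy).elim
        · exact Or.inl (hI.stopAnti_n1Path hQ hc₀ hpq q.walk hy z.nonzero)
      | ofB c =>
        obtain ⟨h3, h4⟩ := hy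
        rcases c.isStop with hS | ⟨hc1, hc2, hc3⟩
        · rw [← h3, ← h4] at hS
          exact Or.inl (hI.stopAnti_stopAnti hQ hc₀ hpq q.walk hS hpq' q'.walk hw z.nonzero)
        · rw [← h4] at hc2
          have h5 := h3.trans hc1
          rw [h5] at hpq'
          have := q'.walk
          rw [show q'.tgt = q'.src from hpq'] at this
          refine (hI.stopAnti_stopPath hQ hc₀ hpq q.walk h5 hc2 this z.nonzero).elim Or.inl ?_
          rintro ⟨a, b, e1, e2, e3⟩
          exact (hc ⟨a, b, c₀, c, rfl, rfl, h1.symm.trans e1, h2.symm.trans e2, hc1,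
            h4.symm.trans e3⟩).elim
    · rw [h1, hc1] at hb
      simp at hb

end GradedGentleQuiver
end

noncomputable section

open GradedHochschild

namespace GradedGentleQuiver

variable {k V E : Type*} [Field k] {Q : GradedGentleQuiver V E}

namespace PrimitiveLoop

variable (u : Q.PrimitiveLoop)

theorem winding_anti (h : u.anti = true) : u.winding = u.len - Q.wdeg u.word := by
  simp [winding, h, len]

theorem winding_path (h : u.anti = false) : u.winding = Q.wdeg u.word := by
  simp [winding, h]

theorem letter_last_add (m : ℕ) :
    u.letter (u.len - 1 + (m * u.len + 1)) = u.letter (u.len - 1 + 1) := by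
  refine u.letter_congr ?_
  rw [← add_assoc, add_right_comm]
  simp

theorem src_last : Q.src u.last = Q.tgt (u.letter (u.len - 1 + 1)) := u.src_letter _

theorem getLast_win_last (m : ℕ+) : (u.win (u.len - 1 + 1) (m * u.len)).getLast? = some u.last := by
  obtain ⟨n, hn⟩ : ∃ n, (m : ℕ) * u.len = n + 1 :=
    Nat.exists_eq_succ_of_ne_zero (Nat.mul_pos m.pos u.len_pos).ne'
  rw [hn, win_succ', List.getLast?_concat, Option.some_inj, letter_eq_last_iff,
    show u.len - 1 + 1 + n + 1 = (u.len - 1 + 1) + (n + 1) by ring, ← hn,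
    Nat.sub_add_cancel u.len_pos]
  simp

theorem win_completeAnti (h : u.anti = true) (i : ℕ) (m : ℕ+) :
    Q.IsCompleteAnti (u.win i (m * u.len)) := by
  rw [IsCompleteAnti, ← u.step_anti h]
  exact u.win_complete i m

theorem win_completePath (h : u.anti = false) (i : ℕ) (m : ℕ+) :
    Q.IsCompletePath (u.win i (m * u.len)) := by
  rw [IsCompletePath, ← u.step_path h]
  exact u.win_complete i m

theorem winPath_word (h : u.anti = false) (i n : ℕ) : (u.winPath h i n).word = u.win i n := rfl

/-- The pairs in `N⁰(uᵐ)`. -/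
def PairN0 (m : ℕ) (p q : List E) : Prop :=
  (u.anti = true ∧ (∃ i, p = u.win i (m * u.len)) ∧ q = []) ∨
    (u.anti = false ∧ p = [] ∧ ∃ i, q = u.win i (m * u.len))

/-- The pairs in `N¹(uᵐ)`. -/
def PairN1 (m : ℕ) (p q : List E) : Prop :=
  (u.anti = true ∧ p = u.win (u.len - 1) (m * u.len + 1) ∧ q = [u.last]) ∨
    (u.anti = false ∧ p = [u.last] ∧ q = u.win (u.len - 1) (m * u.len + 1))

end PrimitiveLoop

/-- The pairs occurring in the cochain of an element. -/
def Elt.IsPair : Q.Elt k → List E → List E → Prop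
  | .unit, p, q => p = [] ∧ q = []
  | .ofH _, p, q => ∃ a, p = [a] ∧ q = [a]
  | .ofN0 u m _, p, q => u.PairN0 m p q
  | .ofN1 u m _, p, q => u.PairN1 m p q
  | .ofB c, p, q => p = c.p ∧ q = c.q

theorem Elt.IsPair.isTerm {x : Q.Elt k} {p q : List E} (h : x.IsPair p q) : x.IsTerm p q := by
  cases x with
  | unit => exact h
  | ofH f => exact h
  | ofN0 u m hm =>
    rcases h with ⟨hu, ⟨i, rfl⟩, rfl⟩ | ⟨hu, rfl, ⟨i, rfl⟩⟩
    · exact Or.inl ⟨hu, u.win_completeAnti hu i m, rfl, fun a => u.mem_win⟩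
    · exact Or.inr ⟨hu, rfl, u.win_completePath hu i m, fun a => u.mem_win⟩
  | ofN1 u m hm =>
    rcases h with ⟨hu, rfl, rfl⟩ | ⟨hu, rfl, rfl⟩
    · exact Or.inl ⟨hu, ⟨_, _, u.win_succ _ _, rfl, u.win_completeAnti hu _ m,
        u.getLast_win_last m⟩, fun a => u.mem_win⟩
    · exact Or.inr ⟨hu, ⟨_, _, rfl, u.win_succ _ _, u.win_completePath hu _ m,
        u.getLast_win_last m⟩, fun a => u.mem_win⟩
  | ofB c => exact h

variable [Fintype V]

theorem terms_mono {T T' : List E → List E → Prop} (h : ∀ p q, T p q → T' p q) (d : ℤ) :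
    Q.terms k T d ≤ Q.terms k T' d := by
  refine Submodule.span_mono ?_
  rintro D ⟨p, q, hT, h'⟩
  exact ⟨p, q, h _ _ hT, h'⟩

theorem PrimitiveLoop.N0_mem_terms (u : Q.PrimitiveLoop) (m : ℕ+) :
    u.N0 k m ∈ Q.terms k (u.PairN0 m) (m * u.winding) := by
  cases hu : u.anti with
  | true =>
    rw [u.N0_anti hu]
    refine Submodule.sum_mem _ fun i _ => Submodule.smul_mem _ _ ?_
    have hw := u.win_walk i (m * u.len)
    rw [letter_add_mul] at hw
    refine dual_mem_terms (q := Q.trivialPath (Q.tgt (u.letter i))) (Or.inl ⟨hu, ⟨i, rfl⟩, rfl⟩)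
      (u.step_anti hu ▸ u.win_chain _ _) hw ?_
    rw [length_win, wdeg_win_mul, winding_anti _ hu]
    simp [trivialPath, wdeg]
    ring
  | false =>
    rw [u.N0_path hu]
    refine Submodule.sum_mem _ fun i _ => Submodule.smul_mem _ _ ?_
    refine dual_mem_terms (Or.inr ⟨hu, rfl, ⟨i, rfl⟩⟩) (by simp) ?_ ?_
    · change Q.tgt (u.letter i) = Q.tgt (u.letter (i + m * u.len))
      rw [letter_add_mul]
    · rw [winding_path _ hu, winPath, wdeg_win_mul]
      simp [wdeg]

theorem PrimitiveLoop.N1_mem_terms (u : Q.PrimitiveLoop) (m : ℕ+) :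
    u.N1 k m ∈ Q.terms k (u.PairN1 m) (m * u.winding + 1) := by
  cases hu : u.anti with
  | true =>
    rw [u.N1_anti hu]
    refine Submodule.smul_mem _ _ ?_
    have hw := u.win_walk (u.len - 1) (m * u.len + 1)
    rw [letter_last_add, ← src_last] at hw
    refine dual_mem_terms (q := Q.arrowPath u.last) (Or.inl ⟨hu, rfl, rfl⟩)
      (u.step_anti hu ▸ u.win_chain _ _) hw ?_
    rw [length_win, win_succ', wdeg_append, wdeg_win_mul, winding_anti _ hu]
    have : u.letter (u.len - 1 + m * u.len) = u.last := u.letter_add_mul _ _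
    rw [this]
    simp [arrowPath, wdeg]
    ring
  | false =>
    rw [u.N1_path hu]
    refine Submodule.neg_mem _ ?_
    refine dual_mem_terms (Or.inr ⟨hu, rfl, rfl⟩) (by simp) ?_ ?_
    · refine ⟨rfl, ?_⟩
      change Q.src u.last = Q.tgt (u.letter (u.len - 1 + (m * u.len + 1)))
      rw [letter_last_add, ← src_last]
    · rw [winding_path _ hu, winPath_word, win_succ', wdeg_append, wdeg_win_mul]
      have : u.letter (u.len - 1 + m * u.len) = u.last := u.letter_add_mul _ _
      rw [this]
      simp [wdeg]
      ring

theorem Elt.cochain_mem_terms [Fintype E] (x : Q.Elt k) :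
    x.cochain ∈ Q.terms k x.IsPair x.degree := by
  cases x with
  | unit =>
    exact Submodule.sum_mem _ fun x _ => dual_mem_terms (q := Q.trivialPath x) ⟨rfl, rfl⟩ (by simp)
      rfl (by simp [degree, trivialPath, wdeg])
  | ofH f =>
    exact Submodule.sum_mem _ fun a _ => Submodule.smul_mem _ _ <|
      dual_mem_terms (q := Q.arrowPath a) ⟨a, rfl, rfl⟩ (by simp) ⟨rfl, rfl⟩
        (by simp [degree, arrowPath, wdeg])
  | ofN0 u m h => exact u.N0_mem_terms m
  | ofN1 u m h => exact u.N1_mem_terms m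
  | ofB c =>
    exact dual_mem_terms (q := ⟨c.t, c.s, c.q, c.q_walk, c.q_path⟩) ⟨rfl, rfl⟩ c.p_anti c.p_walk rfl

/-! ### The cochains are cocycles -/

theorem mem_normalCocycles_of_diff_arr {F : Coch (Q.Alg k)} {d : ℤ} (hF : F ∈ Q.adapted k d)
    (h : ∀ (a b : E) (w v : List E), (a :: w).IsChain Q.rel → a :: w = v ++ [b] →
      sgn k ((d - w.length) * Q.deg a) • (Q.ofPath k (Q.arrowPath a) * ev F (Q.bas k (Q.arr w))) +
      sgn k (w.length + 1) • (ev F (Q.bas k (Q.arr v)) * Q.ofPath k (Q.arrowPath b)) = 0) :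
    F ∈ Q.normalCocycles k d := by
  refine mem_normalCocycles_of_adapted hF fun w hw => ?_
  cases w with
  | nil => rfl
  | cons a w =>
    rw [ev_diff_arr (Lin.of_mem_cochains hF.1) d hw, h a _ w _ hw
      (List.dropLast_append_getLast (List.cons_ne_nil a w)).symm, smul_zero]

theorem dual_mem_normalCocycles {p : List E} {q : Q.NZPath} {d : ℤ}
    (hF : Q.dual k p q.word q.src ∈ Q.adapted k d)
    (hl : ∀ a, (a :: p).IsChain Q.rel → (a :: q.word).IsChain Q.nonrel → False)
    (hr : ∀ a, (p ++ [a]).IsChain Q.rel → (q.word ++ [a]).IsChain Q.nonrel → False) :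
    Q.dual k p q.word q.src ∈ Q.normalCocycles k d := by
  classical
  refine mem_normalCocycles_of_diff_arr hF fun a b w v hw hv => ?_
  have h1 : Q.ofPath k (Q.arrowPath a) * ev (Q.dual k p q.word q.src) (Q.bas k (Q.arr w)) = 0 := by
    rw [ev_dual, dualList_arr]
    split_ifs with h
    · subst h
      exact ofPath_mul_ofPath_neg fun h' => hl a hw h'.2
    · rw [mul_zero]
  have h2 : ev (Q.dual k p q.word q.src) (Q.bas k (Q.arr v)) * Q.ofPath k (Q.arrowPath b) = 0 := by
    rw [ev_dual, dualList_arr]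
    split_ifs with h
    · subst h
      exact ofPath_mul_ofPath_neg fun h' => hr b (hv ▸ hw) h'.2
    · rw [zero_mul]
  rw [h1, h2, smul_zero, smul_zero, add_zero]

theorem cochainUnit_mem_normalCocycles : Q.cochainUnit k ∈ Q.normalCocycles k 0 := by
  classical
  have hev : ∀ w, ev (Q.cochainUnit k) (Q.bas k (Q.arr w)) = if [] = w then 1 else 0 := by
    intro w
    rw [cochainUnit, ev_sum]
    have : ∀ x, ev (Q.dual k [] [] x) (Q.bas k (Q.arr w)) =
        if [] = w then Q.ofPath k (Q.trivialPath x) else 0 := fun x => by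
      rw [← dualList_arr]
      exact ev_dual [] (Q.trivialPath x) _
    simp only [this]
    split_ifs with h
    · exact Q.alg_one_def.symm
    · simp
  refine mem_normalCocycles_of_diff_arr (terms_le_adapted (T := fun _ _ => True)
    (Submodule.sum_mem _ fun x _ => dual_mem_terms (q := Q.trivialPath x) trivial (by simp) rfl
      (by simp [trivialPath, wdeg]))) fun a b w v hw hv => ?_
  rw [hev, hev]
  by_cases h : [] = w
  · subst h
    obtain ⟨rfl, rfl⟩ : v = [] ∧ a = b := by
      cases v with
      | nil => simpa using hv
      | cons x v => simp at hv
    simp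
  · rw [if_neg h, if_neg]
    · simp
    · rintro rfl
      exact h (List.cons.inj hv).2.symm

theorem dual_arrow_mem_normalCocycles (a : E) :
    Q.dual k [a] [a] (Q.src a) ∈ Q.normalCocycles k 1 := by
  refine dual_mem_normalCocycles (q := Q.arrowPath a) (dual_mem_adapted (List.isChain_singleton a)
    (Q.arrowPath a).walk ?_) ?_ ?_
  · simp [arrowPath, wdeg]
  · intro b h1 h2
    exact (List.isChain_cons_cons.1 h2).1.2 (List.isChain_cons_cons.1 h1).1
  · intro b h1 h2
    exact (List.isChain_cons_cons.1 h2).1.2 (List.isChain_cons_cons.1 h1).1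

theorem cochainH_mem_normalCocycles [Fintype E] (f : E → k) :
    Q.cochainH f ∈ Q.normalCocycles k 1 :=
  Submodule.sum_mem _ fun a _ => Submodule.smul_mem _ _ (dual_arrow_mem_normalCocycles a)

theorem OneStop.dual_mem_normalCocycles (c : Q.OneStop) :
    Q.dual k c.p c.q c.s ∈ Q.normalCocycles k (c.p.length + Q.wdeg c.q - Q.wdeg c.p) := by
  refine GradedGentleQuiver.dual_mem_normalCocycles (q := ⟨c.t, c.s, c.q, c.q_walk, c.q_path⟩)
    (dual_mem_adapted c.p_anti c.p_walk rfl) ?_ ?_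
  · intro a h1 h2
    rcases c.isStop with h | ⟨-, h, -⟩
    · exact h.1.not_append (a := [a]) (c := []) (by simpa using h1) (Or.inl (by simp))
    · exact h.not_append (a := [a]) (c := []) (by simpa using h2) (Or.inl (by simp))
  · intro a h1 h2
    rcases c.isStop with h | ⟨-, h, -⟩
    · exact h.1.not_append (a := []) (c := [a]) (by simpa using h1) (Or.inr (by simp))
    · exact h.not_append (a := []) (c := [a]) (by simpa using h2) (Or.inr (by simp))

theorem PrimitiveLoop.N1_mem_normalCocycles (u : Q.PrimitiveLoop) (m : ℕ+) :
    u.N1 k m ∈ Q.normalCocycles k (m * u.winding + 1) := by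
  have had := terms_le_adapted (u.N1_mem_terms (k := k) m)
  cases hu : u.anti with
  | true =>
    rw [u.N1_anti hu] at had ⊢
    refine Submodule.smul_mem _ _ (dual_mem_normalCocycles (q := Q.arrowPath u.last)
      ?_ ?_ ?_)
    · have := Submodule.smul_mem _ (sgn k (m * u.len * (1 + Q.deg u.last))) had
      rwa [smul_smul, sgn_mul_self, one_smul] at this
    · intro a h1 h2
      refine (List.isChain_cons_cons.1 h2).1.2 (chain_cons_head h1 ?_)
      rw [win_succ]
      rfl
    · intro a h1 h2
      refine (List.isChain_cons_cons.1 h2).1.2 (chain_append_head h1 ?_ rfl)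
      rw [win_succ]
      exact last_cons (u.getLast_win_last m)
  | false =>
    rw [u.N1_path hu] at had ⊢
    refine Submodule.neg_mem _ (dual_mem_normalCocycles (by simpa using had) ?_ ?_)
    · intro a h1 h2
      refine (chain_cons_head h2 ?_).2 (List.isChain_cons_cons.1 h1).1
      rw [winPath_word, win_succ]
      rfl
    · intro a h1 h2
      refine (chain_append_head h2 ?_ rfl).2 (List.isChain_cons_cons.1 h1).1
      rw [winPath_word, win_succ]
      exact last_cons (u.getLast_win_last m)

/-- The class of a coboundary vanishes. -/
theorem cochainH_coboundary_mem [Fintype E] (g : V → k) :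
    Q.cochainH (Q.coboundary g) ∈ coboundaries (Q.grading k) 1 := by
  classical
  set G : Coch (Q.Alg k) := ∑ x, g x • Q.dual k [] [] x with hG
  have hGa : G ∈ Q.adapted k 0 := terms_le_adapted (T := fun _ _ => True)
    (Submodule.sum_mem _ fun x _ => Submodule.smul_mem _ _ <|
      dual_mem_terms (q := Q.trivialPath x) trivial (by simp) rfl (by simp [trivialPath, wdeg]))
  have hev : ∀ w, ev G (Q.bas k (Q.arr w)) =
      if [] = w then ∑ x, g x • Q.ofPath k (Q.trivialPath x) else 0 := by
    intro w
    rw [hG, ev_sum]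
    have : ∀ x, ev (g x • Q.dual k [] [] x) (Q.bas k (Q.arr w)) =
        if [] = w then g x • Q.ofPath k (Q.trivialPath x) else 0 := fun x => by
      rw [ev_smul, ← smul_zero (g x), ← smul_ite, ← dualList_arr]
      exact congrArg _ (ev_dual [] (Q.trivialPath x) _)
    simp only [this]
    split_ifs with h
    · rfl
    · simp
  have hevH : ∀ w, ev (Q.cochainH (Q.coboundary g)) (Q.bas k (Q.arr w)) =
      ∑ a, if [a] = w then Q.coboundary g a • Q.ofPath k (Q.arrowPath a) else 0 := by
    intro w
    rw [cochainH, ev_sum]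
    refine Finset.sum_congr rfl fun a _ => ?_
    rw [ev_smul, ← smul_zero (Q.coboundary g a), ← smul_ite, ← dualList_arr]
    exact congrArg _ (ev_dual [a] (Q.arrowPath a) _)
  have hd : Q.cochainH (Q.coboundary g) + GradedHochschild.diff (Q.grading k) 0 G ∈
      coboundaries (Q.grading k) 1 := by
    refine mem_coboundaries_of_normalCocycles (Submodule.add_mem _ (cochainH_mem_normalCocycles _)
      (diff_mem_normalCocycles (by ring) hGa)) fun w hw => ?_
    rw [ev_add, hevH]
    cases w with
    | nil =>
      rw [arr, List.map_nil, bas, List.map_nil, ev_diff_nil]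
      simp
    | cons a w =>
      rw [ev_diff_arr (Lin.of_mem_cochains hGa.1) 0 hw, hev, hev]
      by_cases h : w = []
      · subst h
        rw [Finset.sum_eq_single a (fun b _ hb => by simp [hb]) (by simp)]
        simp only [if_true, List.dropLast_singleton, List.getLast_singleton, Finset.mul_sum,
          Finset.sum_mul, mul_smul_comm, smul_mul_assoc]
        rw [Finset.sum_eq_single (Q.src a), Finset.sum_eq_single (Q.tgt a)]
        · rw [ofPath_mul_ofPath_trivial rfl rfl, ofPath_trivial_mul_ofPath rfl rfl]
          simp only [coboundary, sub_smul, List.length_nil, Nat.cast_zero, sub_zero, zero_mul, zero_add,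
            sgn_zero, sgn_one, one_smul, neg_smul]
          abel
        · intro x _ hx
          rw [ofPath_mul_ofPath_neg fun h => hx h.1, smul_zero]
        · simp
        · intro x _ hx
          rw [ofPath_mul_ofPath_neg fun h => hx h.1.symm, smul_zero]
        · simp
      · rw [if_neg (Ne.symm h), if_neg, Finset.sum_eq_zero]
        · simp
        · intro b _
          rw [if_neg]
          intro h'
          exact h (List.cons.inj h').2.symm
        · intro h'
          have := congrArg List.length h'
          simp at this
          exact h (List.eq_nil_of_length_eq_zero this.symm)
  have := Submodule.sub_mem _ hd (show GradedHochschild.diff (Q.grading k) 0 G ∈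
    coboundaries (Q.grading k) 1 from ⟨G, by simpa using hGa.1, by simp⟩)
  rwa [add_sub_cancel_right] at this

end GradedGentleQuiver
end

noncomputable section

open GradedHochschild

namespace GradedGentleQuiver

variable {k V E : Type*} [Field k] {Q : GradedGentleQuiver V E}

theorem sum_range_shift {M : Type*} [AddCommMonoid M] {g : ℕ → M} {r : ℕ} (h : g r = g 0) :
    ∑ i ∈ Finset.range r, g i = ∑ i ∈ Finset.range r, g (i + 1) := by
  cases r with
  | zero => rfl
  | succ n => rw [Finset.sum_range_succ', Finset.sum_range_succ (fun i => g (i + 1)), h]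

theorem sgn_eq_one_of_two (h : ringChar k = 2) (a : ℤ) : sgn k a = 1 := by
  have := ringChar.of_eq h
  rcases Int.even_or_odd a with h' | h'
  · exact sgn_of_even k h'
  · rw [sgn_of_odd k h', CharTwo.neg_eq]

namespace PrimitiveLoop

variable {u : Q.PrimitiveLoop}

theorem Good.sgn_eq {m : ℕ+} (h : u.Good k m) : sgn k (m * u.winding) = 1 := by
  rcases h with h | h
  · exact sgn_of_even k h
  · exact sgn_eq_one_of_two h _

variable (u)

theorem wdeg_win_succ (i n : ℕ) :
    Q.wdeg (u.win i (n + 1)) = Q.wdeg (u.win i n) + Q.deg (u.letter (i + n)) := by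
  rw [win_succ', wdeg_append]
  simp [wdeg]

theorem wdeg_win_add_len (i n : ℕ) :
    Q.wdeg (u.win i (n + u.len)) = Q.wdeg (u.win i n) + Q.wdeg u.word := by
  rw [win_add, wdeg_append, wdeg_win_len]

variable [Fintype V]

/-- The summands of `N⁰(uᵐ)` for anti-paths. -/
def summandAnti (m : ℕ) (i : ℕ) : Coch (Q.Alg k) :=
  sgn k (i * (m * u.len) + m * Q.wdeg u.word * Q.wdeg (u.win 0 i)) •
    Q.dual k (u.win i (m * u.len)) [] (Q.tgt (u.letter i))

/-- The summands of `N⁰(uᵐ)` for paths. -/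
def summandPath (h : u.anti = false) (m : ℕ) (i : ℕ) : Coch (Q.Alg k) :=
  sgn k (m * Q.wdeg u.word * Q.wdeg (u.win 0 i)) •
    Q.dual k [] (u.winPath h i (m * u.len)).word (u.winPath h i (m * u.len)).src

open scoped Classical in
theorem ev_summandAnti (m i : ℕ) (w : List E) : ev (u.summandAnti m i) (Q.bas k (Q.arr w)) =
    if u.win i (m * u.len) = w then
      sgn k (i * (m * u.len) + m * Q.wdeg u.word * Q.wdeg (u.win 0 i)) •
        Q.ofPath k (Q.trivialPath (Q.tgt (u.letter i))) else 0 := by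
  rw [summandAnti, ev_smul]
  have := ev_dual (k := k) (u.win i (m * u.len)) (Q.trivialPath (Q.tgt (u.letter i))) (Q.arr w)
  rw [dualList_arr] at this
  rw [show ev (Q.dual k (u.win i (m * u.len)) [] (Q.tgt (u.letter i))) (Q.bas k (Q.arr w)) = _
    from this]
  split_ifs <;> simp

open scoped Classical in
theorem ev_summandPath (h : u.anti = false) (m i : ℕ) (w : List E) :
    ev (u.summandPath h m i) (Q.bas k (Q.arr w)) = if [] = w then
      sgn k (m * Q.wdeg u.word * Q.wdeg (u.win 0 i)) • Q.ofPath k (u.winPath h i (m * u.len))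
      else 0 := by
  rw [summandPath, ev_smul, ev_dual, dualList_arr]
  split_ifs <;> simp

theorem winPath_add_mul (h : u.anti = false) (i t n : ℕ) :
    u.winPath h (i + t * u.len) n = u.winPath h i n := by
  refine NZPath.ext_of_tgt (u.win_add_mul i n t) ?_
  change Q.tgt (u.letter (i + t * u.len)) = Q.tgt (u.letter i)
  rw [letter_add_mul]

theorem N0_mem_normalCocycles {m : ℕ+} (hm : u.Good k m) :
    u.N0 k m ∈ Q.normalCocycles k (m * u.winding) := by
  classical
  have had := terms_le_adapted (u.N0_mem_terms (k := k) m)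
  refine mem_normalCocycles_of_diff_arr had fun a b w v hw hv => ?_
  cases hu : u.anti with
  | true =>
    have hN : u.N0 k m = ∑ i ∈ Finset.range u.len, u.summandAnti m i := u.N0_anti hu m
    have hper : u.summandAnti (k := k) m u.len = u.summandAnti m 0 := by
      have h1 := u.win_add_mul 0 (m * u.len) 1
      have h2 := u.letter_add_mul 0 1
      have h3 := u.wdeg_win_add_len 0 0
      rw [zero_add, one_mul] at h1 h2
      rw [zero_add] at h3
      rw [summandAnti, summandAnti, h1, h2, h3]
      congr 1
      rw [← mul_one (sgn k _), ← hm.sgn_eq, ← sgn_add]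
      refine sgn_congr k ?_
      rw [winding_anti _ hu]
      push_cast
      generalize ((m : ℕ) : ZMod 2) = x
      generalize (u.len : ZMod 2) = y
      generalize ((Q.wdeg u.word : ℤ) : ZMod 2) = z
      generalize ((Q.wdeg (u.win 0 0) : ℤ) : ZMod 2) = t
      revert x y z t
      decide
    have key : ∀ i, sgn k ((m * u.winding - w.length) * Q.deg a) • (Q.ofPath k (Q.arrowPath a) *
        ev (u.summandAnti m (i + 1)) (Q.bas k (Q.arr w))) + sgn k (w.length + 1) •
        (ev (u.summandAnti m i) (Q.bas k (Q.arr v)) * Q.ofPath k (Q.arrowPath b)) = 0 := by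
      intro i
      obtain ⟨n, hn⟩ : ∃ n, (m : ℕ) * u.len = n + 1 :=
        Nat.exists_eq_succ_of_ne_zero (Nat.mul_pos m.pos u.len_pos).ne'
      have hl : u.letter (i + m * u.len) = u.letter i := u.letter_add_mul _ _
      have h1 : u.win (i + 1) (m * u.len) = w →
          u.win i (m * u.len) = v ∧ a = u.letter i ∧ b = u.letter i := by
        intro h
        obtain rfl : u.letter i = a := by
          refine Q.rel_left_unique (u.letter (i + 1)) _ _ (u.step_anti hu ▸ u.step_letter i)
            (chain_cons_head hw ?_)
          rw [← h, hn, win_succ]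
          rfl
        rw [← h, ← win_succ, win_succ', hl] at hv
        obtain ⟨h2, h3⟩ := List.append_inj' hv rfl
        exact ⟨h2, rfl, (List.cons.inj h3).1.symm⟩
      have h2 : u.win i (m * u.len) = v → u.win (i + 1) (m * u.len) = w := by
        intro h
        obtain rfl : u.letter i = b := by
          refine Q.rel_right_unique (u.letter (i + n)) _ _ ?_ (chain_append_head (hv ▸ hw) ?_ rfl)
          · rw [← hl, hn, ← add_assoc, ← u.step_anti hu]
            exact u.step_letter (i + n)
          · rw [← h, hn, win_succ']
            simp
        rw [← h, ← hl, ← win_succ', win_succ] at hv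
        exact (List.cons.inj hv).2.symm
      rw [ev_summandAnti, ev_summandAnti]
      by_cases h : u.win (i + 1) (m * u.len) = w
      · obtain ⟨h3, rfl, rfl⟩ := h1 h
        rw [if_pos h, if_pos h3, mul_smul_comm, smul_mul_assoc,
          ofPath_mul_ofPath_trivial rfl (u.src_letter i), ofPath_trivial_mul_ofPath rfl rfl,
          smul_smul, smul_smul, ← add_smul, sgn_mul_sgn, sgn_mul_sgn, wdeg_win_succ, zero_add]
        refine (congrArg (· • _) ?_).trans (zero_smul k _)
        rw [← h, length_win]
        have : sgn k (m * u.len + 1 + (i * (m * u.len) +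
            m * Q.wdeg u.word * Q.wdeg (u.win 0 i))) =
            sgn k (1 + ((m * u.winding - (m * u.len : ℕ)) * Q.deg (u.letter i) +
            ((i + 1 : ℕ) * (m * u.len) + m * Q.wdeg u.word *
              (Q.wdeg (u.win 0 i) + Q.deg (u.letter i))))) := by
          refine sgn_congr k ?_
          rw [winding_anti _ hu]
          push_cast
          generalize ((m : ℕ) : ZMod 2) = x
          generalize (u.len : ZMod 2) = y
          generalize ((Q.wdeg u.word : ℤ) : ZMod 2) = z
          generalize ((Q.wdeg (u.win 0 i) : ℤ) : ZMod 2) = t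
          generalize ((Q.deg (u.letter i) : ℤ) : ZMod 2) = s
          generalize (i : ZMod 2) = j
          revert x y z t s j
          decide
        push_cast at this ⊢
        rw [this, sgn_add k 1, sgn_one]
        ring
      · rw [if_neg h, if_neg fun h' => h (h2 h')]
        simp
    rw [hN, ev_sum, ev_sum, Finset.mul_sum, Finset.sum_mul, Finset.smul_sum, Finset.smul_sum,
      sum_range_shift (by rw [hper]), ← Finset.sum_add_distrib]
    exact Finset.sum_eq_zero fun i _ => key i
  | false =>
    have hN : u.N0 k m = ∑ i ∈ Finset.range u.len, u.summandPath hu m i := u.N0_path hu m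
    have hper : u.summandPath (k := k) hu m u.len = u.summandPath hu m 0 := by
      have h1 := u.winPath_add_mul hu 0 1 (m * u.len)
      have h3 := u.wdeg_win_add_len 0 0
      rw [zero_add, one_mul] at h1
      rw [zero_add] at h3
      rw [summandPath, summandPath, h1, h3]
      congr 1
      rw [← mul_one (sgn k _), ← hm.sgn_eq, ← sgn_add]
      refine sgn_congr k ?_
      rw [winding_path _ hu]
      push_cast
      generalize ((m : ℕ) : ZMod 2) = x
      generalize ((Q.wdeg u.word : ℤ) : ZMod 2) = z
      generalize ((Q.wdeg (u.win 0 0) : ℤ) : ZMod 2) = t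
      revert x z t
      decide
    have hl (i : ℕ) : u.letter (i + m * u.len) = u.letter i := u.letter_add_mul _ _
    by_cases hw0 : w = []
    swap
    · have hv0 : v ≠ [] := by
        rintro rfl
        exact hw0 (List.cons.inj hv).2
      rw [hN, ev_sum, ev_sum, Finset.sum_eq_zero, Finset.sum_eq_zero]
      · simp
      · intro i _
        rw [ev_summandPath, if_neg hv0.symm]
      · intro i _
        rw [ev_summandPath, if_neg (Ne.symm hw0)]
    subst hw0
    obtain ⟨rfl, rfl⟩ : v = [] ∧ a = b := by
      cases v with
      | nil => simpa using hv
      | cons x v => simp at hv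
    have key : ∀ i, sgn k ((m * u.winding - ([] : List E).length) * Q.deg a) •
        (Q.ofPath k (Q.arrowPath a) * ev (u.summandPath hu m (i + 1)) (Q.bas k (Q.arr []))) +
        sgn k (([] : List E).length + 1) • (ev (u.summandPath hu m i) (Q.bas k (Q.arr [])) *
          Q.ofPath k (Q.arrowPath a)) = 0 := by
      intro i
      obtain ⟨n, hn⟩ : ∃ n, (m : ℕ) * u.len = n + 1 :=
        Nat.exists_eq_succ_of_ne_zero (Nat.mul_pos m.pos u.len_pos).ne'
      rw [ev_summandPath, ev_summandPath, if_pos rfl, if_pos rfl, mul_smul_comm, smul_mul_assoc]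
      by_cases ha : a = u.letter i
      · subst ha
        rw [ofPath_mul_ofPath_pos (u.src_letter i) (by
            change (u.letter i :: u.win (i + 1) (m * u.len)).IsChain Q.nonrel
            rw [← win_succ, ← u.step_path hu]
            exact u.win_chain _ _),
          ofPath_mul_ofPath_pos (by
            change Q.tgt (u.letter (i + m * u.len)) = Q.tgt (u.letter i)
            rw [hl]) (by
            change (u.win i (m * u.len) ++ [u.letter i]).IsChain Q.nonrel
            rw [← hl, ← win_succ', ← u.step_path hu]
            exact u.win_chain _ _)]
        have heq : (Q.arrowPath (u.letter i)).append (u.winPath hu (i + 1) (m * u.len))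
            (u.src_letter i) (by
            change (u.letter i :: u.win (i + 1) (m * u.len)).IsChain Q.nonrel
            rw [← win_succ, ← u.step_path hu]
            exact u.win_chain _ _) = (u.winPath hu i (m * u.len)).append
            (Q.arrowPath (u.letter i)) (by
            change Q.tgt (u.letter (i + m * u.len)) = Q.tgt (u.letter i)
            rw [hl]) (by
            change (u.win i (m * u.len) ++ [u.letter i]).IsChain Q.nonrel
            rw [← hl, ← win_succ', ← u.step_path hu]
            exact u.win_chain _ _) := by
          refine NZPath.ext_of_word_ne_nil ?_ (List.cons_ne_nil _ _)
          change u.letter i :: u.win (i + 1) (m * u.len) = u.win i (m * u.len) ++ [u.letter i]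
          rw [← win_succ, win_succ', hl]
        rw [heq, smul_smul, smul_smul, ← add_smul, sgn_mul_sgn, sgn_mul_sgn, wdeg_win_succ,
          zero_add]
        refine (congrArg (· • _) ?_).trans (zero_smul k _)
        have : sgn k (([] : List E).length + 1 + m * Q.wdeg u.word * Q.wdeg (u.win 0 i)) =
            sgn k (1 + ((m * u.winding - ([] : List E).length) * Q.deg (u.letter i) +
            m * Q.wdeg u.word * (Q.wdeg (u.win 0 i) + Q.deg (u.letter i)))) := by
          refine sgn_congr k ?_
          rw [winding_path _ hu]
          push_cast
          generalize ((m : ℕ) : ZMod 2) = x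
          generalize ((Q.wdeg u.word : ℤ) : ZMod 2) = z
          generalize ((Q.wdeg (u.win 0 i) : ℤ) : ZMod 2) = t
          generalize ((Q.deg (u.letter i) : ℤ) : ZMod 2) = s
          simp only [List.length_nil, Nat.cast_zero]
          revert x z t s
          decide
        rw [this, sgn_add k 1, sgn_one]
        ring
      · rw [ofPath_mul_ofPath_neg, ofPath_mul_ofPath_neg]
        · simp
        · rintro ⟨h1, h2⟩
          refine ha (nonrel_right (chain_append_head h2 (a := u.letter (i + n)) ?_ rfl) ?_)
          · change (u.win i (m * u.len)).getLast? = _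
            rw [hn, win_succ']
            simp
          · have := u.step_letter (i + n)
            rwa [u.step_path hu, add_assoc, ← hn, hl] at this
        · rintro ⟨h1, h2⟩
          refine ha (nonrel_left (a := u.letter (i + 1)) (chain_cons_head h2 ?_)
            (u.step_path hu ▸ u.step_letter i))
          change (u.win (i + 1) (m * u.len)).head? = _
          rw [hn, win_succ]
          rfl
    rw [hN, ev_sum, Finset.mul_sum, Finset.sum_mul, Finset.smul_sum, Finset.smul_sum,
      sum_range_shift (by rw [hper]), ← Finset.sum_add_distrib]
    exact Finset.sum_eq_zero fun i _ => key i

end PrimitiveLoop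

theorem Elt.cochain_mem_normalCocycles [Fintype V] [Fintype E] (x : Q.Elt k) :
    x.cochain ∈ Q.normalCocycles k x.degree := by
  cases x with
  | unit => exact cochainUnit_mem_normalCocycles
  | ofH f => exact cochainH_mem_normalCocycles f
  | ofN0 u m h => exact u.N0_mem_normalCocycles h
  | ofN1 u m h => exact u.N1_mem_normalCocycles m
  | ofB c => exact c.dual_mem_normalCocycles

end GradedGentleQuiver
end

noncomputable section

open GradedHochschild

namespace GradedHochschild

theorem sumSplit_eq_first {A M : Type*} [AddCommMonoid M] {φ : List A → List A → M} {l : List A}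
    (h : ∀ a b, a ≠ [] → φ a b = 0) : sumSplit φ l = φ [] l := by
  rw [sumSplit, Finset.sum_eq_single 0]
  · simp
  · intro i hi hi0
    refine h _ _ fun h' => ?_
    have := congrArg List.length h'
    rw [Finset.mem_range] at hi
    rw [List.length_take, List.length_nil] at this
    omega
  · simp

theorem sumSplit_eq_end {A M : Type*} [AddCommMonoid M] {φ : List A → List A → M} {l : List A}
    (h : ∀ a b, b ≠ [] → φ a b = 0) : sumSplit φ l = φ l [] := by
  rw [sumSplit, Finset.sum_eq_single l.length]
  · simp
  · intro i hi hi0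
    refine h _ _ fun h' => ?_
    have := congrArg List.length h'
    rw [Finset.mem_range] at hi
    rw [List.length_drop, List.length_nil] at this
    omega
  · simp

open scoped Classical in
theorem sumSplit_ite {A M : Type*} [AddCommMonoid M] {φ : List A → List A → M} {p l : List A} :
    sumSplit (fun a b => if p = a then φ a b else 0) l =
      if p <+: l then φ p (l.drop p.length) else 0 := by
  rw [sumSplit]
  split_ifs with h
  · obtain ⟨c, rfl⟩ := h
    rw [Finset.sum_eq_single p.length]
    · simp
    · intro i hi hi0
      rw [if_neg]
      intro h'
      have := congrArg List.length h'
      simp at this hi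
      omega
    · simp
  · refine Finset.sum_eq_zero fun i _ => if_neg fun h' => h ?_
    rw [h']
    exact ⟨_, List.take_append_drop _ _⟩

variable {k B : Type*} [Field k] [Ring B] [Algebra k B]

/-- The composition with a cochain of arity one. -/
theorem comp_of_arity_one {𝒜 : ℤ → Submodule k B} [GradedAlgebra 𝒜] {j : ℤ} {f g : List B → B}
    (hf : ∀ l : List B, l.length ≠ 1 → f l = 0) (l : List B) : comp 𝒜 j f g l = f [g l] := by
  rw [comp, sumSplit₃, sumSplit_eq_first, sumSplit_eq_end]
  · simp
  · intro a b hb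
    rw [hf, smul_zero]
    simpa using hb
  · intro a b ha
    refine (sumSplit_congr fun b c _ => ?_).trans (sumSplit_zero _)
    rw [hf, smul_zero]
    have := List.length_pos_of_ne_nil ha
    simp
    omega

theorem bracket_swap {𝒜 : ℤ → Submodule k B} [GradedAlgebra 𝒜] (i j : ℤ) (F G : Coch B) :
    bracket 𝒜 i j F G = -sgn k ((i - 1) * (j - 1)) • bracket 𝒜 j i G F := by
  have h := sgn_mul_self k ((i - 1) * (j - 1))
  unfold bracket
  rw [mul_comm (j - 1) (i - 1)]
  change _ - sgn k _ • _ = _ • (_ - sgn k _ • _)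
  rw [smul_sub, smul_smul, neg_mul, h, neg_smul, neg_smul, one_smul]
  abel

theorem comp_sum_right {𝒜 : ℤ → Submodule k B} [GradedAlgebra 𝒜] {ι : Type*} (j : ℤ)
    {f : List B → B} (hf : Lin k f) (s : Finset ι) (c : ι → k) (G : ι → Coch B) (l : List B) :
    comp 𝒜 j f (ev (∑ i ∈ s, c i • G i)) l = ∑ i ∈ s, c i • comp 𝒜 j f (ev (G i)) l := by
  classical
  induction s using Finset.induction_on with
  | empty => exact congrFun (comp_zero_right j hf) l
  | insert i s hi ih =>
    rw [Finset.sum_insert hi, Finset.sum_insert hi, ← ih]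
    refine (congrFun (comp_add_right j hf (ev (c i • G i)) (ev _)) l).trans
      ((Pi.add_apply _ _ _).trans (congrArg₂ (· + ·) ?_ rfl))
    exact congrFun (comp_smul_right j (c i) hf (ev (G i))) l

end GradedHochschild

namespace GradedGentleQuiver

variable {k V E : Type*} [Field k] {Q : GradedGentleQuiver V E}

/-- The sum of the values of a function along a word. -/
def fsum {M : Type*} [AddMonoid M] (f : E → M) (w : List E) : M := (w.map f).sum

theorem fsum_append {M : Type*} [AddMonoid M] (f : E → M) (v w : List E) :
    fsum f (v ++ w) = fsum f v + fsum f w := by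
  simp [fsum]

open scoped Classical in
theorem sum_prefix_singleton [Fintype E] {M : Type*} [AddCommMonoid M] (f : E → M) (w : List E) :
    ∑ i ∈ Finset.range (w.length + 1), ∑ a, (if [a] <+: w.drop i then f a else 0) = fsum f w := by
  induction w with
  | nil => simp [fsum]
  | cons b w ih =>
    rw [List.length_cons, Finset.sum_range_succ']
    simp only [List.drop_succ_cons, ih, List.drop_zero, List.cons_prefix_cons, List.nil_prefix,
      and_true]
    rw [Finset.sum_eq_single b (fun c _ hc => if_neg hc) (by simp), if_pos rfl, add_comm]
    rfl

variable [Fintype V]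

theorem ofPath_eq_wordElt {z : Q.NZPath} (hz : z.word ≠ []) : Q.ofPath k z = Q.wordElt k z.word := by
  have := mul_wordElt (k := k) 1 z hz
  rwa [one_mul, one_mul, eq_comm] at this

theorem wordElt_append (v w : List E) : Q.wordElt k (v ++ w) = Q.wordElt k v * Q.wordElt k w := by
  simp [wordElt]

theorem wordElt_mul_mul {v v' : List E} {q z : Q.NZPath} (hq : q.word ≠ [])
    (hz : z.word = v ++ (q.word ++ v')) :
    Q.wordElt k v * Q.ofPath k q * Q.wordElt k v' = Q.ofPath k z := by
  rw [ofPath_eq_wordElt hq, ofPath_eq_wordElt (by rw [hz]; simp [hq]), hz, wordElt_append,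
    wordElt_append, mul_assoc]

variable {j : ℤ} {F G : Coch (Q.Alg k)}

open scoped Classical in
/-- The composition with the cochain of a pair on a word. -/
theorem comp_dual_arr (hF : Lin k (ev F)) (p : List E) (q : Q.NZPath) (w : List E) :
    comp (Q.grading k) j (ev F) (ev (Q.dual k p q.word q.src)) (Q.bas k (Q.arr w)) =
      ∑ i ∈ Finset.range (w.length + 1), if p <+: w.drop i then
        sgn k (i * (p.length - 1) + (w.length - p.length) * (j - 1) +
          (j - p.length) * Q.wdeg (w.take i)) •
        ev F (Q.bas k (Q.arr (w.take i) ++ q :: Q.arr (w.drop (i + p.length)))) else 0 := by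
  rw [comp, bas, arr, sumSplit₃_map (Q.ofPath k), sumSplit₃_map Q.arrowPath]
  unfold sumSplit₃
  rw [sumSplit]
  refine Finset.sum_congr rfl fun i hi => ?_
  have hi : i ≤ w.length := by simpa [Nat.lt_succ_iff] using hi
  have hcongr : ∀ b c : List E,
      (sgn k ((((w.take i).map Q.arrowPath).map (Q.ofPath k)).length *
        (((b.map Q.arrowPath).map (Q.ofPath k)).length - 1) +
        ((((w.take i).map Q.arrowPath).map (Q.ofPath k)).length +
          ((c.map Q.arrowPath).map (Q.ofPath k)).length) * (j - 1)) •
        ev F ((((w.take i).map Q.arrowPath).map (Q.ofPath k)).map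
          (koszul (Q.grading k) (j - ((b.map Q.arrowPath).map (Q.ofPath k)).length)) ++
          ev (Q.dual k p q.word q.src) ((b.map Q.arrowPath).map (Q.ofPath k)) ::
            (c.map Q.arrowPath).map (Q.ofPath k))) =
      if p = b then sgn k (i * (b.length - 1) + (i + c.length) * (j - 1)) •
        sgn k ((j - b.length) * Q.wdeg (w.take i)) •
        ev F (Q.bas k (Q.arr (w.take i) ++ q :: Q.arr c)) else 0 := by
    intro b c
    have h1 : ev (Q.dual k p q.word q.src) ((b.map Q.arrowPath).map (Q.ofPath k)) =
        if p = b then Q.ofPath k q else 0 := (ev_dual p q (Q.arr b)).trans dualList_arr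
    rw [h1]
    split_ifs with h
    · have h2 := Lin.koszul_append_left hF (j - b.length) (Q.arr (w.take i)) []
        (Q.ofPath k q :: (c.map Q.arrowPath).map (Q.ofPath k))
      rw [flatten_arr, List.nil_append, List.nil_append] at h2
      simp only [List.length_map, List.length_take, min_eq_left hi]
      congr 1
      rw [arr] at h2
      rw [h2]
      simp [bas, arr]
    · rw [(hF _ _).map_zero, smul_zero]
  rw [sumSplit_congr fun b c _ => hcongr b c, sumSplit_ite]
  split_ifs with h
  · rw [smul_smul, sgn_mul_sgn, List.drop_drop]
    refine congrArg (sgn k · • _) ?_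
    have hle := h.length_le
    rw [List.length_drop] at hle
    rw [List.length_drop, Nat.cast_sub (by omega)]
    push_cast
    ring
  · rfl

open scoped Classical in
theorem dualSum_singleton {a : E} {q y : Q.NZPath} {T : ℕ → Q.NZPath} (hq : q.word ≠ [])
    (hT : ∀ i, [a] <+: y.word.drop i →
      (T i).word = y.word.take i ++ (q.word ++ y.word.drop (i + 1))) :
    dualSum (k := k) [a] q y.word = ∑ i ∈ Finset.range (y.word.length + 1),
      if [a] <+: y.word.drop i then
        sgn k (Q.wdeg (y.word.take i) * (Q.wdeg q.word - Q.deg a)) • Q.ofPath k (T i) else 0 := by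
  rw [dualSum]
  refine Finset.sum_congr rfl fun i _ => ?_
  split_ifs with h
  · rw [List.length_singleton, wordElt_mul_mul hq (hT i h)]
    simp [wdeg]
  · rfl

/-! ### The diagonal action of the first cohomology -/

variable [Fintype E]

theorem ev_cochainH_of_length (f : E → k) {l : List (Q.Alg k)} (h : l.length ≠ 1) :
    ev (Q.cochainH f) l = 0 := by
  rw [cochainH, ev_sum]
  refine Finset.sum_eq_zero fun a _ => ?_
  rw [ev_smul]
  have : ev (Q.dual k [a] [a] (Q.src a)) l = 0 := by
    unfold ev dual
    rw [if_neg fun h' => h (by simpa using h'.symm)]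
  rw [this, smul_zero]

theorem ev_cochainH_ofPath (f : E → k) (y : Q.NZPath) :
    ev (Q.cochainH f) [Q.ofPath k y] = fsum f y.word • Q.ofPath k y := by
  classical
  have h : ∀ a, ev (f a • Q.dual k [a] [a] (Q.src a)) [Q.ofPath k y] =
      ∑ i ∈ Finset.range (y.word.length + 1), (if [a] <+: y.word.drop i then f a else 0) •
        Q.ofPath k y := by
    intro a
    rw [ev_smul]
    have := ev_dual (k := k) [a] (Q.arrowPath a) [y]
    rw [show ev (Q.dual k [a] [a] (Q.src a)) [Q.ofPath k y] = _ from this, dualList, if_pos (by simp)]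
    have h1 : (([y] : List Q.NZPath).map (·.word)).flatten = y.word := by simp
    rw [h1, dualSum_singleton (T := fun _ => y) (List.cons_ne_nil _ _), Finset.smul_sum]
    · refine Finset.sum_congr rfl fun i _ => ?_
      split_ifs
      · rw [arrowPath]
        simp [wdeg]
      · rw [smul_zero, zero_smul]
    · rintro i ⟨c, hc⟩
      have h2 : y.word.drop (i + 1) = c := by
        rw [← List.drop_drop, ← hc]
        rfl
      rw [h2, arrowPath, hc, List.take_append_drop]
  rw [cochainH, ev_sum, Finset.sum_congr rfl fun a _ => h a, Finset.sum_comm]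
  simp only [← Finset.sum_smul]
  rw [sum_prefix_singleton]

theorem coeffs_ev_cochainH (f : E → k) (x : Q.Alg k) (y : Q.NZPath) :
    Q.coeffs (ev (Q.cochainH f) [x]) y = fsum f y.word * Q.coeffs x y := by
  have hl := Lin.of_mem_cochains (mem_cocycles.1 (cochainH_mem_normalCocycles (Q := Q) f).1).1
  have hl := hl [] []
  simp only [List.nil_append] at hl
  induction x using Q.alg_induction with
  | h0 => rw [hl.map_zero]; simp [coeffs_zero]
  | hadd a b ha hb =>
    rw [hl.map_add, coeffs_add, coeffs_add, Finsupp.add_apply, Finsupp.add_apply, ha, hb, mul_add]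
  | hs c p =>
    rw [hl.map_smul, ev_cochainH_ofPath, coeffs_smul, coeffs_smul, coeffs_smul, coeffs_ofPath,
      Finsupp.smul_apply, Finsupp.smul_apply, Finsupp.smul_apply]
    by_cases h : p = y
    · subst h
      simp
      ring
    · simp [Finsupp.single_eq_of_ne (Ne.symm h)]

theorem comp_cochainH_right (f : E → k) (hF : Lin k (ev F)) (w : List E) :
    comp (Q.grading k) 1 (ev F) (ev (Q.cochainH f)) (Q.bas k (Q.arr w)) =
      fsum f w • ev F (Q.bas k (Q.arr w)) := by
  classical
  have key : ∀ a, f a • comp (Q.grading k) 1 (ev F) (ev (Q.dual k [a] [a] (Q.src a)))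
      (Q.bas k (Q.arr w)) =
      ∑ i ∈ Finset.range (w.length + 1), (if [a] <+: w.drop i then f a else 0) •
        ev F (Q.bas k (Q.arr w)) := by
    intro a
    refine (congrArg (f a • ·) (comp_dual_arr (j := 1) hF [a] (Q.arrowPath a) w)).trans ?_
    rw [Finset.smul_sum]
    refine Finset.sum_congr rfl fun i _ => ?_
    split_ifs with h
    · obtain ⟨c, hc⟩ := h
      have h2 : w.drop (i + 1) = c := by
        rw [← List.drop_drop, ← hc]
        rfl
      have h3 : Q.arr (w.take i) ++ Q.arrowPath a :: Q.arr (w.drop (i + 1)) = Q.arr w := by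
        rw [h2]
        conv_rhs => rw [← List.take_append_drop i w, ← hc]
        simp [arr]
      rw [List.length_singleton, h3]
      simp
    · rw [smul_zero, zero_smul]
  rw [cochainH, comp_sum_right 1 hF, Finset.sum_congr rfl fun a _ => key a, Finset.sum_comm]
  simp only [← Finset.sum_smul]
  rw [sum_prefix_singleton]

theorem coef_bracket_cochainH (f : E → k) (hF : Lin k (ev F)) (w : List E) (y : Q.NZPath) :
    coef (bracket (Q.grading k) 1 j (Q.cochainH f) F) w y =
      (fsum f y.word - fsum f w) * coef F w y := by
  rw [coef, ev_bracket, brk, Pi.add_apply, comp_of_arity_one fun l hl => ev_cochainH_of_length f hl,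
    Pi.smul_apply, comp_cochainH_right f hF, sub_self, zero_mul, sgn_zero, coeffs_add, coeffs_smul,
    coeffs_smul, Finsupp.add_apply, Finsupp.smul_apply, Finsupp.smul_apply, coeffs_ev_cochainH, coef]
  simp
  ring

theorem coef_terms_ne {T : List E → List E → Prop} {d : ℤ} (hF : F ∈ Q.terms k T d) {w : List E}
    {y : Q.NZPath} (h : coef F w y ≠ 0) : T w y.word := by
  classical
  obtain ⟨p, q, hT, -, -, h⟩ := coeffs_terms_ne hF h
  rw [dualList_arr] at h
  split_ifs at h with hp
  · rw [← coeffs_ofPath_ne h] at hT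
    exact hp ▸ hT
  · exact absurd rfl h

theorem bracket_cochainH_sub_mem {T : List E → List E → Prop} {f : E → k} {c : k}
    (hF : F ∈ Q.normalCocycles k j) (hFt : F ∈ Q.terms k T j)
    (hT : ∀ p q, T p q → fsum f q - fsum f p = c) :
    bracket (Q.grading k) 1 j (Q.cochainH f) F - c • F ∈ coboundaries (Q.grading k) j := by
  refine mem_coboundaries_of_normalCocycles (Submodule.sub_mem _ (bracket_mem_normalCocycles
    (by ring) (cochainH_mem_normalCocycles f) hF) (Submodule.smul_mem _ _ hF))
    (vanishesAnti_of_coef fun w hw y => ?_)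
  rw [coef_sub, coef_smul, coef_bracket_cochainH f (Lin.of_mem_cochains (mem_cocycles.1 hF.1).1)]
  by_cases h : coef F w y = 0
  · simp [h]
  · rw [hT _ _ (coef_terms_ne hFt h), sub_self]

namespace PrimitiveLoop

variable (u : Q.PrimitiveLoop) {M : Type*} [AddCommMonoid M] (f : E → M)

theorem fsum_win_len (i : ℕ) : fsum f (u.win i u.len) = fsum f u.word := by
  have h := u.rotate_win (i % u.len) 1 (by simpa using (Nat.mod_lt i u.len_pos).le)
  rw [one_mul, win_zero_len] at h
  rw [← Nat.mod_add_div' i u.len, win_add_mul, ← h]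
  exact ((List.rotate_perm _ _).map f).sum_eq

theorem fsum_win_mul (i m : ℕ) : fsum f (u.win i (m * u.len)) = m • fsum f u.word := by
  induction m with
  | zero => simp [fsum]
  | succ m ih => rw [Nat.succ_mul, win_add, fsum_append, ih, fsum_win_len, succ_nsmul]

end PrimitiveLoop

theorem evalWalk_append (f : E → k) (c c' : List (E × Bool)) :
    evalWalk f (c ++ c') = evalWalk f c + evalWalk f c' := by
  simp [evalWalk]

theorem evalWalk_true (f : E → k) (w : List E) :
    evalWalk f (w.map fun a => (a, true)) = fsum f w := by
  rw [evalWalk, fsum, List.map_map]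
  rfl

theorem evalWalk_false (f : E → k) (w : List E) :
    evalWalk f (w.reverse.map fun a => (a, false)) = -fsum f w := by
  rw [evalWalk, fsum, List.map_map, List.map_reverse, List.sum_reverse]
  induction w with
  | nil => simp
  | cons a w ih =>
    simp at ih ⊢
    rw [ih]
    ring

theorem Elt.IsPair.fsum_eq {x : Q.Elt k} (f : E → k) {c : List (E × Bool)}
    (hc : c ∈ x.boundaryCycle) {p q : List E} (h : x.IsPair p q) :
    fsum f q - fsum f p = evalWalk f c := by
  have hn : fsum f [] = 0 := rfl
  have h1 : ∀ a, fsum f [a] = f a := fun a => by simp [fsum]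
  have hcons : ∀ (u : Q.PrimitiveLoop) (m : ℕ+), fsum f (u.win (u.len - 1) (m * u.len + 1)) =
      f u.last + fsum f (u.pow m) := by
    intro u m
    rw [← u.last_cons_pow]
    simp [fsum]
  cases x with
  | unit => simp [boundaryCycle] at hc
  | ofH f => simp [boundaryCycle] at hc
  | ofN0 u m hm =>
    obtain rfl : boundaryCycle.loopCycle u m = c := by simpa [boundaryCycle] using hc
    unfold boundaryCycle.loopCycle
    rcases h with ⟨hu, ⟨i, rfl⟩, rfl⟩ | ⟨hu, rfl, ⟨i, rfl⟩⟩
    · rw [if_pos hu, evalWalk_false, u.pow_eq_win, u.fsum_win_mul, u.fsum_win_mul, hn]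
      ring
    · rw [if_neg (by simp [hu]), evalWalk_true, u.pow_eq_win, u.fsum_win_mul, u.fsum_win_mul, hn,
        sub_zero]
  | ofN1 u m hm =>
    obtain rfl : boundaryCycle.loopCycle u m = c := by simpa [boundaryCycle] using hc
    unfold boundaryCycle.loopCycle
    rcases h with ⟨hu, rfl, rfl⟩ | ⟨hu, rfl, rfl⟩
    · rw [if_pos hu, evalWalk_false, hcons, h1]
      ring
    · rw [if_neg (by simp [hu]), evalWalk_true, hcons, h1]
      ring
  | ofB b =>
    obtain ⟨rfl, rfl⟩ := h
    obtain rfl := Option.some.inj hc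
    rw [evalWalk_append, evalWalk_true, evalWalk_false]
    ring

end GradedGentleQuiver
end

noncomputable section

open GradedHochschild

namespace GradedHochschild

variable {k B : Type*} [Field k] [Ring B] [Algebra k B]

/-- The composition of a cochain of arity zero with another one. -/
theorem comp_of_arity_zero {𝒜 : ℤ → Submodule k B} [GradedAlgebra 𝒜] {j : ℤ} {f g : List B → B}
    (hf : ∀ l : List B, l.length ≠ 0 → f l = 0) (l : List B) : comp 𝒜 j f g l = 0 := by
  rw [comp, sumSplit₃]
  refine (sumSplit_congr fun a b _ => ?_).trans (sumSplit_zero _)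
  refine (sumSplit_congr fun b c _ => ?_).trans (sumSplit_zero _)
  rw [hf _ (by simp), smul_zero]

end GradedHochschild

namespace GradedGentleQuiver

variable {k V E : Type*} [Field k] {Q : GradedGentleQuiver V E}

namespace OneStop

variable {c c' : Q.OneStop} {a b : E}

theorem cycle_rel (hp : c.p = [a, b]) : Q.rel a b := by
  have := c.p_anti
  rw [hp] at this
  simpa using this

theorem cycle_nonrel (hq' : c'.q = [b, a]) : Q.nonrel b a := by
  have := c'.q_path
  rw [hq'] at this
  simpa using this

theorem cycle_maximal (hp' : c'.p = []) (hq' : c'.q = [b, a]) {w : List E}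
    (hw : w.IsChain Q.nonrel) (h : [b, a] <:+: w) :
    w = [b, a] := by
  rcases c'.maximal with h' | h'
  · exact absurd hp' h'.1
  · rw [hq'] at h'
    exact h'.2.2 w hw h

theorem cycle_tgt (hp : c.p = [a, b]) (hp' : c'.p = []) (hq' : c'.q = [b, a]) {e : E}
    (he : Q.tgt e = Q.src a) : e = b := by
  by_contra hne
  have hr := cycle_rel hp
  have := cycle_maximal hp' hq' (w := [b, a, e])
    (by simpa using ⟨cycle_nonrel hq', he.symm, fun h => hne (Q.rel_right_unique _ _ _ h hr)⟩)
    ⟨[], [e], rfl⟩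
  simp at this

theorem cycle_src (hp : c.p = [a, b]) (hp' : c'.p = []) (hq' : c'.q = [b, a]) {e : E}
    (he : Q.src e = Q.src a) : e = a := by
  by_contra hne
  have hr := cycle_rel hp
  have := cycle_maximal hp' hq' (w := [e, b, a])
    (by simpa using ⟨⟨he.trans (Q.rel_composable _ _ hr),
      fun h => hne (Q.rel_left_unique _ _ _ h hr)⟩, cycle_nonrel hq'⟩)
    ⟨[e], [], rfl⟩
  simp at this

theorem cycle_ne (hp : c.p = [a, b]) (hq' : c'.q = [b, a]) : a ≠ b := by
  rintro rfl
  exact (cycle_nonrel hq').2 (cycle_rel hp)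

variable [Fintype V] [Fintype E]

open scoped Classical in
/-- The value of the composition of the two cochains of an oriented cycle on an arrow. -/
theorem ev_dual_cycle (hp : c.p = [a, b]) (hq' : c'.q = [b, a])
    (hq : c.q = []) {q' : Q.NZPath} (hw : q'.word = [b, a]) (e : E) :
    ev (Q.dual k c.p c.q c.s) [Q.ofPath k q', Q.ofPath k (Q.arrowPath e)] =
      (if e = b then sgn k (Q.deg b * (Q.deg a + Q.deg b)) • Q.arrow k b else 0) ∧
    ev (Q.dual k c.p c.q c.s) [Q.ofPath k (Q.arrowPath e), Q.ofPath k q'] =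
      (if e = a then Q.arrow k a else 0) := by
  have hne := cycle_ne hp hq'
  have hs : Q.src b = c.s := by
    have h := c.p_walk
    rw [hp] at h
    exact h.2.2
  have ht : Q.tgt a = c.t := by
    have h := c.p_walk
    rw [hp] at h
    exact h.1
  have hts : c.t = c.s := by
    have h := c.q_walk
    rw [hq] at h
    exact h
  have hd : ∀ L, ev (Q.dual k c.p c.q c.s) (Q.bas k L) =
      dualList c.p ⟨c.t, c.s, c.q, c.q_walk, c.q_path⟩ L := fun L => ev_dual c.p ⟨c.t, c.s, c.q,
        c.q_walk, c.q_path⟩ L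
  have h1 : Q.arrow k b * Q.ofPath k ⟨c.t, c.s, c.q, c.q_walk, c.q_path⟩ = Q.arrow k b :=
    ofPath_mul_ofPath_trivial hq (hs.trans hts.symm)
  have h2 : Q.ofPath k ⟨c.t, c.s, c.q, c.q_walk, c.q_path⟩ * Q.arrow k a = Q.arrow k a :=
    ofPath_trivial_mul_ofPath hq (hts.symm.trans ht.symm)
  refine ⟨(hd [q', Q.arrowPath e]).trans ?_, (hd [Q.arrowPath e, q']).trans ?_⟩ <;> rw [hp]
  · simp only [dualList, dualSum, List.map_cons, List.map_nil, hw, arrowPath, List.flatten_cons,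
      List.flatten_nil, List.length_cons, List.length_nil, if_true, Finset.sum_range_succ,
      Finset.sum_range_zero, List.cons_append, List.nil_append, List.drop_succ_cons, List.drop_zero,
      List.cons_prefix_cons, hne, hne.symm, List.take_zero, List.take_succ_cons, List.drop_nil,
      List.nil_prefix, List.prefix_nil, and_true, if_false, zero_add, add_zero,
      hq, and_false, true_and, reduceCtorEq, wordElt_nil, mul_one, eq_comm (a := b)]
    refine if_congr Iff.rfl ?_ rfl
    simp only [hq] at h1
    rw [show Q.wordElt k [b] = Q.arrow k b by simp [wordElt], h1]
    refine congrArg (· • _) (sgn_congr k ?_)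
    simp only [wdeg, List.map_cons, List.map_nil, List.sum_cons, List.sum_nil]
    push_cast
    rw [add_zero, zero_sub, mul_neg, CharTwo.neg_eq]
  · simp only [dualList, dualSum, List.map_cons, List.map_nil, hw, arrowPath, List.flatten_cons,
      List.flatten_nil, List.length_cons, List.length_nil, if_true, Finset.sum_range_succ,
      Finset.sum_range_zero, List.cons_append, List.nil_append, List.drop_succ_cons, List.drop_zero,
      List.cons_prefix_cons, hne, hne.symm, List.take_zero, List.take_succ_cons, List.drop_nil,
      List.nil_prefix, List.prefix_nil, and_true, if_false, zero_add, add_zero,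
      hq, and_false, reduceCtorEq, wordElt_nil, mul_one]
    refine if_congr eq_comm ?_ rfl
    simp only [hq] at h2
    rw [show Q.wordElt k [a] = Q.arrow k a by simp [wordElt], one_mul, h2]
    simp [wdeg]

end OneStop

theorem Elt.IsCyclePair.bracket_mem [Fintype V] [Fintype E] {x y : Q.Elt k} (h : x.IsCyclePair y)
    (hE : ¬ x.ExceptionalPair y) :
    bracket (Q.grading k) x.degree y.degree x.cochain y.cochain ∈
      coboundaries (Q.grading k) (x.degree + y.degree - 1) := by
  classical
  obtain ⟨a, b, c, c', rfl, rfl, hp, hq, hp', hq'⟩ := h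
  have hD : Even (Q.deg a + Q.deg b) ∨ ringChar k = 2 := by
    by_contra! h
    exact hE ⟨a, b, c, c', rfl, rfl, hp, hq, hp', hq', Int.not_even_iff_odd.1 h.1, h.2⟩
  have hdx : (Elt.ofB c : Q.Elt k).degree = 2 - (Q.deg a + Q.deg b) := by
    simp [degree, hp, hq, wdeg]
  have hdy : (Elt.ofB c' : Q.Elt k).degree = Q.deg a + Q.deg b := by
    simp [degree, hp', hq', wdeg, add_comm]
  have hF := Elt.cochain_mem_normalCocycles (Elt.ofB c : Q.Elt k)
  have hG := Elt.cochain_mem_normalCocycles (Elt.ofB c' : Q.Elt k)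
  rw [hdx] at hF ⊢
  rw [hdy] at hG ⊢
  have e1 : (2 - (Q.deg a + Q.deg b) + (Q.deg a + Q.deg b) - 1) = 1 := by ring
  rw [e1]
  have hFl := Lin.of_mem_cochains (mem_cocycles.1 hF.1).1
  set δ : V → k := fun v => if v = Q.src a then 1 else 0 with hδ
  have hb := bracket_mem_normalCocycles (l := 1) (by ring) hF hG
  have hc := cochainH_mem_normalCocycles (k := k) (Q := Q) (Q.coboundary δ)
  have key : bracket (Q.grading k) (2 - (Q.deg a + Q.deg b)) (Q.deg a + Q.deg b)
      (Elt.ofB c).cochain (Elt.ofB c').cochain + Q.cochainH (Q.coboundary δ) ∈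
        coboundaries (Q.grading k) 1 := by
    refine mem_coboundaries_of_normalCocycles (Submodule.add_mem _ hb hc) fun w _ => ?_
    rw [ev_add, ev_bracket, brk, Pi.add_apply, Pi.smul_apply,
      comp_of_arity_zero (f := ev (Elt.ofB c').cochain), smul_zero, add_zero]
    · have hcomp := comp_dual_arr (j := Q.deg a + Q.deg b) hFl c'.p
        ⟨c'.t, c'.s, c'.q, c'.q_walk, c'.q_path⟩ w
      rw [show comp (Q.grading k) _ (ev (Elt.ofB c).cochain) (ev (Elt.ofB c').cochain) _ = _
        from hcomp]
      by_cases hw : w.length = 1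
      · obtain ⟨e, rfl⟩ := List.length_eq_one_iff.1 hw
        obtain ⟨h1, h2⟩ := OneStop.ev_dual_cycle (k := k) hp hq' hq
          (q' := ⟨c'.t, c'.s, c'.q, c'.q_walk, c'.q_path⟩) hq' e
        have h3 := ev_cochainH_ofPath (k := k) (Q.coboundary δ) (Q.arrowPath e)
        rw [show ev (Q.cochainH (Q.coboundary δ)) (Q.bas k (Q.arr [e])) = _ from h3]
        rw [hp']
        simp only [List.length_cons, List.length_nil, Finset.sum_range_succ, Finset.sum_range_zero,
          List.nil_prefix, if_true, List.take_zero, List.drop_zero, List.take_succ_cons,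
          List.drop_succ_cons, arr, List.map_nil, List.map_cons, List.nil_append, List.cons_append,
          zero_add, add_zero]
        rw [show ev (Elt.ofB c).cochain _ = _ from h1, show ev (Elt.ofB c).cochain _ = _ from h2]
        have hfs : fsum (Q.coboundary δ) (Q.arrowPath e).word =
            (if e = b then 1 else 0) - (if e = a then 1 else 0) := by
          have hba : Q.tgt b = Q.src a := (Q.rel_composable _ _ (OneStop.cycle_rel hp)).symm
          have e1 : (Q.tgt e = Q.src a) = (e = b) :=
            propext ⟨OneStop.cycle_tgt hp hp' hq', fun h => h ▸ hba⟩
          have e2 : (Q.src e = Q.src a) = (e = a) :=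
            propext ⟨OneStop.cycle_src hp hp' hq', fun h => h ▸ rfl⟩
          simp [fsum, arrowPath, coboundary, hδ, e1, e2]
        have hs : ∀ t d, sgn k (t + (Q.deg a + Q.deg b) * d) = sgn k t := by
          intro t d
          rcases hD with h | h
          · rw [sgn_add, sgn_of_even k (h.mul_right d), mul_one]
          · rw [sgn_eq_one_of_two h, sgn_eq_one_of_two h]
        have s1 : ∀ t, sgn k (-1 + (Q.deg a + Q.deg b) * t) = -1 := by
          intro t
          rw [hs, sgn_of_odd k (by decide)]
        have s0 : ∀ t, sgn k ((Q.deg a + Q.deg b) * t) = 1 := by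
          intro t
          have := hs 0 t
          rwa [zero_add, sgn_zero] at this
        have hne := OneStop.cycle_ne hp hq'
        rw [hfs]
        by_cases he : e = a
        · subst he
          rw [if_neg hne, if_neg hne, if_pos rfl, if_pos rfl, smul_zero, zero_add, zero_sub,
            show ((1 : ℕ) : ℤ) * ((0 : ℕ) - 1) + ((1 : ℕ) - (0 : ℕ)) * (Q.deg e + Q.deg b - 1) +
              (Q.deg e + Q.deg b - (0 : ℕ)) * Q.wdeg [e] = -1 + -1 +
                (Q.deg e + Q.deg b) * (1 + Q.wdeg [e]) by push_cast; ring, hs,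
            sgn_of_even k (by decide), one_smul, neg_smul, one_smul]
          exact add_neg_cancel _
        · rw [if_neg he, if_neg he, smul_zero, add_zero, sub_zero]
          by_cases he' : e = b
          · subst he'
            rw [if_pos rfl, if_pos rfl, mul_comm (Q.deg e), s0,
              show ((0 : ℕ) : ℤ) * ((0 : ℕ) - 1) + ((1 : ℕ) - (0 : ℕ)) * (Q.deg a + Q.deg e - 1) +
                (Q.deg a + Q.deg e - (0 : ℕ)) * Q.wdeg [] = -1 + (Q.deg a + Q.deg e) * 1 by
                  simp [wdeg]; ring, s1, one_smul, neg_smul, one_smul, one_smul]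
            exact neg_add_cancel _
          · rw [if_neg he', if_neg he', smul_zero, zero_smul, add_zero]
      · have h1 : ev (Q.cochainH (Q.coboundary δ)) (Q.bas k (Q.arr w)) = 0 :=
          ev_cochainH_of_length _ (by simpa [bas, arr] using hw)
        rw [h1, add_zero]
        refine Finset.sum_eq_zero fun i hi => ?_
        rw [Finset.mem_range] at hi
        split_ifs
        · have := ev_dual (k := k) c.p ⟨c.t, c.s, c.q, c.q_walk, c.q_path⟩
            (Q.arr (w.take i) ++ ⟨c'.t, c'.s, c'.q, c'.q_walk, c'.q_path⟩ ::
              Q.arr (w.drop (i + c'.p.length)))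
          rw [show ev (Elt.ofB c).cochain _ = _ from this, dualList, if_neg, smul_zero]
          simp [arr, hp, hp']
          omega
        · rfl
    · intro l hl
      have hd : ev (Elt.ofB c').cochain l = 0 := by
        change ev (Q.dual k c'.p c'.q c'.s) l = 0
        unfold ev dual
        rw [if_neg (by rw [hp']; simpa using Ne.symm hl)]
      exact hd
  have := Submodule.sub_mem _ key (cochainH_coboundary_mem (k := k) (Q := Q) δ)
  rwa [add_sub_cancel_right] at this

theorem Elt.IsCyclePair.bracket_mem_swap [Fintype V] [Fintype E] {x y : Q.Elt k}
    (h : y.IsCyclePair x) (hE : ¬ y.ExceptionalPair x) :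
    bracket (Q.grading k) x.degree y.degree x.cochain y.cochain ∈
      coboundaries (Q.grading k) (x.degree + y.degree - 1) := by
  rw [bracket_swap, add_comm x.degree]
  exact Submodule.smul_mem _ _ (h.bracket_mem hE)

/-- The bracket of two elements which is not described explicitly is a coboundary. -/
theorem Elt.bracket_mem_coboundaries [Fintype V] [Fintype E] (hQ : Q.NoLoopOrKronecker)
    {x y : Q.Elt k} (h1 : ¬ x.Listed y) (h2 : ¬ y.Listed x) (h3 : ¬ x.ExceptionalPair y)
    (h4 : ¬ y.ExceptionalPair x) :
    bracket (Q.grading k) x.degree y.degree x.cochain y.cochain ∈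
      coboundaries (Q.grading k) (x.degree + y.degree - 1) := by
  by_cases hc : x.IsCyclePair y
  · exact hc.bracket_mem h3
  by_cases hc' : y.IsCyclePair x
  · exact hc'.bracket_mem_swap h4
  have hF := x.cochain_mem_normalCocycles
  have hG := y.cochain_mem_normalCocycles
  by_cases hh : ∃ f g, x = .ofH f ∧ y = .ofH g
  · obtain ⟨f, g, rfl, rfl⟩ := hh
    have := bracket_cochainH_sub_mem (f := f) (c := 0) hG (Elt.ofH g).cochain_mem_terms (by
      rintro p q ⟨a, rfl, rfl⟩
      exact sub_self _)
    rwa [zero_smul, sub_zero] at this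
  push Not at hh
  have ht : ∀ x : Q.Elt k, x.cochain ∈ Q.terms k x.IsTerm x.degree := fun x =>
    terms_mono (fun _ _ => Elt.IsPair.isTerm) _ x.cochain_mem_terms
  exact bracket_mem_coboundaries_of_insRemovable rfl hF hG (ht x) (ht y)
    (Elt.insRemovable hQ ⟨h1, h2, hc, fun f g h => hh f g h.1 h.2⟩)
    (Elt.insRemovable hQ ⟨h2, h1, hc', fun f g h => hh g f h.2 h.1⟩)

end GradedGentleQuiver
end

noncomputable section

open GradedHochschild

namespace GradedGentleQuiver

variable {k V E : Type*} [Field k] {Q : GradedGentleQuiver V E}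

namespace PrimitiveLoop

variable (u : Q.PrimitiveLoop)

section Positions

variable {A : Type*} [AddCommMonoid A]

open scoped Classical in
theorem sum_last {i : ℕ} (hi : i < u.len) (m : ℕ) (g : ℕ → A) :
    ∑ b ∈ Finset.range (m * u.len), (if u.letter (i + b) = u.last then g b else 0) =
      ∑ t ∈ Finset.range m, g (t * u.len + (u.len - 1 - i)) := by
  induction m with
  | zero => simp
  | succ m ih =>
    rw [Nat.succ_mul, Finset.sum_range_add, ih, Finset.sum_range_succ]
    congr 1
    have h : ∀ b, u.letter (i + (m * u.len + b)) = u.letter (i + b) := fun b => by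
      rw [← u.letter_add_mul (i + b) m]
      congr 1
      ring
    rw [Finset.sum_eq_single (u.len - 1 - i)]
    · rw [h, if_pos]
      rw [letter_eq_last_iff, show i + (u.len - 1 - i) + 1 = u.len by omega, Nat.mod_self]
    · intro b hb hne
      rw [Finset.mem_range] at hb
      rw [h, if_neg]
      rw [letter_eq_last_iff]
      intro h0
      obtain ⟨t, ht⟩ := Nat.dvd_of_mod_eq_zero h0
      obtain rfl : t = 1 := by
        rcases t with _ | _ | t
        · omega
        · rfl
        · have := Nat.mul_le_mul_left u.len (show 2 ≤ t + 1 + 1 by omega)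
          omega
      omega
    · intro h'
      exact absurd (Finset.mem_range.2 (by omega)) h'

open scoped Classical in
theorem sum_last_succ (m : ℕ) (g : ℕ → A) :
    ∑ b ∈ Finset.range (m * u.len + 1),
      (if u.letter (u.len - 1 + b) = u.last then g b else 0) =
      ∑ t ∈ Finset.range (m + 1), g (t * u.len) := by
  have hl := u.len_pos
  have h : ∀ b, u.letter (u.len - 1 + (b + 1)) = u.letter (0 + b) := fun b => by
    rw [← u.letter_add_mul (0 + b) 1]
    congr 1
    omega
  rw [Finset.sum_range_succ', Finset.sum_range_succ', if_pos (by rfl), zero_mul]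
  simp only [h]
  rw [u.sum_last hl m fun b => g (b + 1)]
  congr 1
  refine Finset.sum_congr rfl fun t _ => congrArg g ?_
  rw [Nat.succ_mul]
  omega

theorem win_split {i b M : ℕ} (N : ℕ) (h : u.letter (i + b) = u.last) (hb : b < M) :
    u.win i (M + N * u.len) =
      u.win i b ++ (u.win (u.len - 1) (N * u.len + 1) ++ u.win (i + b + 1) (M - b - 1)) := by
  have hl := u.len_pos
  obtain ⟨t, ht⟩ := Nat.dvd_of_mod_eq_zero (u.letter_eq_last_iff.1 h)
  obtain ⟨t, rfl⟩ : ∃ s, t = s + 1 := Nat.exists_eq_succ_of_ne_zero (by rintro rfl; omega)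
  have e1 : i + b = u.len - 1 + t * u.len := by
    rw [mul_comm, Nat.succ_mul] at ht
    omega
  rw [show M + N * u.len = b + (N * u.len + 1 + (M - b - 1)) by omega, win_add, win_add]
  congr 2
  · rw [e1, win_add_mul]
  · rw [show i + b + (N * u.len + 1) = i + b + 1 + N * u.len by ring, win_add_mul]

theorem take_win {i b M : ℕ} (hb : b < M) : (u.win i M).take b = u.win i b := by
  rw [show M = b + (M - b) by omega, win_add, List.take_left' (u.length_win i b)]

theorem drop_win {i b M : ℕ} (hb : b < M) :
    (u.win i M).drop b = u.letter (i + b) :: u.win (i + b + 1) (M - b - 1) := by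
  rw [show M = b + (M - b - 1 + 1) by omega, win_add, List.drop_left' (u.length_win i b), win_succ,
    show b + (M - b - 1 + 1) - b - 1 = M - b - 1 by omega]

theorem prefix_win_iff {i b M N : ℕ} {w : List E} (hb : b ≤ w.length) :
    (u.win (u.len - 1) (N * u.len + 1) <+: w.drop b ∧
      u.win i M = w.take b ++ u.last :: w.drop (b + (N * u.len + 1))) ↔
    (w = u.win i (M + N * u.len) ∧ b < M ∧ u.letter (i + b) = u.last) := by
  constructor
  · rintro ⟨⟨c, hc⟩, h⟩
    have hlb : (w.take b).length = b := by rw [List.length_take, min_eq_left hb]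
    have hbM : b < M := by
      have := congrArg List.length h
      rw [length_win, List.length_append, hlb, List.length_cons] at this
      omega
    have h1 : w.take b = u.win i b := by
      rw [← u.take_win hbM, h, List.take_left' hlb]
    have h2 : u.letter (i + b) :: u.win (i + b + 1) (M - b - 1) =
        u.last :: w.drop (b + (N * u.len + 1)) := by
      rw [← u.drop_win hbM, h, List.drop_left' hlb]
    obtain ⟨h3, h4⟩ := List.cons.inj h2
    refine ⟨?_, hbM, h3⟩
    rw [u.win_split N h3 hbM, h4, ← h1, ← List.drop_drop, ← hc,
      List.drop_left' (u.length_win _ _), hc, List.take_append_drop]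
  · rintro ⟨rfl, hbM, h⟩
    rw [u.win_split N h hbM, List.drop_left' (u.length_win i b),
      List.take_left' (u.length_win i b), ← List.drop_drop, List.drop_left' (u.length_win i b),
      List.drop_left' (u.length_win _ _)]
    refine ⟨List.prefix_append _ _, ?_⟩
    rw [← h, ← u.drop_win hbM, ← u.take_win hbM, List.take_append_drop]

open scoped Classical in
theorem sum_prefix_win (g : ℕ → A) (i M N : ℕ) (w : List E) :
    ∑ b ∈ Finset.range (w.length + 1), (if u.win (u.len - 1) (N * u.len + 1) <+: w.drop b then
      (if u.win i M = w.take b ++ u.last :: w.drop (b + (N * u.len + 1)) then g b else 0) else 0) =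
    if u.win i (M + N * u.len) = w then
      ∑ b ∈ Finset.range M, (if u.letter (i + b) = u.last then g b else 0) else 0 := by
  have h : ∀ b ∈ Finset.range (w.length + 1),
      (if u.win (u.len - 1) (N * u.len + 1) <+: w.drop b then
      (if u.win i M = w.take b ++ u.last :: w.drop (b + (N * u.len + 1)) then g b else 0) else 0) =
      if u.win i (M + N * u.len) = w ∧ b < M ∧ u.letter (i + b) = u.last then g b else 0 := by
    intro b hb
    rw [← ite_and]
    exact if_congr ((u.prefix_win_iff (by simpa [Nat.lt_succ_iff] using hb)).trans
      (and_congr_left' eq_comm)) rfl rfl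
  rw [Finset.sum_congr rfl h]
  split_ifs with hw
  · subst hw
    simp only [true_and, length_win]
    rw [← Finset.sum_subset (Finset.range_mono (by omega : M ≤ M + N * u.len + 1))]
    · refine Finset.sum_congr rfl fun b hb => ?_
      simp [Finset.mem_range.1 hb]
    · intro b _ hb
      rw [if_neg fun h => hb (Finset.mem_range.2 h.1)]
  · exact Finset.sum_eq_zero fun b _ => if_neg fun h => hw h.1

end Positions

variable [Fintype V]

open scoped Classical in
theorem ev_N1_anti (hu : u.anti = true) (m : ℕ+) (w : List E) :
    ev (u.N1 k m) (Q.bas k (Q.arr w)) = if u.win (u.len - 1) (m * u.len + 1) = w then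
      sgn k (m * u.len * (1 + Q.deg u.last)) • Q.ofPath k (Q.arrowPath u.last) else 0 := by
  rw [u.N1_anti hu, ev_smul]
  have := ev_dual (k := k) (u.win (u.len - 1) (m * u.len + 1)) (Q.arrowPath u.last) (Q.arr w)
  rw [dualList_arr] at this
  rw [show ev (Q.dual k _ [u.last] (Q.src u.last)) (Q.bas k (Q.arr w)) = _ from this]
  split_ifs <;> simp

variable {F : Coch (Q.Alg k)}

open scoped Classical in
/-- The composition of a cochain supported on complete anti-paths with `N¹(uⁿ)`. -/
theorem comp_N1_anti (hu : u.anti = true) (n : ℕ+) (hF : Lin k (ev F)) {s : Finset ℕ} {M : ℕ}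
    {y : ℕ → Q.Alg k} (hy : ∀ v, ev F (Q.bas k (Q.arr v)) =
      ∑ i ∈ s, if u.win i M = v then y i else 0) (w : List E) :
    comp (Q.grading k) (n * u.winding + 1) (ev F) (ev (u.N1 k n)) (Q.bas k (Q.arr w)) =
      ∑ i ∈ s, if u.win i (M + n * u.len) = w then
        ∑ b ∈ Finset.range M, (if u.letter (i + b) = u.last then
          sgn k (n * u.len * (1 + Q.deg u.last) + (b * (n * u.len) + (M - 1) * (n * u.winding) +
            n * (u.winding - u.len) * Q.wdeg (u.win i b))) • y i else 0) else 0 := by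
  have h1 := comp_dual_arr (j := n * u.winding + 1) hF (u.win (u.len - 1) (n * u.len + 1))
    (Q.arrowPath u.last) w
  have h2 := congrFun (comp_smul_right (𝒜 := Q.grading k) (n * u.winding + 1)
    (sgn k (n * u.len * (1 + Q.deg u.last))) hF
    (ev (Q.dual k (u.win (u.len - 1) (n * u.len + 1)) [u.last] (Q.src u.last))))
    (Q.bas k (Q.arr w))
  rw [u.N1_anti hu]
  refine (h2.trans (congrArg (sgn k _ • ·) h1)).trans ?_
  have h3 : ∀ b ∈ Finset.range (w.length + 1), (if u.win (u.len - 1) (n * u.len + 1) <+: w.drop b then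
      sgn k (b * ((u.win (u.len - 1) (n * u.len + 1)).length - 1) +
        (w.length - (u.win (u.len - 1) (n * u.len + 1)).length) * (n * u.winding + 1 - 1) +
        (n * u.winding + 1 - (u.win (u.len - 1) (n * u.len + 1)).length) * Q.wdeg (w.take b)) •
        ev F (Q.bas k (Q.arr (w.take b) ++ Q.arrowPath u.last ::
          Q.arr (w.drop (b + (u.win (u.len - 1) (n * u.len + 1)).length)))) else 0) =
      ∑ i ∈ s, if u.win (u.len - 1) (n * u.len + 1) <+: w.drop b then
        (if u.win i M = w.take b ++ u.last :: w.drop (b + (n * u.len + 1)) then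
          sgn k (b * (n * u.len) + (M - 1) * (n * u.winding) +
            n * (u.winding - u.len) * Q.wdeg (u.win i b)) • y i else 0) else 0 := by
    intro b hb
    have hb : b ≤ w.length := by simpa [Nat.lt_succ_iff] using hb
    split_ifs with h
    · rw [length_win, show Q.arr (w.take b) ++ Q.arrowPath u.last ::
        Q.arr (w.drop (b + (n * u.len + 1))) =
          Q.arr (w.take b ++ u.last :: w.drop (b + (n * u.len + 1))) by simp [arr], hy,
        Finset.smul_sum]
      refine Finset.sum_congr rfl fun i _ => ?_
      split_ifs with h'
      · obtain ⟨hw, hbM, -⟩ := (u.prefix_win_iff hb).1 ⟨h, h'⟩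
        have e1 : w.take b = u.win i b := by rw [hw, u.take_win (by omega)]
        rw [e1, hw, length_win]
        congr 2
        push_cast
        ring
      · rw [smul_zero]
    · simp
  rw [Finset.sum_congr rfl h3, Finset.sum_comm, Finset.smul_sum]
  refine Finset.sum_congr rfl fun i _ => ?_
  rw [u.sum_prefix_win]
  split_ifs
  · rw [Finset.smul_sum]
    refine Finset.sum_congr rfl fun b _ => ?_
    split_ifs
    · rw [smul_smul, sgn_mul_sgn]
    · rw [smul_zero]
  · rw [smul_zero]

variable (k) in
/-- The sum of the first `n` powers of the sign `(-1)^d`. -/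
def sgnSum (d : ℤ) (n : ℕ) : k := ∑ t ∈ Finset.range n, sgn k (t * d)

theorem comp_N1_N1_anti (hu : u.anti = true) (m n : ℕ+) (w : List E) :
    comp (Q.grading k) (n * u.winding + 1) (ev (u.N1 k m)) (ev (u.N1 k n)) (Q.bas k (Q.arr w)) =
      (sgn k (m * n * u.len * u.winding) * sgnSum k (n * u.winding) (m + 1)) •
        ev (u.N1 k (m + n)) (Q.bas k (Q.arr w)) := by
  classical
  have hF := Lin.of_mem_cochains (mem_cocycles.1 (u.N1_mem_normalCocycles (k := k) m).1).1
  refine (u.comp_N1_anti hu n hF (s := {u.len - 1}) (fun v => (u.ev_N1_anti hu m v).trans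
    (Finset.sum_singleton (fun i => if u.win i (m * u.len + 1) = v then
      sgn k (m * u.len * (1 + Q.deg u.last)) • Q.ofPath k (Q.arrowPath u.last) else 0)
        (u.len - 1)).symm) w).trans ?_
  rw [Finset.sum_singleton, u.sum_last_succ m, ev_N1_anti _ hu]
  have e : (m : ℕ) * u.len + 1 + n * u.len = ((m + n : ℕ+) : ℕ) * u.len + 1 := by
    push_cast
    ring
  rw [e]
  split_ifs
  · rw [sgnSum, Finset.mul_sum, Finset.sum_smul]
    refine Finset.sum_congr rfl fun t _ => ?_
    rw [smul_smul, smul_smul, sgn_mul_sgn, sgn_mul_sgn, sgn_mul_sgn, wdeg_win_mul]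
    refine congrArg (· • _) (sgn_congr k ?_)
    rw [winding_anti _ hu]
    push_cast
    generalize ((m : ℕ) : ZMod 2) = x
    generalize ((n : ℕ) : ZMod 2) = x'
    generalize (u.len : ZMod 2) = y
    generalize ((Q.wdeg u.word : ℤ) : ZMod 2) = z
    generalize ((Q.deg u.last : ℤ) : ZMod 2) = a
    generalize (t : ZMod 2) = b
    revert x x' y z a b
    decide
  · rw [smul_zero]

open scoped Classical in
theorem ev_N0_anti (hu : u.anti = true) (m : ℕ+) (w : List E) :
    ev (u.N0 k m) (Q.bas k (Q.arr w)) = ∑ i ∈ Finset.range u.len,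
      if u.win i (m * u.len) = w then
        sgn k (i * (m * u.len) + m * Q.wdeg u.word * Q.wdeg (u.win 0 i)) •
          Q.ofPath k (Q.trivialPath (Q.tgt (u.letter i))) else 0 := by
  have h : u.N0 k m = ∑ i ∈ Finset.range u.len, u.summandAnti m i := u.N0_anti hu m
  rw [h, ev_sum, Finset.sum_congr rfl fun i _ => u.ev_summandAnti m i w]

theorem comp_N0_N1_anti (hu : u.anti = true) {m : ℕ+} (n : ℕ+) (hm : u.Good k m) (w : List E) :
    comp (Q.grading k) (n * u.winding + 1) (ev (u.N0 k m)) (ev (u.N1 k n)) (Q.bas k (Q.arr w)) =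
      (sgn k (n * u.winding * (Q.deg u.last + m * u.len)) * sgnSum k (n * u.winding) m) •
        ev (u.N0 k (m + n)) (Q.bas k (Q.arr w)) := by
  classical
  have hF := Lin.of_mem_cochains (mem_cocycles.1 (u.N0_mem_normalCocycles hm).1).1
  refine (u.comp_N1_anti hu n hF (u.ev_N0_anti hu m) w).trans ?_
  have e : (m : ℕ) * u.len + n * u.len = ((m + n : ℕ+) : ℕ) * u.len := by
    push_cast
    ring
  rw [ev_N0_anti _ hu, Finset.smul_sum]
  refine Finset.sum_congr rfl fun i hi => ?_
  have hi := Finset.mem_range.1 hi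
  rw [u.sum_last hi m, e]
  split_ifs
  · rw [sgnSum, Finset.mul_sum, Finset.sum_smul]
    refine Finset.sum_congr rfl fun t _ => ?_
    rw [smul_smul, smul_smul, sgn_mul_sgn, sgn_mul_sgn, sgn_mul_sgn, add_comm (t * u.len), win_add,
      wdeg_append, u.wdeg_win_rest hi, wdeg_win_mul]
    refine congrArg (· • _) (sgn_congr k ?_)
    obtain ⟨l, hl⟩ : ∃ l, u.len - 1 - i = l := ⟨_, rfl⟩
    have hl' : u.len = l + 1 + i := by omega
    rw [winding_anti _ hu, hl, hl']
    push_cast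
    generalize ((m : ℕ) : ZMod 2) = x
    generalize ((n : ℕ) : ZMod 2) = x'
    generalize (l : ZMod 2) = y
    generalize ((Q.wdeg u.word : ℤ) : ZMod 2) = z
    generalize ((Q.deg u.last : ℤ) : ZMod 2) = a
    generalize ((Q.wdeg (u.win 0 i) : ℤ) : ZMod 2) = c
    generalize (t : ZMod 2) = b
    generalize (i : ZMod 2) = j
    revert x x' y z a b c j
    decide
  · rw [smul_zero]

theorem comp_N1_N0_anti (hu : u.anti = true) (m n : ℕ+) (w : List E) :
    comp (Q.grading k) (m * u.winding) (ev (u.N1 k n)) (ev (u.N0 k m)) (Q.bas k (Q.arr w)) = 0 := by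
  classical
  have hF := Lin.of_mem_cochains (mem_cocycles.1 (u.N1_mem_normalCocycles (k := k) n).1).1
  rw [u.N0_anti hu, comp_sum_right _ hF]
  refine Finset.sum_eq_zero fun i _ => (congrArg (sgn k _ • ·) ((comp_dual_arr hF _
    (Q.trivialPath (Q.tgt (u.letter i))) w).trans
      (Finset.sum_eq_zero fun b hb => ?_))).trans (smul_zero _)
  split_ifs with h
  · have hle := h.length_le
    rw [length_win, List.length_drop] at hle
    have := ev_dual (k := k) (u.win (u.len - 1) (n * u.len + 1)) (Q.arrowPath u.last)
      (Q.arr (w.take b) ++ Q.trivialPath (Q.tgt (u.letter i)) ::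
        Q.arr (w.drop (b + (u.win i (m * u.len)).length)))
    rw [u.N1_anti hu, ev_smul,
      show ev (Q.dual k _ [u.last] (Q.src u.last)) (Q.bas k _) = _ from this, dualList]
    split_ifs with hl
    · rw [dualSum, Finset.sum_eq_zero, smul_zero, smul_zero]
      intro c _
      rw [if_neg]
      intro hc
      have hc := hc.length_le
      rw [Finset.mem_range] at hb
      rw [hl, List.length_drop, List.map_append, List.flatten_append, List.map_cons,
        List.flatten_cons, flatten_arr, flatten_arr] at hc
      simp [arr, trivialPath] at hc
      omega
    · rw [smul_zero, smul_zero]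
  · rfl

end PrimitiveLoop

end GradedGentleQuiver
end

noncomputable section

open GradedHochschild

namespace GradedGentleQuiver

variable {k V E : Type*} [Field k] {Q : GradedGentleQuiver V E}

namespace PrimitiveLoop

variable (u : Q.PrimitiveLoop)

theorem singleton_prefix_drop_win {i b M : ℕ} {a : E} :
    [a] <+: (u.win i M).drop b ↔ b < M ∧ u.letter (i + b) = a := by
  by_cases hb : b < M
  · rw [u.drop_win hb, List.cons_prefix_cons]
    simp [hb, eq_comm]
  · rw [List.drop_eq_nil_of_le (by simpa using hb)]
    simp [hb]

variable [Fintype V]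

open scoped Classical in
theorem ev_N1_winPath (hu : u.anti = false) (n : ℕ+) (i M : ℕ) :
    ev (u.N1 k n) [Q.ofPath k (u.winPath hu i M)] = -∑ b ∈ Finset.range M,
      (if u.letter (i + b) = u.last then sgn k (Q.wdeg (u.win i b) * (n * Q.wdeg u.word)) •
        Q.ofPath k (u.winPath hu i (M + n * u.len)) else 0) := by
  have h1 := ev_dual (k := k) [u.last] (u.winPath hu (u.len - 1) (n * u.len + 1)) [u.winPath hu i M]
  have h2 : (([u.winPath hu i M] : List Q.NZPath).map (·.word)).flatten =
      (u.winPath hu i M).word := by simp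
  have hW : (u.winPath hu (u.len - 1) (n * u.len + 1)).word ≠ [] := by
    rw [winPath_word, win_succ]
    exact List.cons_ne_nil _ _
  have hd : Q.wdeg (u.winPath hu (u.len - 1) (n * u.len + 1)).word - Q.deg u.last =
      n * Q.wdeg u.word := by
    rw [winPath_word, wdeg_win_succ, wdeg_win_mul, letter_add_mul, last]
    ring
  rw [u.N1_path hu, ev_neg, show ev (Q.dual k [u.last] _ _) [Q.ofPath k _] = _ from h1, dualList,
    if_pos (by simp), h2, dualSum_singleton (T := fun _ => u.winPath hu i (M + n * u.len)) hW, hd,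
    winPath_word, length_win, Finset.sum_range_succ, if_neg, add_zero]
  · refine congrArg _ (Finset.sum_congr rfl fun b hb => ?_)
    have hb := Finset.mem_range.1 hb
    rw [u.take_win hb]
    refine if_congr ?_ rfl rfl
    rw [singleton_prefix_drop_win]
    exact and_iff_right hb
  · rw [singleton_prefix_drop_win]
    simp
  · intro b hb
    rw [winPath_word, singleton_prefix_drop_win] at hb
    rw [winPath_word, winPath_word, winPath_word, u.take_win hb.1, ← List.drop_drop,
      u.drop_win hb.1, u.win_split n hb.2 hb.1]
    rfl

theorem comp_N1_path (hu : u.anti = false) (n : ℕ+) (j : ℤ) (g : List (Q.Alg k) → Q.Alg k)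
    (l : List (Q.Alg k)) : comp (Q.grading k) j (ev (u.N1 k n)) g l = ev (u.N1 k n) [g l] := by
  refine comp_of_arity_one (fun l hl => ?_) l
  rw [u.N1_path hu, ev_neg]
  unfold ev dual
  rw [if_neg fun h => hl h.symm, neg_zero]

theorem comp_N0_path (hu : u.anti = false) (m : ℕ+) (j : ℤ) (g : List (Q.Alg k) → Q.Alg k)
    (l : List (Q.Alg k)) : comp (Q.grading k) j (ev (u.N0 k m)) g l = 0 := by
  refine comp_of_arity_zero (fun l hl => ?_) l
  rw [u.N0_path hu, ev_sum]
  refine Finset.sum_eq_zero fun i _ => ?_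
  rw [ev_smul]
  unfold ev dual
  rw [if_neg fun h => hl h.symm, smul_zero]

open scoped Classical in
theorem ev_N1_path (hu : u.anti = false) (m : ℕ+) (w : List E) :
    ev (u.N1 k m) (Q.bas k (Q.arr w)) = if [u.last] = w then
      -Q.ofPath k (u.winPath hu (u.len - 1) (m * u.len + 1)) else 0 := by
  rw [u.N1_path hu, ev_neg, ev_dual, dualList_arr]
  split_ifs <;> simp

open scoped Classical in
theorem ev_N0_path (hu : u.anti = false) (m : ℕ+) (w : List E) :
    ev (u.N0 k m) (Q.bas k (Q.arr w)) = ∑ i ∈ Finset.range u.len, if [] = w then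
      sgn k (m * Q.wdeg u.word * Q.wdeg (u.win 0 i)) • Q.ofPath k (u.winPath hu i (m * u.len))
      else 0 := by
  have h : u.N0 k m = ∑ i ∈ Finset.range u.len, u.summandPath hu m i := u.N0_path hu m
  rw [h, ev_sum, Finset.sum_congr rfl fun i _ => u.ev_summandPath hu m i w]

variable [Fintype E]

theorem ev_N1_isLinearMap (n : ℕ+) : IsLinearMap k fun x => ev (u.N1 k n) [x] :=
  Lin.of_mem_cochains (mem_cocycles.1 (u.N1_mem_normalCocycles (k := k) n).1).1 [] []

theorem comp_N1_N1_path (hu : u.anti = false) (m n : ℕ+) (j : ℤ) (w : List E) :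
    comp (Q.grading k) j (ev (u.N1 k m)) (ev (u.N1 k n)) (Q.bas k (Q.arr w)) =
      (-sgnSum k (m * u.winding) (n + 1)) • ev (u.N1 k (m + n)) (Q.bas k (Q.arr w)) := by
  classical
  have hl := u.ev_N1_isLinearMap (k := k) m
  rw [u.comp_N1_path hu, ev_N1_path _ hu, ev_N1_path _ hu]
  split_ifs
  · have e : (n : ℕ) * u.len + 1 + m * u.len = ((m + n : ℕ+) : ℕ) * u.len + 1 := by
      push_cast
      ring
    refine (hl.map_neg _).trans ?_
    rw [u.ev_N1_winPath hu, neg_neg, u.sum_last_succ n, e, smul_neg, neg_smul, neg_neg, sgnSum,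
      Finset.sum_smul]
    refine Finset.sum_congr rfl fun t _ => congrArg (· • _) (sgn_congr k ?_)
    rw [winding_path _ hu, wdeg_win_mul]
    push_cast
    generalize ((m : ℕ) : ZMod 2) = x
    generalize ((Q.wdeg u.word : ℤ) : ZMod 2) = z
    generalize (t : ZMod 2) = b
    revert x z b
    decide
  · exact hl.map_zero.trans (smul_zero _).symm

theorem comp_N1_N0_path (hu : u.anti = false) (m n : ℕ+) (j : ℤ) (w : List E) :
    comp (Q.grading k) j (ev (u.N1 k n)) (ev (u.N0 k m)) (Q.bas k (Q.arr w)) =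
      (-(sgn k (n * u.winding * (1 + Q.deg u.last)) * sgnSum k (n * u.winding) m)) •
        ev (u.N0 k (m + n)) (Q.bas k (Q.arr w)) := by
  classical
  have hl := u.ev_N1_isLinearMap (k := k) n
  have e : (m : ℕ) * u.len + n * u.len = ((m + n : ℕ+) : ℕ) * u.len := by
    push_cast
    ring
  rw [u.comp_N1_path hu, ev_N0_path _ hu, ev_N0_path _ hu, Finset.smul_sum]
  refine (map_sum (IsLinearMap.mk' _ hl) _ _).trans (Finset.sum_congr rfl fun i hi => ?_)
  have hi := Finset.mem_range.1 hi
  rw [IsLinearMap.mk'_apply]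
  split_ifs
  · refine (hl.map_smul _ _).trans ?_
    rw [u.ev_N1_winPath hu, u.sum_last hi m, e, smul_neg, neg_smul, sgnSum, Finset.mul_sum,
      Finset.sum_smul, Finset.smul_sum]
    refine congrArg _ (Finset.sum_congr rfl fun t _ => ?_)
    rw [smul_smul, smul_smul, sgn_mul_sgn, sgn_mul_sgn, sgn_mul_sgn, add_comm (t * u.len), win_add,
      wdeg_append, u.wdeg_win_rest hi, wdeg_win_mul]
    refine congrArg (· • _) (sgn_congr k ?_)
    rw [winding_path _ hu]
    push_cast
    generalize ((m : ℕ) : ZMod 2) = x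
    generalize ((n : ℕ) : ZMod 2) = x'
    generalize ((Q.wdeg u.word : ℤ) : ZMod 2) = z
    generalize ((Q.deg u.last : ℤ) : ZMod 2) = a
    generalize ((Q.wdeg (u.win 0 i) : ℤ) : ZMod 2) = c
    generalize (t : ZMod 2) = b
    revert x x' z a b c
    decide
  · exact hl.map_zero.trans (smul_zero _).symm

theorem ev_bracket_N1_N1 (m n : ℕ+) : ∃ e : ℤ, ∀ w : List E,
    ev (bracket (Q.grading k) (m * u.winding + 1) (n * u.winding + 1) (u.N1 k m) (u.N1 k n))
      (Q.bas k (Q.arr w)) =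
    (sgn k (n * u.winding * e) * (sgnSum k (n * u.winding) (m + 1) -
      sgn k (m * u.winding * (n * u.winding)) * sgnSum k (m * u.winding) (n + 1))) •
      ev (u.N1 k (m + n)) (Q.bas k (Q.arr w)) := by
  cases hu : u.anti with
  | true =>
    refine ⟨m * u.len, fun w => ?_⟩
    rw [ev_bracket, brk, Pi.add_apply, Pi.smul_apply, u.comp_N1_N1_anti hu, u.comp_N1_N1_anti hu,
      add_comm n m, smul_smul, ← add_smul, add_sub_cancel_right, add_sub_cancel_right,
      show (n * m * u.len * u.winding : ℤ) = m * n * u.len * u.winding by ring,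
      show (n * u.winding * (m * u.len) : ℤ) = m * n * u.len * u.winding by ring]
    congr 1
    ring
  | false =>
    refine ⟨m * u.winding, fun w => ?_⟩
    have h := sgn_mul_self k (m * u.winding * (n * u.winding))
    rw [ev_bracket, brk, Pi.add_apply, Pi.smul_apply, u.comp_N1_N1_path hu, u.comp_N1_N1_path hu,
      add_comm n m, smul_smul, ← add_smul, add_sub_cancel_right, add_sub_cancel_right,
      mul_comm (n * u.winding : ℤ)]
    congr 1
    linear_combination sgnSum k (m * u.winding) (n + 1) * h

theorem ev_bracket_N0_N1 {m : ℕ+} (n : ℕ+) (hm : u.Good k m) : ∃ e : ℤ, ∀ w : List E,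
    ev (bracket (Q.grading k) (m * u.winding) (n * u.winding + 1) (u.N0 k m) (u.N1 k n))
      (Q.bas k (Q.arr w)) =
    (sgn k (n * u.winding * e) * sgnSum k (n * u.winding) m) •
      ev (u.N0 k (m + n)) (Q.bas k (Q.arr w)) := by
  cases hu : u.anti with
  | true =>
    refine ⟨Q.deg u.last + m * u.len, fun w => ?_⟩
    rw [ev_bracket, brk, Pi.add_apply, Pi.smul_apply, u.comp_N0_N1_anti hu n hm,
      u.comp_N1_N0_anti hu, smul_zero, add_zero]
  | false =>
    refine ⟨m * u.winding - 1 + (1 + Q.deg u.last), fun w => ?_⟩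
    rw [ev_bracket, brk, Pi.add_apply, Pi.smul_apply, u.comp_N1_N0_path hu, u.comp_N0_path hu,
      zero_add, smul_smul, add_sub_cancel_right, mul_comm (m * u.winding - 1 : ℤ),
      mul_add (n * u.winding : ℤ) (m * u.winding - 1), sgn_add]
    congr 1
    ring

end PrimitiveLoop

end GradedGentleQuiver
end

noncomputable section

open GradedHochschild

namespace GradedGentleQuiver

variable {k V E : Type*} [Field k] {Q : GradedGentleQuiver V E}

namespace PrimitiveLoop

theorem sgnSum_eq_natCast {d : ℤ} (h : Even d ∨ ringChar k = 2) (n : ℕ) : sgnSum k d n = n := by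
  have : ∀ t ∈ Finset.range n, sgn k (t * d) = 1 := fun t _ => by
    rcases h with h | h
    · exact sgn_of_even k (h.mul_left _)
    · exact sgn_eq_one_of_two h _
  rw [sgnSum, Finset.sum_congr rfl this]
  simp

theorem sgnSum_of_odd {d : ℤ} (h : Odd d) (n : ℕ) : sgnSum k d n = if Even n then 0 else 1 := by
  induction n with
  | zero => simp [sgnSum]
  | succ n ih =>
    rw [sgnSum, Finset.sum_range_succ, ← sgnSum, ih]
    by_cases hn : Even n
    · rw [if_pos hn, if_neg (by simpa [Nat.even_add_one] using hn), zero_add,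
        sgn_of_even k (((Int.even_coe_nat n).2 hn).mul_right d)]
    · have hn' : Odd (n : ℤ) := (Int.odd_coe_nat n).2 (Nat.not_even_iff_odd.1 hn)
      rw [if_neg hn, if_pos (by simpa [Nat.even_add_one] using hn), sgn_of_odd k (hn'.mul h)]
      ring

end PrimitiveLoop

variable [Fintype V]

/-- The class of a normalized cocycle. -/
def normalClass {d : ℤ} {F : Coch (Q.Alg k)} (h : F ∈ Q.normalCocycles k d) : HH (Q.grading k) d :=
  Submodule.Quotient.mk ⟨F, h.1⟩

theorem represents_normalClass {d : ℤ} {F : Coch (Q.Alg k)} (h : F ∈ Q.normalCocycles k d) :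
    Represents (Q.grading k) F (normalClass h) := ⟨h.1, rfl⟩

variable {i j l : ℤ} {F G Z : Coch (Q.Alg k)}

theorem isBracket_zero_of_mem (hl : l = i + j - 1) (hF : F ∈ Q.normalCocycles k i)
    (hG : G ∈ Q.normalCocycles k j)
    (h : bracket (Q.grading k) i j F G ∈ coboundaries (Q.grading k) l) :
    IsBracket (Q.grading k) (normalClass hF) (normalClass hG) (0 : HH (Q.grading k) l) :=
  isBracket_of_represents hl (represents_normalClass hF) (represents_normalClass hG)
    (represents_zero l) (by rwa [sub_zero])

theorem isBracket_smul_of_mem (hl : l = i + j - 1) (hF : F ∈ Q.normalCocycles k i)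
    (hG : G ∈ Q.normalCocycles k j) (hZ : Z ∈ Q.normalCocycles k l) {c : k}
    (h : bracket (Q.grading k) i j F G - c • Z ∈ coboundaries (Q.grading k) l) :
    IsBracket (Q.grading k) (normalClass hF) (normalClass hG) (c • normalClass hZ) :=
  isBracket_of_represents hl (represents_normalClass hF) (represents_normalClass hG)
    ((represents_normalClass hZ).smul c) h

/-- The bracket of normalized cocycles is determined by its values on anti-paths. -/
theorem isBracket_smul_of_ev (hl : l = i + j - 1) (hF : F ∈ Q.normalCocycles k i)
    (hG : G ∈ Q.normalCocycles k j) (hZ : Z ∈ Q.normalCocycles k l) {c c' : k} (hc : c = c')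
    (h : ∀ w : List E, ev (bracket (Q.grading k) i j F G) (Q.bas k (Q.arr w)) =
      c • ev Z (Q.bas k (Q.arr w))) :
    IsBracket (Q.grading k) (normalClass hF) (normalClass hG) (c' • normalClass hZ) := by
  subst hc
  refine isBracket_smul_of_mem hl hF hG hZ (mem_coboundaries_of_normalCocycles
    (Submodule.sub_mem _ (bracket_mem_normalCocycles hl hF hG) (Submodule.smul_mem _ _ hZ))
    fun w _ => ?_)
  rw [ev_sub, ev_smul, h, sub_self]

theorem isBracket_zero_of_ev (hl : l = i + j - 1) (hF : F ∈ Q.normalCocycles k i)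
    (hG : G ∈ Q.normalCocycles k j) {c : k} (hc : c = 0)
    (h : ∀ w : List E, ev (bracket (Q.grading k) i j F G) (Q.bas k (Q.arr w)) =
      c • ev Z (Q.bas k (Q.arr w))) :
    IsBracket (Q.grading k) (normalClass hF) (normalClass hG) (0 : HH (Q.grading k) l) :=
  isBracket_zero_of_mem hl hF hG (mem_coboundaries_of_normalCocycles
    (bracket_mem_normalCocycles hl hF hG) fun w _ => by rw [h, hc, zero_smul])

variable [Fintype E]

namespace PrimitiveLoop

variable (u : Q.PrimitiveLoop) (m n : ℕ+)

theorem sgn_mul_eq_one {d : ℤ} (h : Even d ∨ ringChar k = 2) (e : ℤ) : sgn k (d * e) = 1 := by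
  rcases h with h | h
  · exact sgn_of_even k (h.mul_right e)
  · exact sgn_eq_one_of_two h _

theorem add_winding : ((m + n : ℕ+) : ℤ) * u.winding = m * u.winding + n * u.winding := by
  push_cast
  ring

theorem isBracket_N1_N1 (hm : u.Good k m) (hn : u.Good k n) :
    IsBracket (Q.grading k) (normalClass (u.N1_mem_normalCocycles (k := k) m))
      (normalClass (u.N1_mem_normalCocycles (k := k) n))
      (((m : k) - (n : k)) • normalClass (u.N1_mem_normalCocycles (k := k) (m + n))) := by
  obtain ⟨e, h⟩ := u.ev_bracket_N1_N1 (k := k) m n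
  refine isBracket_smul_of_ev (by rw [add_winding]; ring) _ _ _ ?_ h
  rw [sgn_mul_eq_one hm, sgn_mul_eq_one hn, sgnSum_eq_natCast hm, sgnSum_eq_natCast hn]
  push_cast
  ring

theorem isBracket_N1_N1_of_odd_even (hm : Odd (m * u.winding)) (hn : Even (n * u.winding)) :
    IsBracket (Q.grading k) (normalClass (u.N1_mem_normalCocycles (k := k) m))
      (normalClass (u.N1_mem_normalCocycles (k := k) n))
      ((m : k) • normalClass (u.N1_mem_normalCocycles (k := k) (m + n))) := by
  obtain ⟨e, h⟩ := u.ev_bracket_N1_N1 (k := k) m n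
  refine isBracket_smul_of_ev (by rw [add_winding]; ring) _ _ _ ?_ h
  have hω := (Int.odd_mul.1 hm).2
  have hn' : Even (n : ℕ) := by
    rcases Int.even_mul.1 hn with h | h
    · exact_mod_cast h
    · exact absurd hω (Int.not_odd_iff_even.2 h)
  rw [mul_comm (m * u.winding : ℤ), sgn_mul_eq_one (Or.inl hn), sgn_mul_eq_one (Or.inl hn),
    sgnSum_eq_natCast (Or.inl hn), sgnSum_of_odd hm, if_neg (by simpa [Nat.even_add_one] using hn')]
  push_cast
  ring

theorem isBracket_N1_N1_of_odd_odd (hm : Odd (m * u.winding)) (hn : Odd (n * u.winding)) :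
    IsBracket (Q.grading k) (normalClass (u.N1_mem_normalCocycles (k := k) m))
      (normalClass (u.N1_mem_normalCocycles (k := k) n))
      (0 : HH (Q.grading k) ((m + n : ℕ+) * u.winding + 1)) := by
  obtain ⟨e, h⟩ := u.ev_bracket_N1_N1 (k := k) m n
  refine isBracket_zero_of_ev (by rw [add_winding]; ring) _ _ ?_ h
  have hm' : Odd (m : ℕ) := by exact_mod_cast (Int.odd_mul.1 hm).1
  have hn' : Odd (n : ℕ) := by exact_mod_cast (Int.odd_mul.1 hn).1
  rw [sgnSum_of_odd hm, sgnSum_of_odd hn, if_pos hm'.add_one, if_pos hn'.add_one]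
  ring

theorem isBracket_N0_N1 {m n : ℕ+} (hm : u.Good k m) (hn : u.Good k n) :
    IsBracket (Q.grading k) (normalClass (u.N0_mem_normalCocycles hm))
      (normalClass (u.N1_mem_normalCocycles (k := k) n))
      ((m : k) • normalClass (u.N0_mem_normalCocycles (hm.add hn))) := by
  obtain ⟨e, h⟩ := u.ev_bracket_N0_N1 n hm
  refine isBracket_smul_of_ev (by rw [add_winding]; ring) _ _ _ ?_ h
  rw [sgn_mul_eq_one hn, sgnSum_eq_natCast hn, one_mul]

theorem isBracket_N0_N1_of_even_odd {m n : ℕ+} (hm : u.Good k m) (hm' : Even (m * u.winding))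
    (hn : Odd (n * u.winding)) :
    IsBracket (Q.grading k) (normalClass (u.N0_mem_normalCocycles hm))
      (normalClass (u.N1_mem_normalCocycles (k := k) n))
      (0 : HH (Q.grading k) ((m + n : ℕ+) * u.winding)) := by
  obtain ⟨e, h⟩ := u.ev_bracket_N0_N1 n hm
  refine isBracket_zero_of_ev (by rw [add_winding]; ring) _ _ ?_ h
  have hω := (Int.odd_mul.1 hn).2
  have hm2 : Even (m : ℕ) := by
    rcases Int.even_mul.1 hm' with h | h
    · exact_mod_cast h
    · exact absurd hω (Int.not_odd_iff_even.2 h)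
  rw [sgnSum_of_odd hn, if_pos hm2, mul_zero]

end PrimitiveLoop

end GradedGentleQuiver
end

theorem theoremB {k V E : Type*} [Field k] [Fintype V] [Fintype E]
    (Q : GradedGentleQuiver V E) (hQ : Q.NoLoopOrKronecker) :
    ∃ cls : ∀ x : Q.Elt k, HH (Q.grading k) x.degree,
      -- the cochains are cocycles, and `cls x` is the class of the cochain of `x`
      (∀ x, Represents (Q.grading k) x.cochain (cls x)) ∧
      -- the class of `f` only depends on its cohomology class
      (∀ g : V → k, cls (.ofH (Q.coboundary g)) = 0) ∧
      -- the diagonal action of the first cohomology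
      (∀ (f : E → k) (x : Q.Elt k), ∀ c ∈ x.boundaryCycle,
        IsBracket (Q.grading k) (cls (.ofH f)) (cls x) (evalWalk f c • cls x)) ∧
      -- the brackets along a boundary loop
      (∀ (u : Q.PrimitiveLoop) (m n : ℕ+) (hm : u.Good k m) (hn : u.Good k n),
        IsBracket (Q.grading k) (cls (.ofN1 u m hm)) (cls (.ofN1 u n hn))
            (((m : k) - (n : k)) • cls (.ofN1 u (m + n) (hm.add hn))) ∧
        IsBracket (Q.grading k) (cls (.ofN0 u m hm)) (cls (.ofN1 u n hn))
            ((m : k) • cls (.ofN0 u (m + n) (hm.add hn)))) ∧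
      -- the variants for `N¹` of loops of arbitrary parity
      (∀ (u : Q.PrimitiveLoop) (m n : ℕ+),
        ∃ (x : HH (Q.grading k) (m * u.winding + 1)) (y : HH (Q.grading k) (n * u.winding + 1))
          (z : HH (Q.grading k) ((m + n : ℕ+) * u.winding + 1)),
          Represents (Q.grading k) (u.N1 k m) x ∧ Represents (Q.grading k) (u.N1 k n) y ∧
          Represents (Q.grading k) (u.N1 k (m + n)) z ∧
          (Even (m * u.winding) → Even (n * u.winding) →
            IsBracket (Q.grading k) x y (((m : k) - (n : k)) • z)) ∧
          (Odd (m * u.winding) → Even (n * u.winding) →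
            IsBracket (Q.grading k) x y ((m : k) • z)) ∧
          (Odd (m * u.winding) → Odd (n * u.winding) →
            IsBracket (Q.grading k) x y (0 : HH (Q.grading k) ((m + n : ℕ+) * u.winding + 1))) ∧
          (∀ hm : u.Good k m, Even (m * u.winding) → Odd (n * u.winding) →
            IsBracket (Q.grading k) (cls (.ofN0 u m hm)) y
              (0 : HH (Q.grading k) ((m + n : ℕ+) * u.winding)))) ∧
      -- all other brackets vanish
      (∀ x y : Q.Elt k, ¬ x.Listed y → ¬ y.Listed x → ¬ x.ExceptionalPair y →
        ¬ y.ExceptionalPair x →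
        IsBracket (Q.grading k) (cls x) (cls y) (0 : HH (Q.grading k) (x.degree + y.degree - 1))) := by
  refine ⟨fun x => normalClass x.cochain_mem_normalCocycles,
    fun x => represents_normalClass x.cochain_mem_normalCocycles, fun g => ?_, fun f x c hc => ?_,
    fun u m n hm hn => ⟨u.isBracket_N1_N1 m n hm hn, u.isBracket_N0_N1 hm hn⟩,
    fun u m n => ⟨_, _, _, represents_normalClass (u.N1_mem_normalCocycles m),
      represents_normalClass (u.N1_mem_normalCocycles n),
      represents_normalClass (u.N1_mem_normalCocycles (m + n)),
      fun hm hn => u.isBracket_N1_N1 m n (.inl hm) (.inl hn), u.isBracket_N1_N1_of_odd_even m n,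
      u.isBracket_N1_N1_of_odd_odd m n, fun hm => u.isBracket_N0_N1_of_even_odd hm⟩,
    fun x y h1 h2 h3 h4 => isBracket_zero_of_mem rfl _ _
      (Elt.bracket_mem_coboundaries hQ h1 h2 h3 h4)⟩
  · exact (Submodule.Quotient.mk_eq_zero _).2 (cochainH_coboundary_mem g)
  · exact isBracket_smul_of_mem (add_sub_cancel_left _ _).symm _ _ _
      (bracket_cochainH_sub_mem x.cochain_mem_normalCocycles x.cochain_mem_terms
        fun p q => Elt.IsPair.fsum_eq f hc)
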